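/- Let $k$ be a field and let $\mathcal D$ be a triangulated (cohomologically unital) $A_\infty$-category over $k$. Write $\operatorname{Hom}^n(X,Y)$ for the cohomology of the morphism complexes, with its associative graded composition. For objects $X_i$, let $\langle X_i\rangle$ denote the full triangulated subcategory they generate. Let $0<m<N$ and $d\in\mathbb Z$, and let $E_0,\ldots,E_N$ be an exceptional collection in $\mathcal D$, that is, $\operatorname{Hom}^*(E_i,E_i)=k$ in degree $0$ and $\operatorname{Hom}^*(E_j,E_i)=0$ for $i<j$. Assume that $\operatorname{Hom}^*(X,E_i)$ has finite total dimension for every object $X$ of $\mathcal D$ and all $i$. Assume moreover: 1. There is an $A_\infty$-autoequivalence $\tau$ of $\mathcal D$ with $\tau(E_i)\simeq E_{i+1}$ for $0\le i<N$. Fix such isomorphisms, and use them to regard $\tau^s$ as a map $\operatorname{Hom}^*(E_i,E_j)\to\operatorname{Hom}^*(E_{i+s},E_{j+s})$ whenever $i+s,j+s\le N$. 2. $\operatorname{Hom}^*(E_i,E_j)=0$ for $j-i>m$. 3. (Perfect pairing property) $\operatorname{Hom}^*(E_0,E_m)$ is one-dimensional and concentrated in degree $d$, and for $0<i<m$ and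 $a+b=d$ the composition $\operatorname{Hom}^b(E_i,E_m)\otimes\operatorname{Hom}^a(E_0,E_i)\to\operatorname{Hom}^d(E_0,E_m)\simeq k$ is a perfect pairing. 4. ($\tau$-commutativity) For all $i$ with $0<i\le N-m$, all $a+b=d$, all $\alpha\in\operatorname{Hom}^a(E_0,E_i)$ and all $\beta\in\operatorname{Hom}^b(E_i,E_m)$, one has $\tau^i(\beta\circ\alpha)=\tau^m(\alpha)\circ\beta$ in $\operatorname{Hom}^d(E_i,E_{m+i})$. Let $F_{-N},\ldots,F_{-1},F_0$ be the left dual collection to $E_0,\ldots,E_N$, that is, a full exceptional collection in $\langle E_0,\ldots,E_N\rangle$ such that $\operatorname{Hom}^*(E_i,F_{-j})=0$ for $i\ne j$ and $\operatorname{Hom}^*(E_i,F_{-i})=k$ in degree $0$. Let $\mathcal C=\langle E_0,\ldots,E_{m-1}\rangle$. Then the following hold. (a) $F_{-m+1},\ldots,F_0$ is the left dual collection to $E_0,\ldots,E_{m-1}$. In particular it is a full exceptional collection in $\mathcal C$. (b) The left adjoint $\lambda:\mathcal D\to\mathcal C$ to the inclusion exists as an $A_\infty$-functor, and it can be chosen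 so that $\lambda(X)=X$ for all objects $X$ of $\mathcal C$. (c) For every $A_\infty$-functor $\lambda:\mathcal D\to\mathcal C$ left adjoint to the inclusion, the sequence $$\lambda(F_{-N})[\lfloor \tfrac{N}{m}\rfloor(d-1)],\ldots,\lambda(F_{-i})[\lfloor\tfrac{i}{m}\rfloor(d-1)],\ldots,\lambda(F_{-m})[d-1],F_{-m+1},\ldots,F_0$$ is, up to isomorphism of its terms, a part of the helix in $\mathcal C$ generated by $F_{-m+1},\ldots,F_0$. That is, $\mathcal C$ has a Serre functor $S_{\mathcal C}$ and there is a sequence $(H_i)_{i\in\mathbb Z}$ of objects of $\mathcal C$ such that $S_{\mathcal C}(H_i)\simeq H_{i-m}$ for all $i\in\mathbb Z$, such that $H_{-i}=F_{-i}$ for $0\le i<m$, and such that $H_{-i}\simeq\lambda(F_{-i})[\lfloor\frac im\rfloor(d-1)]$ for $0\le i\le N$. (d) For a sequence of objects $X_{-N},\ldots,X_0$, let $\operatorname{end}_{\to}(X_{-N},\ldots,X_0)$ be the directed $A_\infty$-algebra that consists of $\hom(X_i,X_j)$ for $i<j$ together with a strict unit for each $i$. For every $\lambda$ as in (c), $\lambda$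 induces a quasi-isomorphism of directed $A_\infty$-endomorphism algebras $$\operatorname{end}_{\to}(F_{-N},\ldots,F_0)\to\operatorname{end}_{\to}(\lambda(F_{-N}),\ldots,\lambda(F_{-m}),\lambda(F_{-m+1}),\ldots,\lambda(F_0)),$$ where $\lambda(F_{-i})\simeq F_{-i}$ for $0\le i<m$, with equality for $\lambda$ normalised as in (b). -/

import Mathlib

set_option linter.checkUnivs false

open CategoryTheory
open scoped DirectSum

universe w v v' u u' v₁ v₂ v₃ v₄ u₁ u₂ u₃ u₄

/-! ### Words of composable morphisms -/

section Words

open Quiver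

/-- All ways of writing a word `p` as a concatenation of two (possibly empty) words. -/
def Quiver.Path.splits {V : Type u} [Quiver.{v} V] {X : V} :
    {Y : V} → Path X Y → List (Σ Z : V, Path X Z × Path Z Y)
  | _, .nil => [⟨X, .nil, .nil⟩]
  | Y, .cons p a =>
      (Quiver.Path.splits p).map (fun s => ⟨s.1, s.2.1, s.2.2.cons a⟩) ++ [⟨Y, p.cons a, .nil⟩]

end Words

/-! ### Graded quivers and multilinear operations -/

/-- A `k`-linear graded quiver: objects, and for each pair of objects a graded `k`-module. -/
structure GQuiver (k : Type w) [Field k] where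
  Obj : Type u
  Hom : Obj → Obj → ℤ → Type v
  [instAddCommGroup : ∀ X Y n, AddCommGroup (Hom X Y n)]
  [instModule : ∀ X Y n, Module k (Hom X Y n)]

attribute [instance] GQuiver.instAddCommGroup GQuiver.instModule

namespace GQuiver

variable {k : Type w} [Field k] (Q : GQuiver.{w, v, u} k)

/-- The total morphism space, the direct sum of its graded pieces. -/
abbrev Tot (X Y : Q.Obj) : Type v := ⨁ n, Q.Hom X Y n

instance : Quiver.{v} Q.Obj := ⟨fun X Y => Q.Tot X Y⟩

/-- The homogeneous elements of degree `n`. -/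
def gr (X Y : Q.Obj) (n : ℤ) : Submodule k (Q.Tot X Y) :=
  LinearMap.range (DirectSum.lof k ℤ (Q.Hom X Y) n)

/-- The operator `a ↦ (-1)^(|a| - 1) a`. -/
def sgn (X Y : Q.Obj) : Q.Tot X Y →ₗ[k] Q.Tot X Y :=
  DirectSum.lmap (fun n => (((n - 1).negOnePow : ℤˣ) : ℤ) • LinearMap.id)

/-- The operator `sgn` applied to all letters of a word; on a word `a₁ ⋯ aₙ` of homogeneous
letters it is multiplication by `(-1)^(|a₁| + ⋯ + |aₙ| - n)`. -/
def sgnWord {X : Q.Obj} : {Y : Q.Obj} → Quiver.Path X Y → Quiver.Path X Y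
  | _, .nil => .nil
  | _, .cons (b := Y) (c := Z) p a => (sgnWord p).cons (Q.sgn Y Z a)

/-- `Q.HasDeg p s`: all letters of the word `p = a₁ ⋯ aₙ` are homogeneous, and
`s = |a₁| + ⋯ + |aₙ| - n`. -/
inductive HasDeg {X : Q.Obj} : {Y : Q.Obj} → Quiver.Path X Y → ℤ → Prop
  | nil : HasDeg .nil 0
  | cons {Y Z : Q.Obj} {p : Quiver.Path X Y} {s : ℤ} (n : ℤ) (a : Q.Tot Y Z) :
      HasDeg p s → a ∈ Q.gr Y Z n → HasDeg (p.cons a) (s + n - 1)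

end GQuiver

variable {k : Type w} [Field k]

/-- A family of multilinear operations `Φⁿ(aₙ, …, a₁)`, `n ≥ 1`, with values in a second graded
quiver, the `n`-th one being of degree `c - n`. A word `a₁ ⋯ aₙ` is written in the order of
composition (`a₁` is applied first), and `Φⁿ(aₙ, …, a₁)` is the value on that word. -/
structure MultiOp (Q : GQuiver.{w, v, u} k) (R : GQuiver.{w, v', u'} k)
    (f : Q.Obj → R.Obj) (c : ℤ) where
  ev : ∀ {X Y : Q.Obj}, Quiver.Path X Y → R.Tot (f X) (f Y)
  ev_add : ∀ {W X Y Z : Q.Obj} (p : Quiver.Path W X) (a b : Q.Tot X Y) (q : Quiver.Path Y Z),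
    ev (Quiver.Path.comp (p.cons (a + b : Q.Tot X Y)) q) =
      ev (Quiver.Path.comp (p.cons a) q) + ev (Quiver.Path.comp (p.cons b) q)
  ev_smul : ∀ {W X Y Z : Q.Obj} (p : Quiver.Path W X) (r : k) (a : Q.Tot X Y)
    (q : Quiver.Path Y Z),
    ev (Quiver.Path.comp (p.cons (r • a : Q.Tot X Y)) q) =
      r • ev (Quiver.Path.comp (p.cons a) q)
  ev_nil : ∀ X : Q.Obj, ev (Quiver.Path.nil : Quiver.Path X X) = 0
  ev_mem : ∀ {X Y : Q.Obj} (p : Quiver.Path X Y) (s : ℤ), Q.HasDeg p s →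
    ev p ∈ R.gr (f X) (f Y) (s + c)

/-- The sum `∑ (-1)^(|a₁| + ⋯ + |aₙ| - n) Φ(a_d, …, μ(a_{n+m}, …, a_{n+1}), aₙ, …, a₁)` over all
subwords of the word `p = a₁ ⋯ a_d`. (Empty subwords contribute zero, as `μ` vanishes on them.) -/
def insertSum {Q : GQuiver.{w, v, u} k} {R : GQuiver.{w, v', u'} k} {f : Q.Obj → R.Obj} {c : ℤ}
    (μ : MultiOp Q Q (fun X => X) 2) (Φ : MultiOp Q R f c) {X Y : Q.Obj} (p : Quiver.Path X Y) :
    R.Tot (f X) (f Y) :=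
  (p.splits.flatMap fun s => s.2.2.splits.map fun t =>
    Φ.ev ((Q.sgnWord s.2.1).comp
      (Quiver.Path.comp (Quiver.Hom.toPath (μ.ev t.2.1 : s.1 ⟶ t.1)) t.2.2))).sum

/-- All ways of cutting the word `p · t` into nonempty consecutive blocks in such a way that
the last block contains `t` (a nonempty word); each block is replaced by its image under `Φ`. -/
def MultiOp.cutsAux {Q : GQuiver.{w, v, u} k} {R : GQuiver.{w, v', u'} k} {f : Q.Obj → R.Obj}
    {c : ℤ} (Φ : MultiOp Q R f c) {X : Q.Obj} :
    {Y Z : Q.Obj} → Quiver.Path X Y → Quiver.Path Y Z → List (Quiver.Path (f X) (f Z))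
  | _, _, .nil, t => [Quiver.Path.nil.cons (Φ.ev t)]
  | _, _, .cons p a, t =>
      Φ.cutsAux p (Quiver.Path.comp a.toPath t) ++
        (Φ.cutsAux p a.toPath).map (fun q => q.cons (Φ.ev t))

/-- All ways of cutting a word into nonempty consecutive blocks, each block being replaced by
its image under `Φ`. -/
def MultiOp.cuts {Q : GQuiver.{w, v, u} k} {R : GQuiver.{w, v', u'} k} {f : Q.Obj → R.Obj}
    {c : ℤ} (Φ : MultiOp Q R f c) {X : Q.Obj} :
    {Y : Q.Obj} → Quiver.Path X Y → List (Quiver.Path (f X) (f Y))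
  | _, .nil => [.nil]
  | _, .cons p a => Φ.cutsAux p a.toPath

/-- The `A∞`-relations
`∑ (-1)^(|a₁| + ⋯ + |aₙ| - n) μ(a_d, …, μ(a_{n+m}, …, a_{n+1}), aₙ, …, a₁) = 0`. -/
def MultiOp.IsAInf {Q : GQuiver.{w, v, u} k} (μ : MultiOp Q Q (fun X => X) 2) : Prop :=
  ∀ {X Y : Q.Obj} (p : Quiver.Path X Y), insertSum μ μ p = 0

/-! ### A-infinity categories and functors -/

/-- An `A∞`-category over `k`, without any condition on units: a graded quiver with operations
`μᵈ` of degree `2 - d`, for `d ≥ 1`, which satisfy the `A∞`-relations. -/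
structure AInfCat (k : Type w) [Field k] extends GQuiver.{w, v, u} k where
  μ : MultiOp toGQuiver toGQuiver (fun X => X) 2
  rel : μ.IsAInf

/-- An `A∞`-functor with object map `f`: operations `Fᵈ` of degree `1 - d` such that
`∑ μ(F(…), …, F(…)) = ∑ (-1)^(|a₁| + ⋯ + |aₙ| - n) F(a_d, …, μ(…), aₙ, …, a₁)`. -/
structure AInfFunctor (A : AInfCat.{w, v, u} k) (B : AInfCat.{w, v', u'} k)
    (f : A.Obj → B.Obj) where
  F : MultiOp A.toGQuiver B.toGQuiver f 1
  rel : ∀ {X Y : A.Obj} (p : Quiver.Path X Y),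
    ((F.cuts p).map B.μ.ev).sum = insertSum A.μ F p

/-! ### Elementary consequences of multilinearity -/

namespace MultiOp

variable {Q : GQuiver.{w, v, u} k} {R : GQuiver.{w, v', u'} k} {f : Q.Obj → R.Obj} {c : ℤ}

theorem ev_zero (Φ : MultiOp Q R f c) {W X Y Z : Q.Obj} (p : Quiver.Path W X)
    (q : Quiver.Path Y Z) : Φ.ev (Quiver.Path.comp (p.cons (0 : Q.Tot X Y)) q) = 0 := by
  simpa using Φ.ev_smul p (0 : k) (0 : Q.Tot X Y) q

theorem ev_cons_zero (Φ : MultiOp Q R f c) {W X Y : Q.Obj} (p : Quiver.Path W X) :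
    Φ.ev (p.cons (0 : Q.Tot X Y)) = 0 :=
  Φ.ev_zero p .nil

theorem ev_cons_zero_cons (Φ : MultiOp Q R f c) {W X Y Z : Q.Obj} (p : Quiver.Path W X)
    (b : Y ⟶ Z) : Φ.ev ((p.cons (0 : Q.Tot X Y)).cons b) = 0 :=
  Φ.ev_zero p (Quiver.Path.nil.cons b)

theorem ev_cons_zero_cons_cons (Φ : MultiOp Q R f c) {W X Y Z Z' : Q.Obj}
    (p : Quiver.Path W X) (b : Y ⟶ Z) (b' : Z ⟶ Z') :
    Φ.ev (((p.cons (0 : Q.Tot X Y)).cons b).cons b') = 0 :=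
  Φ.ev_zero p ((Quiver.Path.nil.cons b).cons b')

theorem ev_cons_zero_cons_cons_cons (Φ : MultiOp Q R f c) {W X Y Z Z' Z'' : Q.Obj}
    (p : Quiver.Path W X) (b : Y ⟶ Z) (b' : Z ⟶ Z') (b'' : Z' ⟶ Z'') :
    Φ.ev ((((p.cons (0 : Q.Tot X Y)).cons b).cons b').cons b'') = 0 :=
  Φ.ev_zero p (((Quiver.Path.nil.cons b).cons b').cons b'')

end MultiOp

namespace GQuiver

variable (Q : GQuiver.{w, v, u} k)

theorem sgn_of_mem {X Y : Q.Obj} {n : ℤ} {a : Q.Tot X Y} (ha : a ∈ Q.gr X Y n) :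
    Q.sgn X Y a = (((n - 1).negOnePow : ℤˣ) : ℤ) • a := by
  obtain ⟨x, rfl⟩ := ha
  rw [sgn, DirectSum.lmap_lof, LinearMap.smul_apply, LinearMap.id_apply, map_zsmul]

theorem hasDeg_one {X Y : Q.Obj} {n : ℤ} {a : Q.Tot X Y} (ha : a ∈ Q.gr X Y n) :
    Q.HasDeg (Quiver.Path.nil.cons a) (n - 1) := by
  simpa using HasDeg.cons n a HasDeg.nil ha

theorem hasDeg_two {X Y Z : Q.Obj} {n m : ℤ} {a : Q.Tot X Y} {b : Q.Tot Y Z}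
    (ha : a ∈ Q.gr X Y n) (hb : b ∈ Q.gr Y Z m) :
    Q.HasDeg ((Quiver.Path.nil.cons a).cons b) (n + m - 2) := by
  have := HasDeg.cons m b (Q.hasDeg_one ha) hb
  rwa [show n - 1 + m - 1 = n + m - 2 by ring] at this

theorem hasDeg_three {W X Y Z : Q.Obj} {n m l : ℤ} {a : Q.Tot W X} {b : Q.Tot X Y}
    {c : Q.Tot Y Z} (ha : a ∈ Q.gr W X n) (hb : b ∈ Q.gr X Y m) (hc : c ∈ Q.gr Y Z l) :
    Q.HasDeg (((Quiver.Path.nil.cons a).cons b).cons c) (n + m + l - 3) := by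
  have := HasDeg.cons l c (Q.hasDeg_two ha hb) hc
  rwa [show n + m - 2 + l - 1 = n + m + l - 3 by ring] at this

end GQuiver

namespace AInfCat

variable (A : AInfCat.{w, v, u} k)

/-- The differential `μ¹`. -/
def d (X Y : A.Obj) : A.Tot X Y →ₗ[k] A.Tot X Y where
  toFun a := A.μ.ev (Quiver.Path.nil.cons a)
  map_add' a b := A.μ.ev_add .nil a b .nil
  map_smul' r a := A.μ.ev_smul .nil r a .nil

/-- The operation `(a, b) ↦ μ²(b, a)`. -/
def m2 (X Y Z : A.Obj) : A.Tot X Y →ₗ[k] A.Tot Y Z →ₗ[k] A.Tot X Z :=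
  LinearMap.mk₂ k
    (fun (a : A.Tot X Y) (b : A.Tot Y Z) => A.μ.ev ((Quiver.Path.nil.cons a).cons b))
    (by intro a a' b; exact A.μ.ev_add .nil a a' (Quiver.Path.nil.cons b))
    (by intro r a b; exact A.μ.ev_smul .nil r a (Quiver.Path.nil.cons b))
    (by intro a b b'; exact A.μ.ev_add (Quiver.Path.nil.cons a) b b' .nil)
    (by intro r a b; exact A.μ.ev_smul (Quiver.Path.nil.cons a) r b .nil)

/-- The operation `(a, b, c) ↦ μ³(c, b, a)`. -/
def m3 {W X Y Z : A.Obj} (a : A.Tot W X) (b : A.Tot X Y) (c : A.Tot Y Z) : A.Tot W Z :=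
  A.μ.ev (((Quiver.Path.nil.cons a).cons b).cons c)

set_option linter.unusedSimpArgs false in
theorem d_d {X Y : A.Obj} (a : A.Tot X Y) : A.d X Y (A.d X Y a) = 0 := by
  have h := A.rel (Quiver.Path.nil.cons a : Quiver.Path X Y)
  simp only [insertSum, Quiver.Path.splits, List.map_cons, List.map_nil, List.map_append,
    List.flatMap_cons, List.flatMap_nil, List.nil_append, List.append_nil, List.cons_append,
    List.sum_cons, List.sum_nil, Quiver.Hom.toPath, Quiver.Path.comp_nil, Quiver.Path.comp_cons,
    GQuiver.sgnWord, A.μ.ev_nil, MultiOp.ev_cons_zero, MultiOp.ev_cons_zero_cons,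
    MultiOp.ev_cons_zero_cons_cons, MultiOp.ev_cons_zero_cons_cons_cons, add_zero,
    zero_add] at h
  exact h

set_option linter.unusedSimpArgs false in
theorem d_m2 {X Y Z : A.Obj} (a : A.Tot X Y) (b : A.Tot Y Z) :
    A.d X Z (A.m2 X Y Z a b) + A.m2 X Y Z (A.d X Y a) b +
      A.m2 X Y Z (A.sgn X Y a) (A.d Y Z b) = 0 := by
  have h := A.rel ((Quiver.Path.nil.cons a).cons b : Quiver.Path X Z)
  simp only [insertSum, Quiver.Path.splits, List.map_cons, List.map_nil, List.map_append,
    List.flatMap_cons, List.flatMap_nil, List.nil_append, List.append_nil, List.cons_append,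
    List.sum_cons, List.sum_nil, Quiver.Hom.toPath, Quiver.Path.comp_nil, Quiver.Path.comp_cons,
    GQuiver.sgnWord, A.μ.ev_nil, MultiOp.ev_cons_zero, MultiOp.ev_cons_zero_cons,
    MultiOp.ev_cons_zero_cons_cons, MultiOp.ev_cons_zero_cons_cons_cons, add_zero,
    zero_add] at h
  have h' : A.m2 X Y Z (A.d X Y a) b + (A.d X Z (A.m2 X Y Z a b) +
      A.m2 X Y Z (A.sgn X Y a) (A.d Y Z b)) = 0 := h
  rw [← h']
  abel

set_option linter.unusedSimpArgs false in
theorem d_m3 {W X Y Z : A.Obj} (a : A.Tot W X) (b : A.Tot X Y) (c : A.Tot Y Z) :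
    A.d W Z (A.m3 a b c) + A.m3 (A.d W X a) b c + A.m3 (A.sgn W X a) (A.d X Y b) c +
      A.m3 (A.sgn W X a) (A.sgn X Y b) (A.d Y Z c) + A.m2 W Y Z (A.m2 W X Y a b) c +
      A.m2 W X Z (A.sgn W X a) (A.m2 X Y Z b c) = 0 := by
  have h := A.rel (((Quiver.Path.nil.cons a).cons b).cons c : Quiver.Path W Z)
  simp only [insertSum, Quiver.Path.splits, List.map_cons, List.map_nil, List.map_append,
    List.flatMap_cons, List.flatMap_nil, List.nil_append, List.append_nil, List.cons_append,
    List.sum_cons, List.sum_nil, Quiver.Hom.toPath, Quiver.Path.comp_nil, Quiver.Path.comp_cons,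
    GQuiver.sgnWord, A.μ.ev_nil, MultiOp.ev_cons_zero, MultiOp.ev_cons_zero_cons,
    MultiOp.ev_cons_zero_cons_cons, MultiOp.ev_cons_zero_cons_cons_cons, add_zero,
    zero_add] at h
  have h' : A.m3 (A.d W X a) b c + (A.m2 W Y Z (A.m2 W X Y a b) c + (A.d W Z (A.m3 a b c) +
      (A.m3 (A.sgn W X a) (A.d X Y b) c + (A.m2 W X Z (A.sgn W X a) (A.m2 X Y Z b c) +
        A.m3 (A.sgn W X a) (A.sgn X Y b) (A.d Y Z c))))) = 0 := h
  rw [← h']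
  abel

theorem d_mem {X Y : A.Obj} {n : ℤ} {a : A.Tot X Y} (ha : a ∈ A.gr X Y n) :
    A.d X Y a ∈ A.gr X Y (n + 1) := by
  have := A.μ.ev_mem _ _ (A.hasDeg_one ha)
  rwa [show n - 1 + 2 = n + 1 by ring] at this

theorem m2_mem {X Y Z : A.Obj} {n m : ℤ} {a : A.Tot X Y} {b : A.Tot Y Z}
    (ha : a ∈ A.gr X Y n) (hb : b ∈ A.gr Y Z m) : A.m2 X Y Z a b ∈ A.gr X Z (n + m) := by
  have := A.μ.ev_mem _ _ (A.hasDeg_two ha hb)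
  rwa [show n + m - 2 + 2 = n + m by ring] at this

theorem m3_mem {W X Y Z : A.Obj} {n m l : ℤ} {a : A.Tot W X} {b : A.Tot X Y}
    {c : A.Tot Y Z} (ha : a ∈ A.gr W X n) (hb : b ∈ A.gr X Y m) (hc : c ∈ A.gr Y Z l) :
    A.m3 a b c ∈ A.gr W Z (n + m + l - 1) := by
  have := A.μ.ev_mem _ _ (A.hasDeg_three ha hb hc)
  rwa [show n + m + l - 3 + 2 = n + m + l - 1 by ring] at this

/-! ### The cohomology of an A-infinity category -/

/-- Closed morphisms of degree `n`. -/
def Z (n : ℤ) (X Y : A.Obj) : Submodule k (A.Tot X Y) :=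
  A.gr X Y n ⊓ LinearMap.ker (A.d X Y)

/-- Exact morphisms of degree `n`. -/
def B (n : ℤ) (X Y : A.Obj) : Submodule k (A.Tot X Y) :=
  (A.gr X Y (n - 1)).map (A.d X Y)

/-- The cohomology `Hom^n(X, Y)` of the morphism complex. -/
abbrev H (n : ℤ) (X Y : A.Obj) : Type v :=
  A.Z n X Y ⧸ (A.B n X Y).submoduleOf (A.Z n X Y)

/-- The composition `(a, b) ↦ (-1)^|a| μ²(b, a)` of closed morphisms. -/
def compZ {n m l : ℤ} (h : n + m = l) (X Y Z : A.Obj) :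
    A.Z n X Y →ₗ[k] A.Z m Y Z →ₗ[k] A.Z l X Z :=
  LinearMap.mk₂ k
    (fun a b => ⟨((n.negOnePow : ℤˣ) : ℤ) • A.m2 X Y Z a.1 b.1, by
      refine Submodule.mem_inf.2 ⟨zsmul_mem (h ▸ A.m2_mem a.2.1 b.2.1) _, ?_⟩
      have h2 := A.d_m2 a.1 b.1
      have ha : A.d X Y a.1 = 0 := a.2.2
      have hb : A.d Y Z b.1 = 0 := b.2.2
      rw [ha, hb, map_zero, map_zero, LinearMap.zero_apply, add_zero, add_zero] at h2
      rw [LinearMap.mem_ker, map_zsmul, h2, smul_zero]⟩)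
    (by intro a a' b; ext1; simp [smul_add])
    (by intro r a b; ext1; simp [smul_comm _ r])
    (by intro a b b'; ext1; simp [smul_add])
    (by intro r a b; ext1; simp [smul_comm _ r])

/-- The composition `Hom^n(X, Y) × Hom^m(Y, Z) → Hom^{n+m}(X, Z)`, in diagrammatic order. -/
def comp {n m l : ℤ} (h : n + m = l) {X Y Z : A.Obj} :
    A.H n X Y →ₗ[k] A.H m Y Z →ₗ[k] A.H l X Z :=
  LinearMap.liftQ₂ _ _
    ((A.compZ h X Y Z).compr₂ ((A.B l X Z).submoduleOf (A.Z l X Z)).mkQ)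
    (by
      rintro a ⟨a', ha', haa⟩
      rw [LinearMap.mem_ker]
      ext b
      have hb : A.d Y Z b.1 = 0 := b.2.2
      have h2 := A.d_m2 a' b.1
      rw [hb, map_zero, add_zero] at h2
      refine (Submodule.Quotient.mk_eq_zero _).2 ?_
      refine Submodule.mem_comap.2 (zsmul_mem ?_ _)
      refine ⟨-A.m2 X Y Z a' b.1, ?_, ?_⟩
      · have := A.m2_mem ha' b.2.1
        rw [show n - 1 + m = l - 1 by omega] at this
        exact neg_mem this
      · rw [map_neg, neg_eq_iff_add_eq_zero]
        change A.d X Y a' = a.1 at haa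
        rw [← haa]
        exact h2)
    (by
      rintro b ⟨b', hb', hbb⟩
      rw [LinearMap.mem_ker]
      ext a
      have ha : A.d X Y a.1 = 0 := a.2.2
      have h2 := A.d_m2 a.1 b'
      rw [ha, map_zero, LinearMap.zero_apply, add_zero, A.sgn_of_mem a.2.1, map_zsmul,
        LinearMap.smul_apply] at h2
      refine (Submodule.Quotient.mk_eq_zero _).2 ?_
      refine Submodule.mem_comap.2 ?_
      change A.d Y Z b' = b.1 at hbb
      refine ⟨A.m2 X Y Z a.1 b', ?_, ?_⟩
      · have := A.m2_mem a.2.1 hb'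
        rwa [show n + (m - 1) = l - 1 by omega] at this
      · change _ = ((n.negOnePow : ℤˣ) : ℤ) • A.m2 X Y Z a.1 b.1
        rw [← hbb]
        rw [Int.negOnePow_sub, Int.negOnePow_one] at h2
        simpa [add_neg_eq_zero] using h2)

theorem comp_mk {n m l : ℤ} (h : n + m = l) {X Y Z : A.Obj} (a : A.Z n X Y) (b : A.Z m Y Z) :
    A.comp h (Submodule.Quotient.mk a) (Submodule.Quotient.mk b) =
      Submodule.Quotient.mk (A.compZ h X Y Z a b) := rfl

theorem comp_assoc {n m l nm ml nml : ℤ} (h₁ : n + m = nm) (h₂ : m + l = ml)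
    (h₃ : nm + l = nml) (h₄ : n + ml = nml) {W X Y Z : A.Obj}
    (f : A.H n W X) (g : A.H m X Y) (h : A.H l Y Z) :
    A.comp h₃ (A.comp h₁ f g) h = A.comp h₄ f (A.comp h₂ g h) := by
  obtain ⟨a, rfl⟩ := Submodule.Quotient.mk_surjective _ f
  obtain ⟨b, rfl⟩ := Submodule.Quotient.mk_surjective _ g
  obtain ⟨c, rfl⟩ := Submodule.Quotient.mk_surjective _ h
  rw [comp_mk, comp_mk, comp_mk, comp_mk, Submodule.Quotient.eq]
  have ha : A.d W X a.1 = 0 := a.2.2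
  have hb : A.d X Y b.1 = 0 := b.2.2
  have hc : A.d Y Z c.1 = 0 := c.2.2
  have h3 := A.d_m3 a.1 b.1 c.1
  have z1 : A.m3 (0 : A.Tot W X) b.1 c.1 = 0 := A.μ.ev_cons_zero_cons_cons .nil _ _
  have z2 : A.m3 (A.sgn W X a.1) (0 : A.Tot X Y) c.1 = 0 := A.μ.ev_cons_zero_cons _ _
  have z3 : A.m3 (A.sgn W X a.1) (A.sgn X Y b.1) (0 : A.Tot Y Z) = 0 := A.μ.ev_cons_zero _
  rw [ha, hb, hc, z1, z2, z3, A.sgn_of_mem a.2.1] at h3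
  refine Submodule.mem_comap.2 ⟨-((m.negOnePow : ℤˣ) : ℤ) • A.m3 a.1 b.1 c.1, ?_, ?_⟩
  · have := A.m3_mem a.2.1 b.2.1 c.2.1
    rw [show n + m + l - 1 = nml - 1 by omega] at this
    exact zsmul_mem this _
  · change _ = ((nm.negOnePow : ℤˣ) : ℤ) • A.m2 W Y Z
        (((n.negOnePow : ℤˣ) : ℤ) • A.m2 W X Y a.1 b.1) c.1 -
      ((n.negOnePow : ℤˣ) : ℤ) • A.m2 W X Z a.1 (((m.negOnePow : ℤˣ) : ℤ) • A.m2 X Y Z b.1 c.1)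
    rw [map_zsmul]
    subst h₁
    rw [Int.negOnePow_sub, Int.negOnePow_one] at h3
    rw [Int.negOnePow_add]
    have hn : ((n.negOnePow : ℤˣ) : ℤ) * ((n.negOnePow : ℤˣ) : ℤ) = 1 := by
      rw [← Units.val_mul, Int.units_mul_self, Units.val_one]
    simp only [add_zero, Units.val_mul, Units.val_neg, map_zsmul,
      LinearMap.smul_apply, mul_neg, mul_one, map_neg, LinearMap.neg_apply, neg_smul] at h3 ⊢
    rw [← sub_eq_add_neg, sub_eq_zero, ← eq_sub_iff_add_eq] at h3
    rw [h3, smul_smul, smul_smul, mul_right_comm, hn, one_mul, mul_comm]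
    rw [smul_sub, neg_sub, smul_smul]

/-- Cohomological unitality: every object has an identity in the cohomology category. -/
class Unital : Prop where
  exists_id : ∀ X : A.Obj, ∃ e : A.H 0 X X, ∀ (Y : A.Obj) (n : ℤ),
    (∀ f : A.H n X Y, A.comp (zero_add n) e f = f) ∧
      ∀ f : A.H n Y X, A.comp (add_zero n) f e = f

section Unital

variable [A.Unital]

/-- The identity of `X` in the cohomology category. -/
noncomputable def id (X : A.Obj) : A.H 0 X X := (Unital.exists_id (A := A) X).choose

theorem id_comp {X Y : A.Obj} {n : ℤ} (f : A.H n X Y) :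
    A.comp (zero_add n) (A.id X) f = f :=
  ((Unital.exists_id (A := A) X).choose_spec Y n).1 f

theorem comp_id {X Y : A.Obj} {n : ℤ} (f : A.H n X Y) :
    A.comp (add_zero n) f (A.id Y) = f :=
  ((Unital.exists_id (A := A) Y).choose_spec X n).2 f

end Unital

end AInfCat

/-- The objects of the category `H⁰(A)`. -/
@[ext]
structure H0 (A : AInfCat.{w, v, u} k) where
  obj : A.Obj

namespace H0

variable (A : AInfCat.{w, v, u} k) [A.Unital]

noncomputable instance : Category.{v} (H0 A) where
  Hom X Y := A.H 0 X.obj Y.obj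
  id X := A.id X.obj
  comp f g := A.comp (add_zero 0) f g
  id_comp f := A.id_comp f
  comp_id f := A.comp_id f
  assoc f g h := A.comp_assoc _ _ _ _ f g h

noncomputable instance : Preadditive (H0 A) where
  homGroup X Y := inferInstanceAs (AddCommGroup (A.H 0 X.obj Y.obj))
  add_comp X Y Z (f f' : A.H 0 X.obj Y.obj) (g : A.H 0 Y.obj Z.obj) :=
    LinearMap.map_add₂ (A.comp (add_zero 0)) f f' g
  comp_add X Y Z (f : A.H 0 X.obj Y.obj) (g g' : A.H 0 Y.obj Z.obj) :=
    map_add (A.comp (add_zero 0) f) g g'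

noncomputable instance : Linear k (H0 A) where
  homModule X Y := inferInstanceAs (Module k (A.H 0 X.obj Y.obj))
  smul_comp X Y Z r (f : A.H 0 X.obj Y.obj) (g : A.H 0 Y.obj Z.obj) :=
    LinearMap.map_smul₂ (A.comp (add_zero 0)) r f g
  comp_smul X Y Z (f : A.H 0 X.obj Y.obj) r (g : A.H 0 Y.obj Z.obj) :=
    map_smul (A.comp (add_zero 0) f) r g

end H0

namespace AInfFunctor

variable {A : AInfCat.{w, v, u} k} {B : AInfCat.{w, v', u'} k} {f : A.Obj → B.Obj}
  (Φ : AInfFunctor A B f)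

/-- The linear part `F¹` of an `A∞`-functor. -/
def lin (X Y : A.Obj) : A.Tot X Y →ₗ[k] B.Tot (f X) (f Y) where
  toFun a := Φ.F.ev (Quiver.Path.nil.cons a)
  map_add' a b := Φ.F.ev_add .nil a b .nil
  map_smul' r a := Φ.F.ev_smul .nil r a .nil

theorem lin_mem {X Y : A.Obj} {n : ℤ} {a : A.Tot X Y} (ha : a ∈ A.gr X Y n) :
    Φ.lin X Y a ∈ B.gr (f X) (f Y) n := by
  have := Φ.F.ev_mem _ _ (A.hasDeg_one ha)
  rwa [show n - 1 + 1 = n by ring] at this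

theorem lin_d {X Y : A.Obj} (a : A.Tot X Y) :
    Φ.lin X Y (A.d X Y a) = B.d (f X) (f Y) (Φ.lin X Y a) := by
  have h := Φ.rel (Quiver.Path.nil.cons a : Quiver.Path X Y)
  simp only [insertSum, Quiver.Path.splits, MultiOp.cuts, MultiOp.cutsAux, List.map_cons,
    List.map_nil, List.flatMap_cons, List.flatMap_nil, List.nil_append, List.append_nil,
    List.cons_append, List.sum_cons, List.sum_nil, Quiver.Hom.toPath, Quiver.Path.comp_nil,
    Quiver.Path.comp_cons, GQuiver.sgnWord, A.μ.ev_nil, MultiOp.ev_cons_zero,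
    MultiOp.ev_cons_zero_cons, add_zero, zero_add] at h
  exact h.symm

/-- The map induced on `Hom^n` by an `A∞`-functor. -/
def mapH (n : ℤ) (X Y : A.Obj) : A.H n X Y →ₗ[k] B.H n (f X) (f Y) :=
  Submodule.mapQ _ _
    ((Φ.lin X Y).restrict (p := A.Z n X Y) (q := B.Z n (f X) (f Y)) (by
      rintro a ⟨ha, hd⟩
      refine ⟨Φ.lin_mem ha, ?_⟩
      rw [SetLike.mem_coe, LinearMap.mem_ker] at hd ⊢
      rw [← Φ.lin_d, hd, map_zero]))
    (by
      rintro a ⟨a', ha', haa⟩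
      change A.d X Y a' = a.1 at haa
      refine Submodule.mem_comap.2 ⟨Φ.lin X Y a', Φ.lin_mem ha', ?_⟩
      rw [← Φ.lin_d, haa]
      rfl)

/-- `Φ` induces isomorphisms on the cohomology of all morphism complexes. -/
def IsQuasiIso : Prop := ∀ (n : ℤ) (X Y : A.Obj), Function.Bijective (Φ.mapH n X Y)

/-- `Φ` is an equivalence: it induces isomorphisms on the cohomology of all morphism complexes,
and it is essentially surjective on `H⁰`. -/
def IsEquivalence [B.Unital] : Prop :=
  Φ.IsQuasiIso ∧ ∀ Y : B.Obj, ∃ X : A.Obj, Nonempty ((⟨f X⟩ : H0 B) ≅ ⟨Y⟩)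

end AInfFunctor

/-! ### Full subcategories and directed subcategories -/

/-- A strict (linear, degree preserving) morphism of graded quivers with object map `f`. -/
structure GQuiverMap (Q : GQuiver.{w, v, u} k) (R : GQuiver.{w, v', u'} k)
    (f : Q.Obj → R.Obj) where
  tot : ∀ X Y : Q.Obj, Q.Tot X Y →ₗ[k] R.Tot (f X) (f Y)
  tot_mem : ∀ {X Y : Q.Obj} {n : ℤ} {a : Q.Tot X Y}, a ∈ Q.gr X Y n →
    tot X Y a ∈ R.gr (f X) (f Y) n

namespace GQuiverMap

variable {Q : GQuiver.{w, v, u} k} {R : GQuiver.{w, v', u'} k} {f : Q.Obj → R.Obj}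
  (φ : GQuiverMap Q R f)

/-- The induced map on words. -/
def word {X : Q.Obj} : {Y : Q.Obj} → Quiver.Path X Y → Quiver.Path (f X) (f Y)
  | _, .nil => .nil
  | _, .cons (b := Y) (c := Z) p a => (word p).cons (φ.tot Y Z a)

theorem word_comp {X Y Z : Q.Obj} (p : Quiver.Path X Y) (q : Quiver.Path Y Z) :
    φ.word (p.comp q) = (φ.word p).comp (φ.word q) := by
  induction q with
  | nil => rfl
  | cons q a ih => exact congrArg (fun r => Quiver.Path.cons r (φ.tot _ _ a)) ih

theorem tot_sgn {X Y : Q.Obj} (a : Q.Tot X Y) :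
    φ.tot X Y (Q.sgn X Y a) = R.sgn (f X) (f Y) (φ.tot X Y a) := by
  induction a using DirectSum.induction_on with
  | zero => simp
  | of n x =>
    change φ.tot X Y (Q.sgn X Y (DirectSum.lof k ℤ _ n x)) =
      R.sgn (f X) (f Y) (φ.tot X Y (DirectSum.lof k ℤ _ n x))
    rw [Q.sgn_of_mem ⟨x, rfl⟩, R.sgn_of_mem (φ.tot_mem ⟨x, rfl⟩), map_zsmul]
  | add a b ha hb => simp only [map_add, ha, hb]

theorem word_sgnWord {X Y : Q.Obj} (p : Quiver.Path X Y) :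
    φ.word (Q.sgnWord p) = R.sgnWord (φ.word p) := by
  induction p with
  | nil => rfl
  | cons p a ih =>
    simp only [GQuiver.sgnWord, word, ih]
    exact congrArg (Quiver.Path.cons _) (φ.tot_sgn a)

theorem hasDeg_word {X Y : Q.Obj} {p : Quiver.Path X Y} {s : ℤ} (h : Q.HasDeg p s) :
    R.HasDeg (φ.word p) s := by
  induction h with
  | nil => exact .nil
  | cons n a _ ha ih => exact .cons n _ ih (φ.tot_mem ha)

theorem splits_word {X Y : Q.Obj} (p : Quiver.Path X Y) :
    (φ.word p).splits = p.splits.map fun s => ⟨f s.1, φ.word s.2.1, φ.word s.2.2⟩ := by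
  induction p with
  | nil => rfl
  | cons p a ih =>
    simp only [word, Quiver.Path.splits, ih, List.map_append, List.map_map, List.map_cons,
      List.map_nil, Function.comp_def]

end GQuiverMap

/-- The operations `ψ ∘ Φ ∘ φ`, for strict maps `φ` on arguments and `ψ` on values. -/
def MultiOp.conj {Q : GQuiver.{w, v₁, u₁} k} {Q' : GQuiver.{w, v₂, u₂} k}
    {R : GQuiver.{w, v₃, u₃} k} {R' : GQuiver.{w, v₄, u₄} k}
    {f : Q.Obj → R.Obj} {f' : Q'.Obj → R'.Obj} {c : ℤ} (Φ : MultiOp Q R f c)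
    {g : Q'.Obj → Q.Obj} (φ : GQuiverMap Q' Q g)
    (ψ : ∀ X Y : Q'.Obj, R.Tot (f (g X)) (f (g Y)) →ₗ[k] R'.Tot (f' X) (f' Y))
    (hψ : ∀ {X Y : Q'.Obj} {n : ℤ} {a : R.Tot (f (g X)) (f (g Y))},
      a ∈ R.gr (f (g X)) (f (g Y)) n → ψ X Y a ∈ R'.gr (f' X) (f' Y) n) :
    MultiOp Q' R' f' c where
  ev {X Y} p := ψ X Y (Φ.ev (φ.word p))
  ev_add {W X Y Z} p a b q := by
    rw [← map_add]
    congr 1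
    simp only [φ.word_comp, GQuiverMap.word, map_add]
    exact Φ.ev_add _ _ _ _
  ev_smul {W X Y Z} p r a q := by
    rw [← map_smul]
    congr 1
    simp only [φ.word_comp, GQuiverMap.word, map_smul]
    exact Φ.ev_smul _ _ _ _
  ev_nil X := by
    simp only [GQuiverMap.word, Φ.ev_nil, map_zero]
  ev_mem {X Y} p s h := by
    exact hψ (Φ.ev_mem _ s (φ.hasDeg_word h))

/-- If `φ` is compatible with the operations `μ'` and `μ`, it transports insertion sums. -/
theorem insertSum_conj {Q : GQuiver.{w, v₁, u₁} k} {Q' : GQuiver.{w, v₂, u₂} k}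
    {R : GQuiver.{w, v₃, u₃} k} {R' : GQuiver.{w, v₄, u₄} k}
    {f : Q.Obj → R.Obj} {f' : Q'.Obj → R'.Obj} {c : ℤ} (Φ : MultiOp Q R f c)
    {g : Q'.Obj → Q.Obj} (φ : GQuiverMap Q' Q g)
    (ψ : ∀ X Y : Q'.Obj, R.Tot (f (g X)) (f (g Y)) →ₗ[k] R'.Tot (f' X) (f' Y))
    (hψ : ∀ {X Y : Q'.Obj} {n : ℤ} {a : R.Tot (f (g X)) (f (g Y))},
      a ∈ R.gr (f (g X)) (f (g Y)) n → ψ X Y a ∈ R'.gr (f' X) (f' Y) n)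
    (μ : MultiOp Q Q (fun X => X) 2) (μ' : MultiOp Q' Q' (fun X => X) 2)
    (h : ∀ {X Y : Q'.Obj} (p : Quiver.Path X Y), φ.tot X Y (μ'.ev p) = μ.ev (φ.word p))
    {X Y : Q'.Obj} (p : Quiver.Path X Y) :
    insertSum μ' (Φ.conj (R' := R') (f' := f') φ ψ hψ) p =
      ψ X Y (insertSum μ Φ (φ.word p)) := by
  unfold insertSum
  rw [map_list_sum, φ.splits_word, List.map_flatMap, List.flatMap_map]
  congr 1
  refine List.flatMap_congr fun s _ => ?_
  dsimp only
  rw [φ.splits_word, List.map_map, List.map_map]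
  refine List.map_congr_left fun t _ => ?_
  simp only [MultiOp.conj, Function.comp_apply, φ.word_comp, Quiver.Hom.toPath,
    GQuiverMap.word, φ.word_sgnWord, h]

namespace AInfCat

/-- The graded quiver of the full subcategory on the objects satisfying `P`. -/
def fullQuiver (A : AInfCat.{w, v, u} k) (P : A.Obj → Prop) : GQuiver.{w, v, u} k where
  Obj := {X : A.Obj // P X}
  Hom X Y n := A.Hom X.1 Y.1 n

/-- The inclusion of a full subcategory. -/
def fullIncl (A : AInfCat.{w, v, u} k) (P : A.Obj → Prop) :
    GQuiverMap (A.fullQuiver P) A.toGQuiver Subtype.val where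
  tot _ _ := LinearMap.id
  tot_mem h := h

/-- The full `A∞`-subcategory on the objects satisfying `P`. -/
def full (A : AInfCat.{w, v, u} k) (P : A.Obj → Prop) : AInfCat.{w, v, u} k where
  toGQuiver := A.fullQuiver P
  μ := A.μ.conj (R' := A.fullQuiver P) (A.fullIncl P) (fun _ _ => LinearMap.id) (fun h => h)
  rel p := (insertSum_conj A.μ (A.fullIncl P) (fun _ _ => LinearMap.id) (fun h => h) A.μ
    (A.μ.conj (R' := A.fullQuiver P) (A.fullIncl P) (fun _ _ => LinearMap.id) (fun h => h))
    (fun _ => rfl) p).trans (A.rel ((A.fullIncl P).word p))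

instance (A : AInfCat.{w, v, u} k) [A.Unital] (P : A.Obj → Prop) : (A.full P).Unital where
  exists_id X := ⟨A.id X.1, fun Y _ =>
    ⟨fun f => A.id_comp (Y := Y.1) f, fun f => A.comp_id (X := Y.1) f⟩⟩

/-- A morphism of a full subcategory, regarded as a morphism in the ambient category. -/
def ofFull {A : AInfCat.{w, v, u} k} {P : A.Obj → Prop} {n : ℤ} {X Y : (A.full P).Obj}
    (h : (A.full P).H n X Y) : A.H n X.1 Y.1 := h

/-- The objects of the directed category of a collection indexed by `ι`. -/
@[ext]
structure DirObj (ι : Type u') where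
  idx : ι

section Directed

variable {ι : Type u'} [LinearOrder ι]

variable (A : AInfCat.{w, v, u} k) (X : ι → A.Obj)

/-- The subspace of `Hom(Xᵢ, Xⱼ)` which is everything if `i < j`, and zero otherwise. -/
def dirHom (i j : ι) (n : ℤ) : Submodule k (A.Hom (X i) (X j) n) where
  carrier := {x | ¬ i < j → x = 0}
  zero_mem' _ := rfl
  add_mem' ha hb h := by rw [ha h, hb h, add_zero]
  smul_mem' r _ ha h := by rw [ha h, smul_zero]

/-- Given objects `Xᵢ` indexed by a linear order, the graded quiver with object set `ι` and
morphism spaces `Hom(Xᵢ, Xⱼ)` for `i < j`, and zero otherwise. -/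
def dirQuiver : GQuiver.{w, v, u'} k where
  Obj := DirObj ι
  Hom i j n := A.dirHom X i.idx j.idx n

/-- The inclusion of the directed quiver. -/
def dirIncl : GQuiverMap (A.dirQuiver X) A.toGQuiver (fun i => X i.idx) where
  tot i j := DirectSum.lmap (M := fun n => A.dirHom X i.idx j.idx n)
    (N := A.Hom (X i.idx) (X j.idx)) fun n => (A.dirHom X i.idx j.idx n).subtype
  tot_mem := by
    rintro i j n _ ⟨x, rfl⟩
    exact ⟨_, (DirectSum.lmap_lof (M := fun n => A.dirHom X i.idx j.idx n)
      (N := A.Hom (X i.idx) (X j.idx)) _ n x).symm⟩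

open scoped Classical in
/-- The projection from `Hom(Xᵢ, Xⱼ)`: the identity if `i < j`, and zero otherwise. -/
noncomputable def dirProjHom (i j : ι) (n : ℤ) : A.Hom (X i) (X j) n →ₗ[k] A.dirHom X i j n :=
  if h : i < j then LinearMap.id.codRestrict (A.dirHom X i j n) (fun _ h' => absurd h h') else 0

/-- The projection to the morphism spaces of the directed quiver. -/
noncomputable def dirProj (i j : (A.dirQuiver X).Obj) :
    A.Tot (X i.idx) (X j.idx) →ₗ[k] (A.dirQuiver X).Tot i j :=
  DirectSum.lmap (N := fun n => A.dirHom X i.idx j.idx n) (A.dirProjHom X i.idx j.idx)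

theorem dirProj_lof (i j : (A.dirQuiver X).Obj) (n : ℤ) (x : A.Hom (X i.idx) (X j.idx) n) :
    A.dirProj X i j (DirectSum.lof k ℤ _ n x) =
      DirectSum.lof k ℤ (fun n => A.dirHom X i.idx j.idx n) n
        (A.dirProjHom X i.idx j.idx n x) :=
  DirectSum.lmap_lof (N := fun n => A.dirHom X i.idx j.idx n) _ n x

theorem dirIncl_lof (i j : (A.dirQuiver X).Obj) (n : ℤ) (x : A.dirHom X i.idx j.idx n) :
    (A.dirIncl X).tot i j (DirectSum.lof k ℤ (fun n => A.dirHom X i.idx j.idx n) n x) =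
      DirectSum.lof k ℤ _ n x.1 :=
  DirectSum.lmap_lof (M := fun n => A.dirHom X i.idx j.idx n) (N := A.Hom (X i.idx) (X j.idx))
    _ n x

theorem dirProj_mem {i j : (A.dirQuiver X).Obj} {n : ℤ} {a : A.Tot (X i.idx) (X j.idx)}
    (ha : a ∈ A.gr (X i.idx) (X j.idx) n) :
    A.dirProj X i j a ∈ (A.dirQuiver X).gr i j n := by
  obtain ⟨x, rfl⟩ := ha
  exact ⟨_, (A.dirProj_lof X i j n x).symm⟩

theorem dirIncl_dirProj {i j : (A.dirQuiver X).Obj} (h : i.idx < j.idx)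
    (a : A.Tot (X i.idx) (X j.idx)) : (A.dirIncl X).tot i j (A.dirProj X i j a) = a := by
  induction a using DirectSum.induction_on with
  | zero => rw [map_zero, map_zero]
  | of n x =>
    refine (congrArg _ (A.dirProj_lof X i j n x)).trans ((A.dirIncl_lof X i j n _).trans ?_)
    rw [dirProjHom, dif_pos h]
    rfl
  | add a b ha hb => rw [map_add, map_add, ha, hb]

theorem dirIncl_of_not_lt {i j : (A.dirQuiver X).Obj} (h : ¬ i.idx < j.idx)
    (a : (A.dirQuiver X).Tot i j) : (A.dirIncl X).tot i j a = 0 := by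
  induction a using DirectSum.induction_on with
  | zero => rw [map_zero]
  | of n x =>
    refine (A.dirIncl_lof X i j n x).trans ?_
    have hx : (show A.dirHom X i.idx j.idx n from x).1 = 0 := x.2 h
    exact (congrArg (DirectSum.lof k ℤ (A.Hom (X i.idx) (X j.idx)) n) hx).trans (map_zero _)
  | add a b ha hb => rw [map_add, ha, hb, add_zero]

theorem dir_word {R : GQuiver.{w, v', u₁} k} {f : A.Obj → R.Obj} {c : ℤ}
    (Φ : MultiOp A.toGQuiver R f c) {i j : (A.dirQuiver X).Obj} (p : Quiver.Path i j) :
    ((i.idx < j.idx ∨ i.idx = j.idx ∧ p.length = 0) ∨ ∀ (Z : A.Obj) (q : Quiver.Path (X j.idx) Z),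
      Φ.ev (((A.dirIncl X).word p).comp q) = 0) := by
  induction p with
  | nil => exact .inl (.inr ⟨rfl, rfl⟩)
  | @cons j l p a ih =>
    rcases ih with h | h
    · have hij : i.idx ≤ j.idx := h.elim le_of_lt fun h => h.1.le
      by_cases hjl : j.idx < l.idx
      · exact .inl (.inl (lt_of_le_of_lt hij hjl))
      · refine .inr fun Z q => ?_
        have ha := A.dirIncl_of_not_lt X hjl a
        have := Φ.ev_zero (X := X j.idx) (Y := X l.idx) ((A.dirIncl X).word p) q
        rw [← ha] at this
        exact this
    · refine .inr fun Z q => ?_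
      have := h Z (Quiver.Path.comp
        (Quiver.Hom.toPath (show X j.idx ⟶ X l.idx from (A.dirIncl X).tot j l a)) q)
      rw [← Quiver.Path.comp_assoc] at this
      exact this

theorem dir_ev_eq_zero {R : GQuiver.{w, v', u₁} k} {f : A.Obj → R.Obj} {c : ℤ}
    (Φ : MultiOp A.toGQuiver R f c) {i j : (A.dirQuiver X).Obj}
    (h : ¬ i.idx < j.idx) (p : Quiver.Path i j) :
    Φ.ev ((A.dirIncl X).word p) = 0 := by
  rcases A.dir_word X Φ p with h' | h'
  · rcases h' with h' | ⟨hij, h'⟩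
    · exact absurd h' h
    · cases p with
      | nil => exact Φ.ev_nil _
      | cons p a => simp at h'
  · exact h' _ .nil

/-- The operations of the category of left-to-right morphisms. -/
noncomputable def dirOp : MultiOp (A.dirQuiver X) (A.dirQuiver X) (fun i => i) 2 :=
  A.μ.conj (R' := A.dirQuiver X) (A.dirIncl X) (A.dirProj X) (A.dirProj_mem X)

theorem dirIncl_dirOp {i j : (A.dirQuiver X).Obj} (p : Quiver.Path i j) :
    (A.dirIncl X).tot i j ((A.dirOp X).ev p) = A.μ.ev ((A.dirIncl X).word p) := by
  by_cases h : i.idx < j.idx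
  · exact A.dirIncl_dirProj X h _
  · exact (A.dirIncl_of_not_lt X h _).trans (A.dir_ev_eq_zero X A.μ h p).symm

/-- The `A∞`-category of left-to-right morphisms between objects `Xᵢ` indexed by a linear order:
its object set is `ι`, its morphism spaces are `Hom(Xᵢ, Xⱼ)` for `i < j` and zero for `i ≥ j`,
with the operations of `A`. The directed `A∞`-endomorphism algebra of the collection arises from
it by formally adjoining a strict unit to each object; strictly unital `A∞`-functors, identical
on objects, between directed algebras are the same thing as `A∞`-functors, identical on objects,
between these categories of left-to-right morphisms. -/
noncomputable def directed : AInfCat.{w, v, u'} k where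
  toGQuiver := A.dirQuiver X
  μ := A.dirOp X
  rel {i j} p := (insertSum_conj A.μ (A.dirIncl X) (A.dirProj X) (A.dirProj_mem X) A.μ
    (A.dirOp X) (A.dirIncl_dirOp X) p).trans (by rw [A.rel, map_zero])

end Directed

end AInfCat

namespace AInfFunctor

variable {A : AInfCat.{w, v, u} k} {B : AInfCat.{w, v', u'} k} {f : A.Obj → B.Obj}
  (Φ : AInfFunctor A B f) {ι : Type u₁} [LinearOrder ι] (X : ι → A.Obj)

/-- The operations of the directed restriction of an `A∞`-functor. -/
noncomputable def directedOp :
    MultiOp (A.directed X).toGQuiver (B.directed (f ∘ X)).toGQuiver (fun i => i) 1 :=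
  Φ.F.conj (R' := B.dirQuiver (f ∘ X)) (A.dirIncl X) (B.dirProj (f ∘ X))
    (B.dirProj_mem (f ∘ X))

theorem dirIncl_directedOp {i j : (A.directed X).Obj} (p : Quiver.Path i j) :
    (B.dirIncl (f ∘ X)).tot i j ((Φ.directedOp X).ev p) = Φ.F.ev ((A.dirIncl X).word p) := by
  by_cases h : i.idx < j.idx
  · exact B.dirIncl_dirProj (f ∘ X) h _
  · exact (B.dirIncl_of_not_lt (f ∘ X) h _).trans (A.dir_ev_eq_zero X Φ.F h p).symm

theorem word_cutsAux {i j l : (A.directed X).Obj} (p : Quiver.Path i j) (t : Quiver.Path j l) :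
    ((Φ.directedOp X).cutsAux p t).map (B.dirIncl (f ∘ X)).word =
      Φ.F.cutsAux ((A.dirIncl X).word p) ((A.dirIncl X).word t) := by
  induction p generalizing l with
  | nil =>
    exact congrArg (fun a => [Quiver.Path.nil.cons a]) (Φ.dirIncl_directedOp X t)
  | @cons j j' p a ih =>
    have h1 := (A.dirIncl X).word_comp (Quiver.Hom.toPath a) t
    have h2 := congrArg (List.map fun q => Quiver.Path.cons q (Φ.F.ev ((A.dirIncl X).word t)))
      (ih (Quiver.Hom.toPath a))
    refine List.map_append.trans (congrArg₂ (· ++ ·)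
      ((ih _).trans (congrArg (Φ.F.cutsAux ((A.dirIncl X).word p)) h1)) ?_)
    refine List.map_map.trans (Eq.trans ?_ (List.map_map.symm.trans h2))
    refine List.map_congr_left fun q _ => ?_
    exact congrArg (Quiver.Path.cons _) (Φ.dirIncl_directedOp X t)

theorem word_cuts {i j : (A.directed X).Obj} (p : Quiver.Path i j) :
    ((Φ.directedOp X).cuts p).map (B.dirIncl (f ∘ X)).word = Φ.F.cuts ((A.dirIncl X).word p) := by
  cases p with
  | nil => rfl
  | cons p a => exact Φ.word_cutsAux X p (Quiver.Hom.toPath a)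

/-- The restriction of an `A∞`-functor to left-to-right morphisms in a collection of objects. -/
noncomputable def directed : AInfFunctor (A.directed X) (B.directed (f ∘ X)) (fun i => i) where
  F := Φ.directedOp X
  rel {i j} p := by
    have h1 := insertSum_conj (Q' := A.dirQuiver X) (R' := B.dirQuiver (f ∘ X))
      (f' := fun i => i) Φ.F (A.dirIncl X)
      (B.dirProj (f ∘ X)) (B.dirProj_mem (f ∘ X)) A.μ (A.dirOp X)
      (A.dirIncl_dirOp X) p
    refine Eq.trans ?_ h1.symm
    have h2 := congrArg (fun l => (l.map B.μ.ev).sum) (Φ.word_cuts X p)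
    refine Eq.trans ?_ (congrArg (B.dirProj (f ∘ X) i j) (h2.trans (Φ.rel ((A.dirIncl X).word p))))
    refine Eq.trans ?_ (map_list_sum (B.dirProj (f ∘ X) i j) _).symm
    refine congrArg List.sum (Eq.trans ?_ (List.map_map.trans List.map_map).symm)
    rfl

end AInfFunctor
/-! ### Triangulated A-infinity categories, generation, exceptional collections -/

namespace AInfCat

variable (A : AInfCat.{w, v, u} k)

/-- For a closed morphism `c : Y₀ → Y₁` of degree `0`, the object `C` is a mapping cone of `c`:
there are `p ∈ hom¹(C, Y₀)` and `s ∈ hom⁰(C, Y₁)` with `μ¹(p) = 0` and `μ¹(s) + μ²(c, p) = 0` such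
that, for every object `X`, the induced map `x ↦ (μ²(p, x), μ²(s, x) + μ³(c, p, x))` from
`hom(X, C)` to the mapping cone complex `hom(X, Y₀)[1] ⊕ hom(X, Y₁)`, whose differential is
`(a, b) ↦ (μ¹(a), μ¹(b) + μ²(c, a))`, is injective and surjective on cohomology. -/
def IsCone {Y₀ Y₁ : A.Obj} (c : A.Tot Y₀ Y₁) (C : A.Obj) : Prop :=
  ∃ p ∈ A.gr C Y₀ 1, ∃ s ∈ A.gr C Y₁ 0,
    A.d C Y₀ p = 0 ∧ A.d C Y₁ s + A.m2 C Y₀ Y₁ p c = 0 ∧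
    ∀ X : A.Obj,
      (∀ x : A.Tot X C, A.d X C x = 0 →
        (∃ (a : A.Tot X Y₀) (b : A.Tot X Y₁), A.d X Y₀ a = A.m2 X C Y₀ x p ∧
          A.d X Y₁ b + A.m2 X Y₀ Y₁ a c = A.m2 X C Y₁ x s + A.m3 x p c) →
        ∃ y : A.Tot X C, A.d X C y = x) ∧
      ∀ (a : A.Tot X Y₀) (b : A.Tot X Y₁), A.d X Y₀ a = 0 →
        A.d X Y₁ b + A.m2 X Y₀ Y₁ a c = 0 →
        ∃ x : A.Tot X C, A.d X C x = 0 ∧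
          ∃ (a' : A.Tot X Y₀) (b' : A.Tot X Y₁), A.d X Y₀ a' = A.m2 X C Y₀ x p - a ∧
            A.d X Y₁ b' + A.m2 X Y₀ Y₁ a' c = A.m2 X C Y₁ x s + A.m3 x p c - b

section

variable [A.Unital]

/-- `Y` is isomorphic to the shift `X[n]`. -/
def IsShift (n : ℤ) (X Y : A.Obj) : Prop :=
  ∃ (f : A.H (-n) X Y) (g : A.H n Y X),
    A.comp (neg_add_cancel n) f g = A.id X ∧ A.comp (add_neg_cancel n) g f = A.id Y

/-- A (cohomologically unital) `A∞`-category is triangulated if all objects have shifts and all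
closed morphisms of degree `0` have mapping cones. -/
structure IsTriangulated : Prop where
  exists_shift : ∀ (n : ℤ) (X : A.Obj), ∃ Y : A.Obj, A.IsShift n X Y
  exists_cone : ∀ (Y₀ Y₁ : A.Obj), ∀ c ∈ A.Z 0 Y₀ Y₁, ∃ C : A.Obj, A.IsCone c C

/-- The triangulated subcategory `⟨Eᵢ⟩` generated by a collection of objects: the smallest class
of objects which contains the `Eᵢ` and the zero objects and is closed under isomorphisms, shifts
and mapping cones. -/
inductive Gen {ι : Type u'} (E : ι → A.Obj) : A.Obj → Prop
  | of (i : ι) : Gen E (E i)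
  | zero (X : A.Obj) : Subsingleton (A.H 0 X X) → Gen E X
  | shift (n : ℤ) (X Y : A.Obj) : Gen E X → A.IsShift n X Y → Gen E Y
  | cone (X Y : A.Obj) (c : A.Tot X Y) (C : A.Obj) :
      Gen E X → Gen E Y → c ∈ A.Z 0 X Y → A.IsCone c C → Gen E C

end

/-- `Hom^*(X, Y)` is concentrated in degree `d`, where it is one-dimensional. -/
def HomIsLine (d : ℤ) (X Y : A.Obj) : Prop :=
  Module.finrank k (A.H d X Y) = 1 ∧ ∀ n, n ≠ d → Subsingleton (A.H n X Y)

/-- `Hom^*(X, Y) = 0`. -/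
def HomIsZero (X Y : A.Obj) : Prop := ∀ n, Subsingleton (A.H n X Y)

/-- `Hom^*(X, Y)` has finite total dimension. -/
def HomIsFinite (X Y : A.Obj) : Prop :=
  (∀ n, FiniteDimensional k (A.H n X Y)) ∧ {n : ℤ | Nontrivial (A.H n X Y)}.Finite

/-- Exceptional collections indexed by a linear order. -/
structure IsExceptional {ι : Type u'} [LinearOrder ι] (E : ι → A.Obj) : Prop where
  line : ∀ i, A.HomIsLine 0 (E i) (E i)
  zero : ∀ i j, i < j → A.HomIsZero (E j) (E i)

/-- The collection `F_{-(n-1)}, …, F_{-1}, F_0` is left dual to the exceptional collection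
`E_0, …, E_{n-1}`: it is a full exceptional collection in `⟨E_0, …, E_{n-1}⟩` such that
`Hom^*(E_i, F_{-j}) = 0` for `i ≠ j`, and `Hom^*(E_i, F_{-i}) = k` in degree `0`.
The object `F_{-i}` is written `F i`. -/
structure IsLeftDual [A.Unital] (n : ℕ) (E F : ℕ → A.Obj) : Prop where
  exceptional : A.IsExceptional fun i : (Fin n)ᵒᵈ => F (OrderDual.ofDual i : Fin n)
  full : ∀ X : A.Obj, A.Gen (fun i : Fin n => F i) X ↔ A.Gen (fun i : Fin n => E i) X
  zero : ∀ i < n, ∀ j < n, i ≠ j → A.HomIsZero (E i) (F j)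
  line : ∀ i < n, A.HomIsLine 0 (E i) (F i)

/-- The perfect pairing property for `E_0, …, E_m`, with `Hom^*(E_0, E_m) = k` in degree `d`: for
`0 < i < m` the composition `Hom^b(E_i, E_m) ⊗ Hom^a(E_0, E_i) → Hom^d(E_0, E_m)`, `a + b = d`,
is a perfect pairing. -/
structure PerfectPairing (m : ℕ) (E : ℕ → A.Obj) (d : ℤ) : Prop where
  line : A.HomIsLine d (E 0) (E m)
  perfect : ∀ i, 0 < i → i < m → ∀ (a b : ℤ) (h : a + b = d),
    Function.Bijective (A.comp (X := E 0) (Y := E i) (Z := E m) h) ∧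
      Function.Bijective (A.comp (X := E 0) (Y := E i) (Z := E m) h).flip

/-- Transport of morphisms along equalities of objects. -/
def castH {n : ℤ} {X Y X' Y' : A.Obj} (hX : X = X') (hY : Y = Y') (f : A.H n X Y) :
    A.H n X' Y' :=
  cast (by rw [hX, hY]) f

end AInfCat

/-! ### The action of an autoequivalence on a collection shifted by it -/

namespace AInfFunctor

variable {A : AInfCat.{w, v, u} k} [A.Unital] {t : A.Obj → A.Obj} (τ : AInfFunctor A A t)
  {E : ℕ → A.Obj} {N : ℕ} (θ : ∀ i, i < N → ((⟨t (E i)⟩ : H0 A) ≅ ⟨E (i + 1)⟩))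

/-- The map `τˢ : Hom^n(E_i, E_j) → Hom^n(E_{i+s}, E_{j+s})`, where `τ(E_i)` is identified with
`E_{i+1}` by means of the isomorphisms `θ`. -/
noncomputable def powAux {n : ℤ} {i j : ℕ} : (s : ℕ) → i + s ≤ N → j + s ≤ N →
    A.H n (E i) (E j) → A.H n (E (i + s)) (E (j + s))
  | 0, _, _, f => f
  | s + 1, hi, hj, f =>
      A.comp (add_zero n)
        (A.comp (zero_add n) ((θ (i + s) hi).inv : A.H 0 (E (i + s + 1)) (t (E (i + s))))
          (τ.mapH n _ _ (powAux s (Nat.le_of_succ_le hi) (Nat.le_of_succ_le hj) f)))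
        ((θ (j + s) hj).hom : A.H 0 (t (E (j + s))) (E (j + s + 1)))

/-- The map `τˢ : Hom^n(E_i, E_j) → Hom^n(E_{i'}, E_{j'})`, where `i' = i + s` and `j' = j + s`. -/
noncomputable def pow {n : ℤ} {i j i' j' : ℕ} (s : ℕ) (hi : i + s = i') (hj : j + s = j')
    (hi' : i' ≤ N) (hj' : j' ≤ N) (f : A.H n (E i) (E j)) : A.H n (E i') (E j') :=
  A.castH (congrArg E hi) (congrArg E hj)
    (τ.powAux θ s (hi.trans_le hi') (hj.trans_le hj') f)

end AInfFunctor

/-! ### Serre functors, helices and left adjoints -/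

/-- A Serre functor on a `k`-linear category: an autoequivalence `S` with isomorphisms
`Hom(Y, S X) ≅ Hom(X, Y)^∨`, natural in both variables. -/
structure SerreFunctor (k : Type w) [Field k] (C : Type u) [Category.{v} C] [Preadditive C]
    [Linear k C] where
  S : C ≌ C
  iso : ∀ X Y : C, (Y ⟶ S.functor.obj X) ≃ₗ[k] Module.Dual k (X ⟶ Y)
  iso_left : ∀ {X Y Y' : C} (g : Y' ⟶ Y) (h : Y ⟶ S.functor.obj X) (f : X ⟶ Y'),
    iso X Y' (g ≫ h) f = iso X Y h (f ≫ g)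
  iso_right : ∀ {X X' Y : C} (h : Y ⟶ S.functor.obj X) (g : X ⟶ X') (f : X' ⟶ Y),
    iso X' Y (h ≫ S.functor.map g) f = iso X Y h (g ≫ f)

/-- A sequence of objects `(H_i)`, `i ∈ ℤ`, is a helix of period `n` if `S(H_i) ≅ H_{i-n}` for the
Serre functor `S`. -/
def AInfCat.IsHelix (A : AInfCat.{w, v, u} k) [A.Unital] (n : ℕ) (H : ℤ → A.Obj) : Prop :=
  ∃ S : SerreFunctor k (H0 A), ∀ i : ℤ, Nonempty (S.S.functor.obj ⟨H i⟩ ≅ ⟨H (i - n)⟩)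

/-- The `A∞`-functor `Λ : A → C` is left adjoint to the inclusion of the full subcategory `C` on
the objects satisfying `P`: there are morphisms `η_X : X → Λ X` of degree `0`, natural with
respect to morphisms of all degrees, such that composition with `η_X` is a bijection
`Hom^n(Λ X, Z) → Hom^n(X, Z)` for all `Z` in `C` and all `n`. -/
def AInfFunctor.IsLeftAdjoint {A : AInfCat.{w, v, u} k} {P : A.Obj → Prop}
    {L : A.Obj → (A.full P).Obj} (Λ : AInfFunctor A (A.full P) L) : Prop :=
  ∃ η : ∀ X : A.Obj, A.H 0 X (L X).1,
    (∀ (n : ℤ) (X Y : A.Obj) (f : A.H n X Y),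
      A.comp (zero_add n) (η X) (AInfCat.ofFull (Λ.mapH n X Y f)) =
        A.comp (add_zero n) f (η Y)) ∧
    ∀ (n : ℤ) (X : A.Obj) (Z : (A.full P).Obj),
      Function.Bijective fun h : (A.full P).H n (L X) Z =>
        A.comp (zero_add n) (η X) (AInfCat.ofFull h)

/-!
The proof reduces everything but the construction of `λ` to the graded category `Hom^*` (`coh`) and
its exact triangles, and works with pairs of objects which are Serre dual to one another in a
subcategory (`GrCat.SerrePair`): a functional on `Hom^d(Y, Z)` makes the pairing of `Hom^a(Y, X)`
with `Hom^b(X, Z)`, `a + b = d`, perfect for all `X` in the subcategory. Such pairs are unique up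
to isomorphism and compatible with shifts, and exist in any subcategory generated by a
finite-dimensional exceptional collection, since cohomological functors are representable there
(`GrCat.CoFun.exists_repOn`).

*The collection.* The perfect pairing property and translation by `τ` show that `E_{i+m}` is, up to
the shift by `d`, the Serre dual of `E_i` in `⟨E_0, …, E_N⟩`
(`AInfCat.serrePair_exceptional`). To test perfectness it is enough to consider the objects `E_j`;
only those with `i ≤ j ≤ i + m` matter, all other spaces being zero.

*The dual collection.* Let `λ` be the reflection onto `𝒞 = ⟨E_0, …, E_{m-1}⟩`. The cone of the unit
`F_{-j} → λ(F_{-j})` lies in `⟨E_m, …, E_j⟩`. For `i > j` there are no morphisms from `F_{-i}` to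
this subcategory: a morphism space `Hom(F_{-i}, E_{l+m})` is dual to `Hom(E_l, F_{-i}) = 0`, as
`l ≠ i`. So composition with the unit is bijective on `Hom^*(F_{-i}, F_{-j})`
(`GrCat.DualPair.bijective_reflection`). This gives the quasi-isomorphism of directed
endomorphism algebras. For the helix, the Serre dual of `λ(F_{-i})` in `𝒞` is the coreflection of
the Serre dual of `F_{-i}` in `⟨E_0, …, E_N⟩`; comparing the two by their morphisms from the `E_l`,
one finds `S(λ(F_{-i})) ≃ λ(F_{-i-m})[d-1]` (`GrCat.DualPair.serrePair_reflection`). The statement on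
the helix follows by induction in steps of `m`.

*The functor.* An objectwise reflection of `H⁰`, with its graded universal property, extends to an
`A∞`-functor (`AInfCat.exists_isLeftAdjoint`). In terms of the bar construction, the functor and the
homotopy which makes the unit natural are built together, by induction on the length of words. At
each step the obstruction is a cocycle in a complex of multilinear maps with values in the mapping
cone of composition with the unit; this mapping cone is acyclic, and over a field it is contractible,
so the obstruction vanishes.
-/

/-! ### Graded linear categories and exact triangles -/

/-- A `k`-linear graded category. The degree of a composite is a separate parameter, tied to the
degrees of the factors by an equation, so that no transport along equations of degrees is
needed. Composition is written in diagrammatic order. -/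
structure GrCat (k : Type w) [Field k] where
  Obj : Type u
  H : ℤ → Obj → Obj → Type v
  [instAddCommGroup : ∀ n X Y, AddCommGroup (H n X Y)]
  [instModule : ∀ n X Y, Module k (H n X Y)]
  comp : ∀ {n m l : ℤ} (_ : n + m = l) {X Y Z : Obj}, H n X Y →ₗ[k] H m Y Z →ₗ[k] H l X Z
  assoc : ∀ {n m l nm ml nml : ℤ} (h₁ : n + m = nm) (h₂ : m + l = ml) (h₃ : nm + l = nml)
    (h₄ : n + ml = nml) {W X Y Z : Obj} (f : H n W X) (g : H m X Y) (h : H l Y Z),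
    comp h₃ (comp h₁ f g) h = comp h₄ f (comp h₂ g h)
  id : ∀ X, H 0 X X
  id_comp : ∀ {n : ℤ} (h : 0 + n = n) {X Y : Obj} (f : H n X Y), comp h (id X) f = f
  comp_id : ∀ {n : ℤ} (h : n + 0 = n) {X Y : Obj} (f : H n X Y), comp h f (id Y) = f

attribute [instance] GrCat.instAddCommGroup GrCat.instModule

namespace GrCat

/-- The opposite graded category, without signs. -/
def op (G : GrCat.{w, v, u} k) : GrCat.{w, v, u} k where
  Obj := G.Obj
  H n X Y := G.H n Y X
  comp h := (G.comp ((add_comm _ _).trans h)).flip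
  assoc h₁ h₂ h₃ h₄ _ _ _ _ f g h :=
    (G.assoc ((add_comm _ _).trans h₂) ((add_comm _ _).trans h₁) ((add_comm _ _).trans h₄)
      ((add_comm _ _).trans h₃) h g f).symm
  id := G.id
  id_comp h _ _ f := G.comp_id ((add_comm _ _).trans h) f
  comp_id h _ _ f := G.id_comp ((add_comm _ _).trans h) f

variable (G : GrCat.{w, v, u} k)

/-- A sequence `X → Y → Z` which is exact at `Y` for all functors `Hom(W, -)` and
`Hom(-, W)`. -/
structure ExactAt {a b : ℤ} {X Y Z : G.Obj} (f : G.H a X Y) (g : G.H b Y Z) : Prop where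
  comp_eq : ∀ {l : ℤ} (h : a + b = l), G.comp h f g = 0
  lift : ∀ {W : G.Obj} {n n' l : ℤ} (h₁ : n + b = l) (h₂ : n' + a = n) (y : G.H n W Y),
    G.comp h₁ y g = 0 → ∃ x : G.H n' W X, G.comp h₂ x f = y
  desc : ∀ {W : G.Obj} {n n' l : ℤ} (h₁ : a + n = l) (h₂ : b + n' = n) (y : G.H n Y W),
    G.comp h₁ f y = 0 → ∃ z : G.H n' Z W, G.comp h₂ g z = y

/-- Exact triangles `X → Y → C → X`. -/
structure IsTri {a b e : ℤ} {X Y C : G.Obj} (c : G.H a X Y) (i : G.H b Y C) (p : G.H e C X) :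
    Prop where
  exact₁ : G.ExactAt p c
  exact₂ : G.ExactAt c i
  exact₃ : G.ExactAt i p

/-- `Y` is isomorphic to the shift `X[n]`. -/
def Shift (n : ℤ) (X Y : G.Obj) : Prop :=
  ∃ (f : G.H (-n) X Y) (g : G.H n Y X),
    G.comp (neg_add_cancel n) f g = G.id X ∧ G.comp (add_neg_cancel n) g f = G.id Y

/-- A class of objects is closed if it is closed under shifts, isomorphisms and, up to the choice
of the exact triangle, under cones. -/
structure Closed (P : G.Obj → Prop) : Prop where
  nonempty : ∃ X, P X
  exists_shift : ∀ (n : ℤ) (X : G.Obj), P X → ∃ Y, P Y ∧ G.Shift n X Y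
  of_shift : ∀ {n : ℤ} {X Y : G.Obj}, P X → G.Shift n X Y → P Y
  exists_cone : ∀ {a : ℤ} {X Y : G.Obj} (c : G.H a X Y), P X → P Y →
    ∃ C, P C ∧ ∃ (i : G.H 0 Y C) (p : G.H (1 - a) C X), G.IsTri c i p

/-- The class generated by `S` under exact triangles, shifts and isomorphisms. -/
inductive Gen (S : G.Obj → Prop) : G.Obj → Prop
  | of {X : G.Obj} : S X → Gen S X
  | zero {X : G.Obj} : G.id X = 0 → Gen S X
  | shift {n : ℤ} {X Y : G.Obj} : Gen S X → G.Shift n X Y → Gen S Y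
  | tri {a b e : ℤ} {X Y C : G.Obj} {c : G.H a X Y} {i : G.H b Y C} {p : G.H e C X} :
      Gen S X → Gen S Y → G.IsTri c i p → Gen S C

/-- `Hom^*(X, Y) = 0`. -/
def Zero (X Y : G.Obj) : Prop := ∀ (n : ℤ) (f : G.H n X Y), f = 0

/-- `Hom^*(X, Y)` is concentrated in degree `d`, where it is one-dimensional. -/
def Line (d : ℤ) (X Y : G.Obj) : Prop :=
  Module.finrank k (G.H d X Y) = 1 ∧ ∀ n, n ≠ d → ∀ f : G.H n X Y, f = 0

/-- `Hom^*(X, Y)` has finite total dimension. -/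
def HomFin (X Y : G.Obj) : Prop :=
  (∀ n, FiniteDimensional k (G.H n X Y)) ∧ {n : ℤ | Nontrivial (G.H n X Y)}.Finite

variable {G}

/-! ### Formal properties of triangles -/

theorem ExactAt.op {a b : ℤ} {X Y Z : G.Obj} {f : G.H a X Y} {g : G.H b Y Z}
    (h : G.ExactAt f g) : G.op.ExactAt (X := Z) (Y := Y) (Z := X) g f where
  comp_eq e := h.comp_eq ((add_comm _ _).trans e)
  lift h₁ h₂ y hy := h.desc ((add_comm _ _).trans h₁) ((add_comm _ _).trans h₂) y hy
  desc h₁ h₂ y hy := h.lift ((add_comm _ _).trans h₁) ((add_comm _ _).trans h₂) y hy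

theorem IsTri.rotate {a b e : ℤ} {X Y C : G.Obj} {c : G.H a X Y} {i : G.H b Y C}
    {p : G.H e C X} (h : G.IsTri c i p) : G.IsTri i p c := ⟨h.exact₂, h.exact₃, h.exact₁⟩

theorem IsTri.op {a b e : ℤ} {X Y C : G.Obj} {c : G.H a X Y} {i : G.H b Y C}
    {p : G.H e C X} (h : G.IsTri c i p) :
    G.op.IsTri (X := Y) (Y := X) (C := C) c p i :=
  ⟨h.exact₂.op, h.exact₁.op, h.exact₃.op⟩

/-- An isomorphism of degree `a` with inverse of degree `b`. -/
theorem Shift.mk' {n a b : ℤ} (ha : a = -n) (hb : b = n) {X Y : G.Obj} (f : G.H a X Y)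
    (g : G.H b Y X) (h₁ : ∀ h : a + b = 0, G.comp h f g = G.id X)
    (h₂ : ∀ h : b + a = 0, G.comp h g f = G.id Y) : G.Shift n X Y := by
  subst ha hb
  exact ⟨f, g, h₁ _, h₂ _⟩

theorem Shift.symm {n : ℤ} {X Y : G.Obj} (h : G.Shift n X Y) : G.Shift (-n) Y X := by
  obtain ⟨f, g, h₁, h₂⟩ := h
  exact Shift.mk' (by omega) rfl g f (fun _ => h₂) (fun _ => h₁)

theorem Shift.op {n : ℤ} {X Y : G.Obj} (h : G.Shift n X Y) : G.op.Shift (-n) X Y := by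
  obtain ⟨f, g, h₁, h₂⟩ := h
  exact Shift.mk' (G := G.op) (X := X) (Y := Y) (by omega) rfl g f (fun _ => h₁) (fun _ => h₂)

theorem Shift.refl (X : G.Obj) : G.Shift 0 X X :=
  Shift.mk' rfl rfl (G.id X) (G.id X) (fun _ => G.id_comp _ _) (fun _ => G.id_comp _ _)

theorem Shift.exists_iso {n a b : ℤ} {X Y : G.Obj} (h : G.Shift n X Y) (ha : a = -n)
    (hb : b = n) : ∃ (f : G.H a X Y) (g : G.H b Y X),
      (∀ h : a + b = 0, G.comp h f g = G.id X) ∧ ∀ h : b + a = 0, G.comp h g f = G.id Y := by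
  subst ha hb
  obtain ⟨f, g, h₁, h₂⟩ := h
  exact ⟨f, g, fun _ => h₁, fun _ => h₂⟩

theorem Shift.trans {n m l : ℤ} (hl : n + m = l) {X Y Z : G.Obj} (h : G.Shift n X Y)
    (h' : G.Shift m Y Z) : G.Shift l X Z := by
  obtain ⟨f, g, h₁, h₂⟩ := h
  obtain ⟨f', g', h₁', h₂'⟩ := h'
  refine Shift.mk' (a := -n + -m) (b := m + n) (by omega) (by omega) (G.comp rfl f f')
    (G.comp rfl g' g) (fun _ => ?_) (fun _ => ?_)
  · rw [G.assoc rfl (show -m + (m + n) = n by omega) _ (by omega), ← G.assoc (neg_add_cancel m) rfl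
      (by omega) _, h₁', G.id_comp, h₁]
  · rw [G.assoc rfl (show n + (-n + -m) = -m by omega) _ (by omega),
      ← G.assoc (add_neg_cancel n) rfl (by omega) _, h₂, G.id_comp, h₂']

/-- Replacing the cone of an exact triangle by an isomorphic object. -/
theorem IsTri.of_iso {a b e n m b' e' : ℤ} {X Y C C' : G.Obj} {c : G.H a X Y} {i : G.H b Y C}
    {p : G.H e C X} (h : G.IsTri c i p) (s : G.H n C C') (t : G.H m C' C) (h₀ : n + m = 0)
    (h₁ : G.comp h₀ s t = G.id C) (h₂ : G.comp ((add_comm _ _).trans h₀) t s = G.id C')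
    (hb : b + n = b') (he : m + e = e') :
    G.IsTri c (G.comp hb i s) (G.comp he t p) := by
  have hs : ∀ {W : G.Obj} {r r' : ℤ} (hr : r + n = r') (x : G.H r W C),
      G.comp (show r' + m = r by omega) (G.comp hr x s) t = x := fun {W r r'} hr x => by
    rw [G.assoc hr h₀ _ (add_zero r), h₁, G.comp_id]
  have ht : ∀ {W : G.Obj} {r r' : ℤ} (hr : r + m = r') (x : G.H r W C'),
      G.comp (show r' + n = r by omega) (G.comp hr x t) s = x := fun {W r r'} hr x => by
    rw [G.assoc hr ((add_comm _ _).trans h₀) _ (add_zero r), h₂, G.comp_id]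
  have hs' : ∀ {W : G.Obj} {r r' : ℤ} (hr : m + r = r') (x : G.H r C W),
      G.comp (show n + r' = r by omega) s (G.comp hr t x) = x := fun {W r r'} hr x => by
    rw [← G.assoc h₀ hr (zero_add r), h₁, G.id_comp]
  have ht' : ∀ {W : G.Obj} {r r' : ℤ} (hr : n + r = r') (x : G.H r C' W),
      G.comp (show m + r' = r by omega) t (G.comp hr s x) = x := fun {W r r'} hr x => by
    rw [← G.assoc ((add_comm _ _).trans h₀) hr (zero_add r), h₂, G.id_comp]
  refine ⟨⟨fun {l} hl => ?_, fun {W r r' l} h₁' h₂' y hy => ?_, fun {W r r' l} h₁' h₂' y hy => ?_⟩,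
    ⟨fun {l} hl => ?_, fun {W r r' l} h₁' h₂' y hy => ?_, fun {W r r' l} h₁' h₂' y hy => ?_⟩,
    ⟨fun {l} hl => ?_, fun {W r r' l} h₁' h₂' y hy => ?_, fun {W r r' l} h₁' h₂' y hy => ?_⟩⟩
  · rw [G.assoc he rfl _ (by omega), h.exact₁.comp_eq, map_zero]
  · obtain ⟨x, hx⟩ := h.exact₁.lift h₁' (n' := r' + m) (by omega) y hy
    refine ⟨G.comp (show r' + m + n = r' by omega) x s, ?_⟩
    rw [← G.assoc (show r' + m = r' + m from rfl) he (by omega) h₂', hs]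
    exact hx
  · rw [G.assoc he rfl _ (by omega)] at hy
    have hy' := congrArg (G.comp (show n + l = e + r by omega) s) hy
    rw [hs', map_zero] at hy'
    obtain ⟨x, hx⟩ := h.exact₁.desc rfl h₂' y hy'
    exact ⟨x, hx⟩
  · rw [← G.assoc (show a + b = a + b from rfl) hb (by omega), h.exact₂.comp_eq,
      LinearMap.map_zero₂]
  · rw [← G.assoc (show r + b = r + b from rfl) hb (by omega)] at hy
    have hy' := congrArg (fun z => G.comp (show l + m = r + b by omega) z t) hy
    simp only [LinearMap.map_zero₂] at hy'
    rw [hs] at hy'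
    exact h.exact₂.lift _ h₂' y hy'
  · obtain ⟨x, hx⟩ := h.exact₂.desc h₁' (n' := n + r') (by omega) y hy
    refine ⟨G.comp (show m + (n + r') = r' by omega) t x, ?_⟩
    rw [G.assoc hb (show n + r' = n + r' from rfl) _ (by omega), hs']
    exact hx
  · rw [G.assoc hb (show n + e' = e by omega) _ (by omega), hs', h.exact₃.comp_eq]
  · rw [← G.assoc (show r + m = r + m from rfl) he (by omega)] at hy
    obtain ⟨x, hx⟩ := h.exact₃.lift _ (n' := r') (by omega) _ hy
    refine ⟨x, ?_⟩
    rw [← G.assoc (show r' + b = r + m by omega) hb (by omega), hx, ht]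
  · rw [G.assoc hb (show n + r = n + r from rfl) _ (by omega)] at hy
    obtain ⟨x, hx⟩ := h.exact₃.desc _ (n' := r') (by omega) _ hy
    refine ⟨x, ?_⟩
    rw [G.assoc he (show e + r' = n + r by omega) _ (by omega), hx, ht']

end GrCat

namespace GrCat

variable {G : GrCat.{w, v, u} k}

theorem Closed.op {P : G.Obj → Prop} (h : G.Closed P) : G.op.Closed P where
  nonempty := h.nonempty
  exists_shift n X hX := by
    obtain ⟨Y, hY, hs⟩ := h.exists_shift (-n) X hX
    exact ⟨Y, hY, by simpa using hs.op⟩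
  of_shift hX hs := h.of_shift hX hs.op
  exists_cone {a X Y} c hX hY := by
    obtain ⟨C, hC, i, p, ht⟩ := h.exists_cone (X := Y) (Y := X) c hY hX
    obtain ⟨C', hC', hs⟩ := h.exists_shift (a - 1) C hC
    obtain ⟨s, t, h₁, h₂⟩ := hs.exists_iso (show 1 - a = -(a - 1) by omega) rfl
    exact ⟨C', hC', G.comp (by omega) t p, G.comp (by omega) i s,
      (ht.of_iso s t (by omega) (h₁ _) (h₂ _) _ _).op⟩

theorem Gen.op {S : G.Obj → Prop} {X : G.Obj} (h : G.Gen S X) : G.op.Gen S X := by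
  induction h with
  | of h => exact .of h
  | zero h => exact .zero h
  | shift _ h ih => exact .shift ih h.op
  | tri _ _ h ihX ihY => exact .tri (G := G.op) ihY ihX h.op

theorem Gen.closed {P S : G.Obj → Prop} (hP : G.Closed P) (hPS : ∀ X, G.Gen S X → P X)
    (hS : ∃ X, S X) : G.Closed (G.Gen S) where
  nonempty := hS.imp fun _ h => .of h
  exists_shift n X hX := by
    obtain ⟨Y, _, hs⟩ := hP.exists_shift n X (hPS X hX)
    exact ⟨Y, hX.shift hs, hs⟩
  of_shift hX hs := hX.shift hs
  exists_cone c hX hY := by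
    obtain ⟨C, _, i, p, ht⟩ := hP.exists_cone c (hPS _ hX) (hPS _ hY)
    exact ⟨C, .tri hX hY ht, i, p, ht⟩

theorem Gen.mono {S S' : G.Obj → Prop} (h : ∀ X, S X → G.Gen S' X) {X : G.Obj}
    (hX : G.Gen S X) : G.Gen S' X := by
  induction hX with
  | of hX => exact h _ hX
  | zero h => exact .zero h
  | shift _ h ih => exact .shift ih h
  | tri _ _ h ihX ihY => exact .tri ihX ihY h

/-! ### Cohomological functors -/

variable (G) in
/-- A contravariant graded functor to graded vector spaces which is exact on exact sequences. -/
structure CoFun where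
  M : ℤ → G.Obj → Type v'
  [instAddCommGroup : ∀ n X, AddCommGroup (M n X)]
  [instModule : ∀ n X, Module k (M n X)]
  act : ∀ {n m l : ℤ} (_ : n + m = l) {X Y : G.Obj}, G.H n X Y →ₗ[k] M m Y →ₗ[k] M l X
  act_comp : ∀ {n m l nm ml nml : ℤ} (h₁ : n + m = nm) (h₂ : m + l = ml) (h₃ : nm + l = nml)
    (h₄ : n + ml = nml) {X Y Z : G.Obj} (f : G.H n X Y) (g : G.H m Y Z) (x : M l Z),
    act h₃ (G.comp h₁ f g) x = act h₄ f (act h₂ g x)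
  id_act : ∀ {n : ℤ} (h : 0 + n = n) {X : G.Obj} (x : M n X), act h (G.id X) x = x
  exact : ∀ {a b : ℤ} {X Y Z : G.Obj} {f : G.H a X Y} {g : G.H b Y Z}, G.ExactAt f g →
    ∀ {n n' l : ℤ} (h₁ : a + n = l) (h₂ : b + n' = n) (x : M n Y), act h₁ f x = 0 →
      ∃ z : M n' Z, act h₂ g z = x

attribute [instance] CoFun.instAddCommGroup CoFun.instModule

variable (G) in
/-- The functor `Hom(-, W)`. -/
def yoneda (W : G.Obj) : G.CoFun where
  M n X := G.H n X W
  act h := G.comp h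
  act_comp h₁ h₂ h₃ h₄ _ _ _ f g x := G.assoc h₁ h₂ h₃ h₄ f g x
  id_act h _ x := G.id_comp h x
  exact h _ _ _ h₁ h₂ x hx := h.desc h₁ h₂ x hx

/-- A functional on a subspace extends to the whole space. -/
theorem exists_dual_comp_eq {V V' V'' : Type*} [AddCommGroup V] [Module k V] [AddCommGroup V']
    [Module k V'] [AddCommGroup V''] [Module k V''] (f : V →ₗ[k] V') (g : V' →ₗ[k] V'')
    (h : ∀ y, g y = 0 → ∃ x, f x = y) (φ : Module.Dual k V') (hφ : φ ∘ₗ f = 0) :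
    ∃ ψ : Module.Dual k V'', ψ ∘ₗ g = φ := by
  have hker : LinearMap.ker g ≤ LinearMap.ker φ := by
    intro y hy
    obtain ⟨x, rfl⟩ := h y hy
    exact LinearMap.congr_fun hφ x
  obtain ⟨ψ, hψ⟩ := ((LinearMap.ker g).liftQ φ hker ∘ₗ
    g.quotKerEquivRange.symm.toLinearMap).exists_extend
  refine ⟨ψ, LinearMap.ext fun y => ?_⟩
  have := LinearMap.congr_fun hψ ⟨g y, ⟨y, rfl⟩⟩
  refine this.trans ?_
  have h2 : g.quotKerEquivRange.symm ⟨g y, ⟨y, rfl⟩⟩ = Submodule.Quotient.mk y :=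
    (LinearEquiv.symm_apply_eq _).2 (Subtype.ext rfl)
  exact (congrArg ((LinearMap.ker g).liftQ φ hker) h2).trans rfl

variable (G) in
/-- The functor `Hom(Y, -)^∨`, shifted by `d`. An element of degree `n` is a functional on `Hom^m(Y, -)` with
`m + n = d`; the index `m` ranges over a one-element type instead of being replaced by `d - n`. -/
def coyonedaDual (d : ℤ) (Y : G.Obj) : G.CoFun where
  M n X := ∀ m : {m : ℤ // m + n = d}, Module.Dual k (G.H m Y X)
  act {n m l} h {X X'} := LinearMap.mk₂ k
    (fun f x r => x ⟨r + n, by have := r.2; omega⟩ ∘ₗ (G.comp rfl).flip f)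
    (fun f f' x => by funext r; ext g; simp)
    (fun c f x => by funext r; ext g; simp)
    (fun f x x' => by funext r; ext g; simp)
    (fun c f x => by funext r; ext g; simp)
  act_comp {n m l nm ml nml} h₁ h₂ h₃ h₄ X X' X'' f g x := by
    funext r
    ext e
    subst h₁
    have : ∀ (s s' : ℤ) (hs : s + l = d) (hs' : s' + l = d) (h : r + (n + m) = s)
        (h' : r + n + m = s'), x ⟨s, hs⟩ (G.comp h e (G.comp rfl f g)) =
        x ⟨s', hs'⟩ (G.comp h' (G.comp rfl e f) g) := by
      intro s s' hs hs' h h'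
      obtain rfl : s = s' := by omega
      rw [G.assoc rfl rfl h' h]
    exact this _ _ _ _ rfl rfl
  id_act {n} h X x := by
    funext r
    ext e
    have : ∀ (s : ℤ) (hs : s + n = d) (h : r + 0 = s),
        x ⟨s, hs⟩ (G.comp h e (G.id X)) = x r e := by
      intro s hs h
      obtain rfl : s = r := by omega
      rw [G.comp_id]
    exact this _ _ rfl
  exact {a b X X' X''} f g h n n' l h₁ h₂ x hx := by
    have key : ∀ m' : {m : ℤ // m + n' = d}, ∃ ψ : Module.Dual k (G.H m' Y X''),
        ∀ (m : ℤ) (hm : m + n = d) (e : G.H m Y X') (h' : m + b = m'),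
          ψ (G.comp h' e g) = x ⟨m, hm⟩ e := by
      intro m'
      have := m'.2
      obtain ⟨ψ, hψ⟩ := exists_dual_comp_eq
        ((G.comp (show m' - b - a + a = m' - b by omega) (X := Y)).flip f)
        ((G.comp (show m' - b + b = m' by omega) (X := Y)).flip g)
        (fun y hy => h.lift _ _ y hy) (x ⟨m' - b, by omega⟩) (by
          ext e
          have h3 := LinearMap.congr_fun (congrFun hx ⟨m' - b - a, by omega⟩) e
          have h4 : ∀ (s : ℤ) (hs : s + n = d) (hh : m' - b - a + a = s),
              x ⟨s, hs⟩ (G.comp hh e f) = 0 → x ⟨m' - b, by omega⟩ (G.comp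
                (show m' - b - a + a = m' - b by omega) e f) = 0 := by
            intro s hs hh h5
            obtain rfl : s = m' - b := by omega
            exact h5
          exact h4 _ _ rfl h3)
      refine ⟨ψ, fun m hm e h' => ?_⟩
      obtain rfl : m = m' - b := by omega
      exact LinearMap.congr_fun hψ e
    choose ψ hψ using key
    refine ⟨ψ, ?_⟩
    funext r
    ext e
    exact hψ ⟨r + b, by have := r.2; omega⟩ r r.2 e rfl

namespace CoFun

variable (Φ : G.CoFun)

/-- The class of objects on which an element `ξ` of degree `0` represents the functor. -/
def RepOn {L : G.Obj} (ξ : Φ.M 0 L) (X : G.Obj) : Prop :=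
  ∀ n : ℤ, Function.Bijective fun f : G.H n X L => Φ.act (add_zero n) f ξ

variable {Φ}

theorem act_zero_left {n m l : ℤ} (h : n + m = l) {X Y : G.Obj} (x : Φ.M m Y) :
    Φ.act h (0 : G.H n X Y) x = 0 := LinearMap.map_zero₂ _ _

theorem act_eq_zero_of_exactAt {a b : ℤ} {X Y Z : G.Obj} {f : G.H a X Y} {g : G.H b Y Z}
    (h : G.ExactAt f g) {n m l : ℤ} (h₁ : b + n = m) (h₂ : a + m = l) (x : Φ.M n Z) :
    Φ.act h₂ f (Φ.act h₁ g x) = 0 := by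
  rw [← Φ.act_comp rfl h₁ (by omega) h₂, h.comp_eq, act_zero_left]

theorem RepOn.zero {L : G.Obj} (ξ : Φ.M 0 L) {X : G.Obj} (h : G.id X = 0) : Φ.RepOn ξ X := by
  intro n
  have h1 : ∀ f : G.H n X L, f = 0 := fun f => by
    rw [← G.id_comp (zero_add n) f, h, LinearMap.map_zero₂]
  have h2 : ∀ x : Φ.M n X, x = 0 := fun x => by
    rw [← Φ.id_act (zero_add n) x, h, act_zero_left]
  exact ⟨fun f g _ => (h1 f).trans (h1 g).symm, fun x => ⟨0, (h2 _).trans (h2 x).symm⟩⟩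

theorem RepOn.shift {L : G.Obj} {ξ : Φ.M 0 L} {X Y : G.Obj} {n : ℤ} (h : G.Shift n X Y)
    (hX : Φ.RepOn ξ X) : Φ.RepOn ξ Y := by
  obtain ⟨f, g, h₁, h₂⟩ := h
  intro r
  constructor
  · intro x y hxy
    have h3 := congrArg (Φ.act (show -n + r = -n + r from rfl) f) hxy
    dsimp only at h3
    rw [← Φ.act_comp rfl (add_zero r) (add_zero _) rfl,
      ← Φ.act_comp rfl (add_zero r) (add_zero _) rfl] at h3
    have h4 := congrArg (G.comp (show n + (-n + r) = r by omega) g) ((hX _).1 h3)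
    rwa [← G.assoc (add_neg_cancel n) rfl (zero_add r), h₂, G.id_comp,
      ← G.assoc (add_neg_cancel n) rfl (zero_add r), h₂, G.id_comp] at h4
  · intro y
    obtain ⟨x, hx⟩ := (hX (-n + r)).2 (Φ.act rfl f y)
    refine ⟨G.comp (show n + (-n + r) = r by omega) g x, ?_⟩
    dsimp only at hx ⊢
    rw [Φ.act_comp _ (add_zero _) _ (by omega), hx, ← Φ.act_comp (add_neg_cancel n) rfl
      (zero_add r), h₂, Φ.id_act]

/-- The five lemma. -/
theorem RepOn.tri {L : G.Obj} {ξ : Φ.M 0 L} {a b e : ℤ} {X Y C : G.Obj} {c : G.H a X Y}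
    {i : G.H b Y C} {p : G.H e C X} (hX : Φ.RepOn ξ X) (hY : Φ.RepOn ξ Y)
    (h : G.IsTri c i p) : Φ.RepOn ξ C := by
  intro n
  constructor
  · refine (injective_iff_map_eq_zero' (((Φ.act (add_zero n)).flip ξ))).2 fun z => ⟨fun hz => ?_,
      fun hz => by rw [hz, map_zero]⟩
    change Φ.act _ z ξ = 0 at hz
    have h1 : G.comp (show b + n = b + n from rfl) i z = 0 := by
      apply (hY _).1
      dsimp only
      rw [Φ.act_comp rfl (add_zero n) _ rfl, hz, map_zero, act_zero_left]
    obtain ⟨x, rfl⟩ := h.exact₃.desc rfl (show e + (n - e) = n by omega) z h1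
    rw [Φ.act_comp _ (add_zero _) _ (by omega)] at hz
    obtain ⟨y', hy'⟩ := Φ.exact h.exact₁ _ (show a + (n - e - a) = n - e by omega) _ hz
    obtain ⟨y, rfl⟩ := (hY _).2 y'
    dsimp only at hy'
    rw [← Φ.act_comp (by omega) (add_zero _) (add_zero _)] at hy'
    have h2 := (hX _).1 hy'
    rw [← h2, ← G.assoc (show e + a = e + a from rfl) _ (by omega) _, h.exact₁.comp_eq,
      LinearMap.map_zero₂]
  · intro z
    obtain ⟨y, hy⟩ := (hY (b + n)).2 (Φ.act rfl i z)
    have h1 : G.comp (show a + (b + n) = a + (b + n) from rfl) c y = 0 := by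
      apply (hX _).1
      dsimp only at hy ⊢
      rw [Φ.act_comp rfl (add_zero _) _ rfl, hy, act_zero_left, act_eq_zero_of_exactAt h.exact₂]
    obtain ⟨z', rfl⟩ := h.exact₂.desc _ (show b + n = b + n from rfl) y h1
    dsimp only at hy
    rw [Φ.act_comp _ (add_zero _) _ rfl] at hy
    have h2 : Φ.act (show b + n = b + n from rfl) i (z - Φ.act (add_zero n) z' ξ) = 0 := by
      rw [map_sub, hy, sub_self]
    obtain ⟨x', hx'⟩ := Φ.exact h.exact₃ _ (show e + (n - e) = n by omega) _ h2
    obtain ⟨x, rfl⟩ := (hX _).2 x'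
    refine ⟨z' + G.comp (by omega) p x, ?_⟩
    dsimp only at hx' ⊢
    rw [map_add, LinearMap.add_apply, Φ.act_comp _ (add_zero _) _ (by omega), hx']
    abel

theorem RepOn.gen {L : G.Obj} {ξ : Φ.M 0 L} {S : G.Obj → Prop} (h : ∀ X, S X → Φ.RepOn ξ X)
    {X : G.Obj} (hX : G.Gen S X) : Φ.RepOn ξ X := by
  induction hX with
  | of hX => exact h _ hX
  | zero h => exact .zero ξ h
  | shift _ h ih => exact .shift h ih
  | tri _ _ h ihX ihY => exact .tri ihX ihY h

end CoFun

end GrCat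

/-! ### Graded vector spaces of finite total dimension -/

/-- A graded vector space has finite total dimension. -/
def GrFin (k : Type w) [Field k] (V : ℤ → Type v) [∀ n, AddCommGroup (V n)]
    [∀ n, Module k (V n)] : Prop :=
  (∀ n, FiniteDimensional k (V n)) ∧ {n : ℤ | Nontrivial (V n)}.Finite

namespace GrFin

theorem punit : GrFin k fun _ : ℤ => PUnit.{v + 1} :=
  ⟨fun _ => inferInstance, by
    convert Set.finite_empty (α := ℤ)
    ext n
    simpa using not_nontrivial_iff_subsingleton.2 (inferInstanceAs (Subsingleton PUnit))⟩

/-- A graded vector space which is caught in an exact sequence between two of finite total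
dimension has finite total dimension. -/
theorem of_exact {A : ℤ → Type v₁} {V : ℤ → Type v₂} {B : ℤ → Type v₃}
    [∀ n, AddCommGroup (A n)] [∀ n, Module k (A n)] [∀ n, AddCommGroup (V n)]
    [∀ n, Module k (V n)] [∀ n, AddCommGroup (B n)] [∀ n, Module k (B n)]
    (hA : GrFin k A) (hB : GrFin k B) {φ ψ : ℤ → ℤ} (hφ : Function.Injective φ)
    (hψ : Function.Injective ψ) (f : ∀ n, A (φ n) →ₗ[k] V n) (g : ∀ n, V n →ₗ[k] B (ψ n))
    (h : ∀ n v, g n v = 0 → ∃ a, f n a = v) : GrFin k V := by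
  constructor
  · intro n
    have := hA.1 (φ n)
    have := hB.1 (ψ n)
    have h1 : FiniteDimensional k (LinearMap.ker (g n)) := by
      have : LinearMap.ker (g n) ≤ LinearMap.range (f n) := fun v hv => h n v hv
      exact Submodule.finiteDimensional_of_le this
    have h2 : FiniteDimensional k (V n ⧸ LinearMap.ker (g n)) :=
      (g n).quotKerEquivRange.symm.finiteDimensional
    exact Module.Finite.of_submodule_quotient (LinearMap.ker (g n))
  · refine ((hA.2.preimage hφ.injOn).union (hB.2.preimage hψ.injOn)).subset fun n hn => ?_
    by_contra hcon
    simp only [Set.mem_union, Set.mem_preimage, Set.mem_ofPred_eq, not_or,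
      not_nontrivial_iff_subsingleton] at hcon
    obtain ⟨_, _⟩ := hcon
    refine not_subsingleton_iff_nontrivial.2 hn ⟨fun x y => ?_⟩
    have hz : ∀ v : V n, v = 0 := fun v => by
      obtain ⟨a, rfl⟩ := h n v (Subsingleton.elim _ _)
      rw [Subsingleton.elim a 0, map_zero]
    rw [hz x, hz y]

theorem of_injective {V : ℤ → Type v₂} {B : ℤ → Type v₃} [∀ n, AddCommGroup (V n)]
    [∀ n, Module k (V n)] [∀ n, AddCommGroup (B n)] [∀ n, Module k (B n)] (hB : GrFin k B)
    {ψ : ℤ → ℤ} (hψ : Function.Injective ψ) (g : ∀ n, V n →ₗ[k] B (ψ n))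
    (h : ∀ n v, g n v = 0 → v = 0) : GrFin k V :=
  of_exact (punit (k := k)) hB Function.injective_id hψ (fun _ => 0) g fun n v hv =>
    ⟨0, by rw [LinearMap.zero_apply, h n v hv]⟩

theorem dual {V : ℤ → Type v₂} [∀ n, AddCommGroup (V n)] [∀ n, Module k (V n)]
    (hV : GrFin k V) : GrFin k fun n => Module.Dual k (V n) := by
  refine ⟨fun n => ?_, hV.2.subset fun n hn => ?_⟩
  · have := hV.1 n
    infer_instance
  · by_contra hcon
    rw [Set.mem_ofPred_eq, not_nontrivial_iff_subsingleton] at hcon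
    refine not_subsingleton_iff_nontrivial.2 hn ⟨fun x y => LinearMap.ext fun v => ?_⟩
    rw [Subsingleton.elim v 0, map_zero, map_zero]

/-- A graded subspace of a graded vector space of finite total dimension is spanned by finitely
many homogeneous elements. -/
theorem exists_list {V : ℤ → Type v₂} [∀ n, AddCommGroup (V n)] [∀ n, Module k (V n)]
    (hV : GrFin k V) (K : ∀ n, Submodule k (V n)) :
    ∃ l : List (Σ n, V n), (∀ s ∈ l, s.2 ∈ K s.1) ∧
      ∀ n, K n ≤ Submodule.span k {y | ⟨n, y⟩ ∈ l} := by
  classical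
  have hfin : ∀ n, ∃ s : Finset (V n), Submodule.span k (s : Set (V n)) = K n := fun n => by
    have := hV.1 n
    exact (IsNoetherian.noetherian (K n))
  choose s hs using hfin
  let T : Finset (Σ n, V n) := hV.2.toFinset.sigma s
  refine ⟨T.toList, fun x hx => ?_, fun n => ?_⟩
  · rw [Finset.mem_toList, Finset.mem_sigma] at hx
    rw [← hs]
    exact Submodule.subset_span hx.2
  · by_cases hn : Nontrivial (V n)
    · rw [← hs]
      refine Submodule.span_mono fun y hy => ?_
      rw [Set.mem_ofPred_eq, Finset.mem_toList, Finset.mem_sigma]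
      exact ⟨by simpa using hn, hy⟩
    · rw [not_nontrivial_iff_subsingleton] at hn
      intro y _
      rw [Subsingleton.elim y 0]
      exact zero_mem _

end GrFin

namespace GrCat

variable {G : GrCat.{w, v, u} k}

theorem HomFin.shift_right {W X Y : G.Obj} {n : ℤ} (h : G.HomFin W X) (hs : G.Shift n X Y) :
    G.HomFin W Y := by
  obtain ⟨f, g, -, h₂⟩ := hs
  refine GrFin.of_injective (k := k) h (add_left_injective n)
    (fun r => (G.comp rfl).flip g) fun r v hv => ?_
  have h3 := congrArg (fun x => G.comp (show r + n + -n = r by omega) x f) hv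
  dsimp only [LinearMap.flip_apply] at h3
  rwa [LinearMap.map_zero₂, G.assoc rfl (add_neg_cancel n) _ (add_zero r), h₂, G.comp_id] at h3

theorem HomFin.tri_right {W X Y C : G.Obj} {a b e : ℤ} {c : G.H a X Y} {i : G.H b Y C}
    {p : G.H e C X} (hX : G.HomFin W X) (hY : G.HomFin W Y) (h : G.IsTri c i p) : G.HomFin W C :=
  GrFin.of_exact (k := k) hY hX (sub_left_injective (b := b)) (add_left_injective e)
    (fun n => (G.comp (show n - b + b = n by omega)).flip i) (fun n => (G.comp rfl).flip p)
    fun n v hv => h.exact₃.lift rfl (show n - b + b = n by omega) v hv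

theorem zero_of_id {X : G.Obj} (h : G.id X = 0) (Y : G.Obj) : G.Zero X Y := fun n f => by
  rw [← G.id_comp (zero_add n) f, h, LinearMap.map_zero₂]

theorem zero_of_id' {X : G.Obj} (h : G.id X = 0) (Y : G.Obj) : G.Zero Y X := fun n f => by
  rw [← G.comp_id (add_zero n) f, h, map_zero]

theorem Zero.fin {X Y : G.Obj} (h : G.Zero X Y) : G.HomFin X Y := by
  refine GrFin.of_injective (k := k) (GrFin.punit.{w, v} (k := k)) Function.injective_id
    (fun _ => 0) fun n v _ => h n v

theorem HomFin.gen_right {S : G.Obj → Prop} {W : G.Obj} (h : ∀ X, S X → G.HomFin W X) {X : G.Obj}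
    (hX : G.Gen S X) : G.HomFin W X := by
  induction hX with
  | of hX => exact h _ hX
  | zero h => exact (zero_of_id' h _).fin
  | shift _ h ih => exact ih.shift_right h
  | tri _ _ h ihX ihY => exact ihX.tri_right ihY h

theorem Zero.gen_right {S : G.Obj → Prop} {W : G.Obj} (h : ∀ X, S X → G.Zero W X) {X : G.Obj}
    (hX : G.Gen S X) : G.Zero W X := by
  induction hX with
  | of hX => exact h _ hX
  | zero h => exact zero_of_id' h _
  | @shift n X Y _ h ih =>
    obtain ⟨f, g, -, h₂⟩ := h
    intro r x
    rw [← G.comp_id (add_zero r) x, ← h₂, ← G.assoc rfl (add_neg_cancel n) (by omega),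
      ih _ (G.comp rfl x g), LinearMap.map_zero₂]
  | @tri a b e X Y C c i p _ _ h ihX ihY =>
    intro r x
    obtain ⟨y, rfl⟩ := h.exact₃.lift (show r + e = r + e from rfl) (show r - b + b = r by omega) x
      (ihX _ _)
    rw [ihY _ y, LinearMap.map_zero₂]

theorem Zero.gen_left {S : G.Obj → Prop} {W : G.Obj} (h : ∀ X, S X → G.Zero X W) {X : G.Obj}
    (hX : G.Gen S X) : G.Zero X W :=
  Zero.gen_right (G := G.op) (W := W) h hX.op

theorem Line.id_ne_zero {X : G.Obj} {d : ℤ} (h : G.Line d X X) : G.id X ≠ 0 := by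
  intro h0
  have : Subsingleton (G.H d X X) :=
    ⟨fun f g => (zero_of_id h0 X _ f).trans (zero_of_id h0 X _ g).symm⟩
  have := h.1
  rw [Module.finrank_zero_of_subsingleton] at this
  exact zero_ne_one this

theorem Line.exists_smul {X Y : G.Obj} {d : ℤ} (h : G.Line d X Y) {e : G.H d X Y} (he : e ≠ 0)
    (f : G.H d X Y) : ∃ c : k, c • e = f :=
  (finrank_eq_one_iff_of_nonzero' e he).1 h.1 f

theorem Line.exists_ne_zero {X Y : G.Obj} {d : ℤ} (h : G.Line d X Y) : ∃ e : G.H d X Y, e ≠ 0 := by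
  have : Nontrivial (G.H d X Y) := Module.nontrivial_of_finrank_pos (R := k) (by rw [h.1]; simp)
  exact exists_ne 0

/-! ### Representability by means of exceptional collections -/

namespace CoFun

variable {Φ : G.CoFun}

/-- A cone over an object which `Y` does not see does not change representability at `Y`. -/
theorem RepOn.of_cone {a e : ℤ} {X L L' Y : G.Obj} {c : G.H a X L} {i : G.H 0 L L'}
    {p : G.H e L' X} (h : G.IsTri c i p) {ξ : Φ.M 0 L} {ξ' : Φ.M 0 L'}
    (hξ : Φ.act (add_zero 0) i ξ' = ξ) (hY : G.Zero Y X) (hr : Φ.RepOn ξ Y) : Φ.RepOn ξ' Y := by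
  have key : ∀ {n : ℤ} (x : G.H n Y L),
      Φ.act (add_zero n) (G.comp (add_zero n) x i) ξ' = Φ.act (add_zero n) x ξ := fun x => by
    rw [← hξ, Φ.act_comp]
  have hs : ∀ {n : ℤ} (x' : G.H n Y L'), ∃ x : G.H n Y L, G.comp (add_zero n) x i = x' :=
    fun x' => h.exact₃.lift rfl _ x' (hY _ _)
  intro n
  constructor
  · intro x' y' hxy
    obtain ⟨x, rfl⟩ := hs x'
    obtain ⟨y, rfl⟩ := hs y'
    dsimp only at hxy
    rw [key, key] at hxy
    rw [(hr n).1 hxy]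
  · intro z
    obtain ⟨x, hx⟩ := (hr n).2 z
    exact ⟨G.comp (add_zero n) x i, (key x).trans hx⟩

/-- Adding a generator: an element of `Φ(X)` is brought into the image of the transformation
`Hom(-, L) → Φ` by adding a shift of `X` to `L`. -/
theorem exists_add {P : G.Obj → Prop} (hP : G.Closed P) {X L : G.Obj} (hX : P X) (hL : P L)
    (ξ : Φ.M 0 L) (n : ℤ) (v : Φ.M n X) :
    ∃ L', P L' ∧ ∃ (ξ' : Φ.M 0 L') (i : G.H 0 L L'), Φ.act (add_zero 0) i ξ' = ξ ∧
      (∃ f : G.H n X L', Φ.act (add_zero n) f ξ' = v) ∧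
      ∀ Y, G.Zero Y X → Φ.RepOn ξ Y → Φ.RepOn ξ' Y := by
  obtain ⟨L', hL', i, p, h⟩ := hP.exists_cone (0 : G.H (n + 1) X L) hX hL
  obtain ⟨q, hq⟩ := h.exact₁.lift (show 0 + (n + 1) = n + 1 by omega)
    (show n + (1 - (n + 1)) = 0 by omega) (G.id X) (map_zero _)
  obtain ⟨ξ₀, hξ₀⟩ := Φ.exact h.exact₂ (show n + 1 + 0 = n + 1 by omega) (add_zero 0) ξ
    (act_zero_left _ _)
  have hξ : Φ.act (add_zero 0) i
      (ξ₀ + Φ.act (show 1 - (n + 1) + n = 0 by omega) p (v - Φ.act (add_zero n) q ξ₀)) = ξ := by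
    rw [map_add, hξ₀, act_eq_zero_of_exactAt h.exact₃, add_zero]
  refine ⟨L', hL', _, i, hξ, ⟨q, ?_⟩, fun Y hY hr => hr.of_cone h hξ hY⟩
  rw [map_add, ← Φ.act_comp (show n + (1 - (n + 1)) = 0 by omega) _ (zero_add n), hq, Φ.id_act]
  abel

/-- Killing a relation: an element of the kernel of `Hom(X, L) → Φ(X)` is killed by passing to
its cone. -/
theorem exists_kill {P : G.Obj → Prop} (hP : G.Closed P) {X L : G.Obj} (hX : P X)
    (hline : G.Line 0 X X) (hL : P L) (ξ : Φ.M 0 L) {n : ℤ} (x : G.H n X L) (hx : x ≠ 0)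
    (hxξ : Φ.act (add_zero n) x ξ = 0) :
    ∃ L', P L' ∧ ∃ (ξ' : Φ.M 0 L') (i : G.H 0 L L'), Φ.act (add_zero 0) i ξ' = ξ ∧
      G.comp (add_zero n) x i = 0 ∧
      (∀ {r : ℤ} (f : G.H r X L'), ∃ g : G.H r X L, G.comp (add_zero r) g i = f) ∧
      ∀ Y, G.Zero Y X → Φ.RepOn ξ Y → Φ.RepOn ξ' Y := by
  obtain ⟨L', hL', i, p, h⟩ := hP.exists_cone x hX hL
  obtain ⟨ξ', hξ⟩ := Φ.exact h.exact₂ (add_zero n) (add_zero 0) ξ hxξ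
  refine ⟨L', hL', ξ', i, hξ, h.exact₂.comp_eq _, fun {r} f => ?_,
    fun Y hY hr => hr.of_cone h hξ hY⟩
  refine h.exact₃.lift rfl (add_zero r) f ?_
  by_cases hr : r + (1 - n) = 0
  · obtain ⟨c, hc⟩ := hline.exists_smul hline.id_ne_zero (G.comp hr f p)
    have h1 : G.comp (zero_add n) (G.comp hr f p) x = 0 := by
      rw [G.assoc hr rfl _ (by omega), h.exact₁.comp_eq, map_zero]
    rw [← hc, LinearMap.map_smul₂, G.id_comp] at h1
    have hc0 : c = 0 := (smul_eq_zero.1 h1).resolve_right hx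
    have h2 : G.comp hr f p = 0 := by rw [← hc, hc0, zero_smul]
    have : ∀ (s : ℤ) (hs : r + (1 - n) = s), G.comp hs f p = 0 := by
      rintro s hs
      obtain rfl : s = 0 := by omega
      exact h2
    exact this _ rfl
  · exact hline.2 _ hr _

theorem exists_surjective {P : G.Obj → Prop} (hP : G.Closed P) {X : G.Obj} (hX : P X)
    (l : List (Σ n, Φ.M n X)) {L : G.Obj} (hL : P L) (ξ : Φ.M 0 L) :
    ∃ L', P L' ∧ ∃ (ξ' : Φ.M 0 L'),
      (∀ s ∈ l, ∃ f : G.H s.1 X L', Φ.act (add_zero _) f ξ' = s.2) ∧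
      ∀ Y, G.Zero Y X → Φ.RepOn ξ Y → Φ.RepOn ξ' Y := by
  induction l with
  | nil => exact ⟨L, hL, ξ, by simp, fun _ _ h => h⟩
  | cons v l ih =>
    obtain ⟨L₁, hL₁, ξ₁, h₁, hr₁⟩ := ih
    obtain ⟨L₂, hL₂, ξ₂, i, hi, hv, hr₂⟩ := exists_add hP hX hL₁ ξ₁ v.1 v.2
    refine ⟨L₂, hL₂, ξ₂, fun s hs => ?_, fun Y hY hr => hr₂ Y hY (hr₁ Y hY hr)⟩
    rcases List.mem_cons.1 hs with rfl | hs
    · exact hv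
    · obtain ⟨f, hf⟩ := h₁ s hs
      refine ⟨G.comp (add_zero _) f i, ?_⟩
      rw [Φ.act_comp _ (add_zero 0) _ (add_zero _), hi, hf]

/-- If `ξ` is surjective on `Hom^*(X, -)`, its kernel can be killed, by induction on the number of
elements of a list which spans the kernel; the values on objects without morphisms to `X` do not
change. -/
theorem exists_bijective {P : G.Obj → Prop} (hP : G.Closed P) {X : G.Obj} (hX : P X)
    (hline : G.Line 0 X X) : ∀ (r : ℕ) {L : G.Obj} (_ : P L) (ξ : Φ.M 0 L)
    (_ : ∀ (n : ℤ) (v : Φ.M n X), ∃ f : G.H n X L, Φ.act (add_zero n) f ξ = v)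
    (l : List (Σ n, G.H n X L)) (_ : l.length = r)
    (_ : ∀ s ∈ l, Φ.act (add_zero _) s.2 ξ = 0)
    (_ : ∀ (n : ℤ) (x : G.H n X L), Φ.act (add_zero n) x ξ = 0 →
      x ∈ Submodule.span k {y | (⟨n, y⟩ : Σ n, G.H n X L) ∈ l}),
    ∃ L', P L' ∧ ∃ (ξ' : Φ.M 0 L'), Φ.RepOn ξ' X ∧
      ∀ Y, G.Zero Y X → Φ.RepOn ξ Y → Φ.RepOn ξ' Y
  | 0, L, hL, ξ, hs, l, hl, _, hker => by
    refine ⟨L, hL, ξ, fun n => ⟨?_, hs n⟩, fun _ _ h => h⟩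
    refine (injective_iff_map_eq_zero' (((Φ.act (add_zero n)).flip ξ))).2 fun z => ⟨fun hz => ?_,
      fun hz => by rw [hz, map_zero]⟩
    have := hker n z hz
    rw [List.length_eq_zero_iff.1 hl] at this
    simpa using this
  | r + 1, L, hL, ξ, hs, [], hl, _, _ => by simp at hl
  | r + 1, L, hL, ξ, hs, ⟨n, x⟩ :: l, hl, hl0, hker => by
    rw [List.length_cons, Nat.add_right_cancel_iff] at hl
    by_cases hx : x = 0
    · refine exists_bijective hP hX hline r hL ξ hs l hl
        (fun s h => hl0 s (List.mem_cons_of_mem _ h)) fun m y hy => ?_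
      refine Submodule.span_le.2 (fun z hz => ?_) (hker m y hy)
      rcases List.mem_cons.1 hz with hz | hz
      · obtain ⟨rfl, hz⟩ := Sigma.mk.inj hz
        rw [eq_of_heq hz, hx]
        exact zero_mem _
      · exact Submodule.subset_span hz
    · obtain ⟨L', hL', ξ', i, hi, hxi, hsur, hr⟩ :=
        exists_kill hP hX hline hL ξ x hx (hl0 ⟨n, x⟩ List.mem_cons_self)
      have key : ∀ {m : ℤ} (f : G.H m X L),
          Φ.act (add_zero m) (G.comp (add_zero m) f i) ξ' = Φ.act (add_zero m) f ξ := fun f => by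
        rw [← hi, Φ.act_comp]
      obtain ⟨L'', hL'', ξ'', h₁, h₂⟩ := exists_bijective hP hX hline r hL' ξ'
        (fun m v => by
          obtain ⟨f, hf⟩ := hs m v
          exact ⟨G.comp (add_zero m) f i, (key f).trans hf⟩)
        (l.map fun s => ⟨s.1, G.comp (add_zero s.1) s.2 i⟩) (by rw [List.length_map, hl])
        (by
          intro s hs
          obtain ⟨t, ht, rfl⟩ := List.mem_map.1 hs
          exact (key t.2).trans (hl0 t (List.mem_cons_of_mem _ ht)))
        (fun m y hy => by
          obtain ⟨z, rfl⟩ := hsur y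
          have hz := hker m z ((key z).symm.trans hy)
          have h3 := Submodule.mem_map_of_mem (f := (G.comp (add_zero m)).flip i) hz
          rw [Submodule.map_span] at h3
          refine Submodule.span_le.2 ?_ h3
          rintro _ ⟨t, ht, rfl⟩
          rcases List.mem_cons.1 ht with ht | ht
          · obtain ⟨rfl, ht⟩ := Sigma.mk.inj ht
            rw [eq_of_heq ht]
            refine SetLike.mem_coe.2 ?_
            rw [LinearMap.flip_apply, hxi]
            exact zero_mem _
          · exact Submodule.subset_span (List.mem_map.2 ⟨_, ht, rfl⟩))
      exact ⟨L'', hL'', ξ'', h₁, fun Y hY h => h₂ Y hY (hr Y hY h)⟩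

end CoFun

/-- An exceptional collection, as a list of objects. -/
structure ExcList (G : GrCat.{w, v, u} k) (l : List G.Obj) : Prop where
  pairwise : l.Pairwise fun X Y => G.Zero Y X
  line : ∀ X ∈ l, G.Line 0 X X

/-- A cohomological functor with values of finite total dimension on the terms of an exceptional
collection is represented, on this collection, by an object built from the collection. The terms
are treated from the last to the first, so that each step leaves the values on later terms
unchanged. -/
theorem CoFun.exists_repOn (Φ : G.CoFun) {P : G.Obj → Prop} (hP : G.Closed P) (l : List G.Obj)
    (hl : G.ExcList l) (hlP : ∀ X ∈ l, P X) (hfin : ∀ X ∈ l, ∀ L, P L → G.HomFin X L)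
    (hΦ : ∀ X ∈ l, GrFin k fun n => Φ.M n X) :
    ∃ L, P L ∧ ∃ ξ : Φ.M 0 L, ∀ X ∈ l, Φ.RepOn ξ X := by
  induction l with
  | nil =>
    obtain ⟨L, hL⟩ := hP.nonempty
    exact ⟨L, hL, 0, by simp⟩
  | cons X l ih =>
    obtain ⟨L, hL, ξ, hξ⟩ := ih ⟨(List.pairwise_cons.1 hl.pairwise).2,
        fun Y hY => hl.line Y (List.mem_cons_of_mem _ hY)⟩
      (fun Y hY => hlP Y (List.mem_cons_of_mem _ hY))
      (fun Y hY => hfin Y (List.mem_cons_of_mem _ hY))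
      (fun Y hY => hΦ Y (List.mem_cons_of_mem _ hY))
    have hXP := hlP X List.mem_cons_self
    obtain ⟨l₁, -, hl₁⟩ := (hΦ X List.mem_cons_self).exists_list fun _ => ⊤
    obtain ⟨L₁, hL₁, ξ₁, hs₁, hr₁⟩ := exists_surjective hP hXP l₁ hL ξ
    have hs : ∀ (n : ℤ) (v : Φ.M n X), ∃ f : G.H n X L₁, Φ.act (add_zero n) f ξ₁ = v := by
      intro n v
      have h3 : Submodule.span k {y | (⟨n, y⟩ : Σ n, Φ.M n X) ∈ l₁} ≤
          LinearMap.range ((Φ.act (add_zero n) (X := X)).flip ξ₁) :=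
        Submodule.span_le.2 fun y hy => hs₁ ⟨n, y⟩ hy
      exact h3 (hl₁ n trivial)
    obtain ⟨l₂, hl₂, hl₂'⟩ := GrFin.exists_list (k := k) (hfin X List.mem_cons_self L₁ hL₁)
      fun n => LinearMap.ker ((Φ.act (add_zero n)).flip ξ₁)
    obtain ⟨L₂, hL₂, ξ₂, h₂, hr₂⟩ := exists_bijective hP hXP (hl.line X List.mem_cons_self) _ hL₁
      ξ₁ hs l₂ rfl (fun s h => hl₂ s h) (fun n x hx => hl₂' n hx)
    refine ⟨L₂, hL₂, ξ₂, fun Y hY => ?_⟩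
    rcases List.mem_cons.1 hY with rfl | hY
    · exact h₂
    · have hYX := (List.pairwise_cons.1 hl.pairwise).1 Y hY
      exact hr₂ Y hYX (hr₁ Y hYX (hξ Y hY))

end GrCat

namespace GrCat

variable {G : GrCat.{w, v, u} k}

/-! ### Morphisms detected by representable functors -/

/-- The Yoneda lemma, for morphisms of any degree. -/
theorem Shift.of_bijective {n s : ℤ} (hs : n + s = 0) {X Y : G.Obj} (f : G.H n X Y)
    (h : ∀ W, W = X ∨ W = Y → ∀ {a b : ℤ} (hb : a + n = b),
      Function.Bijective fun g : G.H a W X => G.comp hb g f) : G.Shift s X Y := by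
  obtain ⟨g, hg⟩ := (h Y (.inr rfl) (show s + n = 0 by omega)).2 (G.id Y)
  refine Shift.mk' (by omega) rfl f g (fun h' => ?_) fun _ => hg
  apply (h X (.inl rfl) (zero_add n)).1
  dsimp only at hg ⊢
  rw [G.assoc h' (show s + n = 0 by omega) _ (add_zero n), hg, G.comp_id, G.id_comp]

theorem Shift.of_bijective' {n s : ℤ} (hs : n + s = 0) {X Y : G.Obj} (f : G.H n X Y)
    (h : ∀ W, W = X ∨ W = Y → ∀ {a b : ℤ} (hb : n + a = b),
      Function.Bijective fun g : G.H a Y W => G.comp hb f g) : G.Shift s X Y := by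
  have := Shift.of_bijective (G := G.op) (X := Y) (Y := X) hs f fun W hW a b hb =>
    h W hW.symm ((add_comm _ _).trans hb)
  rw [← neg_neg s]
  exact this.symm.op

theorem ExcList.op {l : List G.Obj} (h : G.ExcList l) : G.op.ExcList l.reverse :=
  ⟨List.pairwise_reverse.2 h.pairwise, fun X hX => h.line X (List.mem_reverse.1 hX)⟩

/-- An object generated by an exceptional collection which receives no morphisms from the last
terms of the collection is generated by the remaining terms. -/
theorem mem_of_zero_left {P : G.Obj → Prop} (hP : G.Closed P) {l₁ l₂ : List G.Obj}
    (hl : G.ExcList (l₁ ++ l₂)) (hfin : ∀ X ∈ l₁ ++ l₂, ∀ Y ∈ l₁ ++ l₂, G.HomFin X Y)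
    (hlP : ∀ X ∈ l₁, P X) (hPl : ∀ X, P X → G.Gen (· ∈ l₁) X) {X : G.Obj}
    (hX : G.Gen (· ∈ l₁ ++ l₂) X) (h : ∀ Y ∈ l₂, G.Zero Y X) : P X := by
  have hl₁ : ∀ Y ∈ l₁, Y ∈ l₁ ++ l₂ := fun Y => List.mem_append_left _
  obtain ⟨L, hL, ξ, hξ⟩ := (G.yoneda X).exists_repOn hP l₁
    ⟨(List.pairwise_append.1 hl.pairwise).1, fun Y hY => hl.line Y (hl₁ Y hY)⟩ hlP
    (fun Y hY L hL => HomFin.gen_right (fun Z hZ => hfin Y (hl₁ Y hY) Z (hl₁ Z hZ)) (hPl L hL))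
    (fun Y hY => HomFin.gen_right (fun Z hZ => hfin Y (hl₁ Y hY) Z hZ) hX)
  have hrep : ∀ Y, G.Gen (· ∈ l₁ ++ l₂) Y → (G.yoneda X).RepOn ξ Y := fun Y hY =>
    CoFun.RepOn.gen (fun Z hZ => by
      rcases List.mem_append.1 hZ with hZ | hZ
      · exact hξ Z hZ
      · have h0 : G.Zero Z L := Zero.gen_right (fun W hW =>
          (List.pairwise_append.1 hl.pairwise).2.2 W hW Z hZ) (hPl L hL)
        exact fun n => ⟨fun f g _ => (h0 n f).trans (h0 n g).symm,
          fun f => ⟨0, (h Z hZ n _).trans (h Z hZ n f).symm⟩⟩) hY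
  refine hP.of_shift hL (Shift.of_bijective (n := 0) (s := 0) rfl (show G.H 0 L X from ξ) ?_)
  rintro W hW a b hb
  obtain rfl : a = b := by omega
  refine hrep W ?_ a
  rcases hW with rfl | rfl
  · exact (hPl _ hL).mono fun Y hY => .of (hl₁ Y hY)
  · exact hX

/-- An object generated by an exceptional collection which has no morphisms to the first terms of
the collection is generated by the remaining terms. -/
theorem mem_of_zero_right {P : G.Obj → Prop} (hP : G.Closed P) {l₁ l₂ : List G.Obj}
    (hl : G.ExcList (l₁ ++ l₂)) (hfin : ∀ X ∈ l₁ ++ l₂, ∀ Y ∈ l₁ ++ l₂, G.HomFin X Y)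
    (hlP : ∀ X ∈ l₂, P X) (hPl : ∀ X, P X → G.Gen (· ∈ l₂) X) {X : G.Obj}
    (hX : G.Gen (· ∈ l₁ ++ l₂) X) (h : ∀ Y ∈ l₁, G.Zero X Y) : P X := by
  have hrev : ∀ Y, Y ∈ l₂.reverse ++ l₁.reverse ↔ Y ∈ l₁ ++ l₂ := by
    intro Y
    rw [← List.reverse_append, List.mem_reverse]
  refine mem_of_zero_left (G := G.op) hP.op (l₁ := l₂.reverse) (l₂ := l₁.reverse) ?_ ?_ ?_ ?_ ?_ ?_
  · exact List.reverse_append (as := l₁) ▸ hl.op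
  · exact fun X hX Y hY => hfin Y ((hrev Y).1 hY) X ((hrev X).1 hX)
  · exact fun X hX => hlP X (List.mem_reverse.1 hX)
  · exact fun X hX => (hPl X hX).op.mono fun Y hY => .of (List.mem_reverse.2 hY)
  · exact Gen.mono (G := G.op) (fun Y hY => .of ((hrev Y).2 hY)) hX.op
  · exact fun Y hY => h Y (List.mem_reverse.1 hY)

/-- Any closed class of objects which contains an exceptional collection contains everything
generated by it. -/
theorem mem_of_gen {P : G.Obj → Prop} (hP : G.Closed P) {l : List G.Obj} (hl : G.ExcList l)
    (hfin : ∀ X ∈ l, ∀ Y ∈ l, G.HomFin X Y) (hlP : ∀ X ∈ l, P X)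
    (hPl : ∀ X, P X → G.Gen (· ∈ l) X) {X : G.Obj} (hX : G.Gen (· ∈ l) X) : P X := by
  refine mem_of_zero_left hP (l₁ := l) (l₂ := []) ?_ ?_ hlP hPl ?_ (by simp)
  all_goals rwa [List.append_nil]

/-! ### Serre duality for a pair of objects -/

variable (G) in
/-- `Z` is the shift by `-d` of the value at `Y` of a Serre functor on the class `P`: a functional
on `Hom^d(Y, Z)` such that, for `X` in `P` and `a + b = d`, the resulting pairing of
`Hom^a(Y, X)` and `Hom^b(X, Z)` is perfect. This notion is symmetric under passage to the opposite
category. -/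
def SerrePair (P : G.Obj → Prop) (d : ℤ) (Y Z : G.Obj) : Prop :=
  ∃ tr : Module.Dual k (G.H d Y Z), ∀ X, P X → ∀ {a b : ℤ} (h : a + b = d),
    (Function.Bijective fun f : G.H a Y X => tr ∘ₗ G.comp h f (Z := Z)) ∧
      Function.Bijective fun g : G.H b X Z => tr ∘ₗ (G.comp h (X := Y)).flip g

theorem SerrePair.op {P : G.Obj → Prop} {d : ℤ} {Y Z : G.Obj} (h : G.SerrePair P d Y Z) :
    G.op.SerrePair P d Z Y := by
  obtain ⟨tr, htr⟩ := h
  exact ⟨tr, fun X hX a b h => (htr X hX ((add_comm _ _).trans h)).symm⟩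

theorem SerrePair.mono {P P' : G.Obj → Prop} {d : ℤ} {Y Z : G.Obj} (h : G.SerrePair P d Y Z)
    (hP : ∀ X, P' X → P X) : G.SerrePair P' d Y Z :=
  h.imp fun _ h X hX => h X (hP X hX)

/-- A pairing of vector spaces, one of which is finite-dimensional, is perfect if it is perfect on
one side. -/
theorem bijective_of_bijective_flip {V W : Type*} [AddCommGroup V] [Module k V] [AddCommGroup W]
    [Module k W] [FiniteDimensional k V] (B : V →ₗ[k] W →ₗ[k] k)
    (h : Function.Bijective B.flip) : Function.Bijective B := by
  let e : W ≃ₗ[k] Module.Dual k V := LinearEquiv.ofBijective B.flip h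
  have : B = e.dualMap.toLinearMap ∘ₗ (Module.evalEquiv k V).toLinearMap := by
    ext v w
    rfl
  rw [this]
  exact e.dualMap.bijective.comp (Module.evalEquiv k V).bijective

/-- Representing `Hom^{d-*}(Y, -)^∨` by `Z` amounts to a pairing which is perfect on one side. -/
theorem coyonedaDual_repOn_iff {d : ℤ} {Y Z : G.Obj} (ξ : (G.coyonedaDual d Y).M 0 Z)
    (X : G.Obj) : (G.coyonedaDual d Y).RepOn ξ X ↔ ∀ {a b : ℤ} (h : a + b = d),
      Function.Bijective fun g : G.H b X Z => ξ ⟨d, add_zero d⟩ ∘ₗ (G.comp h (X := Y)).flip g := by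
  have key : ∀ {n : ℤ} (g : G.H n X Z) (r : ℤ) (hr : r + n = d),
      (G.coyonedaDual d Y).act (add_zero n) g ξ ⟨r, hr⟩ =
        ξ ⟨d, add_zero d⟩ ∘ₗ (G.comp hr (X := Y)).flip g := by
    intro n g r hr
    subst hr
    rfl
  constructor
  · intro h a b hab
    constructor
    · intro g g' hg
      refine (h b).1 (funext fun r => ?_)
      obtain ⟨r, hr⟩ := r
      obtain rfl : r = a := by omega
      exact (key g r hr).trans (hg.trans (key g' r hr).symm)
    · intro φ
      obtain ⟨g, hg⟩ := (h b).2 fun r => (show a = r.1 by have := r.2; omega) ▸ φ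
      exact ⟨g, (key g a hab).symm.trans (congrFun hg ⟨a, hab⟩)⟩
  · intro h n
    constructor
    · intro g g' hg
      refine (h (show d - n + n = d by omega)).1 ?_
      dsimp only
      rw [← key, ← key]
      exact congrFun hg ⟨d - n, by omega⟩
    · intro φ
      obtain ⟨g, hg⟩ := (h (show d - n + n = d by omega)).2 (φ ⟨d - n, by omega⟩)
      refine ⟨g, funext fun r => ?_⟩
      obtain ⟨r, hr⟩ := r
      obtain rfl : r = d - n := by omega
      exact (key g _ hr).trans hg

theorem SerrePair.of_repOn {P : G.Obj → Prop} {d : ℤ} {Y Z : G.Obj}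
    (ξ : (G.coyonedaDual d Y).M 0 Z) (h : ∀ X, P X → (G.coyonedaDual d Y).RepOn ξ X)
    (hfin : ∀ X, P X → G.HomFin Y X) : G.SerrePair P d Y Z := by
  refine ⟨ξ ⟨d, add_zero d⟩, fun X hX a b hab => ?_⟩
  have h2 := (coyonedaDual_repOn_iff ξ X).1 (h X hX) hab
  refine ⟨?_, h2⟩
  have := (hfin X hX).1 a
  exact bijective_of_bijective_flip
    ((LinearMap.compr₂ (G.comp hab) (ξ ⟨d, add_zero d⟩ : Module.Dual k (G.H d Y Z)))) h2

/-- Serre duality holds on the class generated by a collection if it holds on the collection. -/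
theorem SerrePair.of_gen {S : G.Obj → Prop} {d : ℤ} {Y Z : G.Obj} (tr : Module.Dual k (G.H d Y Z))
    (h : ∀ X, S X → ∀ {a b : ℤ} (h : a + b = d),
      Function.Bijective fun g : G.H b X Z => tr ∘ₗ (G.comp h (X := Y)).flip g)
    (hfin : ∀ X, S X → G.HomFin Y X) : G.SerrePair (G.Gen S) d Y Z := by
  let ξ : (G.coyonedaDual d Y).M 0 Z := fun r => (show d = r.1 by have := r.2; omega) ▸ tr
  refine .of_repOn ξ (fun X hX => CoFun.RepOn.gen (fun X hX => ?_) hX) fun X hX =>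
    HomFin.gen_right hfin hX
  exact (coyonedaDual_repOn_iff ξ X).2 fun hab => h X hX hab

theorem exists_serrePair_right {P : G.Obj → Prop} (hP : G.Closed P) {l : List G.Obj}
    (hl : G.ExcList l) (hfin : ∀ X ∈ l, ∀ Y ∈ l, G.HomFin X Y) (hlP : ∀ X ∈ l, P X)
    (hPl : ∀ X, P X → G.Gen (· ∈ l) X) (Y : G.Obj) (hY : ∀ X ∈ l, G.HomFin Y X) :
    ∃ Z, P Z ∧ G.SerrePair P 0 Y Z := by
  obtain ⟨Z, hZ, ξ, hξ⟩ := (G.coyonedaDual 0 Y).exists_repOn hP l hl hlP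
    (fun X hX L hL => HomFin.gen_right (hfin X hX) (hPl L hL))
    (fun X hX => by
      refine GrFin.of_injective (k := k) (GrFin.dual (k := k) (hY X hX)) neg_injective
        (fun n => LinearMap.proj (⟨-n, by omega⟩ : {m : ℤ // m + n = 0})) fun n v hv => ?_
      funext r
      obtain ⟨r, hr⟩ := r
      obtain rfl : r = -n := by omega
      exact hv)
  exact ⟨Z, hZ, .of_repOn ξ (fun X hX => CoFun.RepOn.gen hξ (hPl X hX))
    fun X hX => HomFin.gen_right hY (hPl X hX)⟩

theorem exists_serrePair_left {P : G.Obj → Prop} (hP : G.Closed P) {l : List G.Obj}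
    (hl : G.ExcList l) (hfin : ∀ X ∈ l, ∀ Y ∈ l, G.HomFin X Y) (hlP : ∀ X ∈ l, P X)
    (hPl : ∀ X, P X → G.Gen (· ∈ l) X) (Z : G.Obj) (hZ : ∀ X ∈ l, G.HomFin X Z) :
    ∃ Y, P Y ∧ G.SerrePair P 0 Y Z := by
  obtain ⟨Y, hY, h⟩ := exists_serrePair_right (G := G.op) hP.op hl.op
    (fun X hX Y hY => hfin Y (List.mem_reverse.1 hY) X (List.mem_reverse.1 hX))
    (fun X hX => hlP X (List.mem_reverse.1 hX))
    (fun X hX => (hPl X hX).op.mono fun Y hY => .of (List.mem_reverse.2 hY)) Z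
    (fun X hX => hZ X (List.mem_reverse.1 hX))
  exact ⟨Y, hY, h.op⟩

section

variable {P : G.Obj → Prop} {d : ℤ} {Y Z : G.Obj}

theorem SerrePair.finrank_eq (h : G.SerrePair P d Y Z) {X : G.Obj} (hX : P X) {a b : ℤ}
    (hab : a + b = d) : Module.finrank k (G.H a Y X) = Module.finrank k (G.H b X Z) := by
  obtain ⟨tr, htr⟩ := h
  have := LinearEquiv.finrank_eq (LinearEquiv.ofBijective
    (LinearMap.compr₂ (G.comp hab) tr : G.H a Y X →ₗ[k] Module.Dual k (G.H b X Z))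
    (htr X hX hab).1)
  rw [this, Subspace.dual_finrank_eq]

theorem SerrePair.eq_zero_right (h : G.SerrePair P d Y Z) {X : G.Obj} (hX : P X) {a b : ℤ}
    (hab : a + b = d) (h0 : ∀ f : G.H a Y X, f = 0) (g : G.H b X Z) : g = 0 := by
  obtain ⟨tr, htr⟩ := h
  refine (htr X hX hab).2.1 (LinearMap.ext fun f => ?_)
  rw [h0 f, map_zero, map_zero]

theorem SerrePair.eq_zero_left (h : G.SerrePair P d Y Z) {X : G.Obj} (hX : P X) {a b : ℤ}
    (hab : a + b = d) (h0 : ∀ g : G.H b X Z, g = 0) (f : G.H a Y X) : f = 0 :=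
  h.op.eq_zero_right (G := G.op) hX ((add_comm _ _).trans hab) h0 f

theorem SerrePair.zero_right (h : G.SerrePair P d Y Z) {X : G.Obj} (hX : P X)
    (h0 : G.Zero Y X) : G.Zero X Z :=
  fun b g => h.eq_zero_right hX (show d - b + b = d by omega) (h0 _) g

theorem SerrePair.zero_left (h : G.SerrePair P d Y Z) {X : G.Obj} (hX : P X)
    (h0 : G.Zero X Z) : G.Zero Y X :=
  fun b g => h.eq_zero_left hX (show b + (d - b) = d by omega) (h0 _) g

theorem SerrePair.line_right (h : G.SerrePair P d Y Z) {X : G.Obj} (hX : P X) {a b : ℤ}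
    (hab : a + b = d) (h0 : G.Line a Y X) : G.Line b X Z :=
  ⟨(h.finrank_eq hX hab).symm.trans h0.1, fun n hn =>
    h.eq_zero_right hX (show d - n + n = d by omega) (h0.2 _ (by omega))⟩

/-- If `Y'` is the reflection of `Y` in the class `P'`, then the Serre dual of `Y'` in `P'` is the
coreflection in `P'` of the Serre dual of `Y`. -/
theorem SerrePair.exists_map (h : G.SerrePair P d Y Z) {P' : G.Obj → Prop} (hP : ∀ X, P' X → P X)
    {d' : ℤ} {Y' Z' : G.Obj} (h' : G.SerrePair P' d' Y' Z') (hZ' : P' Z') {n s : ℤ}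
    (hs : n + d' + s = d) (y : G.H n Y Y')
    (hy : ∀ X, P' X → ∀ {a b : ℤ} (hb : n + a = b),
      Function.Bijective fun f : G.H a Y' X => G.comp hb y f) :
    ∃ r : G.H s Z' Z, ∀ X, P' X → ∀ {a b : ℤ} (hb : a + s = b),
      Function.Bijective fun g : G.H a X Z' => G.comp hb g r := by
  obtain ⟨tr, htr⟩ := h
  obtain ⟨tr', htr'⟩ := h'
  let e : ∀ (X : G.Obj) (_ : P' X) (a b : ℤ) (_ : n + a = b), G.H a Y' X ≃ₗ[k] G.H b Y X :=
    fun X hX a b hb => LinearEquiv.ofBijective (G.comp hb y) (hy X hX hb)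
  obtain ⟨r, hr⟩ := (htr Z' (hP _ hZ') hs).2.2 (tr' ∘ₗ (e Z' hZ' d' _ rfl).symm.toLinearMap)
  have hr' : ∀ f : G.H d' Y' Z', tr (G.comp hs (G.comp rfl y f) r) = tr' f := fun f => by
    refine (LinearMap.congr_fun hr ((e Z' hZ' d' _ rfl) f)).trans ?_
    rw [LinearMap.comp_apply]
    exact congrArg tr' ((e Z' hZ' d' _ rfl).symm_apply_apply f)
  refine ⟨r, fun X hX a b hb => ?_⟩
  have hA := (htr' X hX (show d' - a + a = d' by omega)).2
  have hB := (htr X (hP X hX) (show n + (d' - a) + b = d by omega)).2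
  have hC := (e X hX (d' - a) _ rfl).dualMap.bijective
  rw [← Function.Bijective.of_comp_iff' (hC.comp hB)]
  convert hA using 1
  funext g
  refine LinearMap.ext fun f => ?_
  change tr (G.comp _ (G.comp rfl y f) (G.comp hb g r)) = tr' (G.comp _ f g)
  rw [← hr' (G.comp (show d' - a + a = d' by omega) f g),
    ← G.assoc (show n + (d' - a) + a = n + d' by omega) hb hs,
    G.assoc rfl (show d' - a + a = d' by omega) (by omega) rfl]

/-- Serre duals are unique up to isomorphism, and compatible with shifts. -/
theorem SerrePair.shift (h : G.SerrePair P d Y Z) (hZ : P Z) {d' : ℤ} {Y' Z' : G.Obj}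
    (h' : G.SerrePair P d' Y' Z') (hZ' : P Z') {n s : ℤ} (hY : G.Shift n Y Y')
    (hs : s = d' - d - n) : G.Shift s Z' Z := by
  obtain ⟨f, g, h₁, h₂⟩ := hY
  obtain ⟨r, hr⟩ := h.exists_map (fun _ h => h) h' hZ' (s := -s) (n := -n) (by omega) f
    (fun X _ a b hb => by
      constructor
      · intro x x' hx
        have := congrArg (G.comp (show n + b = a by omega) g) hx
        dsimp only at this
        rwa [← G.assoc (add_neg_cancel n) hb (zero_add a), h₂, G.id_comp,
          ← G.assoc (add_neg_cancel n) hb (zero_add a), h₂, G.id_comp] at this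
      · intro x
        refine ⟨G.comp (show n + b = a by omega) g x, ?_⟩
        dsimp only
        rw [← G.assoc (neg_add_cancel n) _ (zero_add b), h₁, G.id_comp])
  exact .of_bijective (neg_add_cancel s) r fun W hW a b hb =>
    hr W (by rcases hW with rfl | rfl <;> assumption) hb

end

end GrCat

namespace GrCat

variable {G : GrCat.{w, v, u} k}

/-! ### Dual exceptional collections -/

variable (G) in
/-- The part `E_a, …, E_{b-1}` of a sequence of objects. -/
def seg (E : ℕ → G.Obj) (a b : ℕ) : List G.Obj := (List.Ico a b).map E

theorem mem_seg {E : ℕ → G.Obj} {a b : ℕ} {X : G.Obj} :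
    X ∈ G.seg E a b ↔ ∃ i, a ≤ i ∧ i < b ∧ E i = X := by
  simp only [seg, List.mem_map, List.Ico.mem, and_assoc]

theorem seg_append (E : ℕ → G.Obj) {a b c : ℕ} (h : a ≤ b) (h' : b ≤ c) :
    G.seg E a b ++ G.seg E b c = G.seg E a c := by
  rw [seg, seg, ← List.map_append, List.Ico.append_consecutive h h', seg]

theorem ExcList.seg {E : ℕ → G.Obj} {a b : ℕ} (h : ∀ i, a ≤ i → i < b → G.Line 0 (E i) (E i))
    (h' : ∀ i j, a ≤ i → i < j → j < b → G.Zero (E j) (E i)) : G.ExcList (G.seg E a b) := by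
  refine ⟨List.pairwise_map.2 ?_, fun X hX => ?_⟩
  · refine (List.Ico.pairwise_lt a b).imp_of_mem fun {i j} hi hj hij => ?_
    exact h' i j (List.Ico.mem.1 hi).1 hij (List.Ico.mem.1 hj).2
  · obtain ⟨i, hi, hi', rfl⟩ := mem_seg.1 hX
    exact h i hi hi'

variable (G) in
/-- A full exceptional collection `E_0, …, E_N` of some subcategory, into the terms of which all
objects have finite-dimensional morphism spaces, and its left dual collection; `F i` stands for
`F_{-i}`. -/
structure DualPair (N : ℕ) (E F : ℕ → G.Obj) : Prop where
  closed : G.Closed fun _ => True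
  fin : ∀ X, ∀ i ≤ N, G.HomFin X (E i)
  lineE : ∀ i ≤ N, G.Line 0 (E i) (E i)
  zeroE : ∀ i j, i < j → j ≤ N → G.Zero (E j) (E i)
  lineF : ∀ i ≤ N, G.Line 0 (F i) (F i)
  zeroF : ∀ i j, i < j → j ≤ N → G.Zero (F i) (F j)
  memE : ∀ i ≤ N, G.Gen (· ∈ G.seg F 0 (N + 1)) (E i)
  memF : ∀ i ≤ N, G.Gen (· ∈ G.seg E 0 (N + 1)) (F i)
  zero : ∀ i j, i ≤ N → j ≤ N → i ≠ j → G.Zero (E i) (F j)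
  line : ∀ i ≤ N, G.Line 0 (E i) (F i)

namespace DualPair

variable {N : ℕ} {E F : ℕ → G.Obj} (D : G.DualPair N E F)

include D

theorem gen_closed {S : G.Obj → Prop} (hS : ∃ X, S X) : G.Closed (G.Gen S) :=
  Gen.closed D.closed (fun _ _ => trivial) hS

theorem seg_closed {a b : ℕ} (h : a < b) : G.Closed (G.Gen (· ∈ G.seg E a b)) :=
  D.gen_closed ⟨E a, mem_seg.2 ⟨a, le_rfl, h, rfl⟩⟩

theorem excE {a b : ℕ} (hb : b ≤ N + 1) : G.ExcList (G.seg E a b) :=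
  .seg (fun i _ hi => D.lineE i (by omega)) fun i j _ hij hj => D.zeroE i j hij (by omega)

theorem excF {a b : ℕ} (hb : b ≤ N + 1) : G.ExcList (G.seg F a b).reverse := by
  refine ⟨List.pairwise_reverse.2 (List.pairwise_map.2 ?_), fun X hX => ?_⟩
  · refine (List.Ico.pairwise_lt a b).imp_of_mem fun {i j} hi hj hij => ?_
    exact D.zeroF i j hij (by have := (List.Ico.mem.1 hj).2; omega)
  · obtain ⟨i, hi, hi', rfl⟩ := mem_seg.1 (List.mem_reverse.1 hX)
    exact D.lineF i (by omega)

theorem fin_gen {X : G.Obj} (W : G.Obj) (hX : G.Gen (· ∈ G.seg E 0 (N + 1)) X) : G.HomFin W X :=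
  HomFin.gen_right (fun Y hY => by
    obtain ⟨i, -, hi, rfl⟩ := mem_seg.1 hY
    exact D.fin W i (by omega)) hX

theorem finE {a b : ℕ} (hb : b ≤ N + 1) (W : G.Obj) : ∀ X ∈ G.seg E a b, G.HomFin W X :=
  fun X hX => by
    obtain ⟨i, -, hi, rfl⟩ := mem_seg.1 hX
    exact D.fin W i (by omega)

theorem finF {a b : ℕ} (hb : b ≤ N + 1) (W : G.Obj) : ∀ X ∈ G.seg F a b, G.HomFin W X :=
  fun X hX => by
    obtain ⟨i, -, hi, rfl⟩ := mem_seg.1 hX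
    exact D.fin_gen W (D.memF i (by omega))

omit D in
theorem gen_mono {a b a' b' : ℕ} (ha : a' ≤ a) (hb : b ≤ b') {X : G.Obj}
    (hX : G.Gen (· ∈ G.seg E a b) X) : G.Gen (· ∈ G.seg E a' b') X :=
  hX.mono fun Y hY => .of (by
    obtain ⟨i, hi, hi', rfl⟩ := mem_seg.1 hY
    exact mem_seg.2 ⟨i, by omega, by omega, rfl⟩)

theorem memF_seg {i q : ℕ} (hi : i < q) (hq : q ≤ N + 1) : G.Gen (· ∈ G.seg E 0 q) (F i) := by
  have happ := seg_append E (Nat.zero_le q) hq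
  refine mem_of_zero_left (D.seg_closed (by omega)) (l₁ := G.seg E 0 q) (l₂ := G.seg E q (N + 1))
    ?_ ?_ (fun X hX => .of hX) (fun _ h => h) ?_ fun Y hY => ?_
  · rw [happ]
    exact D.excE le_rfl
  · rw [happ]
    exact fun X _ => D.finE le_rfl X
  · rw [happ]
    exact D.memF i (by omega)
  · obtain ⟨j, hj, hj', rfl⟩ := mem_seg.1 hY
    exact D.zero j i (by omega) (by omega) (by omega)

theorem memE_seg {i q : ℕ} (hi : i < q) (hq : q ≤ N + 1) : G.Gen (· ∈ G.seg F 0 q) (E i) := by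
  have happ : (G.seg F q (N + 1)).reverse ++ (G.seg F 0 q).reverse =
      (G.seg F 0 (N + 1)).reverse := by
    rw [← List.reverse_append, seg_append F (Nat.zero_le q) hq]
  have hc : G.Closed (G.Gen (· ∈ G.seg F 0 q)) :=
    D.gen_closed ⟨F i, mem_seg.2 ⟨i, Nat.zero_le _, hi, rfl⟩⟩
  refine mem_of_zero_right hc (l₁ := (G.seg F q (N + 1)).reverse)
    (l₂ := (G.seg F 0 q).reverse) ?_ ?_ (fun X hX => .of (List.mem_reverse.1 hX))
    (fun _ h => h.mono fun X hX => .of (List.mem_reverse.2 hX)) ?_ fun Y hY => ?_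
  · rw [happ]
    exact D.excF le_rfl
  · rw [happ]
    exact fun X _ Y hY => D.finF le_rfl X Y (List.mem_reverse.1 hY)
  · rw [happ]
    exact (D.memE i (by omega)).mono fun X hX => .of (List.mem_reverse.2 hX)
  · obtain ⟨j, hj, hj', rfl⟩ := mem_seg.1 (List.mem_reverse.1 hY)
    exact D.zero i j (by omega) (by omega) (by omega)

/-- An object of `⟨E_0, …, E_{b-1}⟩` with no morphisms to `E_0, …, E_{a-1}` belongs to
`⟨E_a, …, E_{b-1}⟩`. -/
theorem mem_seg_of_zero {a b : ℕ} (hab : a ≤ b) (hb : b ≤ N + 1) {X : G.Obj}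
    (hX : G.Gen (· ∈ G.seg E 0 b) X) (h : ∀ i < a, G.Zero X (E i)) :
    G.Gen (· ∈ G.seg E a b) X := by
  have happ := seg_append E (Nat.zero_le a) hab
  rcases hab.eq_or_lt with rfl | hab'
  · refine .zero ?_
    have : G.Zero X X := Zero.gen_right (fun Y hY => by
      obtain ⟨j, -, hj, rfl⟩ := mem_seg.1 hY
      exact h j hj) hX
    exact this 0 _
  refine mem_of_zero_right (D.seg_closed hab') (l₁ := G.seg E 0 a) (l₂ := G.seg E a b)
    ?_ ?_ (fun X hX => .of hX) (fun _ h => h) ?_ fun Y hY => ?_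
  · rw [happ]
    exact D.excE hb
  · rw [happ]
    exact fun X _ => D.finE hb X
  · rwa [happ]
  · obtain ⟨j, hj, hj', rfl⟩ := mem_seg.1 hY
    exact h j hj'

/-- Up to shift, `F_{-l}` is the only object of `⟨E_0, …, E_N⟩` which receives no morphisms from the
`E_j` with `j ≠ l`, and a one-dimensional space of morphisms from `E_l`. -/
theorem shift_of_line {l : ℕ} (hl : l ≤ N) {Q : G.Obj} (hQ : G.Gen (· ∈ G.seg E 0 (N + 1)) Q)
    (h0 : ∀ j ≤ N, j ≠ l → G.Zero (E j) Q) {e : ℤ} (h1 : G.Line e (E l) Q) :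
    G.Shift (-e) (F l) Q := by
  obtain ⟨v, hv⟩ := (D.line l hl).exists_ne_zero
  obtain ⟨x, hx⟩ := h1.exists_ne_zero
  obtain ⟨K, -, i, p, ht⟩ := D.closed.exists_cone v trivial trivial
  have hEl : G.Gen (· ∈ G.seg E 0 (N + 1)) (E l) :=
    .of (mem_seg.2 ⟨l, Nat.zero_le _, by omega, rfl⟩)
  have hK : G.Gen (· ∈ G.seg E 0 (N + 1)) K := .tri hEl (D.memF l hl) ht
  have happ := seg_append E (Nat.zero_le l) (show l ≤ N + 1 by omega)
  -- `E_j` does not see the cone of `E_l → F_{-l}` for `j ≥ l`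
  have hjK : ∀ j, l ≤ j → j ≤ N → G.Zero (E j) K := by
    intro j hj hjN n f
    rcases hj.eq_or_lt with rfl | hj
    · have hfp : G.comp (show n + (1 - 0) = n + 1 by omega) f p = 0 := by
        by_cases hn : n + 1 = 0
        · obtain ⟨c, hc⟩ := (D.lineE l hl).exists_smul (D.lineE l hl).id_ne_zero
            (G.comp (show n + (1 - 0) = 0 by omega) f p)
          have h2 : G.comp (zero_add 0) (G.comp (show n + (1 - 0) = 0 by omega) f p) v = 0 := by
            rw [G.assoc _ (show 1 - 0 + 0 = (1 : ℤ) by omega) _ (by omega), ht.exact₁.comp_eq,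
              map_zero]
          rw [← hc, LinearMap.map_smul₂, G.id_comp] at h2
          have h3 : G.comp (show n + (1 - 0) = 0 by omega) f p = 0 := by
            rw [← hc, (smul_eq_zero.1 h2).resolve_right hv, zero_smul]
          obtain rfl : n = -1 := by omega
          exact h3
        · exact (D.lineE l hl).2 _ hn _
      obtain ⟨g, rfl⟩ := ht.exact₃.lift _ (add_zero n) f hfp
      by_cases hn : n = 0
      · subst hn
        obtain ⟨c, rfl⟩ := (D.line l hl).exists_smul hv g
        rw [LinearMap.map_smul₂, ht.exact₂.comp_eq, smul_zero]
      · rw [(D.line l hl).2 n hn g, LinearMap.map_zero₂]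
    · obtain ⟨g, rfl⟩ := ht.exact₃.lift rfl (add_zero n) f (D.zeroE l j hj hjN _ _)
      rw [D.zero j l hjN hl (by omega) _ g, LinearMap.map_zero₂]
  have hKQ : G.Zero K Q := by
    rcases Nat.eq_zero_or_pos l with rfl | hl0
    · have : G.Zero K K := Zero.gen_left (fun X hX => by
        obtain ⟨j, -, hj, rfl⟩ := mem_seg.1 hX
        exact hjK j (Nat.zero_le _) (by omega)) hK
      exact zero_of_id (this 0 _) _
    have hK' : G.Gen (· ∈ G.seg E 0 l) K := by
      refine mem_of_zero_left (D.seg_closed hl0) (l₁ := G.seg E 0 l) (l₂ := G.seg E l (N + 1))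
        ?_ ?_ (fun X hX => .of hX) (fun _ h => h) ?_ fun Y hY => ?_
      · rw [happ]
        exact D.excE le_rfl
      · rw [happ]
        exact fun X _ => D.finE le_rfl X
      · rwa [happ]
      · obtain ⟨j, hj, hj', rfl⟩ := mem_seg.1 hY
        exact hjK j hj (by omega)
    exact Zero.gen_left (fun X hX => by
      obtain ⟨j, -, hj, rfl⟩ := mem_seg.1 hX
      exact h0 j (by omega) (by omega)) hK'
  obtain ⟨y, hy⟩ := ht.exact₁.desc rfl (zero_add e) x (hKQ _ _)
  -- the factorization `y` of `x` through `v` is an isomorphism, as it is on morphisms from all `E_j`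
  have hrep : ∀ X, G.Gen (· ∈ G.seg E 0 (N + 1)) X → ∀ {a b : ℤ} (hb : a + e = b),
      Function.Bijective fun g : G.H a X (F l) => G.comp hb g y := by
    obtain ⟨C, -, i', p', ht'⟩ := D.closed.exists_cone y trivial trivial
    have hEC : ∀ j ≤ N, G.Zero (E j) C := by
      intro j hj n f
      by_cases hjl : j = l
      · subst hjl
        have hfp : G.comp (show n + (1 - e) = n + (1 - e) from rfl) f p' = 0 := by
          by_cases hn : n + (1 - e) = 0
          · obtain ⟨c, hc⟩ := (D.line j hl).exists_smul hv (G.comp hn f p')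
            have h2 : G.comp (zero_add e) (G.comp hn f p') y = 0 := by
              rw [G.assoc _ rfl _ (by omega), ht'.exact₁.comp_eq, map_zero]
            rw [← hc, LinearMap.map_smul₂, hy] at h2
            have h3 : G.comp hn f p' = 0 := by
              rw [← hc, (smul_eq_zero.1 h2).resolve_right hx, zero_smul]
            obtain rfl : n = e - 1 := by omega
            have : ∀ (s : ℤ) (hs : e - 1 + (1 - e) = s), G.comp hs f p' = 0 := by
              rintro s hs
              obtain rfl : s = 0 := by omega
              exact h3
            exact this _ _
          · exact (D.line j hl).2 _ hn _
        obtain ⟨g, rfl⟩ := ht'.exact₃.lift _ (add_zero n) f hfp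
        by_cases hn : n = e
        · subst hn
          obtain ⟨c, rfl⟩ := h1.exists_smul hx g
          rw [← hy, LinearMap.map_smul₂, G.assoc (zero_add n) (add_zero n) _ (zero_add n),
            ht'.exact₂.comp_eq, map_zero, smul_zero]
        · rw [h1.2 n hn g, LinearMap.map_zero₂]
      · obtain ⟨g, rfl⟩ := ht'.exact₃.lift rfl (add_zero n) f (D.zero j l hj hl hjl _ _)
        rw [h0 j hj hjl _ g, LinearMap.map_zero₂]
    intro X hX a b hb
    have hXC : G.Zero X C := Zero.gen_left (fun Y hY => by
      obtain ⟨j, -, hj, rfl⟩ := mem_seg.1 hY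
      exact hEC j (by omega)) hX
    refine ⟨(injective_iff_map_eq_zero' ((G.comp hb).flip y)).2 fun z => ⟨fun hz => ?_,
      fun hz => by rw [hz, map_zero]⟩, fun z => ?_⟩
    · obtain ⟨g, rfl⟩ := ht'.exact₁.lift hb (show a - (1 - e) + (1 - e) = a by omega) z hz
      rw [hXC _ g, LinearMap.map_zero₂]
    · exact ht'.exact₂.lift (add_zero b) hb z (hXC _ _)
  refine Shift.of_bijective (add_neg_cancel e) y fun W hW a b hb => hrep W ?_ hb
  rcases hW with rfl | rfl
  · exact D.memF l hl
  · exact hQ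

/-- A reflection of `F_0, …, F_{-N}` in the subcategory `⟨E_0, …, E_{m-1}⟩`. -/
theorem bijective_reflection {m : ℕ} (hm : 0 < m) (hmN : m ≤ N) {d : ℤ}
    (hS : ∀ i, i + m ≤ N → G.SerrePair (G.Gen (· ∈ G.seg E 0 (N + 1))) d (E i) (E (i + m)))
    {i j : ℕ} (hji : j < i) (hi : i ≤ N) {L : G.Obj} (hL : G.Gen (· ∈ G.seg E 0 m) L)
    (η : G.H 0 (F j) L)
    (hη : ∀ Z, G.Gen (· ∈ G.seg E 0 m) Z → ∀ {a b : ℤ} (hb : 0 + a = b),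
      Function.Bijective fun f : G.H a L Z => G.comp hb η f)
    {a b : ℤ} (hb : a + 0 = b) : Function.Bijective fun f : G.H a (F i) (F j) => G.comp hb f η := by
  -- the cone of the unit has no morphisms to the subcategory, so it belongs to `⟨E_m, …, E_j⟩`
  obtain ⟨A, -, c, p, ht⟩ := D.closed.exists_cone η trivial trivial
  have hq : max (j + 1) m ≤ N + 1 := by omega
  have hA : G.Gen (· ∈ G.seg E 0 (max (j + 1) m)) A :=
    .tri (D.memF_seg (by omega) hq) (gen_mono le_rfl (le_max_right _ _) hL) ht
  have hA' : G.Gen (· ∈ G.seg E m (max (j + 1) m)) A := by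
    refine D.mem_seg_of_zero (le_max_right _ _) hq hA fun l hl n f => ?_
    have hEl : G.Gen (· ∈ G.seg E 0 m) (E l) := .of (mem_seg.2 ⟨l, Nat.zero_le _, hl, rfl⟩)
    have h1 : G.comp (zero_add n) c f = 0 := by
      apply (hη _ hEl (zero_add n)).1
      dsimp only
      rw [map_zero, ← G.assoc (zero_add 0) (zero_add n) (zero_add n), ht.exact₂.comp_eq,
        LinearMap.map_zero₂]
    obtain ⟨g, rfl⟩ := ht.exact₃.desc _ (show 1 - 0 + (n - 1) = n by omega) f h1
    obtain ⟨g', rfl⟩ := (hη _ hEl (show 0 + (n - 1) = n - 1 by omega)).2 g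
    dsimp only
    rw [← G.assoc (show 1 - 0 + 0 = (1 : ℤ) by omega) _ (by omega), ht.exact₁.comp_eq,
      LinearMap.map_zero₂]
  have hFA : G.Zero (F i) A := Zero.gen_right (fun Y hY => by
    obtain ⟨l, hl, hl', rfl⟩ := mem_seg.1 hY
    have h2 := hS (l - m) (by omega)
    rw [Nat.sub_add_cancel hl] at h2
    exact h2.zero_right (D.memF i hi) (D.zero _ _ (by omega) hi (by omega))) hA'
  refine ⟨(injective_iff_map_eq_zero' ((G.comp hb).flip η)).2 fun z => ⟨fun hz => ?_,
    fun hz => by rw [hz, map_zero]⟩, fun z => ?_⟩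
  · obtain ⟨g, rfl⟩ := ht.exact₁.lift hb (show a - 1 + (1 - 0) = a by omega) z hz
    rw [hFA _ g, LinearMap.map_zero₂]
  · exact ht.exact₂.lift (add_zero b) hb z (hFA _ _)

/-- If `S(E_i) = E_{i+m}[d]` for the Serre functor of `⟨E_0, …, E_N⟩`, then
`S(λ(F_{-i})) = λ(F_{-i-m})[d-1]` for the reflection `λ` in `⟨E_0, …, E_{m-1}⟩` and the Serre
functor of this subcategory. -/
theorem serrePair_reflection {m : ℕ} (hm : 0 < m) {d : ℤ}
    (hS : ∀ i, i + m ≤ N → G.SerrePair (G.Gen (· ∈ G.seg E 0 (N + 1))) d (E i) (E (i + m)))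
    {i : ℕ} (hi : i + m ≤ N) {L L' : G.Obj}
    (hL' : G.Gen (· ∈ G.seg E 0 m) L') (η : G.H 0 (F i) L) (η' : G.H 0 (F (i + m)) L')
    (hη : ∀ Z, G.Gen (· ∈ G.seg E 0 m) Z → ∀ {a b : ℤ} (hb : 0 + a = b),
      Function.Bijective fun f : G.H a L Z => G.comp hb η f)
    (hη' : ∀ Z, G.Gen (· ∈ G.seg E 0 m) Z → ∀ {a b : ℤ} (hb : 0 + a = b),
      Function.Bijective fun f : G.H a L' Z => G.comp hb η' f) :
    ∃ R, G.Gen (· ∈ G.seg E 0 m) R ∧ G.SerrePair (G.Gen (· ∈ G.seg E 0 m)) 0 L R ∧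
      G.Shift (d - 1) L' R := by
  have hCT : ∀ X, G.Gen (· ∈ G.seg E 0 m) X → G.Gen (· ∈ G.seg E 0 (N + 1)) X :=
    fun X hX => gen_mono le_rfl (by omega) hX
  have hET : ∀ j ≤ N, G.Gen (· ∈ G.seg E 0 (N + 1)) (E j) := fun j hj =>
    .of (mem_seg.2 ⟨j, Nat.zero_le _, by omega, rfl⟩)
  have hEC : ∀ j < m, G.Gen (· ∈ G.seg E 0 m) (E j) := fun j hj =>
    .of (mem_seg.2 ⟨j, Nat.zero_le _, by omega, rfl⟩)
  obtain ⟨Y, hY, hFY⟩ := exists_serrePair_right (D.seg_closed (Nat.succ_pos N)) (D.excE le_rfl)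
    (fun X _ => D.finE le_rfl X) (fun X hX => .of hX) (fun _ h => h) (F i) (D.finE le_rfl _)
  obtain ⟨R, hR, hLR⟩ := exists_serrePair_right (D.seg_closed hm) (D.excE (by omega))
    (fun X _ => D.finE (by omega) X) (fun X hX => .of hX) (fun _ h => h) L (D.finE (by omega) _)
  refine ⟨R, hR, hLR, ?_⟩
  obtain ⟨r, hr⟩ := hFY.exists_map hCT hLR hR (s := 0) rfl η hη
  obtain ⟨Q, -, c, p, ht⟩ := D.closed.exists_cone r trivial trivial
  have hQ : G.Gen (· ∈ G.seg E 0 (N + 1)) Q := .tri (hCT _ hR) hY ht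
  -- no morphisms from `Y` to the subcategory
  have hYE : ∀ j < m, G.Zero Y (E j) := by
    intro j hj
    obtain ⟨V, hV, hVE⟩ := exists_serrePair_left (D.seg_closed (Nat.succ_pos N)) (D.excE le_rfl)
      (fun X _ => D.finE le_rfl X) (fun X hX => .of hX) (fun _ h => h) (E j)
      (fun X _ => D.fin X j (by omega))
    have h1 : ∀ l, l + m ≤ N → G.Zero (E l) V := fun l hl =>
      (hS l hl).zero_left hV (hVE.zero_left (hET _ hl) (D.zeroE _ _ (by omega) hl))
    have h2 : G.Zero (F i) V := Zero.gen_left (fun X hX => by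
      obtain ⟨l, -, hl, rfl⟩ := mem_seg.1 hX
      exact h1 l (by omega)) (D.memF_seg (Nat.lt_succ_self i) (by omega))
    exact hVE.zero_right hY (hFY.zero_right hV h2)
  have hYC : ∀ Z, G.Gen (· ∈ G.seg E 0 m) Z → G.Zero Y Z := fun Z hZ =>
    Zero.gen_right (fun X hX => by
      obtain ⟨j, -, hj, rfl⟩ := mem_seg.1 hX
      exact hYE j hj) hZ
  have hEj : ∀ j, m ≤ j → j ≤ N → G.SerrePair (G.Gen (· ∈ G.seg E 0 (N + 1))) d (E (j - m))
      (E j) := by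
    intro j hj hjN
    have := hS (j - m) (by omega)
    rwa [Nat.sub_add_cancel hj] at this
  have hER : ∀ j, m ≤ j → j ≤ N → G.Zero (E j) R := fun j hj hjN =>
    Zero.gen_right (fun X hX => by
      obtain ⟨l, -, hl, rfl⟩ := mem_seg.1 hX
      exact D.zeroE l j (by omega) hjN) hR
  -- the only `E_j` with morphisms to `Q` is `E_{i+m}`, so that `Q` is a shift of `F_{-i-m}`
  have hQ0 : ∀ j ≤ N, j ≠ i + m → G.Zero (E j) Q := by
    intro j hj hji n f
    by_cases hjm : j < m
    · have h1 : G.comp (show n + (1 - 0) = n + 1 by omega) f p = 0 := by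
        apply (hr _ (hEC j hjm) (add_zero _)).1
        dsimp only
        rw [G.assoc _ (show 1 - 0 + 0 = (1 : ℤ) by omega) _ (by omega), ht.exact₁.comp_eq,
          map_zero, LinearMap.map_zero₂]
      obtain ⟨g, rfl⟩ := ht.exact₃.lift _ (add_zero n) f h1
      obtain ⟨g', rfl⟩ := (hr _ (hEC j hjm) (add_zero _)).2 g
      dsimp only
      rw [G.assoc (add_zero n) (add_zero 0) _ (add_zero n), ht.exact₂.comp_eq, map_zero]
    · obtain ⟨g, rfl⟩ := ht.exact₃.lift rfl (add_zero n) f (hER j (by omega) hj _ _)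
      have h2 : G.Zero (E j) Y := hFY.zero_right (hET j hj) ((hEj j (by omega) hj).zero_right
        (D.memF i (by omega)) (D.zero _ _ (by omega) (by omega) (by omega)))
      rw [h2 _ g, LinearMap.map_zero₂]
  have hEY : G.Line (-d) (E (i + m)) Y :=
    hFY.line_right (hET _ hi) (show d + -d = 0 by omega)
      ((hS i hi).line_right (D.memF i (by omega)) (zero_add d) (D.line i (by omega)))
  have hQ1 : G.Line (-d) (E (i + m)) Q := by
    have hb : ∀ n : ℤ, Function.Bijective ((G.comp (add_zero n) (X := E (i + m))).flip c) := by
      intro n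
      refine ⟨(injective_iff_map_eq_zero' ((G.comp _).flip c)).2 fun z => ⟨fun hz => ?_,
        fun hz => by rw [hz, map_zero]⟩, fun z => ?_⟩
      · obtain ⟨g, rfl⟩ := ht.exact₂.lift _ (add_zero n) z hz
        rw [hER _ (by omega) hi _ g, LinearMap.map_zero₂]
      · exact ht.exact₃.lift rfl (add_zero n) z (hER _ (by omega) hi _ _)
    refine ⟨(LinearEquiv.ofBijective _ (hb (-d))).finrank_eq.symm.trans hEY.1, fun n hn f => ?_⟩
    obtain ⟨g, rfl⟩ := (hb n).2 f
    rw [hEY.2 n hn g, map_zero]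
  have hFQ := D.shift_of_line hi hQ hQ0 hQ1
  rw [neg_neg] at hFQ
  obtain ⟨f, g, h₁, h₂⟩ := hFQ
  -- `p` is universal among morphisms from `Q` to the subcategory
  have hp : ∀ Z, G.Gen (· ∈ G.seg E 0 m) Z → ∀ {a b : ℤ} (hb : 1 - 0 + a = b),
      Function.Bijective fun x : G.H a R Z => G.comp hb p x := by
    intro Z hZ a b hb
    refine ⟨(injective_iff_map_eq_zero' (G.comp hb p)).2 fun z => ⟨fun hz => ?_,
      fun hz => by rw [hz, map_zero]⟩, fun z => ?_⟩
    · obtain ⟨g, rfl⟩ := ht.exact₁.desc hb (zero_add a) z hz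
      rw [hYC Z hZ _ g, map_zero]
    · exact ht.exact₃.desc (zero_add b) hb z (hYC Z hZ _ _)
  have hf : ∀ Z, G.Gen (· ∈ G.seg E 0 m) Z → ∀ {a b : ℤ} (hb : 1 - d + a = b),
      Function.Bijective fun x : G.H a R Z =>
        G.comp hb (G.comp (show -d + (1 - 0) = 1 - d by omega) f p) x := by
    intro Z hZ a b hb
    have h3 : Function.Bijective fun x : G.H (1 + a) Q Z =>
        G.comp (show -d + (1 + a) = b by omega) f x := by
      constructor
      · intro x x' hx
        have := congrArg (G.comp (show d + b = 1 + a by omega) g) hx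
        dsimp only at this
        rwa [← G.assoc (add_neg_cancel d) _ (zero_add _), h₂, G.id_comp,
          ← G.assoc (add_neg_cancel d) _ (zero_add _), h₂, G.id_comp] at this
      · intro x
        refine ⟨G.comp (show d + b = 1 + a by omega) g x, ?_⟩
        dsimp only
        rw [← G.assoc (neg_add_cancel d) _ (zero_add b), h₁, G.id_comp]
    convert h3.comp (hp Z hZ (show 1 - 0 + a = 1 + a by omega)) using 1
    funext x
    exact G.assoc _ _ _ _ _ _ _
  -- `F_{-i-m} → Q → R` is therefore another reflection of `F_{-i-m}`, up to shift
  obtain ⟨ζ, hζ⟩ := (hη' R hR (show 0 + (1 - d) = 1 - d by omega)).2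
    (G.comp (show -d + (1 - 0) = 1 - d by omega) f p)
  dsimp only at hζ
  refine Shift.of_bijective' (n := 1 - d) (by omega) ζ fun W hW a b hb => ?_
  have hW' : G.Gen (· ∈ G.seg E 0 m) W := by rcases hW with rfl | rfl <;> assumption
  have h4 := hf W hW' hb
  rw [← Function.Bijective.of_comp_iff' (hη' W hW' (zero_add b))]
  convert h4 using 1
  funext x
  rw [← hζ]
  exact (G.assoc _ _ _ _ _ _ _).symm

end DualPair

end GrCat

/-! ### The cohomology of an A-infinity category as a graded category -/

namespace AInfCat

variable (A : AInfCat.{w, v, u} k)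

/-- The operation `(a, b, c, e) ↦ μ⁴(e, c, b, a)`. -/
def m4 {V W X Y Z : A.Obj} (a : A.Tot V W) (b : A.Tot W X) (c : A.Tot X Y) (e : A.Tot Y Z) :
    A.Tot V Z :=
  A.μ.ev ((((Quiver.Path.nil.cons a).cons b).cons c).cons e)

set_option linter.unusedSimpArgs false in
/-- The `A∞`-relation on words of length four. It enters the exactness of the triangle of a mapping
cone, whose comparison with the formal cone involves `μ³`. -/
theorem d_m4 {V W X Y Z : A.Obj} (a : A.Tot V W) (b : A.Tot W X) (c : A.Tot X Y)
    (e : A.Tot Y Z) :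
    A.d V Z (A.m4 a b c e) + A.m4 (A.d V W a) b c e + A.m4 (A.sgn V W a) (A.d W X b) c e +
      A.m4 (A.sgn V W a) (A.sgn W X b) (A.d X Y c) e +
      A.m4 (A.sgn V W a) (A.sgn W X b) (A.sgn X Y c) (A.d Y Z e) +
      A.m3 (A.m2 V W X a b) c e + A.m3 (A.sgn V W a) (A.m2 W X Y b c) e +
      A.m3 (A.sgn V W a) (A.sgn W X b) (A.m2 X Y Z c e) +
      A.m2 V Y Z (A.m3 a b c) e + A.m2 V W Z (A.sgn V W a) (A.m3 b c e) = 0 := by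
  have hz : ∀ {X₁ X₂ X₃ : A.Obj} (p : Quiver.Path X₁ X₂) (b₁ : X₃ ⟶ W) (b₂ : W ⟶ X) (b₃ : X ⟶ Y)
      (b₄ : Y ⟶ Z), A.μ.ev (((((p.cons (0 : A.Tot X₂ X₃)).cons b₁).cons b₂).cons b₃).cons b₄) = 0 :=
    fun p b₁ b₂ b₃ b₄ => A.μ.ev_zero p
      ((((Quiver.Path.nil.cons b₁).cons b₂).cons b₃).cons b₄)
  have h := A.rel ((((Quiver.Path.nil.cons a).cons b).cons c).cons e : Quiver.Path V Z)
  simp only [insertSum, Quiver.Path.splits, List.map_cons, List.map_nil, List.map_append,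
    List.flatMap_cons, List.flatMap_nil, List.nil_append, List.append_nil, List.cons_append,
    List.sum_cons, List.sum_nil, Quiver.Hom.toPath, Quiver.Path.comp_nil, Quiver.Path.comp_cons,
    GQuiver.sgnWord, A.μ.ev_nil, MultiOp.ev_cons_zero, MultiOp.ev_cons_zero_cons,
    MultiOp.ev_cons_zero_cons_cons, MultiOp.ev_cons_zero_cons_cons_cons, hz, add_zero,
    zero_add] at h
  have h' : A.m4 (A.d V W a) b c e + (A.m3 (A.m2 V W X a b) c e + (A.m2 V Y Z (A.m3 a b c) e +
      (A.d V Z (A.m4 a b c e) + (A.m4 (A.sgn V W a) (A.d W X b) c e +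
      (A.m3 (A.sgn V W a) (A.m2 W X Y b c) e + (A.m2 V W Z (A.sgn V W a) (A.m3 b c e) +
      (A.m4 (A.sgn V W a) (A.sgn W X b) (A.d X Y c) e +
      (A.m3 (A.sgn V W a) (A.sgn W X b) (A.m2 X Y Z c e) +
      A.m4 (A.sgn V W a) (A.sgn W X b) (A.sgn X Y c) (A.d Y Z e))))))))) = 0 := h
  rw [← h']
  abel

/-- The component of degree `n` of a morphism. -/
noncomputable def homog (n : ℤ) (X Y : A.Obj) : A.Tot X Y →ₗ[k] A.Tot X Y :=
  DirectSum.lof k ℤ (A.Hom X Y) n ∘ₗ DirectSum.component k ℤ (A.Hom X Y) n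

variable {A}

theorem homog_mem (n : ℤ) {X Y : A.Obj} (a : A.Tot X Y) : A.homog n X Y a ∈ A.gr X Y n :=
  ⟨_, rfl⟩

theorem homog_of_mem {n : ℤ} {X Y : A.Obj} {a : A.Tot X Y} (ha : a ∈ A.gr X Y n) :
    A.homog n X Y a = a := by
  obtain ⟨x, rfl⟩ := ha
  rw [homog, LinearMap.comp_apply, DirectSum.component.lof_self]

theorem homog_of_mem_ne {n m : ℤ} {X Y : A.Obj} {a : A.Tot X Y} (ha : a ∈ A.gr X Y n)
    (h : n ≠ m) : A.homog m X Y a = 0 := by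
  obtain ⟨x, rfl⟩ := ha
  rw [homog, LinearMap.comp_apply, DirectSum.component.of, dif_neg h, map_zero]

/-- A linear map of degree `e` commutes with the projections to homogeneous components. -/
theorem map_homog {X Y : A.Obj} {B : AInfCat.{w, v', u'} k} {X' Y' : B.Obj} {e : ℤ}
    (f : A.Tot X Y →ₗ[k] B.Tot X' Y')
    (hf : ∀ {n : ℤ} {a : A.Tot X Y}, a ∈ A.gr X Y n → f a ∈ B.gr X' Y' (n + e)) (n : ℤ)
    (a : A.Tot X Y) : f (A.homog n X Y a) = B.homog (n + e) X' Y' (f a) := by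
  induction a using DirectSum.induction_on with
  | zero => simp only [map_zero]
  | of m x =>
    have hx : DirectSum.of (A.Hom X Y) m x ∈ A.gr X Y m := ⟨x, rfl⟩
    by_cases h : m = n
    · subst h
      rw [homog_of_mem hx, homog_of_mem (hf hx)]
    · rw [homog_of_mem_ne hx h, homog_of_mem_ne (hf hx) (by omega), map_zero]
  | add a b ha hb => simp only [map_add, ha, hb]

/-- If a homogeneous morphism is exact, it is the differential of a homogeneous morphism. -/
theorem exists_mem_of_exact {n : ℤ} {X Y : A.Obj} {x y : A.Tot X Y} (hx : x ∈ A.gr X Y n)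
    (h : A.d X Y y = x) : ∃ y ∈ A.gr X Y (n - 1), A.d X Y y = x := by
  refine ⟨A.homog (n - 1) X Y y, homog_mem _ _, ?_⟩
  rw [map_homog (A.d X Y) (e := 1) (fun ha => A.d_mem ha), sub_add_cancel, h, homog_of_mem hx]

theorem mk_eq_zero_iff {n : ℤ} {X Y : A.Obj} (x : A.Z n X Y) :
    (Submodule.Quotient.mk x : A.H n X Y) = 0 ↔ ∃ w, A.d X Y w = x.1 := by
  rw [Submodule.Quotient.mk_eq_zero, Submodule.submoduleOf, Submodule.mem_comap]
  constructor
  · rintro ⟨w, -, hw⟩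
    exact ⟨w, hw⟩
  · rintro ⟨w, hw⟩
    obtain ⟨y, hy, hyx⟩ := exists_mem_of_exact x.2.1 hw
    exact ⟨y, hy, hyx⟩

theorem mk_eq_iff {n : ℤ} {X Y : A.Obj} (x y : A.Z n X Y) :
    (Submodule.Quotient.mk x : A.H n X Y) = Submodule.Quotient.mk y ↔
      ∃ w, A.d X Y w = x.1 - y.1 := by
  rw [← sub_eq_zero, ← Submodule.Quotient.mk_sub, mk_eq_zero_iff]
  rfl

theorem negOnePow_smul_cancel {M : Type*} [AddCommGroup M] (n : ℤ) (x : M) :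
    ((n.negOnePow : ℤˣ) : ℤ) • ((n.negOnePow : ℤˣ) : ℤ) • x = x := by
  rw [smul_smul, ← Units.val_mul, Int.units_mul_self, Units.val_one, one_smul]

theorem comp_mk_eq_zero_iff {n m l : ℤ} (h : n + m = l) {X Y Z : A.Obj} (a : A.Z n X Y)
    (b : A.Z m Y Z) :
    A.comp h (Submodule.Quotient.mk a) (Submodule.Quotient.mk b) = 0 ↔
      ∃ w, A.d X Z w = A.m2 X Y Z a.1 b.1 := by
  rw [comp_mk, mk_eq_zero_iff]
  change (∃ w, A.d X Z w = ((n.negOnePow : ℤˣ) : ℤ) • A.m2 X Y Z a.1 b.1) ↔ _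
  constructor
  · rintro ⟨w, hw⟩
    exact ⟨((n.negOnePow : ℤˣ) : ℤ) • w, by rw [map_zsmul, hw, negOnePow_smul_cancel]⟩
  · rintro ⟨w, hw⟩
    exact ⟨((n.negOnePow : ℤˣ) : ℤ) • w, by rw [map_zsmul, hw]⟩

theorem comp_mk_eq_iff {n m l : ℤ} (h : n + m = l) {X Y Z : A.Obj} (a : A.Z n X Y)
    (b : A.Z m Y Z) (c : A.Z l X Z) :
    A.comp h (Submodule.Quotient.mk a) (Submodule.Quotient.mk b) = Submodule.Quotient.mk c ↔
      ∃ w, A.d X Z w = A.m2 X Y Z a.1 b.1 - ((n.negOnePow : ℤˣ) : ℤ) • c.1 := by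
  rw [comp_mk, mk_eq_iff]
  change (∃ w, A.d X Z w = ((n.negOnePow : ℤˣ) : ℤ) • A.m2 X Y Z a.1 b.1 - c.1) ↔ _
  constructor
  · rintro ⟨w, hw⟩
    exact ⟨((n.negOnePow : ℤˣ) : ℤ) • w, by
      rw [map_zsmul, hw, smul_sub, negOnePow_smul_cancel]⟩
  · rintro ⟨w, hw⟩
    exact ⟨((n.negOnePow : ℤˣ) : ℤ) • w, by
      rw [map_zsmul, hw, smul_sub, negOnePow_smul_cancel]⟩

section Unital

variable [A.Unital]

variable (A) in
/-- The cohomology of a cohomologically unital `A∞`-category, as a graded category. -/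
noncomputable def coh : GrCat.{w, v, u} k where
  Obj := A.Obj
  H := fun n X Y => A.H n X Y
  comp := fun h _ _ _ => A.comp h
  assoc := fun h₁ h₂ h₃ h₄ _ _ _ _ f g h => A.comp_assoc h₁ h₂ h₃ h₄ f g h
  id := A.id
  id_comp := fun _ _ _ f => A.id_comp f
  comp_id := fun _ _ _ f => A.comp_id f

/-- A closed representative of the identity. -/
theorem exists_unit (X : A.Obj) : ∃ e : A.Z 0 X X, Submodule.Quotient.mk e = A.id X :=
  Submodule.Quotient.mk_surjective _ _

theorem m2_unit_left {X Y : A.Obj} {e : A.Z 0 X X} (he : Submodule.Quotient.mk e = A.id X)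
    {n : ℤ} (f : A.Z n X Y) : ∃ w, A.d X Y w = A.m2 X X Y e.1 f.1 - f.1 := by
  have h := A.id_comp (Submodule.Quotient.mk f : A.H n X Y)
  rw [← he, comp_mk_eq_iff] at h
  simpa using h

theorem m2_unit_right {X Y : A.Obj} {e : A.Z 0 Y Y} (he : Submodule.Quotient.mk e = A.id Y)
    {n : ℤ} (f : A.Z n X Y) :
    ∃ w, A.d X Y w = A.m2 X Y Y f.1 e.1 - ((n.negOnePow : ℤˣ) : ℤ) • f.1 := by
  have h := A.comp_id (Submodule.Quotient.mk f : A.H n X Y)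
  rwa [← he, comp_mk_eq_iff] at h

end Unital

end AInfCat

namespace GrCat

variable {G : GrCat.{w, v, u} k}

variable (G) in
/-- Triangles which are exact for all functors `Hom(W, -)`, and at `Y` for all functors
`Hom(-, W)`. -/
structure HalfTri {X Y C : G.Obj} (c : G.H 0 X Y) (i : G.H 0 Y C) (p : G.H 1 C X) : Prop where
  comp₁ : ∀ {l : ℤ} (h : 1 + 0 = l), G.comp h p c = 0
  comp₂ : ∀ {l : ℤ} (h : 0 + 0 = l), G.comp h c i = 0
  comp₃ : ∀ {l : ℤ} (h : 0 + 1 = l), G.comp h i p = 0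
  lift₁ : ∀ {W : G.Obj} {n n' l : ℤ} (h₁ : n + 0 = l) (h₂ : n' + 1 = n) (y : G.H n W X),
    G.comp h₁ y c = 0 → ∃ x : G.H n' W C, G.comp h₂ x p = y
  lift₂ : ∀ {W : G.Obj} {n n' l : ℤ} (h₁ : n + 0 = l) (h₂ : n' + 0 = n) (y : G.H n W Y),
    G.comp h₁ y i = 0 → ∃ x : G.H n' W X, G.comp h₂ x c = y
  lift₃ : ∀ {W : G.Obj} {n n' l : ℤ} (h₁ : n + 1 = l) (h₂ : n' + 0 = n) (y : G.H n W C),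
    G.comp h₁ y p = 0 → ∃ x : G.H n' W Y, G.comp h₂ x i = y
  desc₂ : ∀ {W : G.Obj} {n n' l : ℤ} (h₁ : 0 + n = l) (h₂ : 0 + n' = n) (y : G.H n Y W),
    G.comp h₁ c y = 0 → ∃ z : G.H n' C W, G.comp h₂ i z = y

/-- If a class of half-exact triangles is stable under rotation, in the weak sense that the cone
`C'` of `Y → C` maps to `X` compatibly with the other morphisms, then its members are exact:
this comparison map is an isomorphism by the five lemma for `Hom(W, -)`, and exactness of
`Hom(-, W)` at the remaining places follows by rotation. -/
theorem HalfTri.isTri {K : ∀ {X Y C : G.Obj}, G.H 0 X Y → G.H 0 Y C → G.H 1 C X → Prop}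
    (hK : ∀ {X Y C : G.Obj} {c : G.H 0 X Y} {i : G.H 0 Y C} {p : G.H 1 C X}, K c i p →
      G.HalfTri c i p)
    (hrot : ∀ {X Y C : G.Obj} {c : G.H 0 X Y} {i : G.H 0 Y C} {p : G.H 1 C X}, K c i p →
      ∃ (C' : G.Obj) (i' : G.H 0 C C') (p' : G.H 1 C' Y) (q : G.H 1 C' X), K i i' p' ∧
        G.comp (zero_add 1) i' q = p ∧ G.comp (add_zero 1) q c = -p')
    {X Y C : G.Obj} {c : G.H 0 X Y} {i : G.H 0 Y C} {p : G.H 1 C X} (h : K c i p) :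
    G.IsTri c i p := by
  have key : ∀ {X Y C : G.Obj} {c : G.H 0 X Y} {i : G.H 0 Y C} {p : G.H 1 C X}, K c i p →
      ∃ (C' : G.Obj) (i' : G.H 0 C C') (p' : G.H 1 C' Y) (q : G.H 1 C' X) (r : G.H (-1) X C'),
        K i i' p' ∧ G.comp (zero_add 1) i' q = p ∧ G.comp (add_zero 1) q c = -p' ∧
        G.comp (add_neg_cancel 1) q r = G.id C' ∧ G.comp (neg_add_cancel 1) r q = G.id X := by
    intro X Y C c i p h
    obtain ⟨C', i', p', q, hK', h₁, h₂⟩ := hrot h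
    have hq : ∀ W, W = C' ∨ W = X → ∀ {a b : ℤ} (hb : a + 1 = b),
        Function.Bijective fun g : G.H a W C' => G.comp hb g q := by
      intro W _ a b hb
      refine ⟨(injective_iff_map_eq_zero' ((G.comp hb).flip q)).2 fun z => ⟨fun hz => ?_,
        fun hz => by rw [hz, map_zero]⟩, fun x => ?_⟩
      · change G.comp hb z q = 0 at hz
        have hzp : G.comp hb z p' = 0 := by
          rw [← neg_neg p', ← h₂, map_neg, ← G.assoc hb (add_zero 1) (add_zero b) hb, hz,
            LinearMap.map_zero₂, neg_zero]
        obtain ⟨x, rfl⟩ := (hK hK').lift₃ hb (add_zero a) z hzp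
        rw [G.assoc _ (zero_add 1) _ hb, h₁] at hz
        obtain ⟨y, rfl⟩ := (hK h).lift₃ hb (add_zero a) x hz
        rw [G.assoc _ (add_zero 0) _ (add_zero a), (hK hK').comp₂, map_zero]
      · have h3 : G.comp (add_zero b) (G.comp (add_zero b) x c) i = 0 := by
          rw [G.assoc _ (add_zero 0) _ (add_zero b), (hK h).comp₂, map_zero]
        obtain ⟨z, hz⟩ := (hK hK').lift₁ _ hb _ h3
        have h4 : G.comp (add_zero b) (x + G.comp hb z q) c = 0 := by
          rw [map_add, LinearMap.add_apply, G.assoc hb (add_zero 1) _ hb, h₂, map_neg, hz,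
            add_neg_cancel]
        obtain ⟨y, hy⟩ := (hK h).lift₁ _ hb _ h4
        refine ⟨G.comp (add_zero a) y i' - z, ?_⟩
        dsimp only
        rw [map_sub, LinearMap.sub_apply, G.assoc _ (zero_add 1) _ hb, h₁, hy]
        abel
    obtain ⟨r, hr⟩ := (hq X (.inr rfl) (neg_add_cancel 1)).2 (G.id X)
    refine ⟨C', i', p', q, r, hK', h₁, h₂, ?_, hr⟩
    apply (hq C' (.inl rfl) (zero_add 1)).1
    dsimp only at hr ⊢
    rw [G.assoc _ (neg_add_cancel 1) _ (add_zero 1), hr, G.comp_id, G.id_comp]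
  have hdesc₃ : ∀ {X Y C : G.Obj} {c : G.H 0 X Y} {i : G.H 0 Y C} {p : G.H 1 C X}, K c i p →
      ∀ {W : G.Obj} {n n' l : ℤ} (h₁ : 0 + n = l) (h₂ : 1 + n' = n) (y : G.H n C W),
        G.comp h₁ i y = 0 → ∃ z : G.H n' X W, G.comp h₂ p z = y := by
    intro X Y C c i p h W n n' l e₁ e₂ y hy
    obtain ⟨C', i', p', q, r, hK', h₁, h₂, h₃, h₄⟩ := key h
    obtain ⟨z, rfl⟩ := (hK hK').desc₂ e₁ (zero_add n) y hy
    refine ⟨G.comp (show -1 + n = n' by omega) r z, ?_⟩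
    rw [← h₁, G.assoc _ (show 1 + n' = n by omega) _ (zero_add n), ← G.assoc (add_neg_cancel 1) _
      (zero_add n), h₃, G.id_comp]
  refine ⟨⟨(hK h).comp₁, (hK h).lift₁, fun {W n n' l} e₁ e₂ y hy => ?_⟩,
    ⟨(hK h).comp₂, (hK h).lift₂, (hK h).desc₂⟩, ⟨(hK h).comp₃, (hK h).lift₃, hdesc₃ h⟩⟩
  obtain ⟨C', i', p', q, r, hK', h₁, h₂, h₃, h₄⟩ := key h
  have h5 : G.comp (show 0 + (1 + n) = 1 + n by omega) i' (G.comp rfl q y) = 0 := by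
    rw [← G.assoc (zero_add 1) rfl (by omega), h₁]
    have : ∀ (s : ℤ) (hs : 1 + n = s), G.comp hs p y = 0 := by
      rintro s hs
      obtain rfl : s = l := by omega
      exact hy
    exact this _ _
  obtain ⟨z, hz⟩ := hdesc₃ hK' _ (show 1 + n' = 1 + n by omega) _ h5
  have h6 := congrArg (G.comp (show -1 + (1 + n) = n by omega) r) hz
  have hp' : p' = -G.comp (add_zero 1) q c := by rw [h₂, neg_neg]
  refine ⟨-z, ?_⟩
  rw [← G.assoc (neg_add_cancel 1) rfl (zero_add n), h₄, G.id_comp, hp', map_neg,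
    LinearMap.neg_apply, map_neg, G.assoc (add_zero 1) e₂ _ rfl, ← G.assoc (neg_add_cancel 1) rfl
      (zero_add n), h₄, G.id_comp] at h6
  rw [map_neg, h6]

end GrCat

namespace AInfCat

variable {A : AInfCat.{w, v, u} k}

section Linearity

variable {W X Y Z : A.Obj}

theorem m3_add_left (a a' : A.Tot W X) (b : A.Tot X Y) (c : A.Tot Y Z) :
    A.m3 (a + a') b c = A.m3 a b c + A.m3 a' b c :=
  A.μ.ev_add .nil a a' ((Quiver.Path.nil.cons (show X ⟶ Y from b)).cons (show Y ⟶ Z from c))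

theorem m3_smul_left (r : k) (a : A.Tot W X) (b : A.Tot X Y) (c : A.Tot Y Z) :
    A.m3 (r • a) b c = r • A.m3 a b c :=
  A.μ.ev_smul .nil r a ((Quiver.Path.nil.cons (show X ⟶ Y from b)).cons (show Y ⟶ Z from c))

theorem m3_smul_mid (r : k) (a : A.Tot W X) (b : A.Tot X Y) (c : A.Tot Y Z) :
    A.m3 a (r • b) c = r • A.m3 a b c :=
  A.μ.ev_smul (Quiver.Path.nil.cons (show W ⟶ X from a)) r b (Quiver.Path.nil.cons c)

theorem m3_smul_right (r : k) (a : A.Tot W X) (b : A.Tot X Y) (c : A.Tot Y Z) :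
    A.m3 a b (r • c) = r • A.m3 a b c :=
  A.μ.ev_smul ((Quiver.Path.nil.cons (show W ⟶ X from a)).cons (show X ⟶ Y from b)) r c .nil

theorem m3_neg_left (a : A.Tot W X) (b : A.Tot X Y) (c : A.Tot Y Z) :
    A.m3 (-a) b c = -A.m3 a b c := by
  simpa using m3_smul_left (-1 : k) a b c

theorem m3_neg_mid (a : A.Tot W X) (b : A.Tot X Y) (c : A.Tot Y Z) :
    A.m3 a (-b) c = -A.m3 a b c := by
  simpa using m3_smul_mid (-1 : k) a b c

theorem m3_neg_right (a : A.Tot W X) (b : A.Tot X Y) (c : A.Tot Y Z) :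
    A.m3 a b (-c) = -A.m3 a b c := by
  simpa using m3_smul_right (-1 : k) a b c

theorem m3_zero_left (b : A.Tot X Y) (c : A.Tot Y Z) : A.m3 (0 : A.Tot W X) b c = 0 := by
  simpa using m3_smul_left (0 : k) (0 : A.Tot W X) b c

theorem m3_zero_mid (a : A.Tot W X) (c : A.Tot Y Z) : A.m3 a (0 : A.Tot X Y) c = 0 := by
  simpa using m3_smul_mid (0 : k) a (0 : A.Tot X Y) c

theorem m3_zero_right (a : A.Tot W X) (b : A.Tot X Y) : A.m3 a b (0 : A.Tot Y Z) = 0 := by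
  simpa using m3_smul_right (0 : k) a b (0 : A.Tot Y Z)

variable {V : A.Obj}

theorem m4_zero₁ (b : A.Tot W X) (c : A.Tot X Y) (e : A.Tot Y Z) :
    A.m4 (0 : A.Tot V W) b c e = 0 :=
  A.μ.ev_zero .nil (((Quiver.Path.nil.cons (show W ⟶ X from b)).cons (show X ⟶ Y from c)).cons (show Y ⟶ Z from e))

theorem m4_zero₂ (a : A.Tot V W) (c : A.Tot X Y) (e : A.Tot Y Z) :
    A.m4 a (0 : A.Tot W X) c e = 0 :=
  A.μ.ev_zero (Quiver.Path.nil.cons (show V ⟶ W from a)) ((Quiver.Path.nil.cons (show X ⟶ Y from c)).cons (show Y ⟶ Z from e))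

theorem m4_zero₃ (a : A.Tot V W) (b : A.Tot W X) (e : A.Tot Y Z) :
    A.m4 a b (0 : A.Tot X Y) e = 0 :=
  A.μ.ev_zero ((Quiver.Path.nil.cons (show V ⟶ W from a)).cons (show W ⟶ X from b)) (Quiver.Path.nil.cons (show Y ⟶ Z from e))

theorem m4_zero₄ (a : A.Tot V W) (b : A.Tot W X) (c : A.Tot X Y) :
    A.m4 a b c (0 : A.Tot Y Z) = 0 :=
  A.μ.ev_zero (((Quiver.Path.nil.cons (show V ⟶ W from a)).cons (show W ⟶ X from b)).cons (show X ⟶ Y from c)) .nil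

theorem sgn_of_mem_zero {a : A.Tot X Y} (ha : a ∈ A.gr X Y 0) : A.sgn X Y a = -a := by
  rw [A.sgn_of_mem ha]
  simp

theorem sgn_of_mem_one {a : A.Tot X Y} (ha : a ∈ A.gr X Y 1) : A.sgn X Y a = a := by
  rw [A.sgn_of_mem ha]
  simp

end Linearity

/-! ### Cones -/

section Cone

variable {Y₀ Y₁ C : A.Obj} {c : A.Tot Y₀ Y₁} {i : A.Tot Y₁ C} {p : A.Tot C Y₀} {s : A.Tot C Y₁}
  {a' : A.Tot Y₁ Y₀} {b' e : A.Tot Y₁ Y₁}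

/-- The composite of `Y₁ → C` with the comparison from `C` to the formal cone is homotopic to the
inclusion of `Y₁`; this is the resulting statement for `Hom(X, -)`. -/
theorem cone_homotopy (hc : A.d Y₀ Y₁ c = 0) (hi : i ∈ A.gr Y₁ C 0) (hdi : A.d Y₁ C i = 0)
    (hdp : A.d C Y₀ p = 0) (hs : A.d C Y₁ s + A.m2 C Y₀ Y₁ p c = 0)
    (ha' : A.d Y₁ Y₀ a' = A.m2 Y₁ C Y₀ i p)
    (hb' : A.d Y₁ Y₁ b' + A.m2 Y₁ Y₀ Y₁ a' c = A.m2 Y₁ C Y₁ i s + A.m3 i p c - e)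
    {X : A.Obj} {y : A.Tot X Y₁} (hy : A.d X Y₁ y = 0) :
    ∃ w, A.d X Y₁ w = A.m3 (A.m2 X Y₁ C y i) p c + A.m2 X C Y₁ (A.m2 X Y₁ C y i) s +
      A.m2 X Y₀ Y₁ (A.m3 y i p - A.m2 X Y₁ Y₀ y a') c + A.m2 X Y₁ Y₁ (A.sgn X Y₁ y) e := by
  have e1 := A.d_m4 y i p c
  have e2 := A.d_m3 y a' c
  have e3 := A.d_m3 y i s
  have e4 := A.d_m2 y b'
  have hb'' := congrArg (A.m2 X Y₁ Y₁ (A.sgn X Y₁ y)) hb'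
  have hpc : A.m2 C Y₀ Y₁ p c = -A.d C Y₁ s := eq_neg_of_add_eq_zero_right hs
  rw [hy, hdi, hdp, hc, m4_zero₁, m4_zero₂, m4_zero₃, m4_zero₄, ← ha', hpc, m3_neg_right,
    sgn_of_mem_zero hi, m3_neg_mid] at e1
  rw [hy, hc, m3_zero_left, m3_zero_right] at e2
  rw [hy, hdi, m3_zero_left, m3_zero_mid, sgn_of_mem_zero hi, m3_neg_mid] at e3
  rw [hy, LinearMap.map_zero₂] at e4
  refine ⟨-A.m4 y i p c + A.m3 y a' c - A.m3 y i s + A.m2 X Y₁ Y₁ y b', ?_⟩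
  simp only [map_add, map_sub, map_neg, LinearMap.sub_apply] at hb'' ⊢
  linear_combination (norm := module) e2 - e1 - e3 + e4 - hb''

/-- A morphism from `Y₁` whose composite with `c` is exact extends to the cone. -/
theorem cone_extend (hc : A.d Y₀ Y₁ c = 0) (hic : i ∈ A.gr Y₁ C 0) (hdi : A.d Y₁ C i = 0)
    (hpc : p ∈ A.gr C Y₀ 1) (hac : a' ∈ A.gr Y₁ Y₀ 0)
    (hdp : A.d C Y₀ p = 0) (hs : A.d C Y₁ s + A.m2 C Y₀ Y₁ p c = 0)
    (ha' : A.d Y₁ Y₀ a' = A.m2 Y₁ C Y₀ i p)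
    (hb' : A.d Y₁ Y₁ b' + A.m2 Y₁ Y₀ Y₁ a' c = A.m2 Y₁ C Y₁ i s + A.m3 i p c - e)
    {W : A.Obj} {f : A.Tot Y₁ W} (hf : A.d Y₁ W f = 0) {h : A.Tot Y₀ W}
    (hh : A.d Y₀ W h = A.m2 Y₀ Y₁ W c f) :
    A.d C W (A.m2 C Y₁ W s f + A.m3 p c f - A.m2 C Y₀ W p h) = 0 ∧
      ∃ w, A.d Y₁ W w = A.m2 Y₁ C W i (A.m2 C Y₁ W s f + A.m3 p c f - A.m2 C Y₀ W p h) -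
        A.m2 Y₁ Y₁ W e f := by
  have hpc' : A.m2 C Y₀ Y₁ p c = -A.d C Y₁ s := eq_neg_of_add_eq_zero_right hs
  constructor
  · have e1 := A.d_m2 s f
    have e2 := A.d_m3 p c f
    have e3 := A.d_m2 p h
    rw [hf, map_zero, add_zero] at e1
    rw [hdp, hc, hf, m3_zero_left, m3_zero_mid, m3_zero_right, sgn_of_mem_one hpc, ← hh,
      hpc'] at e2
    rw [hdp, LinearMap.map_zero₂, sgn_of_mem_one hpc] at e3
    simp only [map_add, map_sub, map_neg, LinearMap.neg_apply] at e2 ⊢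
    linear_combination (norm := module) e1 + e2 - e3
  · have e1 := A.d_m3 i s f
    have e2 := A.d_m4 i p c f
    have e3 := A.d_m3 a' c f
    have e4 := A.d_m3 i p h
    have e5 := A.d_m2 a' h
    have e6 := A.d_m2 b' f
    have e7 := congrArg (fun x => A.m2 Y₁ Y₁ W x f) hb'
    rw [hdi, hf, m3_zero_left, m3_zero_right, sgn_of_mem_zero hic, m3_neg_left] at e1
    rw [hdi, hdp, hc, hf, m4_zero₁, m4_zero₂, m4_zero₃, m4_zero₄, sgn_of_mem_zero hic,
      sgn_of_mem_one hpc, hpc', ← hh, ← ha', m3_neg_left, m3_neg_mid, m3_neg_left] at e2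
    rw [hc, hf, m3_zero_mid, m3_zero_right, ← hh] at e3
    rw [hdi, hdp, m3_zero_left, m3_zero_mid, sgn_of_mem_zero hic, sgn_of_mem_one hpc,
      m3_neg_left, ← ha'] at e4
    rw [sgn_of_mem_zero hac] at e5 e3
    rw [hf, map_zero] at e6
    refine ⟨A.m3 i s f + A.m4 i p c f - A.m3 a' c f - A.m3 i p h + A.m2 Y₁ Y₀ W a' h -
      A.m2 Y₁ Y₁ W b' f, ?_⟩
    simp only [map_add, map_sub, map_neg, LinearMap.neg_apply, LinearMap.add_apply,
      LinearMap.sub_apply] at e1 e2 e3 e4 e5 e7 ⊢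
    linear_combination (norm := module) e1 + e2 - e3 - e4 + e5 - e6 + e7

end Cone

end AInfCat

/-! ### The exact triangle of a mapping cone -/

namespace AInfCat

variable {A : AInfCat.{w, v, u} k}

theorem Z_d {n : ℤ} {X Y : A.Obj} (x : A.Z n X Y) : A.d X Y x.1 = 0 := x.2.2

theorem homog_m2_right {X Y Z : A.Obj} {m : ℤ} {b : A.Tot Y Z} (hb : b ∈ A.gr Y Z m) {n l : ℤ}
    (h : n + m = l) (a : A.Tot X Y) :
    A.homog l X Z (A.m2 X Y Z a b) = A.m2 X Y Z (A.homog n X Y a) b := by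
  subst h
  exact (map_homog ((A.m2 X Y Z).flip b) (fun ha => A.m2_mem ha hb) n a).symm

theorem homog_d {X Y : A.Obj} {n l : ℤ} (h : n + 1 = l) (a : A.Tot X Y) :
    A.homog l X Y (A.d X Y a) = A.d X Y (A.homog n X Y a) := by
  subst h
  exact (map_homog (A.d X Y) (fun ha => A.d_mem ha) n a).symm

theorem homog_m3_right {W X Y Z : A.Obj} {m m' : ℤ} {b : A.Tot X Y} (hb : b ∈ A.gr X Y m)
    {c : A.Tot Y Z} (hc : c ∈ A.gr Y Z m') {n l : ℤ} (h : n + (m + m' - 1) = l) (a : A.Tot W X) :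
    A.homog l W Z (A.m3 a b c) = A.m3 (A.homog n W X a) b c := by
  subst h
  let f : A.Tot W X →ₗ[k] A.Tot W Z :=
    { toFun := fun a => A.m3 a b c
      map_add' := fun a a' => m3_add_left a a' b c
      map_smul' := fun r a => m3_smul_left r a b c }
  refine (map_homog f (fun {n a} ha => ?_) n a).symm
  have := A.m3_mem ha hb hc
  rwa [show n + m + m' - 1 = n + (m + m' - 1) by ring] at this

/-- A composite is determined by the product `μ²` up to sign. -/
theorem comp_mk_smul {n m l : ℤ} (h : n + m = l) {X Y Z : A.Obj} (a : A.Z n X Y)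
    (b : A.Z m Y Z) (c : A.Z l X Z) (hw : ∃ w, A.d X Z w = A.m2 X Y Z a.1 b.1 - c.1) :
    A.comp h (((n.negOnePow : ℤˣ) : ℤ) • Submodule.Quotient.mk a) (Submodule.Quotient.mk b) =
      Submodule.Quotient.mk c := by
  rw [← Submodule.Quotient.mk_smul, comp_mk_eq_iff]
  obtain ⟨w, hw⟩ := hw
  refine ⟨((n.negOnePow : ℤˣ) : ℤ) • w, ?_⟩
  change _ = A.m2 X Y Z (((n.negOnePow : ℤˣ) : ℤ) • a.1) b.1 - _
  rw [map_zsmul, hw, map_zsmul, LinearMap.smul_apply, smul_sub]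

section Unital

variable [A.Unital]

/-- Chain level data of a mapping cone: `C` is a cone of `c` by means of `p` and `s`, the morphism
`i` is closed, and `a'`, `b'` are a homotopy between the image of `i` in the formal cone
complex and the inclusion `(0, e)` of `Y₁`, where `e` represents the identity. -/
structure ConeData {Y₀ Y₁ C : A.Obj} (c : A.Z 0 Y₀ Y₁) (i : A.Z 0 Y₁ C) (p : A.Z 1 C Y₀)
    (s : A.Tot C Y₁) (a' : A.Tot Y₁ Y₀) (b' : A.Tot Y₁ Y₁) (e : A.Z 0 Y₁ Y₁) : Prop where
  s_mem : s ∈ A.gr C Y₁ 0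
  d_s : A.d C Y₁ s + A.m2 C Y₀ Y₁ p.1 c.1 = 0
  a_mem : a' ∈ A.gr Y₁ Y₀ 0
  d_a : A.d Y₁ Y₀ a' = A.m2 Y₁ C Y₀ i.1 p.1
  d_b : A.d Y₁ Y₁ b' + A.m2 Y₁ Y₀ Y₁ a' c.1 = A.m2 Y₁ C Y₁ i.1 s + A.m3 i.1 p.1 c.1 - e.1
  mk_e : Submodule.Quotient.mk e = A.id Y₁
  inj : ∀ {X : A.Obj} (x : A.Tot X C), A.d X C x = 0 →
    ∀ (a : A.Tot X Y₀) (b : A.Tot X Y₁), A.d X Y₀ a = A.m2 X C Y₀ x p.1 →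
      A.d X Y₁ b + A.m2 X Y₀ Y₁ a c.1 = A.m2 X C Y₁ x s + A.m3 x p.1 c.1 →
      ∃ y : A.Tot X C, A.d X C y = x
  surj : ∀ {X : A.Obj} (a : A.Tot X Y₀) (b : A.Tot X Y₁), A.d X Y₀ a = 0 →
    A.d X Y₁ b + A.m2 X Y₀ Y₁ a c.1 = 0 →
    ∃ x : A.Tot X C, A.d X C x = 0 ∧
      ∃ (a' : A.Tot X Y₀) (b' : A.Tot X Y₁), A.d X Y₀ a' = A.m2 X C Y₀ x p.1 - a ∧
        A.d X Y₁ b' + A.m2 X Y₀ Y₁ a' c.1 = A.m2 X C Y₁ x s + A.m3 x p.1 c.1 - b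

theorem IsCone.exists_coneData {Y₀ Y₁ C : A.Obj} {c : A.Z 0 Y₀ Y₁} (h : A.IsCone c.1 C) :
    ∃ i p s a' b' e, A.ConeData (C := C) c i p s a' b' e := by
  obtain ⟨p, hp, s, hs, hdp, hds, hX⟩ := h
  obtain ⟨e, he⟩ := A.exists_unit Y₁
  obtain ⟨x, hx, a', b', ha', hb'⟩ := (hX Y₁).2 0 e.1 (map_zero _)
    (by rw [Z_d e, LinearMap.map_zero₂, add_zero])
  rw [sub_zero] at ha'
  have hi : A.homog 0 Y₁ C x ∈ A.Z 0 Y₁ C :=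
    ⟨homog_mem _ _, LinearMap.mem_ker.2 (by rw [← homog_d rfl, hx, map_zero])⟩
  refine ⟨⟨_, hi⟩, ⟨p, hp, hdp⟩, s, A.homog 0 Y₁ Y₀ a', A.homog (-1) Y₁ Y₁ b', e, hs, hds,
    homog_mem _ _, ?_, ?_, he, fun {X} x hx a b h₁ h₂ => (hX X).1 x hx ⟨a, b, h₁, h₂⟩,
    fun {X} => (hX X).2⟩
  · rw [← homog_d rfl, ha', homog_m2_right hp rfl]
  · have := congrArg (A.homog 0 Y₁ Y₁) hb'
    rwa [map_add, map_sub, map_add, homog_d (neg_add_cancel 1),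
      homog_m2_right c.2.1 (add_zero 0), homog_m2_right hs (add_zero 0),
      homog_m3_right hp c.2.1 (n := 0) (by norm_num), homog_of_mem e.2.1] at this

/-- Products with a unit on the right are, up to sign and homotopy, trivial. -/
theorem m2_sgn_unit {X Y : A.Obj} {e : A.Z 0 Y Y} (he : Submodule.Quotient.mk e = A.id Y)
    {n : ℤ} (f : A.Z n X Y) :
    ∃ w, A.d X Y w = A.m2 X Y Y (A.sgn X Y f.1) e.1 + f.1 := by
  obtain ⟨w, hw⟩ := m2_unit_right he f
  refine ⟨-(((n.negOnePow : ℤˣ) : ℤ) • w), ?_⟩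
  rw [map_neg, map_zsmul, hw, A.sgn_of_mem f.2.1, Int.negOnePow_sub, Int.negOnePow_one, smul_sub,
    negOnePow_smul_cancel]
  simp only [mul_neg, mul_one, Units.val_neg, neg_smul, map_neg, map_zsmul, LinearMap.neg_apply,
    LinearMap.smul_apply]
  abel

namespace ConeData

variable {Y₀ Y₁ C : A.Obj} {c : A.Z 0 Y₀ Y₁} {i : A.Z 0 Y₁ C} {p : A.Z 1 C Y₀}
  {s : A.Tot C Y₁} {a' : A.Tot Y₁ Y₀} {b' : A.Tot Y₁ Y₁} {e : A.Z 0 Y₁ Y₁}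

/-- The image of `y ∘ i` in the formal cone complex is homotopic to `(0, y)`. -/
theorem homotopy (h : A.ConeData c i p s a' b' e) {X : A.Obj} {n : ℤ} (y : A.Z n X Y₁) :
    A.d X Y₀ (A.m2 X Y₁ Y₀ y.1 a' - A.m3 y.1 i.1 p.1) =
        A.m2 X C Y₀ (A.m2 X Y₁ C y.1 i.1) p.1 ∧
      ∃ b, A.d X Y₁ b + A.m2 X Y₀ Y₁ (A.m2 X Y₁ Y₀ y.1 a' - A.m3 y.1 i.1 p.1) c.1 =
        A.m2 X C Y₁ (A.m2 X Y₁ C y.1 i.1) s + A.m3 (A.m2 X Y₁ C y.1 i.1) p.1 c.1 - y.1 := by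
  constructor
  · have e1 := A.d_m3 y.1 i.1 p.1
    have e2 := A.d_m2 y.1 a'
    rw [Z_d y, Z_d i, Z_d p, m3_zero_left, m3_zero_mid, m3_zero_right, ← h.d_a] at e1
    rw [Z_d y, LinearMap.map_zero₂] at e2
    rw [map_sub]
    linear_combination (norm := module) e2 - e1
  · obtain ⟨w, hw⟩ := cone_homotopy (Z_d c) i.2.1 (Z_d i) (Z_d p) h.d_s h.d_a h.d_b (Z_d y)
    obtain ⟨w', hw'⟩ := m2_sgn_unit h.mk_e y
    refine ⟨w - w', ?_⟩
    rw [map_sub, hw, hw', map_sub, map_sub, LinearMap.sub_apply, LinearMap.sub_apply]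
    module

/-- The image of a boundary in the formal cone complex. -/
theorem d_aux (h : A.ConeData c i p s a' b' e) {X : A.Obj} (w : A.Tot X C) :
    A.d X Y₀ (A.m2 X C Y₀ w p.1) = -A.m2 X C Y₀ (A.d X C w) p.1 ∧
    A.d X Y₁ (A.m3 w p.1 c.1 + A.m2 X C Y₁ w s) = -A.m3 (A.d X C w) p.1 c.1 -
      A.m2 X C Y₁ (A.d X C w) s - A.m2 X Y₀ Y₁ (A.m2 X C Y₀ w p.1) c.1 := by
  have e1 := A.d_m2 w p.1
  have e2 := A.d_m2 w s
  have e3 := A.d_m3 w p.1 c.1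
  rw [Z_d p, map_zero, add_zero] at e1
  rw [Z_d p, Z_d c, m3_zero_mid, m3_zero_right, eq_neg_of_add_eq_zero_right h.d_s, map_neg] at e3
  rw [map_add]
  exact ⟨eq_neg_of_add_eq_zero_left e1, by linear_combination (norm := module) e2 + e3⟩

/-- The exactness properties of the triangle of a mapping cone which follow from the comparison of
`C` with the formal cone. The maps out of `C` and the remaining exactness statements are reached by
rotation. -/
theorem halfTri (h : A.ConeData c i p s a' b' e) :
    A.coh.HalfTri (X := Y₀) (Y := Y₁) (C := C) (Submodule.Quotient.mk c : A.H 0 Y₀ Y₁)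
      (Submodule.Quotient.mk i : A.H 0 Y₁ C) (Submodule.Quotient.mk p : A.H 1 C Y₀) where
  comp₁ {l} hl := (comp_mk_eq_zero_iff hl p c).2
    ⟨-s, by rw [map_neg]; exact (eq_neg_of_add_eq_zero_right h.d_s).symm⟩
  comp₂ {l} hl := by
    refine (comp_mk_eq_zero_iff hl c i).2 ?_
    obtain ⟨h₁, b, h₂⟩ := h.homotopy c
    obtain ⟨e₀, he₀⟩ := A.exists_unit Y₀
    obtain ⟨w, hw⟩ := m2_unit_left he₀ c
    refine h.inj _ ?_ (A.m2 Y₀ Y₁ Y₀ c.1 a' - A.m3 c.1 i.1 p.1 + e₀.1) (b - w) ?_ ?_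
    · have := A.d_m2 c.1 i.1
      rwa [Z_d c, Z_d i, LinearMap.map_zero₂, map_zero, add_zero, add_zero] at this
    · rw [map_add, h₁, Z_d e₀, add_zero]
    · rw [map_sub, map_add (A.m2 Y₀ Y₀ Y₁), LinearMap.add_apply, hw]
      linear_combination (norm := module) h₂
  comp₃ {l} hl := (comp_mk_eq_zero_iff hl i p).2 ⟨a', h.d_a⟩
  lift₁ := fun {W : A.Obj} {n n' l} h₁ h₂ y hy => by
    obtain ⟨y, rfl⟩ := Submodule.Quotient.mk_surjective _ y
    obtain ⟨w, hw⟩ := (comp_mk_eq_zero_iff h₁ y c).1 hy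
    obtain ⟨x, hx, a, b, ha, -⟩ := h.surj y.1 (-w) (Z_d y) (by rw [map_neg, hw, neg_add_cancel])
    have hz : A.homog n' W C x ∈ A.Z n' W C :=
      ⟨homog_mem _ _, LinearMap.mem_ker.2 (by rw [← homog_d rfl, hx, map_zero])⟩
    refine ⟨_, comp_mk_smul h₂ ⟨_, hz⟩ p y ⟨A.homog n' W Y₀ a, ?_⟩⟩
    rw [← homog_d h₂, ha, map_sub, homog_of_mem y.2.1, homog_m2_right p.2.1 h₂]
  lift₂ := fun {W : A.Obj} {n n' l} h₁ h₂ y hy => by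
    obtain ⟨y, rfl⟩ := Submodule.Quotient.mk_surjective _ y
    obtain ⟨w, hw⟩ := (comp_mk_eq_zero_iff h₁ y i).1 hy
    obtain ⟨w, hwm, hw⟩ := exists_mem_of_exact (h₁ ▸ A.m2_mem y.2.1 i.2.1) hw
    obtain ⟨e₁, b, e₂⟩ := h.homotopy y
    obtain ⟨e₃, e₄⟩ := h.d_aux w
    rw [hw] at e₃ e₄
    have hx : -(A.m2 W Y₁ Y₀ y.1 a' - A.m3 y.1 i.1 p.1 + A.m2 W C Y₀ w p.1) ∈ A.Z n' W Y₀ := by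
      refine neg_mem ⟨add_mem (sub_mem ?_ ?_) ?_, LinearMap.mem_ker.2 ?_⟩
      · have := A.m2_mem y.2.1 h.a_mem
        rwa [show n + 0 = n' by omega] at this
      · have := A.m3_mem y.2.1 i.2.1 p.2.1
        rwa [show n + 0 + 1 - 1 = n' by omega] at this
      · have := A.m2_mem hwm p.2.1
        rwa [show l - 1 + 1 = n' by omega] at this
      · rw [map_add, e₁, e₃, add_neg_cancel]
    refine ⟨_, comp_mk_smul h₂ ⟨_, hx⟩ c y ⟨b + (A.m3 w p.1 c.1 + A.m2 W C Y₁ w s), ?_⟩⟩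
    rw [map_add, e₄, map_neg, map_add (A.m2 W Y₀ Y₁), LinearMap.neg_apply, LinearMap.add_apply]
    linear_combination (norm := module) e₂
  lift₃ := fun {W : A.Obj} {n n' l} h₁ h₂ y hy => by
    obtain ⟨y, rfl⟩ := Submodule.Quotient.mk_surjective _ y
    obtain ⟨w, hw⟩ := (comp_mk_eq_zero_iff h₁ y p).1 hy
    obtain ⟨w, hwm, hw⟩ := exists_mem_of_exact (h₁ ▸ A.m2_mem y.2.1 p.2.1) hw
    have hz : A.m3 y.1 p.1 c.1 + A.m2 W C Y₁ y.1 s - A.m2 W Y₀ Y₁ w c.1 ∈ A.Z n' W Y₁ := by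
      refine ⟨sub_mem (add_mem ?_ ?_) ?_, LinearMap.mem_ker.2 ?_⟩
      · have := A.m3_mem y.2.1 p.2.1 c.2.1
        rwa [show n + 1 + 0 - 1 = n' by omega] at this
      · have := A.m2_mem y.2.1 h.s_mem
        rwa [show n + 0 = n' by omega] at this
      · have := A.m2_mem hwm c.2.1
        rwa [show l - 1 + 0 = n' by omega] at this
      · have e₁ := (h.d_aux y.1).2
        have e₂ := A.d_m2 w c.1
        rw [Z_d c, map_zero, add_zero, hw] at e₂
        rw [Z_d y, m3_zero_left, LinearMap.map_zero₂] at e₁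
        rw [map_sub]
        linear_combination (norm := module) e₁ - e₂
    obtain ⟨z, ez⟩ : ∃ z : A.Z n' W Y₁, z.1 =
      A.m3 y.1 p.1 c.1 + A.m2 W C Y₁ y.1 s - A.m2 W Y₀ Y₁ w c.1 := ⟨⟨_, hz⟩, rfl⟩
    obtain ⟨e₁, b, e₂⟩ := h.homotopy z
    refine ⟨_, comp_mk_smul h₂ z i y (h.inj _ ?_ (A.m2 W Y₁ Y₀ z.1 a' - A.m3 z.1 i.1 p.1 - w) b
      ?_ ?_)⟩
    · have := A.d_m2 z.1 i.1
      rw [Z_d z, Z_d i, LinearMap.map_zero₂, map_zero, add_zero, add_zero] at this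
      rw [map_sub, this, Z_d y, sub_zero]
    · rw [map_sub, e₁, hw, map_sub (A.m2 W C Y₀), LinearMap.sub_apply]
    · rw [map_sub (A.m2 W Y₀ Y₁), LinearMap.sub_apply, map_sub (A.m2 W C Y₁), LinearMap.sub_apply,
        sub_eq_add_neg (A.m2 W Y₁ C _ _), m3_add_left, m3_neg_left]
      linear_combination (norm := module) e₂ - ez
  desc₂ := fun {W : A.Obj} {n n' l} h₁ h₂ f hf => by
    obtain ⟨f, rfl⟩ := Submodule.Quotient.mk_surjective _ f
    obtain ⟨w, hw⟩ := (comp_mk_eq_zero_iff h₁ c f).1 hf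
    obtain ⟨w, hwm, hw⟩ := exists_mem_of_exact (h₁ ▸ A.m2_mem c.2.1 f.2.1) hw
    obtain ⟨e₁, b, e₂⟩ := cone_extend (Z_d c) i.2.1 (Z_d i) p.2.1 h.a_mem (Z_d p) h.d_s h.d_a
      h.d_b (Z_d f) hw
    obtain ⟨b', e₃⟩ := m2_unit_left h.mk_e f
    have hg : A.m2 C Y₁ W s f.1 + A.m3 p.1 c.1 f.1 - A.m2 C Y₀ W p.1 w ∈ A.Z n' C W := by
      refine ⟨sub_mem (add_mem ?_ ?_) ?_, LinearMap.mem_ker.2 e₁⟩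
      · have := A.m2_mem h.s_mem f.2.1
        rwa [show 0 + n = n' by omega] at this
      · have := A.m3_mem p.2.1 c.2.1 f.2.1
        rwa [show 1 + 0 + n - 1 = n' by omega] at this
      · have := A.m2_mem p.2.1 hwm
        rwa [show 1 + (l - 1) = n' by omega] at this
    refine ⟨(Submodule.Quotient.mk ⟨_, hg⟩ : A.H n' C W), (comp_mk_eq_iff h₂ i ⟨_, hg⟩ f).2
      ⟨b + b', ?_⟩⟩
    rw [map_add, e₂, e₃, Int.negOnePow_zero, Units.val_one, one_smul]
    module

end ConeData

variable (A) in
/-- The triangles of the cohomology category which arise from mapping cones. -/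
def ConeTri {X Y C : A.coh.Obj} (c : A.coh.H 0 X Y) (i : A.coh.H 0 Y C) (p : A.coh.H 1 C X) :
    Prop :=
  ∃ (c' : A.Z 0 X Y) (i' : A.Z 0 Y C) (p' : A.Z 1 C X) (s : A.Tot C Y) (a' : A.Tot Y X)
    (b' : A.Tot Y Y) (e : A.Z 0 Y Y), A.ConeData c' i' p' s a' b' e ∧
    Submodule.Quotient.mk c' = c ∧ Submodule.Quotient.mk i' = i ∧ Submodule.Quotient.mk p' = p

/-- The cone of `i : Y → C` maps to `X`, compatibly with the other morphisms of the triangle. -/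
theorem ConeTri.rotate (hA : A.IsTriangulated) {X Y C : A.Obj} {c : A.H 0 X Y}
    {i : A.H 0 Y C} {p : A.H 1 C X} (h : A.ConeTri (X := X) (Y := Y) (C := C) c i p) :
    ∃ (C' : A.Obj) (i' : A.H 0 C C') (p' : A.H 1 C' Y) (q : A.H 1 C' X),
      A.ConeTri (X := Y) (Y := C) (C := C') i i' p' ∧ A.comp (zero_add 1) i' q = p ∧
        A.comp (add_zero 1) q c = -p' := by
  obtain ⟨c, i, p, s, a, b, e, h, rfl, rfl, rfl⟩ := h
  obtain ⟨C', hC'⟩ := hA.exists_cone _ _ i.1 i.2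
  obtain ⟨i', p', s', a', b', e', h'⟩ := hC'.exists_coneData
  obtain ⟨e₁, w, e₂⟩ := cone_extend (Z_d i) i'.2.1 (Z_d i') p'.2.1 h'.a_mem (Z_d p') h'.d_s h'.d_a
    h'.d_b (Z_d p) h.d_a
  obtain ⟨w', e₃⟩ := m2_unit_left h'.mk_e p
  have hq : A.m2 C' C X s' p.1 + A.m3 p'.1 i.1 p.1 - A.m2 C' Y X p'.1 a ∈ A.Z 1 C' X := by
    refine ⟨sub_mem (add_mem ?_ ?_) ?_, LinearMap.mem_ker.2 e₁⟩
    · exact A.m2_mem h'.s_mem p.2.1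
    · exact A.m3_mem p'.2.1 i.2.1 p.2.1
    · exact A.m2_mem p'.2.1 h.a_mem
  refine ⟨C', (Submodule.Quotient.mk i' : A.H 0 C C'), (Submodule.Quotient.mk p' : A.H 1 C' Y),
    (Submodule.Quotient.mk ⟨_, hq⟩ : A.H 1 C' X), ⟨i, i', p', s', a', b', e', h', rfl, rfl, rfl⟩,
    (comp_mk_eq_iff _ i' ⟨_, hq⟩ p).2 ⟨w + w', ?_⟩, ?_⟩
  · rw [map_add, e₂, e₃, Int.negOnePow_zero, Units.val_one, one_smul]
    module
  · refine (comp_mk_eq_iff (add_zero 1) ⟨_, hq⟩ c (-p')).2 ?_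
    obtain ⟨-, b, e₄⟩ := h.homotopy p'
    obtain ⟨-, e₅⟩ := h.d_aux s'
    rw [eq_neg_of_add_eq_zero_right h'.d_s, m3_neg_left] at e₄
    refine ⟨b - (A.m3 s' p.1 c.1 + A.m2 C' C Y s' s), ?_⟩
    rw [map_sub, e₅]
    change _ = A.m2 C' X Y (_ + _ - _) c.1 - _ • (-p'.1)
    rw [Int.negOnePow_one]
    simp only [map_add, map_sub, map_neg, LinearMap.add_apply, LinearMap.sub_apply,
      LinearMap.neg_apply, Units.val_neg, Units.val_one, neg_smul, one_smul] at e₄ ⊢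
    linear_combination (norm := module) e₄

theorem ConeData.isTri (hA : A.IsTriangulated) {Y₀ Y₁ C : A.Obj} {c : A.Z 0 Y₀ Y₁}
    {i : A.Z 0 Y₁ C} {p : A.Z 1 C Y₀} {s : A.Tot C Y₁} {a' : A.Tot Y₁ Y₀} {b' : A.Tot Y₁ Y₁}
    {e : A.Z 0 Y₁ Y₁} (h : A.ConeData c i p s a' b' e) :
    A.coh.IsTri (X := Y₀) (Y := Y₁) (C := C) (Submodule.Quotient.mk c : A.H 0 Y₀ Y₁)
      (Submodule.Quotient.mk i : A.H 0 Y₁ C) (Submodule.Quotient.mk p : A.H 1 C Y₀) :=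
  GrCat.HalfTri.isTri (G := A.coh) (K := fun c i p => A.ConeTri c i p)
    (fun {X Y C c i p} ⟨_, _, _, _, _, _, _, h, h₁, h₂, h₃⟩ => by
      subst h₁ h₂ h₃; exact h.halfTri)
    (fun h => h.rotate hA) ⟨_, _, _, _, _, _, _, h, rfl, rfl, rfl⟩

end Unital

end AInfCat

namespace GrCat

variable {G : GrCat.{w, v, u} k}

/-! ### Translating the perfect pairing property -/

theorem Line.ne_zero_aux {V : Type*} [AddCommGroup V] [Module k V] (h : Module.finrank k V = 1) :
    Nonempty (V ≃ₗ[k] k) := by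
  have : FiniteDimensional k V := Module.finite_of_finrank_pos (by rw [h]; exact one_pos)
  exact ⟨LinearEquiv.ofFinrankEq _ _ (by rw [h, Module.finrank_self])⟩

/-- Translating the perfect pairing property along an autoequivalence: all pairs `E_i`, `E_{i+m}`
are related by Serre duality on the subcategory generated by the collection. Outside the range
`i ≤ j ≤ i + m`, the spaces which are to be paired are zero. -/
theorem serrePair_of_translation {N m : ℕ} {d : ℤ} {E : ℕ → G.Obj}
    (fin : ∀ X, ∀ i ≤ N, G.HomFin X (E i)) (lineE : ∀ i ≤ N, G.Line 0 (E i) (E i))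
    (zeroE : ∀ i j, i < j → j ≤ N → G.Zero (E j) (E i))
    (far : ∀ i j, i + m < j → j ≤ N → G.Zero (E i) (E j)) (line : G.Line d (E 0) (E m))
    (hm : m ≤ N)
    (perfect : ∀ i, 0 < i → i < m → ∀ (a b : ℤ) (h : a + b = d),
      Function.Bijective (G.comp h (X := E 0) (Y := E i) (Z := E m)).flip)
    (κ : ∀ n i j, i < N → j < N → (G.H n (E i) (E j) ≃ₗ[k] G.H n (E (i + 1)) (E (j + 1))))
    (κ_comp : ∀ {n n' l : ℤ} (h : n + n' = l) {i j r : ℕ} (hi : i < N) (hj : j < N) (hr : r < N)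
      (f : G.H n (E i) (E j)) (g : G.H n' (E j) (E r)),
      κ l i r hi hr (G.comp h f g) = G.comp h (κ n i j hi hj f) (κ n' j r hj hr g))
    (i l : ℕ) (hl : i + m = l) (hlN : l ≤ N) :
    G.SerrePair (G.Gen (· ∈ G.seg E 0 (N + 1))) d (E i) (E l) := by
  have triv : ∀ {V V' : Type v} [AddCommGroup V] [Module k V] [AddCommGroup V'] [Module k V']
      (f : V →ₗ[k] Module.Dual k V'), (∀ x : V, x = 0) → (∀ x : V', x = 0) →
      Function.Bijective f := fun {V V'} _ _ _ _ f h h' =>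
    ⟨fun x y _ => by rw [h x, h y], fun x => ⟨0, by ext y; rw [h' y, map_zero, map_zero]⟩⟩
  have main : ∀ i l, i + m = l → l ≤ N → ∃ tr : Module.Dual k (G.H d (E i) (E l)), ∀ j ≤ N,
      ∀ {a b : ℤ} (h : a + b = d),
        Function.Bijective fun g : G.H b (E j) (E l) => tr ∘ₗ (G.comp h (X := E i)).flip g := by
    intro i
    induction i with
    | zero =>
      rintro l hl -
      obtain rfl : m = l := by omega
      obtain ⟨tr⟩ := Line.ne_zero_aux line.1
      refine ⟨tr.toLinearMap, fun j hj a b h => ?_⟩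
      have bij_of_inj : ∀ {V V' : Type v} [AddCommGroup V] [Module k V] [AddCommGroup V']
          [Module k V'] (f : V →ₗ[k] Module.Dual k V'), Module.finrank k V = 1 →
          Module.finrank k V' = 1 → Function.Injective f → Function.Bijective f := by
        intro V V' _ _ _ _ f h h' hf
        have : FiniteDimensional k V := Module.finite_of_finrank_pos (by rw [h]; exact one_pos)
        have : FiniteDimensional k V' := Module.finite_of_finrank_pos (by rw [h']; exact one_pos)
        exact ⟨hf, (LinearMap.injective_iff_surjective_of_finrank_eq_finrank
          (by rw [h, Subspace.dual_finrank_eq, h'])).1 hf⟩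
      let f : G.H b (E j) (E m) →ₗ[k] Module.Dual k (G.H a (E 0) (E j)) :=
        (LinearMap.llcomp k _ _ _ tr.toLinearMap) ∘ₗ (G.comp h (X := E 0)).flip
      change Function.Bijective f
      rcases lt_or_ge m j with hmj | hmj
      · exact triv f (zeroE m j hmj hj b) (far 0 j (by omega) hj a)
      rcases Nat.eq_zero_or_pos j with rfl | hj0
      · by_cases ha : a = 0
        · subst ha
          obtain rfl : b = d := by omega
          refine bij_of_inj f line.1 (lineE 0 hj).1
            ((injective_iff_map_eq_zero f).2 fun g hg => ?_)
          have := LinearMap.congr_fun hg (G.id (E 0))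
          change tr (G.comp h (G.id (E 0)) g) = 0 at this
          rwa [G.id_comp, LinearEquiv.map_eq_zero_iff] at this
        · exact triv f (line.2 b (by omega)) ((lineE 0 hj).2 a ha)
      rcases hmj.eq_or_lt with rfl | hjm
      · by_cases hb : b = 0
        · subst hb
          obtain rfl : a = d := by omega
          refine bij_of_inj f (lineE j hj).1 line.1
            ((injective_iff_map_eq_zero f).2 fun g hg => ?_)
          obtain ⟨c, hc⟩ := (finrank_eq_one_iff_of_nonzero' (G.id (E j)) (fun h0 => by
            have h1 := (lineE j hj).1
            have : Subsingleton (G.H 0 (E j) (E j)) := ⟨fun x y => by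
              rw [← G.comp_id (add_zero 0) x, ← G.comp_id (add_zero 0) y, h0, map_zero, map_zero]⟩
            rw [Module.finrank_zero_of_subsingleton] at h1
            exact zero_ne_one h1)).1 (lineE j hj).1 g
          have := LinearMap.congr_fun hg (tr.symm 1)
          change tr (G.comp h (tr.symm 1) g) = 0 at this
          rw [← hc, map_smul, G.comp_id, map_smul, LinearEquiv.apply_symm_apply, smul_eq_mul,
            mul_one] at this
          rw [← hc, this, zero_smul]
        · exact triv f ((lineE j hj).2 b hb) (line.2 a (by omega))
      · have hp := perfect j hj0 hjm a b h
        refine ⟨fun x y hxy => hp.1 ?_, fun x => ?_⟩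
        · ext z
          exact tr.injective (LinearMap.congr_fun hxy z)
        · obtain ⟨y, hy⟩ := hp.2 (tr.symm.toLinearMap ∘ₗ x)
          refine ⟨y, ?_⟩
          change tr.toLinearMap ∘ₗ (G.comp h (X := E 0)).flip y = x
          rw [hy]
          ext z
          exact tr.apply_symm_apply _
    | succ i ih =>
      rintro l hl hlN
      obtain ⟨l, rfl⟩ : ∃ l', l = l' + 1 := ⟨i + m, by omega⟩
      obtain ⟨tr, htr⟩ := ih l (by omega) (by omega)
      refine ⟨tr ∘ₗ (κ d i l (by omega) (by omega)).symm.toLinearMap, fun j hj a b h => ?_⟩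
      let f : G.H b (E j) (E (l + 1)) →ₗ[k] Module.Dual k (G.H a (E (i + 1)) (E j)) :=
        (LinearMap.llcomp k _ _ _ (tr ∘ₗ (κ d i l (by omega) (by omega)).symm.toLinearMap)) ∘ₗ
          (G.comp h (X := E (i + 1))).flip
      change Function.Bijective f
      rcases j with - | j
      · exact triv f (far 0 _ (by omega) hlN b) (zeroE 0 _ (by omega) (by omega) a)
      · let e₁ := κ b j l (by omega) (by omega)
        let e₂ := κ a i j (by omega) (by omega)
        have hf : ∀ g, e₂.dualMap (f (e₁ g)) = tr ∘ₗ (G.comp h (X := E i)).flip g := by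
          intro g
          ext x
          change tr ((κ d i l _ _).symm (G.comp h (e₂ x) (e₁ g))) = tr (G.comp h x g)
          rw [← κ_comp h (i := i) (j := j) (r := l) (by omega) (by omega) (by omega),
            LinearEquiv.symm_apply_apply]
        have h1 : Function.Bijective (e₂.dualMap ∘ f ∘ e₁) := by
          have : e₂.dualMap ∘ f ∘ e₁ = fun g => tr ∘ₗ (G.comp h (X := E i)).flip g :=
            funext hf
          rw [this]
          exact htr j (by omega) h
        exact ((Function.Bijective.of_comp_iff _ e₁.bijective).1
          ((Function.Bijective.of_comp_iff' e₂.dualMap.bijective _).1 h1))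
  obtain ⟨tr, htr⟩ := main i l hl hlN
  refine .of_gen tr (fun X hX => ?_) fun X hX => ?_
  · obtain ⟨j, -, hj, rfl⟩ := mem_seg.1 hX
    exact htr j (by omega)
  · obtain ⟨j, -, hj, rfl⟩ := mem_seg.1 hX
    exact fin _ j (by omega)

end GrCat

namespace AInfFunctor

variable {A : AInfCat.{w, v, u} k} {B : AInfCat.{w, v', u'} k} {f : A.Obj → B.Obj}
  (Φ : AInfFunctor A B f)

set_option linter.unusedSimpArgs false in
theorem lin_m2 {X Y Z : A.Obj} (a : A.Tot X Y) (b : A.Tot Y Z) :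
    B.m2 _ _ _ (Φ.lin X Y a) (Φ.lin Y Z b) +
        B.d _ _ (Φ.F.ev ((Quiver.Path.nil.cons a).cons b)) =
      Φ.lin X Z (A.m2 X Y Z a b) + Φ.F.ev ((Quiver.Path.nil.cons (A.d X Y a)).cons b) +
        Φ.F.ev ((Quiver.Path.nil.cons (A.sgn X Y a)).cons (A.d Y Z b)) := by
  have h := Φ.rel ((Quiver.Path.nil.cons a).cons b : Quiver.Path X Z)
  simp only [insertSum, Quiver.Path.splits, MultiOp.cuts, MultiOp.cutsAux, List.map_cons,
    List.map_nil, List.map_append, List.flatMap_cons, List.flatMap_nil, List.nil_append,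
    List.append_nil,
    List.cons_append, List.sum_cons, List.sum_nil, Quiver.Hom.toPath, Quiver.Path.comp_nil,
    Quiver.Path.comp_cons, GQuiver.sgnWord, A.μ.ev_nil, MultiOp.ev_cons_zero,
    MultiOp.ev_cons_zero_cons, MultiOp.ev_cons_zero_cons_cons, add_zero, zero_add] at h
  have h' : B.d _ _ (Φ.F.ev ((Quiver.Path.nil.cons a).cons b)) +
      B.m2 _ _ _ (Φ.lin X Y a) (Φ.lin Y Z b) =
      Φ.F.ev ((Quiver.Path.nil.cons (A.d X Y a)).cons b) + (Φ.lin X Z (A.m2 X Y Z a b) +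
        Φ.F.ev ((Quiver.Path.nil.cons (A.sgn X Y a)).cons (A.d Y Z b))) := h
  linear_combination (norm := abel) h'

theorem mapH_comp {n m l : ℤ} (h : n + m = l) {X Y Z : A.Obj} (a : A.H n X Y) (b : A.H m Y Z) :
    Φ.mapH l X Z (A.comp h a b) = B.comp h (Φ.mapH n X Y a) (Φ.mapH m Y Z b) := by
  obtain ⟨a, rfl⟩ := Submodule.Quotient.mk_surjective _ a
  obtain ⟨b, rfl⟩ := Submodule.Quotient.mk_surjective _ b
  refine (AInfCat.mk_eq_iff _ _).2 ⟨((n.negOnePow : ℤˣ) : ℤ) •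
    Φ.F.ev ((Quiver.Path.nil.cons a.1).cons b.1), ?_⟩
  change _ = Φ.lin X Z (((n.negOnePow : ℤˣ) : ℤ) • A.m2 X Y Z a.1 b.1) -
    ((n.negOnePow : ℤˣ) : ℤ) • B.m2 _ _ _ (Φ.lin X Y a.1) (Φ.lin Y Z b.1)
  have h2 := Φ.lin_m2 a.1 b.1
  rw [AInfCat.Z_d a, AInfCat.Z_d b, Φ.F.ev_cons_zero_cons, Φ.F.ev_cons_zero, add_zero,
    add_zero] at h2
  rw [map_zsmul, map_zsmul, ← smul_sub, ← h2, add_sub_cancel_left]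

end AInfFunctor

/-! ### Exceptional collections in a triangulated category -/

namespace AInfCat

variable {A : AInfCat.{w, v, u} k} [A.Unital]

theorem HomIsLine.line {d : ℤ} {X Y : A.Obj} (h : A.HomIsLine d X Y) : A.coh.Line d X Y :=
  ⟨h.1, fun n hn f => (h.2 n hn).elim f 0⟩

theorem HomIsZero.zero {X Y : A.Obj} (h : A.HomIsZero X Y) : A.coh.Zero X Y :=
  fun n f => (h n).elim f 0

/-- A class of objects of a triangulated `A∞`-category which is stable under shifts and mapping
cones is closed; triangles on morphisms of arbitrary degree are obtained by shifting. -/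
theorem IsTriangulated.closed (hA : A.IsTriangulated) {P : A.Obj → Prop} (h₀ : ∃ X, P X)
    (hs : ∀ n X Y, P X → A.IsShift n X Y → P Y)
    (hc : ∀ X Y (c : A.Tot X Y) C, P X → P Y → c ∈ A.Z 0 X Y → A.IsCone c C → P C) :
    A.coh.Closed P where
  nonempty := h₀
  exists_shift n X hX := by
    obtain ⟨Y, hY⟩ := hA.exists_shift n X
    exact ⟨Y, hs n X Y hX hY, hY⟩
  of_shift {n X Y} hX h := hs n X Y hX h
  exists_cone := fun {a} {X Y : A.Obj} (c : A.H a X Y) hX hY => by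
    obtain ⟨X', hX'⟩ := hA.exists_shift (-a) X
    obtain ⟨f, g, h₁, h₂⟩ := hX'
    obtain ⟨c', hc'⟩ := Submodule.Quotient.mk_surjective _ (A.comp (neg_add_cancel a) g c)
    obtain ⟨C, hC⟩ := hA.exists_cone _ _ c'.1 c'.2
    obtain ⟨i, p, s, a', b', e, h⟩ := hC.exists_coneData
    have ht := GrCat.IsTri.of_iso (G := A.coh) (X := Y) (Y := C) (C := X') (C' := X) (n := -a)
      (m := - -a) (h.isTri hA).rotate g f (add_neg_cancel (-a))
      h₂ h₁ (show 1 + -a = 1 - a by omega)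
      (show - -a + 0 = a by omega)
    have he : A.coh.comp (show - -a + 0 = a by omega) (X := X) (Y := X') (Z := Y) f
        (Submodule.Quotient.mk c' : A.H 0 X' Y) = c := by
      change A.comp _ f (Submodule.Quotient.mk c' : A.H 0 X' Y) = c
      rw [hc', ← A.comp_assoc (neg_add_cancel (-a)) (neg_add_cancel a) (zero_add a) (by omega), h₁,
        A.id_comp]
    rw [he] at ht
    exact ⟨C, hc X' Y c'.1 C (hs _ _ _ hX ⟨f, g, h₁, h₂⟩) hY c'.2 hC, _, _, ht.rotate.rotate⟩

theorem IsTriangulated.closed_top (hA : A.IsTriangulated) (X : A.Obj) :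
    A.coh.Closed fun _ => True :=
  hA.closed ⟨X, trivial⟩ (fun _ _ _ _ _ => trivial) fun _ _ _ _ _ _ _ _ => trivial

theorem IsTriangulated.closed_gen (hA : A.IsTriangulated) {ι : Type u'} [Nonempty ι]
    (E : ι → A.Obj) : A.coh.Closed (A.Gen E) :=
  hA.closed ⟨_, .of (Classical.arbitrary ι)⟩ (fun n X Y hX h => .shift n X Y hX h)
    fun X Y c C hX hY hc h => .cone X Y c C hX hY hc h

theorem Gen.coh_gen (hA : A.IsTriangulated) {E : ℕ → A.Obj} {n : ℕ} {X : A.Obj}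
    (hX : A.Gen (fun i : Fin n => E i) X) : A.coh.Gen (· ∈ A.coh.seg E 0 n) X := by
  induction hX with
  | of i => exact .of (GrCat.mem_seg.2 ⟨i, Nat.zero_le _, i.2, rfl⟩)
  | zero X h => exact .zero (h.elim _ _)
  | shift n X Y _ h ih => exact .shift ih h
  | cone X Y c C _ _ hc h ih₁ ih₂ =>
    obtain ⟨i, p, s, a', b', e, h⟩ := IsCone.exists_coneData (c := ⟨c, hc⟩) h
    exact .tri ih₁ ih₂ (h.isTri hA)

/-- For exceptional collections, the generated subcategory may be described by means of the
triangles of the cohomology category. -/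
theorem gen_iff_coh_gen (hA : A.IsTriangulated) {E : ℕ → A.Obj} {n : ℕ} (hn : 0 < n)
    (hE : A.coh.ExcList (A.coh.seg E 0 n)) (hfin : ∀ X, ∀ i < n, A.coh.HomFin X (E i))
    {X : A.Obj} : A.Gen (fun i : Fin n => E i) X ↔ A.coh.Gen (· ∈ A.coh.seg E 0 n) X := by
  have : NeZero n := ⟨hn.ne'⟩
  refine ⟨fun h => h.coh_gen hA, fun h => ?_⟩
  refine GrCat.mem_of_gen (G := A.coh) (hA.closed_gen _) hE (fun X _ Y hY => ?_) (fun X hX => ?_)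
    (fun X hX => hX.coh_gen hA) h
  · obtain ⟨i, -, hi, rfl⟩ := GrCat.mem_seg.1 hY
    exact hfin X i hi
  · obtain ⟨i, -, hi, rfl⟩ := GrCat.mem_seg.1 hX
    exact .of (⟨i, hi⟩ : Fin n)

theorem dualPair (hA : A.IsTriangulated) {N : ℕ} {E F : ℕ → A.Obj}
    (hE : A.IsExceptional fun i : Fin (N + 1) => E i)
    (hfin : ∀ X : A.Obj, ∀ i ≤ N, A.HomIsFinite X (E i)) (hF : A.IsLeftDual (N + 1) E F) :
    A.coh.DualPair N E F where
  closed := hA.closed_top (E 0)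
  fin X i hi := hfin X i hi
  lineE i hi := (hE.line ⟨i, by omega⟩).line
  zeroE i j hij hj := (hE.zero ⟨i, by omega⟩ ⟨j, by omega⟩ hij).zero
  lineF i hi := (hF.exceptional.line (OrderDual.toDual ⟨i, by omega⟩)).line
  zeroF i j hij hj := (hF.exceptional.zero (OrderDual.toDual ⟨j, by omega⟩)
    (OrderDual.toDual ⟨i, by omega⟩) hij).zero
  memE i hi := ((hF.full _).2 (.of (⟨i, by omega⟩ : Fin (N + 1)))).coh_gen hA
  memF i hi := ((hF.full _).1 (.of (⟨i, by omega⟩ : Fin (N + 1)))).coh_gen hA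
  zero i j hi hj hij := (hF.zero i (by omega) j (by omega) hij).zero
  line i hi := (hF.line i (by omega)).line

/-- The first `m` terms of a left dual collection are left dual to the first `m` terms of the
collection. -/
theorem IsLeftDual.truncate (hA : A.IsTriangulated) {N m : ℕ} (hm : 0 < m) (hmN : m ≤ N)
    {E F : ℕ → A.Obj} (hE : A.IsExceptional fun i : Fin (N + 1) => E i)
    (hfin : ∀ X : A.Obj, ∀ i ≤ N, A.HomIsFinite X (E i)) (hF : A.IsLeftDual (N + 1) E F) :
    A.IsLeftDual m E F := by
  have D := dualPair hA hE hfin hF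
  have hgE : ∀ {X : A.Obj}, A.Gen (fun i : Fin m => E i) X ↔
      A.coh.Gen (· ∈ A.coh.seg E 0 m) X :=
    gen_iff_coh_gen hA hm (D.excE (by omega)) fun X i hi => D.fin X i (by omega)
  have : NeZero m := ⟨hm.ne'⟩
  refine ⟨⟨fun i => hF.exceptional.line (OrderDual.toDual ⟨(OrderDual.ofDual i : Fin m), by omega⟩),
    fun i j hij => ?_⟩, fun X => ⟨fun hX => ?_, fun hX => ?_⟩,
    fun i hi j hj => hF.zero i (by omega) j (by omega), fun i hi => hF.line i (by omega)⟩
  · exact hF.exceptional.zero (OrderDual.toDual ⟨(OrderDual.ofDual i : Fin m), by omega⟩)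
      (OrderDual.toDual ⟨(OrderDual.ofDual j : Fin m), by omega⟩) hij
  · refine hgE.2 ((hX.coh_gen hA).mono fun Y hY => ?_)
    obtain ⟨i, -, hi, rfl⟩ := GrCat.mem_seg.1 hY
    exact D.memF_seg hi (by omega)
  · have hX' : A.coh.Gen (· ∈ (A.coh.seg F 0 m).reverse) X :=
      (hX.coh_gen hA).mono fun Y hY => by
        obtain ⟨i, -, hi, rfl⟩ := GrCat.mem_seg.1 hY
        exact (D.memE_seg hi (by omega)).mono fun Y hY => .of (List.mem_reverse.2 hY)
    refine GrCat.mem_of_gen (G := A.coh) (hA.closed_gen _) (D.excF (a := 0) (b := m) (by omega))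
      (fun X _ Y hY => D.finF (by omega) X Y (List.mem_reverse.1 hY)) (fun Y hY => ?_)
      (fun Y hY => (hY.coh_gen hA).mono fun Y hY => .of (List.mem_reverse.2 hY)) hX'
    obtain ⟨i, -, hi, rfl⟩ := GrCat.mem_seg.1 (List.mem_reverse.1 hY)
    exact .of (⟨i, hi⟩ : Fin m)

end AInfCat

/-! ### Sums over the splittings of a word -/

namespace Quiver.Path

variable {V : Type u} [Quiver.{v} V] {M : Type*} [AddCommMonoid M]

/-- The sum of `τ s t` over all ways of writing a word as a concatenation of `s` and `t`. -/
def sumSplits {X Y : V} (p : Path X Y) (τ : ∀ Z, Path X Z → Path Z Y → M) : M :=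
  (p.splits.map fun s => τ s.1 s.2.1 s.2.2).sum

variable {X Y Z : V}

@[simp]
theorem sumSplits_nil (τ : ∀ Z, Path X Z → Path Z X → M) :
    (nil : Path X X).sumSplits τ = τ X nil nil := by
  simp [sumSplits, splits]

theorem sumSplits_cons (p : Path X Y) (a : Y ⟶ Z) (τ : ∀ W, Path X W → Path W Z → M) :
    (p.cons a).sumSplits τ =
      p.sumSplits (fun W s t => τ W s (t.cons a)) + τ Z (p.cons a) nil := by
  simp [sumSplits, splits, Function.comp_def]

theorem sumSplits_congr {p : Path X Y} {τ τ' : ∀ Z, Path X Z → Path Z Y → M}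
    (h : ∀ Z s t, s.comp t = p → τ Z s t = τ' Z s t) : p.sumSplits τ = p.sumSplits τ' := by
  induction p with
  | nil => simpa using h X nil nil rfl
  | cons p a ih =>
    rw [sumSplits_cons, sumSplits_cons, ih fun Z s t hst => h Z s (t.cons a) (by rw [← hst]; rfl),
      h _ _ nil rfl]

theorem sumSplits_add (p : Path X Y) (τ τ' : ∀ Z, Path X Z → Path Z Y → M) :
    p.sumSplits (fun Z s t => τ Z s t + τ' Z s t) = p.sumSplits τ + p.sumSplits τ' := by
  induction p with
  | nil => simp
  | cons p a ih =>
    rw [sumSplits_cons, sumSplits_cons, sumSplits_cons, ih]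
    exact add_add_add_comm _ _ _ _

theorem sumSplits_zero (p : Path X Y) : p.sumSplits (fun _ _ _ => (0 : M)) = 0 := by
  induction p with
  | nil => simp
  | cons p a ih => rw [sumSplits_cons, ih, add_zero]

theorem sumSplits_eq_zero {p : Path X Y} {τ : ∀ Z, Path X Z → Path Z Y → M}
    (h : ∀ Z s t, s.comp t = p → τ Z s t = 0) : p.sumSplits τ = 0 :=
  (sumSplits_congr h).trans (sumSplits_zero p)

theorem map_sumSplits {N F : Type*} [AddCommMonoid N] [FunLike F M N] [AddMonoidHomClass F M N]
    (f : F) (p : Path X Y) (τ : ∀ Z, Path X Z → Path Z Y → M) :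
    f (p.sumSplits τ) = p.sumSplits fun Z s t => f (τ Z s t) := by
  induction p with
  | nil => simp
  | cons p a ih => rw [sumSplits_cons, sumSplits_cons, map_add, ih]

theorem smul_sumSplits {R : Type*} [DistribSMul R M] (r : R) (p : Path X Y)
    (τ : ∀ Z, Path X Z → Path Z Y → M) :
    r • p.sumSplits τ = p.sumSplits fun Z s t => r • τ Z s t :=
  map_sumSplits (DistribSMul.toAddMonoidHom M r) p τ

theorem sumSplits_neg {M : Type*} [AddCommGroup M] (p : Path X Y)
    (τ : ∀ Z, Path X Z → Path Z Y → M) :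
    p.sumSplits (fun Z s t => -τ Z s t) = -p.sumSplits τ :=
  (map_sumSplits (negAddMonoidHom : M →+ M) p τ).symm

theorem sumSplits_sub {M : Type*} [AddCommGroup M] (p : Path X Y)
    (τ τ' : ∀ Z, Path X Z → Path Z Y → M) :
    p.sumSplits (fun Z s t => τ Z s t - τ' Z s t) = p.sumSplits τ - p.sumSplits τ' := by
  simp only [sub_eq_add_neg, sumSplits_add, sumSplits_neg]

theorem sumSplits_assoc (p : Path X Y) (τ : ∀ Z W, Path X Z → Path Z W → Path W Y → M) :
    p.sumSplits (fun W s t => s.sumSplits fun Z s₁ s₂ => τ Z W s₁ s₂ t) =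
      p.sumSplits fun Z s₁ r => r.sumSplits fun W s₂ t => τ Z W s₁ s₂ t := by
  induction p with
  | nil => simp
  | cons p a ih =>
    rw [sumSplits_cons, sumSplits_cons, sumSplits_cons, ih]
    simp only [sumSplits_cons, sumSplits_nil, sumSplits_add]
    rw [add_assoc]

theorem sumSplits_of_right (p : Path X Y) {τ : ∀ Z, Path X Z → Path Z Y → M}
    (h : ∀ Z s t, s.comp t = p → t.length ≠ 0 → τ Z s t = 0) :
    p.sumSplits τ = τ Y p nil := by
  cases p with
  | nil => simp
  | cons p a =>
    rw [sumSplits_cons, sumSplits_eq_zero, zero_add]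
    exact fun Z s t hst => h _ _ _ (by rw [← hst]; rfl) (by simp)

theorem sumSplits_of_left (p : Path X Y) {τ : ∀ Z, Path X Z → Path Z Y → M}
    (h : ∀ Z s t, s.comp t = p → s.length ≠ 0 → τ Z s t = 0) :
    p.sumSplits τ = τ X nil p := by
  induction p with
  | nil => simp
  | cons p a ih =>
    rw [sumSplits_cons, ih fun Z s t hst => h _ _ _ (by rw [← hst]; rfl), h _ _ nil rfl (by simp),
      add_zero]

theorem length_of_comp_eq {p : Path X Y} {s : Path X Z} {t : Path Z Y} (h : s.comp t = p) :
    s.length + t.length = p.length := by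
  rw [← h, length_comp]

end Quiver.Path

/-! ### The tensor coalgebra of a graded quiver -/

namespace GQuiver

open Quiver (Path)

variable (Q : GQuiver.{w, v, u} k)

/-- The relations of multilinearity between formal linear combinations of words. -/
noncomputable def wordRel (X Y : Q.Obj) : Submodule k (Path X Y →₀ k) :=
  Submodule.span k
    ({x | ∃ (Z W : Q.Obj) (p : Path X Z) (a b : Q.Tot Z W) (q : Path W Y),
      x = Finsupp.single ((p.cons (a + b : Q.Tot Z W)).comp q) 1 -
        Finsupp.single ((p.cons (a : Q.Tot Z W)).comp q) 1 -
        Finsupp.single ((p.cons (b : Q.Tot Z W)).comp q) 1} ∪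
    {x | ∃ (Z W : Q.Obj) (p : Path X Z) (r : k) (a : Q.Tot Z W) (q : Path W Y),
      x = Finsupp.single ((p.cons (r • a : Q.Tot Z W)).comp q) 1 -
        r • Finsupp.single ((p.cons (a : Q.Tot Z W)).comp q) 1})

/-- The sum of the tensor products of morphism spaces along all words from `X` to `Y`. -/
def Words (X Y : Q.Obj) : Type _ := (Path X Y →₀ k) ⧸ Q.wordRel X Y

noncomputable instance (X Y : Q.Obj) : AddCommGroup (Q.Words X Y) :=
  inferInstanceAs (AddCommGroup ((Path X Y →₀ k) ⧸ Q.wordRel X Y))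

noncomputable instance (X Y : Q.Obj) : Module k (Q.Words X Y) :=
  inferInstanceAs (Module k ((Path X Y →₀ k) ⧸ Q.wordRel X Y))

/-- Multilinear functions on words. -/
structure IsMultilinear {X Y : Q.Obj} {M : Type*} [AddCommGroup M] [Module k M]
    (f : Path X Y → M) : Prop where
  map_add : ∀ {Z W : Q.Obj} (p : Path X Z) (a b : Q.Tot Z W) (q : Path W Y),
    f ((p.cons (a + b : Q.Tot Z W)).comp q) =
      f ((p.cons (a : Q.Tot Z W)).comp q) + f ((p.cons (b : Q.Tot Z W)).comp q)
  map_smul : ∀ {Z W : Q.Obj} (p : Path X Z) (r : k) (a : Q.Tot Z W) (q : Path W Y),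
    f ((p.cons (r • a : Q.Tot Z W)).comp q) = r • f ((p.cons (a : Q.Tot Z W)).comp q)

namespace Words

variable {Q} {X Y Z : Q.Obj} {M : Type*} [AddCommGroup M] [Module k M]

/-- The class of a word. -/
noncomputable def of (p : Path X Y) : Q.Words X Y :=
  (Q.wordRel X Y).mkQ (Finsupp.single p 1)

theorem isMultilinear_of : Q.IsMultilinear (of : Path X Y → Q.Words X Y) where
  map_add p a b q := by
    have h : (Q.wordRel X Y).mkQ _ = 0 := (Submodule.Quotient.mk_eq_zero _).2
      (Submodule.subset_span (.inl ⟨_, _, p, a, b, q, rfl⟩))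
    rw [map_sub, map_sub, sub_sub, sub_eq_zero] at h
    exact h
  map_smul p r a q := by
    have h : (Q.wordRel X Y).mkQ _ = 0 := (Submodule.Quotient.mk_eq_zero _).2
      (Submodule.subset_span (.inr ⟨_, _, p, r, a, q, rfl⟩))
    rw [map_sub, map_smul, sub_eq_zero] at h
    exact h

/-- The linear map defined by a multilinear function on words. -/
noncomputable def lift (f : Path X Y → M) (hf : Q.IsMultilinear f) : Q.Words X Y →ₗ[k] M :=
  (Q.wordRel X Y).liftQ (Finsupp.linearCombination k f) (Submodule.span_le.2 (by
    rintro x (⟨Z, W, p, a, b, q, rfl⟩ | ⟨Z, W, p, r, a, q, rfl⟩)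
    · simp [hf.map_add]
    · simp [hf.map_smul]))

@[simp]
theorem lift_of (f : Path X Y → M) (hf : Q.IsMultilinear f) (p : Path X Y) :
    lift f hf (of p) = f p := by
  refine ((Q.wordRel X Y).liftQ_apply _ _).trans ?_
  simp

theorem hom_ext {f g : Q.Words X Y →ₗ[k] M} (h : ∀ p, f (of p) = g (of p)) : f = g := by
  refine Submodule.linearMap_qext _ (Finsupp.lhom_ext' fun p => LinearMap.ext_ring ?_)
  exact h p

theorem induction_on {P : Q.Words X Y → Prop} (x : Q.Words X Y) (h : ∀ p, P (of p))
    (h₀ : P 0) (hadd : ∀ x y, P x → P y → P (x + y)) (hsmul : ∀ (r : k) x, P x → P (r • x)) :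
    P x := by
  obtain ⟨x, rfl⟩ := Submodule.Quotient.mk_surjective _ x
  induction x using Finsupp.induction_linear with
  | zero => exact h₀
  | add x y hx hy => exact hadd _ _ hx hy
  | single p r =>
    have := hsmul r _ (h p)
    have e : (Finsupp.single p r : Path X Y →₀ k) = r • Finsupp.single p 1 := by simp
    rw [e]
    exact this

theorem _root_.GQuiver.IsMultilinear.comp {N : Type*} [AddCommGroup N] [Module k N]
    {f : Path X Y → M} (hf : Q.IsMultilinear f) (g : M →ₗ[k] N) :
    Q.IsMultilinear fun p => g (f p) where
  map_add p a b q := by rw [hf.map_add, map_add]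
  map_smul p r a q := by rw [hf.map_smul, map_smul]

theorem _root_.GQuiver.IsMultilinear.add {f g : Path X Y → M} (hf : Q.IsMultilinear f)
    (hg : Q.IsMultilinear g) : Q.IsMultilinear fun p => f p + g p where
  map_add p a b q := by rw [hf.map_add, hg.map_add, add_add_add_comm]
  map_smul p r a q := by rw [hf.map_smul, hg.map_smul, smul_add]

/-- The empty word. -/
noncomputable def one (X : Q.Obj) : Q.Words X X := of .nil

/-- A morphism as a word with one letter. -/
noncomputable def letter (X Y : Q.Obj) : Q.Tot X Y →ₗ[k] Q.Words X Y where
  toFun a := of (Path.nil.cons (a : Q.Tot X Y))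
  map_add' a b := isMultilinear_of.map_add .nil a b .nil
  map_smul' r a := isMultilinear_of.map_smul .nil r a .nil

theorem isMultilinear_comp_left (p : Path X Y) {f : Path X Z → M} (hf : Q.IsMultilinear f) :
    Q.IsMultilinear fun q : Path Y Z => f (p.comp q) where
  map_add p' a b q := by
    have := hf.map_add (p.comp p') a b q
    simpa only [← Path.comp_assoc, Path.comp_cons] using this
  map_smul p' r a q := by
    have := hf.map_smul (p.comp p') r a q
    simpa only [← Path.comp_assoc, Path.comp_cons] using this

theorem isMultilinear_comp_right (q : Path Y Z) {f : Path X Z → M} (hf : Q.IsMultilinear f) :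
    Q.IsMultilinear fun p : Path X Y => f (p.comp q) where
  map_add p a b q' := by simpa only [Path.comp_assoc] using hf.map_add p a b (q'.comp q)
  map_smul p r a q' := by simpa only [Path.comp_assoc] using hf.map_smul p r a (q'.comp q)

/-- Concatenation of words. -/
noncomputable def conc (X Y Z : Q.Obj) : Q.Words X Y →ₗ[k] Q.Words Y Z →ₗ[k] Q.Words X Z :=
  lift (fun p => lift (fun q => of (p.comp q)) (isMultilinear_comp_left p isMultilinear_of))
    { map_add := fun p a b q => hom_ext fun q' => by
        simpa using (isMultilinear_comp_right q' isMultilinear_of).map_add p a b q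
      map_smul := fun p r a q => hom_ext fun q' => by
        simpa using (isMultilinear_comp_right q' isMultilinear_of).map_smul p r a q }

@[simp]
theorem conc_of (p : Path X Y) (q : Path Y Z) : conc X Y Z (of p) (of q) = of (p.comp q) := by
  simp [conc]

theorem conc_letter (p : Path X Y) (a : Y ⟶ Z) :
    conc X Y Z (of p) (letter Y Z a) = of (p.cons a) := conc_of _ _

theorem conc_assoc {W : Q.Obj} (x : Q.Words W X) (y : Q.Words X Y) (z : Q.Words Y Z) :
    conc W Y Z (conc W X Y x y) z = conc W X Z x (conc X Y Z y z) := by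
  induction x using induction_on with
  | h p =>
    induction y using induction_on with
    | h q =>
      induction z using induction_on with
      | h r => simp
      | h₀ => simp
      | hadd z z' h h' => simp only [map_add, h, h']
      | hsmul r z h => simp only [map_smul, h]
    | h₀ => simp
    | hadd y y' h h' => simp only [map_add, LinearMap.add_apply, h, h']
    | hsmul r y h => simp only [map_smul, LinearMap.smul_apply, h]
  | h₀ => simp
  | hadd x x' h h' => simp only [map_add, LinearMap.add_apply, h, h']
  | hsmul r x h => simp only [map_smul, LinearMap.smul_apply, h]

theorem one_conc (x : Q.Words X Y) : conc X X Y (one X) x = x := by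
  have : conc X X Y (one X) = LinearMap.id := hom_ext fun p => by simp [one]
  rw [this, LinearMap.id_apply]

theorem conc_one (x : Q.Words X Y) : conc X Y Y x (one Y) = x := by
  have : (conc X Y Y).flip (one Y) = LinearMap.id := hom_ext fun p => by simp [one]
  exact LinearMap.congr_fun this x

/-- Composition of linear functions on words with deconcatenation. -/
noncomputable def split (φ : ∀ Z, Q.Words X Z →ₗ[k] Q.Words Z Y →ₗ[k] M) :
    Q.Words X Y →ₗ[k] M :=
  lift (fun p => p.sumSplits fun Z s t => φ Z (of s) (of t)) (by
    have key : ∀ {W Y' Z' : Q.Obj} (p : Path X W) (q : Path Z' Y')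
        (φ : ∀ Z, Q.Words X Z →ₗ[k] Q.Words Z Y' →ₗ[k] M),
        (∀ a b : Q.Tot W Z', (((p.cons (a + b : Q.Tot W Z')).comp q).sumSplits fun Z s t =>
          φ Z (of s) (of t)) = (((p.cons (a : Q.Tot W Z')).comp q).sumSplits fun Z s t =>
          φ Z (of s) (of t)) + (((p.cons (b : Q.Tot W Z')).comp q).sumSplits fun Z s t =>
          φ Z (of s) (of t))) ∧
        ∀ (r : k) (a : Q.Tot W Z'),
          (((p.cons (r • a : Q.Tot W Z')).comp q).sumSplits fun Z s t =>
            φ Z (of s) (of t)) = r • (((p.cons (a : Q.Tot W Z')).comp q).sumSplits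
              fun Z s t => φ Z (of s) (of t)) := by
      intro W Y' Z' p q
      induction q with
      | nil =>
        intro φ
        have h₁ : ∀ {U : Q.Obj} (s : Path X U) (t : Path U W) (a b : Q.Tot W Z'),
            φ U (of s) (of (t.cons (a + b : Q.Tot W Z'))) =
              φ U (of s) (of (t.cons (a : Q.Tot W Z'))) +
                φ U (of s) (of (t.cons (b : Q.Tot W Z'))) := fun s t a b => by
          rw [← map_add]
          exact congrArg _ (isMultilinear_of.map_add t a b .nil)
        have h₂ : ∀ {U : Q.Obj} (s : Path X U) (t : Path U W) (r : k) (a : Q.Tot W Z'),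
            φ U (of s) (of (t.cons (r • a : Q.Tot W Z'))) =
              r • φ U (of s) (of (t.cons (a : Q.Tot W Z'))) := fun s t r a => by
          rw [← map_smul]
          exact congrArg _ (isMultilinear_of.map_smul t r a .nil)
        have h₃ := fun a b : Q.Tot W Z' => isMultilinear_of.map_add p a b .nil
        have h₄ := fun (r : k) (a : Q.Tot W Z') => isMultilinear_of.map_smul p r a .nil
        simp only [Path.comp_nil] at h₃ h₄
        refine ⟨fun a b => ?_, fun r a => ?_⟩
        · simp only [Path.comp_nil, Path.sumSplits_cons, h₁, h₃, Path.sumSplits_add, map_add,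
            LinearMap.add_apply]
          exact add_add_add_comm _ _ _ _
        · simp only [Path.comp_nil, Path.sumSplits_cons, h₂, h₄, map_smul,
            LinearMap.smul_apply, smul_add]
          rw [Path.smul_sumSplits]
      | @cons U U' q c ih =>
        intro φ
        let ψ : ∀ Z, Q.Words X Z →ₗ[k] Q.Words Z U →ₗ[k] M := fun Z =>
          (φ Z).compl₂ ((conc Z U U').flip (letter U U' c))
        have hψ : ∀ (Z : Q.Obj) (s : Path X Z) (t : Path Z U),
            φ Z (of s) (of (t.cons c)) = ψ Z (of s) (of t) := fun Z s t =>
          congrArg (φ Z (of s)) (conc_letter t c).symm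
        obtain ⟨h₁, h₂⟩ := ih ψ
        refine ⟨fun a b => ?_, fun r a => ?_⟩
        · have := isMultilinear_of.map_add p a b (q.cons c)
          simp only [Path.comp_cons] at this
          simp only [Path.comp_cons, Path.sumSplits_cons, hψ, h₁, this, map_add,
            LinearMap.add_apply]
          exact add_add_add_comm _ _ _ _
        · have := isMultilinear_of.map_smul p r a (q.cons c)
          simp only [Path.comp_cons] at this
          simp only [Path.comp_cons, Path.sumSplits_cons, hψ, h₂, this, map_smul,
            LinearMap.smul_apply, smul_add]
    exact ⟨fun p a b q => (key p q φ).1 a b, fun p r a q => (key p q φ).2 r a⟩)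

@[simp]
theorem split_of (φ : ∀ Z, Q.Words X Z →ₗ[k] Q.Words Z Y →ₗ[k] M) (p : Path X Y) :
    split φ (of p) = p.sumSplits fun Z s t => φ Z (of s) (of t) := lift_of _ _ _

theorem split_one (φ : ∀ Z, Q.Words X Z →ₗ[k] Q.Words Z X →ₗ[k] M) :
    split φ (one X) = φ X (one X) (one X) := by
  simp [one]

/-- Deconcatenation of a word followed by a letter. -/
theorem split_conc_letter (φ : ∀ W, Q.Words X W →ₗ[k] Q.Words W Z →ₗ[k] M) (x : Q.Words X Y)
    (a : Q.Tot Y Z) :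
    split φ (conc X Y Z x (letter Y Z a)) =
      split (fun W => (φ W).compl₂ ((conc W Y Z).flip (letter Y Z a))) x +
        φ Z (conc X Y Z x (letter Y Z a)) (one Z) := by
  have : split φ ∘ₗ (conc X Y Z).flip (letter Y Z a) =
      split (fun W => (φ W).compl₂ ((conc W Y Z).flip (letter Y Z a))) +
        (φ Z).flip (one Z) ∘ₗ (conc X Y Z).flip (letter Y Z a) := hom_ext fun p => by
    have h := conc_letter p (a : Q.Tot Y Z)
    have h' := fun {W : Q.Obj} (t : Path W Y) => conc_letter t (a : Q.Tot Y Z)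
    simp only [LinearMap.comp_apply, LinearMap.flip_apply, LinearMap.add_apply, split_of,
      LinearMap.compl₂_apply]
    simp only [h, h', split_of, Path.sumSplits_cons, one]
  exact LinearMap.congr_fun this x

end Words

end GQuiver

namespace GQuiver

open Quiver (Path)

variable {Q : GQuiver.{w, v, u} k}

namespace Words

variable {X Y Z : Q.Obj}

/-! ### The reduced part and the projection to letters -/

variable (Q) in
/-- The span of the nonempty words. -/
noncomputable def reduced (X Y : Q.Obj) : Submodule k (Q.Words X Y) :=
  Submodule.span k {x | ∃ p : Path X Y, p.length ≠ 0 ∧ of p = x}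

theorem of_mem_reduced {p : Path X Y} (h : p.length ≠ 0) : of p ∈ reduced Q X Y :=
  Submodule.subset_span ⟨p, h, rfl⟩

theorem letter_mem_reduced (a : Q.Tot X Y) : letter X Y a ∈ reduced Q X Y :=
  of_mem_reduced (by simp)

theorem conc_mem_reduced_left {x : Q.Words X Y} (hx : x ∈ reduced Q X Y) (y : Q.Words Y Z) :
    conc X Y Z x y ∈ reduced Q X Z := by
  induction hx using Submodule.span_induction with
  | mem x h =>
    obtain ⟨p, hp, rfl⟩ := h
    induction y using induction_on with
    | h q => rw [conc_of]; exact of_mem_reduced (by rw [Path.length_comp]; omega)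
    | h₀ => rw [map_zero]; exact zero_mem _
    | hadd y y' h h' => rw [map_add]; exact add_mem h h'
    | hsmul r y h => rw [map_smul]; exact Submodule.smul_mem _ _ h
  | zero => rw [LinearMap.map_zero₂]; exact zero_mem _
  | add x x' _ _ h h' => rw [LinearMap.map_add₂]; exact add_mem h h'
  | smul r x _ h => rw [LinearMap.map_smul₂]; exact Submodule.smul_mem _ _ h

theorem conc_mem_reduced_right (x : Q.Words X Y) {y : Q.Words Y Z} (hy : y ∈ reduced Q Y Z) :
    conc X Y Z x y ∈ reduced Q X Z := by
  induction hy using Submodule.span_induction with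
  | mem y h =>
    obtain ⟨p, hp, rfl⟩ := h
    induction x using induction_on with
    | h q => rw [conc_of]; exact of_mem_reduced (by rw [Path.length_comp]; omega)
    | h₀ => rw [LinearMap.map_zero₂]; exact zero_mem _
    | hadd x x' h h' => rw [LinearMap.map_add₂]; exact add_mem h h'
    | hsmul r x h => rw [LinearMap.map_smul₂]; exact Submodule.smul_mem _ _ h
  | zero => rw [map_zero]; exact zero_mem _
  | add y y' _ _ h h' => rw [map_add]; exact add_mem h h'
  | smul r y _ h => rw [map_smul]; exact Submodule.smul_mem _ _ h

/-- The letter of a word of length one, and zero for other words. -/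
def prPath {X : Q.Obj} : {Y : Q.Obj} → Path X Y → Q.Tot X Y
  | _, .nil => 0
  | _, .cons .nil a => a
  | _, .cons (.cons _ _) _ => 0

theorem prPath_of_length {p : Path X Y} (h : p.length ≠ 1) : prPath p = 0 := by
  match p, h with
  | .nil, _ => rfl
  | .cons .nil a, h => simp at h
  | .cons (.cons _ _) _, _ => rfl

theorem prPath_comp_cons {W : Q.Obj} (p : Path X Z) (a : Q.Tot Z W) (q : Path W Y)
    (h : p.length + q.length ≠ 0) : prPath ((p.cons a).comp q) = 0 :=
  prPath_of_length (by rw [Path.length_comp, Path.length_cons]; omega)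

/-- The projection from words to letters. -/
noncomputable def pr (X Y : Q.Obj) : Q.Words X Y →ₗ[k] Q.Tot X Y :=
  lift prPath
    { map_add := fun {Z W} p a b q => by
        by_cases h : p.length + q.length = 0
        · cases q with
          | nil =>
            cases p with
            | nil => rfl
            | cons p c => simp at h
          | cons q c => simp at h
        · rw [prPath_comp_cons p (a + b) q h, prPath_comp_cons p a q h, prPath_comp_cons p b q h,
            add_zero]
      map_smul := fun {Z W} p r a q => by
        by_cases h : p.length + q.length = 0
        · cases q with
          | nil =>
            cases p with
            | nil => rfl
            | cons p c => simp at h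
          | cons q c => simp at h
        · rw [prPath_comp_cons p (r • a) q h, prPath_comp_cons p a q h, smul_zero] }

theorem pr_of_length {p : Path X Y} (h : p.length ≠ 1) : pr X Y (of p) = 0 :=
  (lift_of _ _ _).trans (prPath_of_length h)

theorem pr_letter (a : Q.Tot X Y) : pr X Y (letter X Y a) = a := lift_of _ _ _

theorem pr_conc {x : Q.Words X Y} (hx : x ∈ reduced Q X Y) {y : Q.Words Y Z}
    (hy : y ∈ reduced Q Y Z) : pr X Z (conc X Y Z x y) = 0 := by
  induction hx using Submodule.span_induction with
  | mem x h =>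
    obtain ⟨p, hp, rfl⟩ := h
    induction hy using Submodule.span_induction with
    | mem y h =>
      obtain ⟨q, hq, rfl⟩ := h
      rw [conc_of, pr_of_length]
      rw [Path.length_comp]
      omega
    | zero => rw [map_zero, map_zero]
    | add y y' _ _ h h' => rw [map_add, map_add, h, h', add_zero]
    | smul r y _ h => rw [map_smul, map_smul, h, smul_zero]
  | zero => rw [LinearMap.map_zero₂, map_zero]
  | add x x' _ _ h h' => rw [LinearMap.map_add₂, map_add, h, h', add_zero]
  | smul r x _ h => rw [LinearMap.map_smul₂, map_smul, h, smul_zero]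

theorem sumSplits_pr {M : Type*} [AddCommMonoid M] (p : Path X Y) (a : Q.Tot Y Z)
    (τ : ∀ W, Path X W → Q.Tot W Z → M) (hτ : ∀ W s, τ W s 0 = 0) :
    (p.sumSplits fun W s t => τ W s (pr W Z (of (t.cons a)))) = τ Y p a := by
  rw [Path.sumSplits_of_right]
  · exact congrArg (τ Y p) (pr_letter a)
  · intro W s t _ ht
    rw [pr_of_length (by rw [Path.length_cons]; omega), hτ]

/-- A reduced element is recovered by splitting off the last letter. -/
theorem split_last {x : Q.Words X Y} (hx : x ∈ reduced Q X Y) :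
    split (fun Z => (conc X Z Y).compl₂ (letter Z Y ∘ₗ pr Z Y)) x = x := by
  induction hx using Submodule.span_induction with
  | mem x h =>
    obtain ⟨p, hp, rfl⟩ := h
    cases p with
    | nil => simp at hp
    | cons p a =>
      simp only [split_of, Path.sumSplits_cons, LinearMap.compl₂_apply, LinearMap.comp_apply]
      rw [pr_of_length (p := Path.nil) (by simp), map_zero, map_zero, add_zero]
      refine (sumSplits_pr p a (fun W s c => conc X W _ (of s) (letter W _ c)) fun W s => ?_).trans
        (conc_letter p a)
      rw [map_zero, map_zero]
  | zero => rw [map_zero]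
  | add x x' _ _ h h' => rw [map_add, h, h']
  | smul r x _ h => rw [map_smul, h]

/-! ### Cohomomorphisms and coderivations -/

section Coalgebra

variable {i j l r : Q.Obj → Q.Obj}

/-- Linear maps on words which are compatible with deconcatenation. -/
def IsComult (F : ∀ X Y, Q.Words X Y →ₗ[k] Q.Words (j X) (j Y)) : Prop :=
  ∀ {X Y : Q.Obj} {M : Type (max u v w)} [AddCommGroup M] [Module k M]
    (φ : ∀ Z, Q.Words (j X) Z →ₗ[k] Q.Words Z (j Y) →ₗ[k] M) (p : Path X Y),
    split φ (F X Y (of p)) = p.sumSplits fun Z s t => φ (j Z) (F X Z (of s)) (F Z Y (of t))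

/-- The cohomomorphism `G` with components `g`: it maps a word to the sum, over all ways of
cutting it into nonempty blocks, of the words obtained by applying `g` to the blocks. -/
structure IsHat (G : ∀ X Y, Q.Words X Y →ₗ[k] Q.Words (j X) (j Y))
    (g : ∀ X Y, Q.Words X Y →ₗ[k] Q.Tot (j X) (j Y)) : Prop where
  map_one : ∀ X, G X X (one X) = one (j X)
  map_cons : ∀ {X Y Z : Q.Obj} (p : Path X Y) (a : Q.Tot Y Z), G X Z (of (p.cons a)) =
    p.sumSplits fun W s t => conc (j X) (j W) (j Z) (G X W (of s))
      (letter (j W) (j Z) (g W Z (of (t.cons a))))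

/-- `(F, G)`-coderivations. -/
def IsCoder (F : ∀ X Y, Q.Words X Y →ₗ[k] Q.Words (j X) (j Y))
    (K : ∀ X Y, Q.Words X Y →ₗ[k] Q.Words (j X) (l Y))
    (G : ∀ X Y, Q.Words X Y →ₗ[k] Q.Words (l X) (l Y)) : Prop :=
  ∀ {X Y : Q.Obj} {M : Type (max u v w)} [AddCommGroup M] [Module k M]
    (φ : ∀ Z, Q.Words (j X) Z →ₗ[k] Q.Words Z (l Y) →ₗ[k] M) (p : Path X Y),
    split φ (K X Y (of p)) = (p.sumSplits fun Z s t => φ (j Z) (F X Z (of s)) (K Z Y (of t))) +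
      p.sumSplits fun Z s t => φ (l Z) (K X Z (of s)) (G Z Y (of t))

/-- A cohomomorphism is compatible with deconcatenation: a way of cutting a word into blocks,
together with a cut of the resulting word, is a cut of the original word, together with ways of
cutting both parts into blocks. -/
theorem IsHat.comult {G : ∀ X Y, Q.Words X Y →ₗ[k] Q.Words (j X) (j Y)}
    {g : ∀ X Y, Q.Words X Y →ₗ[k] Q.Tot (j X) (j Y)} (h : IsHat G g) : IsComult G := by
  suffices ∀ (n : ℕ) {X Y : Q.Obj} {M : Type (max u v w)} [AddCommGroup M] [Module k M]
      (φ : ∀ Z, Q.Words (j X) Z →ₗ[k] Q.Words Z (j Y) →ₗ[k] M) (p : Path X Y), p.length = n →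
      split φ (G X Y (of p)) =
        p.sumSplits fun Z s t => φ (j Z) (G X Z (of s)) (G Z Y (of t)) from
    fun {X Y M} _ _ φ p => this _ φ p rfl
  intro n
  induction n using Nat.strong_induction_on with
  | _ n ih =>
    intro X Y M _ _ φ p hp
    cases p with
    | nil =>
      have h1 := h.map_one X
      rw [one] at h1
      rw [h1, Path.sumSplits_nil, h1]
      exact split_one φ
    | @cons Y' _ p a =>
      rw [h.map_cons, Path.map_sumSplits (split φ)]
      simp only [split_conc_letter]
      have e : (p.sumSplits fun W s t => φ (j Y) (conc (j X) (j W) (j Y) (G X W (of s))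
          (letter (j W) (j Y) (g W Y (of (t.cons a))))) (one (j Y))) =
          φ (j Y) (G X Y (of (p.cons a))) (one (j Y)) := by
        rw [h.map_cons]
        exact (Path.map_sumSplits ((φ (j Y)).flip (one (j Y))) p _).symm
      rw [Path.sumSplits_add, e, Path.sumSplits_cons]
      congr 1
      · rw [Path.sumSplits_congr (fun W s t hst => ih s.length (by
          have := Path.length_of_comp_eq hst
          rw [Path.length_cons] at hp
          omega) _ s rfl)]
        simp only [LinearMap.compl₂_apply, LinearMap.flip_apply]
        rw [Path.sumSplits_assoc p (fun Z W s₁ s₂ t => φ (j Z) (G X Z (of s₁))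
          (conc (j Z) (j W) (j Y) (G Z W (of s₂)) (letter (j W) (j Y) (g W Y (of (t.cons a))))))]
        refine Path.sumSplits_congr fun Z s₁ q _ => ?_
        rw [h.map_cons, Path.map_sumSplits (φ (j Z) (G X Z (of s₁)))]
      · exact congrArg _ (h.map_one Y).symm

/-- The composite of `F` and `c`. -/
noncomputable def convLetter (F : ∀ X Y, Q.Words X Y →ₗ[k] Q.Words (j X) (j Y))
    (c : ∀ X Y, Q.Words X Y →ₗ[k] Q.Tot (j X) (l Y)) (X Y : Q.Obj) :
    Q.Words X Y →ₗ[k] Q.Words (j X) (l Y) :=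
  split fun Z => (conc (j X) (j Z) (l Y)).compl₁₂ (F X Z) (letter (j Z) (l Y) ∘ₗ c Z Y)

theorem convLetter_of (F : ∀ X Y, Q.Words X Y →ₗ[k] Q.Words (j X) (j Y))
    (c : ∀ X Y, Q.Words X Y →ₗ[k] Q.Tot (j X) (l Y)) (p : Path X Y) :
    convLetter F c X Y (of p) = p.sumSplits fun Z s t => conc (j X) (j Z) (l Y) (F X Z (of s))
      (letter (j Z) (l Y) (c Z Y (of t))) := split_of _ _

/-- The `(F, G)`-coderivation with component `c`: a word is mapped to the sum, over all ways of
writing it as a concatenation of three words, of the results of applying `F`, `c` and `G`. -/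
noncomputable def coder (F : ∀ X Y, Q.Words X Y →ₗ[k] Q.Words (j X) (j Y))
    (c : ∀ X Y, Q.Words X Y →ₗ[k] Q.Tot (j X) (l Y))
    (G : ∀ X Y, Q.Words X Y →ₗ[k] Q.Words (l X) (l Y)) (X Y : Q.Obj) :
    Q.Words X Y →ₗ[k] Q.Words (j X) (l Y) :=
  split fun Z => (conc (j X) (l Z) (l Y)).compl₁₂ (convLetter F c X Z) (G Z Y)

variable {F : ∀ X Y, Q.Words X Y →ₗ[k] Q.Words (j X) (j Y)}
  {c : ∀ X Y, Q.Words X Y →ₗ[k] Q.Tot (j X) (l Y)}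
  {G : ∀ X Y, Q.Words X Y →ₗ[k] Q.Words (l X) (l Y)}

theorem coder_of (p : Path X Y) : coder F c G X Y (of p) =
    p.sumSplits fun Z s t => conc (j X) (l Z) (l Y) (convLetter F c X Z (of s)) (G Z Y (of t)) :=
  split_of _ _

theorem coder_of' (p : Path X Y) : coder F c G X Y (of p) =
    p.sumSplits fun Z s r => r.sumSplits fun W t q => conc (j X) (l W) (l Y)
      (conc (j X) (j Z) (l W) (F X Z (of s)) (letter (j Z) (l W) (c Z W (of t))))
      (G W Y (of q)) := by
  rw [coder_of, ← Path.sumSplits_assoc p (fun Z W s t q => conc (j X) (l W) (l Y)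
      (conc (j X) (j Z) (l W) (F X Z (of s)) (letter (j Z) (l W) (c Z W (of t))))
      (G W Y (of q)))]
  refine Path.sumSplits_congr fun Z s t _ => ?_
  rw [convLetter_of]
  exact Path.map_sumSplits ((conc (j X) (l Z) (l Y)).flip (G Z Y (of t))) _ _

theorem split_convLetter (hF : IsComult F) {M : Type (max u v w)} [AddCommGroup M] [Module k M]
    (φ : ∀ Z, Q.Words (j X) Z →ₗ[k] Q.Words Z (l Y) →ₗ[k] M) (p : Path X Y) :
    split φ (convLetter F c X Y (of p)) =
      (p.sumSplits fun Z s t => φ (j Z) (F X Z (of s)) (convLetter F c Z Y (of t))) +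
        φ (l Y) (convLetter F c X Y (of p)) (one (l Y)) := by
  rw [convLetter_of, Path.map_sumSplits (split φ)]
  simp only [split_conc_letter]
  rw [Path.sumSplits_add]
  congr 1
  · simp only [hF _ _, LinearMap.compl₂_apply, LinearMap.flip_apply]
    rw [Path.sumSplits_assoc p (fun Z W s₁ s₂ t => φ (j Z) (F X Z (of s₁))
          (conc (j Z) (j W) (l Y) (F Z W (of s₂)) (letter (j W) (l Y) (c W Y (of t)))))]
    refine Path.sumSplits_congr fun Z s₁ q _ => ?_
    rw [convLetter_of, Path.map_sumSplits (φ (j Z) (F X Z (of s₁)))]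
  · exact (Path.map_sumSplits ((φ (l Y)).flip (one (l Y))) p _).symm

theorem coder_one {g : ∀ X Y, Q.Words X Y →ₗ[k] Q.Tot (l X) (l Y)} (hG : IsHat G g) (X : Q.Obj) :
    coder F c G X X (one X) = convLetter F c X X (one X) := by
  have h1 := hG.map_one X
  rw [one] at h1 ⊢
  rw [coder_of, Path.sumSplits_nil, h1]
  exact conc_one _

theorem coder_cons {g : ∀ X Y, Q.Words X Y →ₗ[k] Q.Tot (l X) (l Y)} (hG : IsHat G g)
    (p : Path X Y) (a : Q.Tot Y Z) : coder F c G X Z (of (p.cons a)) =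
      (p.sumSplits fun W s t => conc (j X) (l W) (l Z) (coder F c G X W (of s))
        (letter (l W) (l Z) (g W Z (of (t.cons a))))) + convLetter F c X Z (of (p.cons a)) := by
  have h1 := hG.map_one Z
  rw [one] at h1
  rw [coder_of, Path.sumSplits_cons, h1]
  congr 1
  · simp only [hG.map_cons, Path.map_sumSplits (conc _ _ _ _), ← conc_assoc]
    rw [← Path.sumSplits_assoc p (fun U W s₁ s₂ t => conc (j X) (l W) (l Z)
      (conc (j X) (l U) (l W) (convLetter F c X U (of s₁)) (G U W (of s₂)))
      (letter (l W) (l Z) (g W Z (of (t.cons a)))))]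
    refine Path.sumSplits_congr fun W s t _ => ?_
    rw [coder_of]
    exact (Path.map_sumSplits ((conc (j X) (l W) (l Z)).flip
      (letter (l W) (l Z) (g W Z (of (t.cons a))))) _ _).symm
  · exact conc_one _

/-- A cut of a word falls before or after the letter to which `c` contributed, and these two kinds of
cuts give the two terms of the co-Leibniz rule. -/
theorem isCoder_coder (hF : IsComult F) {g : ∀ X Y, Q.Words X Y →ₗ[k] Q.Tot (l X) (l Y)}
    (hG : IsHat G g) : IsCoder F (coder F c G) G := by
  suffices ∀ (n : ℕ) {X Y : Q.Obj} {M : Type (max u v w)} [AddCommGroup M] [Module k M]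
      (φ : ∀ Z, Q.Words (j X) Z →ₗ[k] Q.Words Z (l Y) →ₗ[k] M) (p : Path X Y), p.length = n →
      split φ (coder F c G X Y (of p)) =
      (p.sumSplits fun Z s t => φ (j Z) (F X Z (of s)) (coder F c G Z Y (of t))) +
      p.sumSplits fun Z s t => φ (l Z) (coder F c G X Z (of s)) (G Z Y (of t)) from
    fun {X Y M} _ _ φ p => this _ φ p rfl
  intro n
  induction n using Nat.strong_induction_on with
  | _ n ih =>
    intro X Y M _ _ φ p hp
    cases p with
    | nil =>
      have h1 := hG.map_one X
      have h2 := coder_one (F := F) (c := c) hG X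
      have h3 := split_convLetter (c := c) hF φ Path.nil
      rw [Path.sumSplits_nil] at h3
      rw [one] at h1 h2
      rw [Path.sumSplits_nil, Path.sumSplits_nil, h2, h3, h1]
    | @cons Y' _ p a =>
      have h1 := hG.map_one Y
      rw [one] at h1
      have h2 := coder_one (F := F) (c := c) hG Y
      rw [one] at h2
      rw [coder_cons hG, map_add, Path.map_sumSplits (split φ)]
      simp only [split_conc_letter]
      rw [Path.sumSplits_add, split_convLetter hF φ]
      have e₁ : (p.sumSplits fun W s t => split (fun U => (φ U).compl₂ ((conc U (l W) (l Y)).flip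
          (letter (l W) (l Y) (g W Y (of (t.cons a)))))) (coder F c G X W (of s))) =
          (p.sumSplits fun Z s₁ q => φ (j Z) (F X Z (of s₁))
            (q.sumSplits fun W s t => conc (j Z) (l W) (l Y) (coder F c G Z W (of s))
              (letter (l W) (l Y) (g W Y (of (t.cons a)))))) +
          p.sumSplits fun Z s₁ q => φ (l Z) (coder F c G X Z (of s₁)) (G Z Y (of (q.cons a))) := by
        rw [Path.sumSplits_congr (fun W s t hst => ih s.length (by
          have := Path.length_of_comp_eq hst
          rw [Path.length_cons] at hp
          omega) _ s rfl), Path.sumSplits_add]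
        simp only [LinearMap.compl₂_apply, LinearMap.flip_apply]
        congr 1
        · rw [Path.sumSplits_assoc p (fun Z W s₁ s₂ t => φ (j Z) (F X Z (of s₁))
            (conc (j Z) (l W) (l Y) (coder F c G Z W (of s₂))
              (letter (l W) (l Y) (g W Y (of (t.cons a))))))]
          refine Path.sumSplits_congr fun Z s₁ q _ => ?_
          rw [Path.map_sumSplits (φ (j Z) (F X Z (of s₁)))]
        · rw [Path.sumSplits_assoc p (fun Z W s₁ s₂ t => φ (l Z) (coder F c G X Z (of s₁))
            (conc (l Z) (l W) (l Y) (G Z W (of s₂))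
              (letter (l W) (l Y) (g W Y (of (t.cons a))))))]
          refine Path.sumSplits_congr fun Z s₁ q _ => ?_
          rw [hG.map_cons, Path.map_sumSplits (φ (l Z) (coder F c G X Z (of s₁)))]
      have e₂ : (p.sumSplits fun W s t => φ (l Y) (conc (j X) (l W) (l Y) (coder F c G X W (of s))
          (letter (l W) (l Y) (g W Y (of (t.cons a))))) (one (l Y))) +
          φ (l Y) (convLetter F c X Y (of (p.cons a))) (one (l Y)) =
          φ (l Y) (coder F c G X Y (of (p.cons a))) (G Y Y (of Path.nil)) := by
        rw [h1, coder_cons hG, map_add, LinearMap.add_apply]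
        congr 1
        exact (Path.map_sumSplits ((φ (l Y)).flip (one (l Y))) p _).symm
      rw [e₁, Path.sumSplits_cons, Path.sumSplits_cons, Path.sumSplits_cons, ← e₂, h2]
      simp only [coder_cons hG, map_add, Path.sumSplits_add]
      simp only [one]
      abel

end Coalgebra

end Words

end GQuiver

namespace Quiver.Path

theorem sumSplits_mem {V : Type u} [Quiver.{v} V] {M : Type*} [AddCommMonoid M] {X Y : V}
    {p : Path X Y} {τ : ∀ Z, Path X Z → Path Z Y → M} (N : AddSubmonoid M)
    (h : ∀ Z s t, s.comp t = p → τ Z s t ∈ N) : p.sumSplits τ ∈ N := by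
  induction p with
  | nil => rw [sumSplits_nil]; exact h _ nil nil rfl
  | cons p a ih =>
    rw [sumSplits_cons]
    exact add_mem (ih fun Z s t hst => h Z s (t.cons a) (by rw [← hst]; rfl)) (h _ _ nil rfl)

end Quiver.Path

namespace GQuiver

open Quiver (Path)

variable {Q : GQuiver.{w, v, u} k}

theorem sgn_sgn {X Y : Q.Obj} (a : Q.Tot X Y) : Q.sgn X Y (Q.sgn X Y a) = a := by
  induction a using DirectSum.induction_on with
  | zero => simp
  | of n x =>
    change Q.sgn X Y (Q.sgn X Y (DirectSum.lof k ℤ _ n x)) = DirectSum.lof k ℤ _ n x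
    rw [Q.sgn_of_mem ⟨x, rfl⟩, map_zsmul, Q.sgn_of_mem ⟨x, rfl⟩, smul_smul, ← Units.val_mul,
      Int.units_mul_self, Units.val_one, one_smul]
  | add a b ha hb => rw [map_add, map_add, ha, hb]

theorem sgnWord_comp {X Y Z : Q.Obj} (p : Path X Y) (q : Path Y Z) :
    Q.sgnWord (p.comp q) = (Q.sgnWord p).comp (Q.sgnWord q) := by
  induction q with
  | nil => rfl
  | cons q a ih => exact congrArg (fun r => Path.cons r _) ih

theorem sgnWord_sgnWord {X Y : Q.Obj} (p : Path X Y) : Q.sgnWord (Q.sgnWord p) = p := by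
  induction p with
  | nil => rfl
  | cons p a ih => simp only [sgnWord, ih, sgn_sgn]

theorem length_sgnWord {X Y : Q.Obj} (p : Path X Y) : (Q.sgnWord p).length = p.length := by
  induction p with
  | nil => rfl
  | cons p a ih => simp only [sgnWord, Path.length_cons, ih]

theorem sumSplits_sgnWord {M : Type*} [AddCommMonoid M] {X Y : Q.Obj} (p : Path X Y)
    (τ : ∀ Z, Path X Z → Path Z Y → M) : (Q.sgnWord p).sumSplits τ =
      p.sumSplits fun Z s t => τ Z (Q.sgnWord s) (Q.sgnWord t) := by
  induction p with
  | nil => simp [sgnWord]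
  | cons p a ih =>
    simp only [sgnWord, Path.sumSplits_cons, ih]

theorem HasDeg.comp {X Y Z : Q.Obj} {p : Path X Y} {q : Path Y Z} {s t : ℤ} (hp : Q.HasDeg p s)
    (hq : Q.HasDeg q t) : Q.HasDeg (p.comp q) (s + t) := by
  induction hq with
  | nil => rwa [add_zero]
  | @cons _ _ q t n a _ ha ih =>
    rw [show s + (t + n - 1) = s + t + n - 1 by ring]
    exact HasDeg.cons n a ih ha

theorem HasDeg.of_comp {X Y Z : Q.Obj} {p : Path X Y} {q : Path Y Z} {s : ℤ}
    (h : Q.HasDeg (p.comp q) s) : ∃ s₁ s₂, Q.HasDeg p s₁ ∧ Q.HasDeg q s₂ ∧ s₁ + s₂ = s := by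
  induction q generalizing s with
  | nil => exact ⟨s, 0, h, .nil, add_zero s⟩
  | cons q a ih =>
    rw [Path.comp_cons] at h
    cases h with
    | cons n _ h ha =>
      obtain ⟨s₁, s₂, h₁, h₂, h₃⟩ := ih h
      exact ⟨s₁, _, h₁, .cons n a h₂ ha, by omega⟩

namespace Words

variable {X Y Z : Q.Obj}

/-! ### Signs -/

/-- The sign operator on words. -/
noncomputable def sg (X Y : Q.Obj) : Q.Words X Y →ₗ[k] Q.Words X Y :=
  lift (fun p => of (Q.sgnWord p))
    { map_add := fun {Z W} p a b q => by
        have := isMultilinear_of.map_add (Q.sgnWord p) (Q.sgn Z W a) (Q.sgn Z W b) (Q.sgnWord q)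
        rw [← map_add] at this
        simp only [sgnWord_comp]
        exact this
      map_smul := fun {Z W} p r a q => by
        have := isMultilinear_of.map_smul (Q.sgnWord p) r (Q.sgn Z W a) (Q.sgnWord q)
        rw [← map_smul] at this
        simp only [sgnWord_comp]
        exact this }

@[simp]
theorem sg_of (p : Path X Y) : sg X Y (of p) = of (Q.sgnWord p) := lift_of _ _ _

theorem sg_one (X : Q.Obj) : sg X X (one X) = one X := sg_of _

theorem sg_letter (a : Q.Tot X Y) : sg X Y (letter X Y a) = letter X Y (Q.sgn X Y a) := sg_of _

theorem sg_conc (x : Q.Words X Y) (y : Q.Words Y Z) :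
    sg X Z (conc X Y Z x y) = conc X Y Z (sg X Y x) (sg Y Z y) := by
  have : (conc X Y Z).compr₂ (sg X Z) = (conc X Y Z).compl₁₂ (sg X Y) (sg Y Z) :=
    hom_ext fun p => hom_ext fun q => by
      simp [sgnWord_comp]
  exact LinearMap.congr_fun₂ this x y

theorem sg_sg (x : Q.Words X Y) : sg X Y (sg X Y x) = x := by
  have : sg X Y ∘ₗ sg X Y = LinearMap.id := hom_ext fun p => by
    rw [LinearMap.comp_apply, sg_of, sg_of, LinearMap.id_apply, sgnWord_sgnWord]
  exact LinearMap.congr_fun this x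

theorem isHat_sg : IsHat (Q := Q) (j := fun X => X) (fun X Y => sg X Y)
    (fun X Y => Q.sgn X Y ∘ₗ pr X Y) where
  map_one := sg_one
  map_cons {X Y Z} p a := by
    have h : sg X Z (of (p.cons a)) = conc X Y Z (of (Q.sgnWord p)) (letter Y Z (Q.sgn Y Z a)) :=
      (sg_of _).trans (conc_letter _ _).symm
    refine h.trans ?_
    refine Eq.trans ?_ (sumSplits_pr p a (fun W s c => conc X W Z (sg X W (of s))
      (letter W Z (Q.sgn W Z c))) fun W s => by rw [map_zero, map_zero, map_zero]).symm
    rw [sg_of]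

theorem isHat_id : IsHat (Q := Q) (j := fun X => X) (fun _ _ => LinearMap.id)
    (fun X Y => pr X Y) where
  map_one _ := rfl
  map_cons {X Y Z} p a := ((sumSplits_pr p a (fun W s c => conc X W Z (of s)
      (letter W Z c)) fun W s => by rw [map_zero, map_zero]).trans (conc_letter p a)).symm

section Coalgebra

variable {i j l r : Q.Obj → Q.Obj}

/-! ### Cohomomorphisms -/

/-- The sum, over all ways of cutting the word `p · t` into nonempty blocks in such a way that
the last block contains `t`, of the words obtained by applying `g` to the blocks. -/
noncomputable def hatAux (g : ∀ X Y, Q.Words X Y →ₗ[k] Q.Tot (j X) (j Y)) {X : Q.Obj} :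
    {Y Z : Q.Obj} → Path X Y → Path Y Z → Q.Words (j X) (j Z)
  | _, Z, .nil, t => letter (j X) (j Z) (g X Z (of t))
  | Y, Z, .cons p a, t => hatAux g p (Path.comp a.toPath t) +
      conc (j X) (j Y) (j Z) (hatAux g p a.toPath) (letter (j Y) (j Z) (g Y Z (of t)))

theorem isMultilinear_hatAux_right (g : ∀ X Y, Q.Words X Y →ₗ[k] Q.Tot (j X) (j Y))
    (p : Path X Y) : Q.IsMultilinear fun t : Path Y Z => hatAux g p t := by
  induction p with
  | nil => exact isMultilinear_of.comp (letter (j X) (j Z) ∘ₗ g X Z)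
  | @cons W Y p a ih =>
    exact .add (isMultilinear_comp_left _ ih)
      (isMultilinear_of.comp (conc (j X) (j Y) (j Z) (hatAux g p a.toPath) ∘ₗ
        letter (j Y) (j Z) ∘ₗ g Y Z))

theorem isMultilinear_hatAux_left (g : ∀ X Y, Q.Words X Y →ₗ[k] Q.Tot (j X) (j Y))
    (t : Path Y Z) : Q.IsMultilinear fun p : Path X Y => hatAux g p t := by
  constructor
  · intro U W p a b q
    induction q generalizing Z with
    | nil =>
      have h₁ := (isMultilinear_hatAux_right (Z := Z) g p).map_add .nil a b t
      have h₂ := (isMultilinear_hatAux_right (Z := W) g p).map_add .nil a b .nil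
      simp only [Path.comp_nil] at h₂ ⊢
      simp only [hatAux]
      refine (congrArg₂ (· + ·) h₁ ((congrArg (fun z => conc (j X) (j W) (j Z) z
        (letter (j W) (j Z) (g W Z (of t)))) h₂).trans (LinearMap.map_add₂ _ _ _ _))).trans ?_
      exact add_add_add_comm _ _ _ _
    | cons q c ih =>
      simp only [Path.comp_cons, hatAux, ih, map_add, LinearMap.add_apply]
      exact add_add_add_comm _ _ _ _
  · intro U W p r a q
    induction q generalizing Z with
    | nil =>
      have h₁ := (isMultilinear_hatAux_right (Z := Z) g p).map_smul .nil r a t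
      have h₂ := (isMultilinear_hatAux_right (Z := W) g p).map_smul .nil r a .nil
      simp only [Path.comp_nil] at h₂ ⊢
      simp only [hatAux]
      refine (congrArg₂ (· + ·) h₁ ((congrArg (fun z => conc (j X) (j W) (j Z) z
        (letter (j W) (j Z) (g W Z (of t)))) h₂).trans (LinearMap.map_smul₂ _ _ _ _))).trans ?_
      exact (smul_add _ _ _).symm
    | cons q c ih =>
      simp only [Path.comp_cons, hatAux, ih, map_smul, LinearMap.smul_apply, smul_add]

/-- The sum, over all ways of cutting a word into nonempty blocks, of the words obtained by
applying `g` to the blocks. -/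
noncomputable def hatPath (g : ∀ X Y, Q.Words X Y →ₗ[k] Q.Tot (j X) (j Y)) {X : Q.Obj} :
    {Y : Q.Obj} → Path X Y → Q.Words (j X) (j Y)
  | _, .nil => one (j X)
  | _, .cons p a => hatAux g p a.toPath

theorem isMultilinear_hatPath (g : ∀ X Y, Q.Words X Y →ₗ[k] Q.Tot (j X) (j Y)) :
    Q.IsMultilinear fun p : Path X Y => hatPath g p where
  map_add p a b q := by
    cases q with
    | nil => exact (isMultilinear_hatAux_right g p).map_add .nil a b .nil
    | cons q c => exact (isMultilinear_hatAux_left g c.toPath).map_add p a b q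
  map_smul p r a q := by
    cases q with
    | nil => exact (isMultilinear_hatAux_right g p).map_smul .nil r a .nil
    | cons q c => exact (isMultilinear_hatAux_left g c.toPath).map_smul p r a q

/-- The cohomomorphism with components `g`. -/
noncomputable def hat (g : ∀ X Y, Q.Words X Y →ₗ[k] Q.Tot (j X) (j Y)) (X Y : Q.Obj) :
    Q.Words X Y →ₗ[k] Q.Words (j X) (j Y) :=
  lift (fun p => hatPath g p) (isMultilinear_hatPath g)

theorem hat_of (g : ∀ X Y, Q.Words X Y →ₗ[k] Q.Tot (j X) (j Y)) (p : Path X Y) :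
    hat g X Y (of p) = hatPath g p := lift_of _ _ _

theorem hatAux_eq (g : ∀ X Y, Q.Words X Y →ₗ[k] Q.Tot (j X) (j Y)) (p : Path X Y)
    (t : Path Y Z) : hatAux g p t = p.sumSplits fun W s q => conc (j X) (j W) (j Z)
      (hat g X W (of s)) (letter (j W) (j Z) (g W Z (of (q.comp t)))) := by
  induction p generalizing Z with
  | nil =>
    rw [Path.sumSplits_nil, hat_of, Path.nil_comp]
    exact (one_conc _).symm
  | cons p a ih =>
    rw [Path.sumSplits_cons, hat_of, Path.nil_comp, hatAux, hatPath, ih]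
    simp only [← Path.comp_assoc]
    rfl

theorem isHat_hat (g : ∀ X Y, Q.Words X Y →ₗ[k] Q.Tot (j X) (j Y)) : IsHat (hat g) g where
  map_one _ := hat_of _ _
  map_cons p a := (hat_of _ _).trans (hatAux_eq g p (Quiver.Hom.toPath a))

variable {F : ∀ X Y, Q.Words X Y →ₗ[k] Q.Words (j X) (j Y)}
  {f : ∀ X Y, Q.Words X Y →ₗ[k] Q.Tot (j X) (j Y)}
  {c : ∀ X Y, Q.Words X Y →ₗ[k] Q.Tot (j X) (l Y)}
  {G : ∀ X Y, Q.Words X Y →ₗ[k] Q.Words (l X) (l Y)}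
  {g : ∀ X Y, Q.Words X Y →ₗ[k] Q.Tot (l X) (l Y)}

theorem IsHat.mem_reduced (h : IsHat F f) {p : Path X Y} (hp : p.length ≠ 0) :
    F X Y (of p) ∈ reduced Q (j X) (j Y) := by
  cases p with
  | nil => simp at hp
  | cons p a =>
    rw [h.map_cons]
    exact Path.sumSplits_mem (reduced Q (j X) (j Y)).toAddSubmonoid fun W s t _ =>
      conc_mem_reduced_right _ (letter_mem_reduced _)

theorem IsHat.map_nil (h : IsHat F f) (X : Q.Obj) : F X X (of .nil) = of .nil := h.map_one X

theorem IsHat.pr_apply (h : IsHat F f) {p : Path X Y} (hp : p.length ≠ 0) :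
    pr (j X) (j Y) (F X Y (of p)) = f X Y (of p) := by
  cases p with
  | nil => simp at hp
  | cons p a =>
    rw [h.map_cons, Path.map_sumSplits (pr (j X) (j Y)), Path.sumSplits_of_left, h.map_nil]
    · exact (congrArg _ (one_conc _)).trans (pr_letter _)
    · exact fun W s t _ hs => pr_conc (h.mem_reduced hs) (letter_mem_reduced _)

theorem pr_nil (X : Q.Obj) : pr X X (of Path.nil) = 0 := pr_of_length (by simp)

theorem coder_mem_reduced (p : Path X Y) :
    coder F c G X Y (of p) ∈ reduced Q (j X) (l Y) := by
  rw [coder_of']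
  exact Path.sumSplits_mem (reduced Q (j X) (l Y)).toAddSubmonoid fun Z s r _ =>
    Path.sumSplits_mem (reduced Q (j X) (l Y)).toAddSubmonoid fun W t q _ =>
    conc_mem_reduced_left (conc_mem_reduced_right _ (letter_mem_reduced _)) _

theorem pr_coder (hF : IsHat F f) (hG : IsHat G g) (p : Path X Y) :
    pr (j X) (l Y) (coder F c G X Y (of p)) = c X Y (of p) := by
  rw [coder_of', Path.map_sumSplits (pr (j X) (l Y)), Path.sumSplits_of_left,
    Path.map_sumSplits (pr (j X) (l Y)), Path.sumSplits_of_right, hF.map_nil, hG.map_nil]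
  · refine (congrArg _ ((conc_one _).trans (one_conc _))).trans (pr_letter _)
  · intro W t q _ hq
    exact pr_conc (conc_mem_reduced_right _ (letter_mem_reduced _)) (hG.mem_reduced hq)
  · intro Z s q _ hs
    rw [Path.map_sumSplits (pr (j X) (l Y))]
    refine Path.sumSplits_eq_zero fun W t q _ => ?_
    rw [conc_assoc]
    exact pr_conc (hF.mem_reduced hs) (conc_mem_reduced_left (letter_mem_reduced _) _)

/-- A family of maps which is a coderivation up to a correction term is determined by its
components. This is used for families whose components vanish on short words. -/
theorem eq_letter_of_coder (hF : ∀ X, F X X (one X) = one (j X)) (hG : IsHat G g)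
    {K : ∀ X Y, Q.Words X Y →ₗ[k] Q.Words (j X) (l Y)}
    {A : ∀ X Y, Q.Words X Y →ₗ[k] Q.Words (j X) (r Y)}
    {B : ∀ X Y, Q.Words X Y →ₗ[k] Q.Words (r X) (l Y)}
    (hK : ∀ {X Y : Q.Obj} {M : Type (max u v w)} [AddCommGroup M] [Module k M]
      (φ : ∀ Z, Q.Words (j X) Z →ₗ[k] Q.Words Z (l Y) →ₗ[k] M) (p : Path X Y),
      split φ (K X Y (of p)) = (p.sumSplits fun Z s t => φ (j Z) (F X Z (of s)) (K Z Y (of t))) +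
        (p.sumSplits fun Z s t => φ (l Z) (K X Z (of s)) (G Z Y (of t))) +
        p.sumSplits fun Z s t => φ (r Z) (A X Z (of s)) (B Z Y (of t)))
    (hred : ∀ {X Y : Q.Obj} (p : Path X Y), K X Y (of p) ∈ reduced Q (j X) (l Y)) (n : ℕ)
    (hKn : ∀ {X Y : Q.Obj} (p : Path X Y), p.length ≤ n → pr (j X) (l Y) (K X Y (of p)) = 0)
    (hBn : ∀ {X Y : Q.Obj} (p : Path X Y), p.length ≤ n → pr (r X) (l Y) (B X Y (of p)) = 0)
    {X Y : Q.Obj} (p : Path X Y) (hp : p.length ≤ n + 1) :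
    K X Y (of p) = letter (j X) (l Y) (pr (j X) (l Y) (K X Y (of p))) +
      conc (j X) (r X) (l Y) (A X X (one X)) (letter (r X) (l Y) (pr (r X) (l Y) (B X Y (of p)))) := by
  suffices ∀ (m : ℕ) {X Y : Q.Obj} (p : Path X Y), p.length = m → p.length ≤ n + 1 →
      K X Y (of p) = letter (j X) (l Y) (pr (j X) (l Y) (K X Y (of p))) +
        conc (j X) (r X) (l Y) (A X X (one X))
          (letter (r X) (l Y) (pr (r X) (l Y) (B X Y (of p)))) from this _ p rfl hp
  intro m
  induction m using Nat.strong_induction_on with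
  | _ m ih =>
    intro X Y p hpm hp
    conv_lhs => rw [← split_last (hred p), hK]
    simp only [LinearMap.compl₂_apply, LinearMap.comp_apply]
    have h₁ : (p.sumSplits fun Z s t => conc (j X) (j Z) (l Y) (F X Z (of s))
        (letter (j Z) (l Y) (pr (j Z) (l Y) (K Z Y (of t))))) =
          letter (j X) (l Y) (pr (j X) (l Y) (K X Y (of p))) := by
      rw [Path.sumSplits_of_left]
      · exact (congrArg (fun z => conc (j X) (j X) (l Y) z (letter (j X) (l Y)
          (pr (j X) (l Y) (K X Y (of p))))) (hF X)).trans (one_conc _)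
      · intro Z s t hst hs
        have := Path.length_of_comp_eq hst
        rw [hKn t (by omega), map_zero, map_zero]
    have h₂ : (p.sumSplits fun Z s t => conc (j X) (l Z) (l Y) (K X Z (of s))
        (letter (l Z) (l Y) (pr (l Z) (l Y) (G Z Y (of t))))) = 0 := by
      refine Path.sumSplits_eq_zero fun Z s t hst => ?_
      have := Path.length_of_comp_eq hst
      by_cases ht : t.length = 0
      · cases t with
        | nil => rw [hG.map_nil, pr_nil, map_zero, map_zero]
        | cons t a => simp at ht
      · rw [ih s.length (by omega) s rfl (by omega), hKn s (by omega), hBn s (by omega),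
          map_zero, map_zero, map_zero, add_zero, LinearMap.map_zero₂]
    have h₃ : (p.sumSplits fun Z s t => conc (j X) (r Z) (l Y) (A X Z (of s))
        (letter (r Z) (l Y) (pr (r Z) (l Y) (B Z Y (of t))))) =
          conc (j X) (r X) (l Y) (A X X (one X))
            (letter (r X) (l Y) (pr (r X) (l Y) (B X Y (of p)))) := by
      rw [Path.sumSplits_of_left]
      · rfl
      · intro Z s t hst hs
        have := Path.length_of_comp_eq hst
        rw [hBn t (by omega), map_zero, map_zero]
    rw [h₁, h₂, h₃, add_zero]

theorem IsHat.map_sg (h : IsHat F f)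
    (hf : ∀ {X Y : Q.Obj} (p : Path X Y), f X Y (sg X Y (of p)) = Q.sgn (j X) (j Y) (f X Y (of p)))
    (p : Path X Y) : F X Y (sg X Y (of p)) = sg (j X) (j Y) (F X Y (of p)) := by
  suffices ∀ (m : ℕ) {X Y : Q.Obj} (p : Path X Y), p.length = m →
    F X Y (sg X Y (of p)) = sg (j X) (j Y) (F X Y (of p)) from this _ p rfl
  intro m
  induction m using Nat.strong_induction_on with
  | _ m ih =>
    intro X Y p hp
    cases p with
    | nil => rw [sg_of, sgnWord, h.map_nil, sg_of, sgnWord]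
    | @cons Y' _ p a =>
      rw [sg_of, h.map_cons, Path.map_sumSplits (sg (j X) (j Y))]
      refine (h.map_cons (Q.sgnWord p) (Q.sgn Y' Y a)).trans ?_
      rw [sumSplits_sgnWord]
      refine Path.sumSplits_congr fun W s t hst => ?_
      have := Path.length_of_comp_eq hst
      rw [Path.length_cons] at hp
      rw [sg_conc, ← ih s.length (by omega) s rfl, sg_letter, ← hf, sg_of, sg_of]
      rfl

theorem coder_sg (hF : ∀ {X Y : Q.Obj} (p : Path X Y),
      F X Y (sg X Y (of p)) = sg (j X) (j Y) (F X Y (of p)))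
    (hc : ∀ {X Y : Q.Obj} (p : Path X Y), c X Y (sg X Y (of p)) = -Q.sgn (j X) (l Y) (c X Y (of p)))
    (hG : ∀ {X Y : Q.Obj} (p : Path X Y),
      G X Y (sg X Y (of p)) = sg (l X) (l Y) (G X Y (of p))) (p : Path X Y) :
    coder F c G X Y (sg X Y (of p)) = -sg (j X) (l Y) (coder F c G X Y (of p)) := by
  rw [sg_of, coder_of', coder_of', Path.map_sumSplits (sg (j X) (l Y)), ← neg_one_zsmul,
    Path.smul_sumSplits, sumSplits_sgnWord]
  refine Path.sumSplits_congr fun Z s t _ => ?_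
  rw [Path.map_sumSplits (sg (j X) (l Y)), Path.smul_sumSplits, sumSplits_sgnWord]
  refine Path.sumSplits_congr fun W t q _ => ?_
  rw [← sg_of, ← sg_of, ← sg_of, hF, hG, hc, sg_conc, sg_conc, sg_letter]
  simp

end Coalgebra

end Words

end GQuiver

namespace GQuiver

open Quiver (Path)

variable {Q : GQuiver.{w, v, u} k}

namespace Words

variable {X Y Z : Q.Obj}

/-! ### Degrees of words -/

/-- Words of homogeneous letters span. -/
theorem hom_ext_deg {M : Type*} [AddCommGroup M] [Module k M] {f g : Q.Words X Y →ₗ[k] M}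
    (h : ∀ (p : Path X Y) (s : ℤ), Q.HasDeg p s → f (of p) = g (of p)) : f = g := by
  refine hom_ext fun p => ?_
  suffices ∀ {Z : Q.Obj} (p : Path X Z) (q : Path Z Y) (s : ℤ), Q.HasDeg q s →
      f (of (p.comp q)) = g (of (p.comp q)) from this p .nil 0 .nil
  intro Z p
  induction p with
  | nil =>
    intro q s hq
    rw [Path.nil_comp]
    exact h q s hq
  | @cons Z W p a ih =>
    intro q s hq
    generalize (a : Q.Tot Z W) = a
    induction a using DirectSum.induction_on with
    | zero =>
      have h₀ := isMultilinear_of.map_smul p (0 : k) (0 : Q.Tot Z W) q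
      rw [zero_smul, zero_smul] at h₀
      rw [h₀, map_zero, map_zero]
    | of n x =>
      have := ih (Path.comp (Path.nil.cons (DirectSum.lof k ℤ (Q.Hom Z W) n x : Q.Tot Z W)) q)
        _ (HasDeg.comp (Q.hasDeg_one ⟨x, rfl⟩) hq)
      rw [← Path.comp_assoc] at this
      exact this
    | add a b ha hb => rw [isMultilinear_of.map_add, map_add, map_add, ha, hb]

variable (Q) in
/-- The span of the words of homogeneous letters of total degree `s`, each letter being counted
with its degree minus one. -/
noncomputable def deg (s : ℤ) (X Y : Q.Obj) : Submodule k (Q.Words X Y) :=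
  Submodule.span k {x | ∃ p : Path X Y, Q.HasDeg p s ∧ of p = x}

theorem of_mem_deg {p : Path X Y} {s : ℤ} (h : Q.HasDeg p s) : of p ∈ deg Q s X Y :=
  Submodule.subset_span ⟨p, h, rfl⟩

theorem letter_mem_deg {a : Q.Tot X Y} {n s : ℤ} (ha : a ∈ Q.gr X Y n) (h : n - 1 = s) :
    letter X Y a ∈ deg Q s X Y :=
  of_mem_deg (h ▸ Q.hasDeg_one ha)

theorem map_mem_of_deg {M : Type*} [AddCommGroup M] [Module k M] {f : Q.Words X Y →ₗ[k] M}
    {N : Submodule k M} {s : ℤ} (h : ∀ p : Path X Y, Q.HasDeg p s → f (of p) ∈ N)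
    {x : Q.Words X Y} (hx : x ∈ deg Q s X Y) : f x ∈ N := by
  have : deg Q s X Y ≤ N.comap f := Submodule.span_le.2 fun x ⟨p, hp, hx⟩ => hx ▸ h p hp
  exact this hx

theorem conc_mem_deg {s t r : ℤ} {x : Q.Words X Y} {y : Q.Words Y Z} (hx : x ∈ deg Q s X Y)
    (hy : y ∈ deg Q t Y Z) (h : s + t = r) : conc X Y Z x y ∈ deg Q r X Z := by
  refine map_mem_of_deg (f := (conc X Y Z).flip y) (fun p hp => ?_) hx
  refine map_mem_of_deg (f := conc X Y Z (of p)) (fun q hq => ?_) hy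
  rw [conc_of]
  exact of_mem_deg (h ▸ hp.comp hq)

section Coalgebra

variable {j l : Q.Obj → Q.Obj}

/-- The linear maps `c`, defined on words, are homogeneous of degree `e`. -/
def IsDeg (c : ∀ X Y, Q.Words X Y →ₗ[k] Q.Tot (j X) (l Y)) (e : ℤ) : Prop :=
  ∀ {X Y : Q.Obj} (p : Path X Y) (s : ℤ), Q.HasDeg p s → c X Y (of p) ∈ Q.gr (j X) (l Y) (s + e)

theorem IsDeg.mem {c : ∀ X Y, Q.Words X Y →ₗ[k] Q.Tot (j X) (l Y)} {e s r : ℤ} (hc : IsDeg c e)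
    {x : Q.Words X Y} (hx : x ∈ deg Q s X Y) (h : s + e = r) : c X Y x ∈ Q.gr (j X) (l Y) r :=
  map_mem_of_deg (fun p hp => h ▸ hc p s hp) hx

theorem sg_of_hasDeg {p : Path X Y} {s : ℤ} (h : Q.HasDeg p s) :
    sg X Y (of p) = ((s.negOnePow : ℤˣ) : ℤ) • of p := by
  induction h with
  | nil => simp [sg_of, sgnWord]
  | @cons Y Z p s n a _ ha ih =>
    have h : sg X Z (of (p.cons a)) = conc X Y Z (sg X Y (of p)) (letter Y Z (Q.sgn Y Z a)) := by
      rw [sg_of, sg_of]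
      exact (conc_letter _ _).symm
    rw [h, ih, Q.sgn_of_mem ha, map_zsmul, map_zsmul, map_zsmul, LinearMap.smul_apply, smul_smul,
      ← Units.val_mul, ← Int.negOnePow_add, conc_letter]
    congr 3
    ring_nf

theorem sg_mem_deg {s : ℤ} {x : Q.Words X Y} (hx : x ∈ deg Q s X Y) :
    sg X Y x ∈ deg Q s X Y :=
  map_mem_of_deg (fun p hp => by
    rw [sg_of_hasDeg hp]
    exact zsmul_mem (of_mem_deg hp) _) hx

theorem IsDeg.map_sg {c : ∀ X Y, Q.Words X Y →ₗ[k] Q.Tot (j X) (l Y)} {e : ℤ} (hc : IsDeg c e)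
    (x : Q.Words X Y) :
    c X Y (sg X Y x) = (((e - 1).negOnePow : ℤˣ) : ℤ) • Q.sgn (j X) (l Y) (c X Y x) := by
  have : c X Y ∘ₗ sg X Y =
      (((e - 1).negOnePow : ℤˣ) : ℤ) • (Q.sgn (j X) (l Y) ∘ₗ c X Y) := hom_ext_deg fun p s hp => by
    rw [LinearMap.comp_apply, LinearMap.smul_apply, LinearMap.comp_apply, sg_of_hasDeg hp,
      map_zsmul, Q.sgn_of_mem (hc p s hp), smul_smul, ← Units.val_mul, ← Int.negOnePow_add]
    congr 2
    rw [show e - 1 + (s + e - 1) = s + ((e - 1) + (e - 1)) by ring, Int.negOnePow_add s,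
      Int.negOnePow_add (e - 1), Int.units_mul_self, mul_one]
  exact LinearMap.congr_fun this x

variable {F : ∀ X Y, Q.Words X Y →ₗ[k] Q.Words (j X) (j Y)}
  {f : ∀ X Y, Q.Words X Y →ₗ[k] Q.Tot (j X) (j Y)}
  {c : ∀ X Y, Q.Words X Y →ₗ[k] Q.Tot (j X) (l Y)}
  {G : ∀ X Y, Q.Words X Y →ₗ[k] Q.Words (l X) (l Y)}

theorem IsHat.mem_deg (h : IsHat F f) (hf : IsDeg f 1) (p : Path X Y) (s : ℤ)
    (hp : Q.HasDeg p s) : F X Y (of p) ∈ deg Q s (j X) (j Y) := by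
  suffices ∀ (m : ℕ) {X Y : Q.Obj} (p : Path X Y) (s : ℤ), p.length = m → Q.HasDeg p s →
    F X Y (of p) ∈ deg Q s (j X) (j Y) from this _ p s rfl hp
  intro m
  induction m using Nat.strong_induction_on with
  | _ m ih =>
    intro X Y p s hpm hp
    cases p with
    | nil =>
      cases hp
      rw [h.map_nil]
      exact of_mem_deg .nil
    | cons p a =>
      rw [h.map_cons]
      refine Path.sumSplits_mem (deg Q s (j X) (j Y)).toAddSubmonoid fun W t q hq => ?_
      have hl := Path.length_of_comp_eq hq
      rw [Path.length_cons] at hpm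
      rw [← hq, ← Path.comp_cons] at hp
      obtain ⟨s₁, s₂, h₁, h₂, h₃⟩ := hp.of_comp
      exact conc_mem_deg (ih t.length (by omega) t s₁ rfl h₁)
        (letter_mem_deg (hf _ _ h₂) (add_sub_cancel_right s₂ 1)) h₃

theorem coder_mem_deg
    (hF : ∀ {X Y : Q.Obj} (p : Path X Y) (s : ℤ), Q.HasDeg p s → F X Y (of p) ∈ deg Q s (j X) (j Y))
    {e : ℤ} (hc : IsDeg c e)
    (hG : ∀ {X Y : Q.Obj} (p : Path X Y) (s : ℤ), Q.HasDeg p s → G X Y (of p) ∈ deg Q s (l X) (l Y))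
    (p : Path X Y) (s : ℤ) (hp : Q.HasDeg p s) :
    coder F c G X Y (of p) ∈ deg Q (s + e - 1) (j X) (l Y) := by
  rw [coder_of']
  refine Path.sumSplits_mem (deg Q (s + e - 1) (j X) (l Y)).toAddSubmonoid fun Z t q hq => ?_
  rw [← hq] at hp
  obtain ⟨s₁, s₂, h₁, h₂, h₃⟩ := hp.of_comp
  refine Path.sumSplits_mem (deg Q (s + e - 1) (j X) (l Y)).toAddSubmonoid fun W q₁ q₂ hq' => ?_
  rw [← hq'] at h₂
  obtain ⟨t₁, t₂, h₁', h₂', h₃'⟩ := h₂.of_comp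
  exact conc_mem_deg (conc_mem_deg (hF _ _ h₁) (letter_mem_deg (hc _ _ h₁') rfl) rfl)
    (hG _ _ h₂') (by omega)

theorem IsCoder.split_apply {K : ∀ X Y, Q.Words X Y →ₗ[k] Q.Words (j X) (l Y)}
    (hK : IsCoder F K G) {M : Type (max u v w)} [AddCommGroup M] [Module k M]
    (φ : ∀ Z, Q.Words (j X) Z →ₗ[k] Q.Words Z (l Y) →ₗ[k] M) (x : Q.Words X Y) :
    split φ (K X Y x) = split (fun Z => (φ (j Z)).compl₁₂ (F X Z) (K Z Y)) x +
      split (fun Z => (φ (l Z)).compl₁₂ (K X Z) (G Z Y)) x := by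
  have : split φ ∘ₗ K X Y = split (fun Z => (φ (j Z)).compl₁₂ (F X Z) (K Z Y)) +
      split (fun Z => (φ (l Z)).compl₁₂ (K X Z) (G Z Y)) := hom_ext fun p => by
    rw [LinearMap.comp_apply, hK, LinearMap.add_apply, split_of, split_of]
    rfl
  exact LinearMap.congr_fun this x

theorem IsComult.split_apply (hF : IsComult F) {M : Type (max u v w)} [AddCommGroup M]
    [Module k M] (φ : ∀ Z, Q.Words (j X) Z →ₗ[k] Q.Words Z (j Y) →ₗ[k] M) (x : Q.Words X Y) :
    split φ (F X Y x) = split (fun Z => (φ (j Z)).compl₁₂ (F X Z) (F Z Y)) x := by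
  have : split φ ∘ₗ F X Y = split (fun Z => (φ (j Z)).compl₁₂ (F X Z) (F Z Y)) :=
    hom_ext fun p => by
      rw [LinearMap.comp_apply, hF, split_of]
      rfl
  exact LinearMap.congr_fun this x

end Coalgebra

end Words

end GQuiver

/-! ### The bar differential -/

namespace AInfCat

open GQuiver Words
open Quiver (Path)

variable (A : AInfCat.{w, v, u} k) {X Y Z : A.Obj}

/-- The operations `μ`, as linear maps on words. -/
noncomputable def b (X Y : A.Obj) : A.Words X Y →ₗ[k] A.Tot X Y :=
  lift (fun p => A.μ.ev p) ⟨A.μ.ev_add, A.μ.ev_smul⟩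

theorem b_of (p : Path X Y) : A.b X Y (of p) = A.μ.ev p := lift_of _ _ _

theorem b_one (X : A.Obj) : A.b X X (one X) = 0 := (A.b_of _).trans (A.μ.ev_nil X)

theorem isDeg_b : IsDeg (Q := A.toGQuiver) (j := fun X => X) (l := fun X => X) A.b 2 :=
  fun p s h => by
    rw [b_of]
    exact A.μ.ev_mem p s h

/-- The bar differential. -/
noncomputable def bar (X Y : A.Obj) : A.Words X Y →ₗ[k] A.Words X Y :=
  coder (j := fun X => X) (l := fun X => X) (fun X Y => sg X Y) A.b (fun _ _ => LinearMap.id) X Y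

theorem isCoder_bar : IsCoder (Q := A.toGQuiver) (j := fun X => X) (l := fun X => X)
    (fun X Y => sg X Y) A.bar (fun _ _ => LinearMap.id) :=
  isCoder_coder isHat_sg.comult isHat_id

theorem split_bar {M : Type (max u v w)} [AddCommGroup M] [Module k M]
    (φ : ∀ Z, A.Words X Z →ₗ[k] A.Words Z Y →ₗ[k] M) (x : A.Words X Y) :
    split φ (A.bar X Y x) = split (fun Z => (φ Z).compl₁₂ (sg X Z) (A.bar Z Y)) x +
      split (fun Z => φ Z ∘ₗ A.bar X Z) x :=
  IsCoder.split_apply (Q := A.toGQuiver) (j := fun X => X) (l := fun X => X) A.isCoder_bar φ x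

theorem bar_mem_reduced (x : A.Words X Y) : A.bar X Y x ∈ reduced A.toGQuiver X Y := by
  induction x using Words.induction_on with
  | h p =>
    exact coder_mem_reduced (Q := A.toGQuiver) (j := fun X => X) (l := fun X => X)
      (F := fun X Y => sg X Y) (c := A.b) (G := fun _ _ => LinearMap.id) p
  | h₀ => rw [map_zero]; exact zero_mem _
  | hadd x y hx hy => rw [map_add]; exact add_mem hx hy
  | hsmul r x hx => rw [map_smul]; exact Submodule.smul_mem _ r hx

theorem pr_bar (x : A.Words X Y) : pr X Y (A.bar X Y x) = A.b X Y x := by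
  have : pr X Y ∘ₗ A.bar X Y = A.b X Y := hom_ext fun p => pr_coder isHat_sg isHat_id p
  exact LinearMap.congr_fun this x

theorem bar_mem_deg (p : Path X Y) (s : ℤ) (hp : A.HasDeg p s) :
    A.bar X Y (of p) ∈ deg A.toGQuiver (s + 1) X Y := by
  have := coder_mem_deg (Q := A.toGQuiver) (j := fun X => X) (l := fun X => X)
    (F := fun X Y => sg X Y) (G := fun _ _ => LinearMap.id)
    (fun p s h => sg_mem_deg (of_mem_deg h)) A.isDeg_b (fun p s h => of_mem_deg h) p s hp
  rwa [show s + 2 - 1 = s + 1 by ring] at this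

theorem bar_sg (x : A.Words X Y) : A.bar X Y (sg X Y x) = -sg X Y (A.bar X Y x) := by
  have : A.bar X Y ∘ₗ sg X Y = -(sg X Y ∘ₗ A.bar X Y) := hom_ext fun p =>
    coder_sg (Q := A.toGQuiver) (j := fun X => X) (l := fun X => X) (F := fun X Y => sg X Y)
      (c := A.b) (G := fun _ _ => LinearMap.id) (fun p => rfl)
      (fun p => (IsDeg.map_sg A.isDeg_b (of p)).trans (by
        rw [show (2 : ℤ) - 1 = 1 by norm_num, Int.negOnePow_one, Units.val_neg, Units.val_one,
          neg_one_smul])) (fun p => rfl) p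
  exact LinearMap.congr_fun this x

/-- Insertion sums are composites with the bar differential. -/
theorem insertSum_eq {R : GQuiver.{w, v', u'} k} {f : A.Obj → R.Obj} {c : ℤ}
    (Φ : MultiOp A.toGQuiver R f c) (g : A.Words X Y →ₗ[k] R.Tot (f X) (f Y))
    (hg : ∀ p, g (of p) = Φ.ev p) (p : Path X Y) :
    insertSum A.μ Φ p = g (A.bar X Y (of p)) := by
  rw [bar, coder_of', Path.map_sumSplits g, insertSum, List.flatMap_def,
    List.sum_flatten, List.map_map, Path.sumSplits]
  congr 1
  refine List.map_congr_left fun s _ => ?_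
  rw [Path.map_sumSplits g, Path.sumSplits, Function.comp_apply]
  congr 1
  refine List.map_congr_left fun t _ => ?_
  rw [← hg]
  congr 1
  rw [sg_of, b_of, conc_assoc, LinearMap.id_apply]
  refine Eq.trans ?_ (congrArg _ (conc_of (Path.nil.cons (A.μ.ev t.2.1)) t.2.2).symm)
  exact (conc_of _ _).symm

theorem b_bar (x : A.Words X Y) : A.b X Y (A.bar X Y x) = 0 := by
  have : A.b X Y ∘ₗ A.bar X Y = 0 := hom_ext fun p =>
    (A.insertSum_eq A.μ (A.b X Y) A.b_of p).symm.trans (A.rel p)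
  exact LinearMap.congr_fun this x

/-- The square of the bar differential is a coderivation whose component is the sum which vanishes
by the `A∞`-relations, so it is zero. -/
theorem bar_bar (x : A.Words X Y) : A.bar X Y (A.bar X Y x) = 0 := by
  have : A.bar X Y ∘ₗ A.bar X Y = 0 := hom_ext fun p => by
    have hpr : ∀ {X Y : A.Obj} (p : Path X Y),
        pr X Y ((A.bar X Y ∘ₗ A.bar X Y) (of p)) = 0 := fun p =>
      (A.pr_bar _).trans (A.b_bar _)
    have := eq_letter_of_coder (Q := A.toGQuiver) (j := fun X => X) (l := fun X => X)
      (r := fun X => X) (F := fun _ _ => LinearMap.id) (G := fun _ _ => LinearMap.id)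
      (K := fun X Y => A.bar X Y ∘ₗ A.bar X Y) (A := fun _ _ => 0) (B := fun _ _ => 0)
      (fun _ => rfl) isHat_id
      (fun φ p => by
        have e : (p.sumSplits fun Z s t => φ Z (sg _ _ (A.bar _ _ (of s))) (A.bar _ _ (of t))) +
            (p.sumSplits fun Z s t => φ Z (A.bar _ _ (sg _ _ (of s))) (A.bar _ _ (of t))) = 0 := by
          rw [← Path.sumSplits_add]
          refine Path.sumSplits_eq_zero fun Z s t _ => ?_
          rw [bar_sg, map_neg, LinearMap.neg_apply, add_neg_cancel]
        simp only [LinearMap.comp_apply, LinearMap.zero_apply, map_zero,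
          Path.sumSplits_zero, add_zero]
        rw [split_bar, split_bar, split_bar]
        simp only [split_of, LinearMap.compl₁₂_apply, LinearMap.comp_apply, LinearMap.id_apply,
          sg_sg] at e ⊢
        linear_combination (norm := abel) e)
      (fun p => A.bar_mem_reduced _) p.length (fun p _ => hpr p)
      (fun p _ => by rw [LinearMap.zero_apply, map_zero]) p (Nat.le_succ _)
    rw [hpr] at this
    refine this.trans ?_
    simp
  exact LinearMap.congr_fun this x

end AInfCat

namespace GQuiver

open Quiver (Path)

variable {Q : GQuiver.{w, v, u} k}

namespace Words

variable {X Y Z : Q.Obj} {j l : Q.Obj → Q.Obj}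

/-! ### Changing the components on long words -/

/-- Changing the components of a cohomomorphism on words of length greater than `n` changes it on
words of length `n + 1` only by adding the change of its component. -/
theorem hat_eq_add_letter {f f' φ : ∀ X Y, Q.Words X Y →ₗ[k] Q.Tot (j X) (j Y)}
    (hf : ∀ X Y x, f' X Y x = f X Y x + φ X Y x) {n : ℕ}
    (hφ : ∀ {X Y : Q.Obj} (p : Path X Y), p.length ≤ n → φ X Y (of p) = 0)
    (p : Path X Y) (hp : p.length ≤ n + 1) :
    hat f' X Y (of p) = hat f X Y (of p) + letter (j X) (j Y) (φ X Y (of p)) := by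
  suffices ∀ (m : ℕ) {X Y : Q.Obj} (p : Path X Y), p.length = m → p.length ≤ n + 1 →
      hat f' X Y (of p) = hat f X Y (of p) + letter (j X) (j Y) (φ X Y (of p)) from
    this _ p rfl hp
  intro m
  induction m using Nat.strong_induction_on with
  | _ m ih =>
    intro X Y p hpm hp
    cases p with
    | nil =>
      rw [(isHat_hat f').map_nil, (isHat_hat f).map_nil, hφ _ (by simp), map_zero, add_zero]
    | @cons Y' _ p a =>
      rw [Path.length_cons] at hpm hp
      have h : letter (j X) (j Y) (φ X Y (of (p.cons a))) = p.sumSplits fun W s t =>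
          conc (j X) (j W) (j Y) (hat f X W (of s))
            (letter (j W) (j Y) (φ W Y (of (t.cons a)))) := by
        rw [Path.sumSplits_of_left, (isHat_hat f).map_nil]
        · exact (one_conc _).symm
        · intro W s t hst hs
          have := Path.length_of_comp_eq hst
          rw [hφ (t.cons a) (by rw [Path.length_cons]; omega), map_zero, map_zero]
      rw [(isHat_hat f').map_cons, (isHat_hat f).map_cons, h, ← Path.sumSplits_add]
      refine Path.sumSplits_congr fun W s t hst => ?_
      have := Path.length_of_comp_eq hst
      rw [ih s.length (by omega) s rfl (by omega), hφ s (by omega), map_zero, add_zero, hf,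
        map_add, map_add]

/-- Changing the components of a cohomomorphism and of a coderivation on words of length greater
than `n` changes the coderivation on words of length `n + 1` by two terms. -/
theorem coder_eq_add_letter {F : ∀ X Y, Q.Words X Y →ₗ[k] Q.Words (j X) (j Y)}
    (hF : ∀ X, F X X (one X) = one (j X))
    {f f' φ : ∀ X Y, Q.Words X Y →ₗ[k] Q.Tot (l X) (l Y)}
    (hf : ∀ X Y x, f' X Y x = f X Y x + φ X Y x)
    {c c' γ : ∀ X Y, Q.Words X Y →ₗ[k] Q.Tot (j X) (l Y)}
    (hc : ∀ X Y x, c' X Y x = c X Y x + γ X Y x) {n : ℕ}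
    (hφ : ∀ {X Y : Q.Obj} (p : Path X Y), p.length ≤ n → φ X Y (of p) = 0)
    (hγ : ∀ {X Y : Q.Obj} (p : Path X Y), p.length ≤ n → γ X Y (of p) = 0)
    (p : Path X Y) (hp : p.length ≤ n + 1) :
    coder F c' (hat f') X Y (of p) = coder F c (hat f) X Y (of p) +
      (letter (j X) (l Y) (γ X Y (of p)) + conc (j X) (l X) (l Y)
        (letter (j X) (l X) (c X X (one X))) (letter (l X) (l Y) (φ X Y (of p)))) := by
  have h₁ : letter (j X) (l Y) (γ X Y (of p)) =
      p.sumSplits fun Z s r => r.sumSplits fun W t q => conc (j X) (l W) (l Y)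
        (conc (j X) (j Z) (l W) (F X Z (of s)) (letter (j Z) (l W) (γ Z W (of t))))
        (hat f W Y (of q)) := by
    rw [Path.sumSplits_of_left, Path.sumSplits_of_right, (isHat_hat f).map_nil]
    · exact ((conc_one _).trans ((congrArg (fun z => conc (j X) (j X) (l Y) z
        (letter (j X) (l Y) (γ X Y (of p)))) (hF X)).trans (one_conc _))).symm
    · intro W t q hq hl
      have := Path.length_of_comp_eq hq
      rw [hγ t (by omega), map_zero, map_zero, map_zero, LinearMap.zero_apply]
    · intro Z s r hr hl
      have := Path.length_of_comp_eq hr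
      refine Path.sumSplits_eq_zero fun W t q hq => ?_
      have := Path.length_of_comp_eq hq
      rw [hγ t (by omega), map_zero, map_zero, map_zero, LinearMap.zero_apply]
  have h₂ : conc (j X) (l X) (l Y) (letter (j X) (l X) (c X X (one X)))
        (letter (l X) (l Y) (φ X Y (of p))) =
      p.sumSplits fun Z s r => r.sumSplits fun W t q => conc (j X) (l W) (l Y)
        (conc (j X) (j Z) (l W) (F X Z (of s)) (letter (j Z) (l W) (c Z W (of t))))
        (letter (l W) (l Y) (φ W Y (of q))) := by
    rw [Path.sumSplits_of_left, Path.sumSplits_of_left]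
    · exact (congrArg (fun z => conc (j X) (l X) (l Y) z (letter (l X) (l Y) (φ X Y (of p))))
        ((congrArg (fun z => conc (j X) (j X) (l X) z
          (letter (j X) (l X) (c X X (one X)))) (hF X)).trans (one_conc _))).symm
    · intro W t q hq hl
      have := Path.length_of_comp_eq hq
      rw [hφ q (by omega), map_zero, map_zero]
    · intro Z s r hr hl
      have := Path.length_of_comp_eq hr
      refine Path.sumSplits_eq_zero fun W t q hq => ?_
      have := Path.length_of_comp_eq hq
      rw [hφ q (by omega), map_zero, map_zero]
  rw [h₁, h₂, ← Path.sumSplits_add, coder_of', coder_of', ← Path.sumSplits_add]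
  refine Path.sumSplits_congr fun Z s r hr => ?_
  rw [← Path.sumSplits_add, ← Path.sumSplits_add]
  refine Path.sumSplits_congr fun W t q hq => ?_
  have hl₁ := Path.length_of_comp_eq hr
  have hl₂ := Path.length_of_comp_eq hq
  rw [hat_eq_add_letter hf hφ q (by omega), hc]
  by_cases ht : t.length ≤ n
  · rw [hγ t ht]
    simp only [map_add, map_zero, add_zero, zero_add, LinearMap.zero_apply]
  · rw [hφ q (by omega)]
    simp only [map_add, map_zero, add_zero, LinearMap.add_apply]

end Words

end GQuiver

/-! ### The defects of a prefunctor and of a pretransformation -/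

namespace AInfCat

open GQuiver Words
open Quiver (Path)

variable (A : AInfCat.{w, v, u} k) {X Y Z : A.Obj} {L : A.Obj → A.Obj}
  (f : ∀ X Y, A.Words X Y →ₗ[k] A.Tot (L X) (L Y)) (t : ∀ X Y, A.Words X Y →ₗ[k] A.Tot X (L Y))

theorem b_letter (a : A.Tot X Y) : A.b X Y (letter X Y a) = A.d X Y a := A.b_of _

theorem b_conc_letter (a : A.Tot X Y) (c : A.Tot Y Z) :
    A.b X Z (conc X Y Z (letter X Y a) (letter Y Z c)) = A.m2 X Y Z a c :=
  (congrArg _ (conc_of _ _)).trans (A.b_of _)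

theorem bar_one (X : A.Obj) : A.bar X X (one X) = 0 := by
  refine (coder_one (Q := A.toGQuiver) (j := fun X => X) (l := fun X => X)
    (F := fun X Y => sg X Y) (c := A.b) (G := fun _ _ => LinearMap.id) isHat_id X).trans ?_
  rw [one, convLetter_of, Path.sumSplits_nil]
  have := A.b_one X
  rw [one] at this
  rw [this, map_zero, map_zero]

/-- The failure of the family `f` to satisfy the equations of an `A∞`-functor. -/
noncomputable def funDefect (X Y : A.Obj) : A.Words X Y →ₗ[k] A.Tot (L X) (L Y) :=
  A.b (L X) (L Y) ∘ₗ hat f X Y - f X Y ∘ₗ A.bar X Y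

/-- The coderivation with component `t`, from the identity to the cohomomorphism with
components `f`. -/
noncomputable def natHat (X Y : A.Obj) : A.Words X Y →ₗ[k] A.Words X (L Y) :=
  coder (j := fun X => X) (l := L) (fun X Y => sg X Y) t (hat f) X Y

/-- The failure of the family `t` to satisfy the equations of a natural transformation from the
identity to the functor with components `f`. -/
noncomputable def natDefect (X Y : A.Obj) : A.Words X Y →ₗ[k] A.Tot X (L Y) :=
  A.b X (L Y) ∘ₗ A.natHat f t X Y + t X Y ∘ₗ A.bar X Y

/-- The families `f` and `t` are homogeneous of the degrees of the components of an `A∞`-functor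
and of a natural transformation of degree zero from the identity to this functor, and on empty
words they have the values `0` and `η`. -/
structure IsPre (η : ∀ X, A.Tot X (L X)) : Prop where
  f_one : ∀ X, f X X (one X) = 0
  t_one : ∀ X, t X X (one X) = η X
  deg_f : IsDeg (Q := A.toGQuiver) (j := L) (l := L) f 1
  deg_t : IsDeg (Q := A.toGQuiver) (j := fun X => X) (l := L) t 0

variable {A f t} {η : ∀ X, A.Tot X (L X)}

theorem IsPre.hat_sg (h : A.IsPre f t η) (x : A.Words X Y) :
    hat f X Y (sg X Y x) = sg (L X) (L Y) (hat f X Y x) := by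
  have : hat f X Y ∘ₗ sg X Y = sg (L X) (L Y) ∘ₗ hat f X Y := hom_ext fun p =>
    (isHat_hat f).map_sg (fun p => (IsDeg.map_sg h.deg_f (of p)).trans (by simp)) p
  exact LinearMap.congr_fun this x

theorem IsPre.natHat_sg (h : A.IsPre f t η) (x : A.Words X Y) :
    A.natHat f t X Y (sg X Y x) = -sg X (L Y) (A.natHat f t X Y x) := by
  have : A.natHat f t X Y ∘ₗ sg X Y = -(sg X (L Y) ∘ₗ A.natHat f t X Y) := hom_ext fun p =>
    coder_sg (Q := A.toGQuiver) (j := fun X => X) (l := L) (F := fun X Y => sg X Y)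
      (c := t) (G := hat f) (fun p => rfl)
      (fun p => (IsDeg.map_sg h.deg_t (of p)).trans (by
        rw [show (0 : ℤ) - 1 = -1 by norm_num, Int.negOnePow_neg, Int.negOnePow_one,
          Units.val_neg, Units.val_one, neg_one_smul]))
      (fun p => h.hat_sg (of p)) p
  exact LinearMap.congr_fun this x

theorem IsPre.pr_hat (h : A.IsPre f t η) (x : A.Words X Y) :
    pr (L X) (L Y) (hat f X Y x) = f X Y x := by
  have : pr (L X) (L Y) ∘ₗ hat f X Y = f X Y := hom_ext fun p => by
    cases p with
    | nil =>
      have h1 := h.f_one X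
      rw [one] at h1
      rw [h1, LinearMap.comp_apply, (isHat_hat f).map_nil, pr_nil]
    | cons p a => exact (isHat_hat f).pr_apply (by simp)
  exact LinearMap.congr_fun this x

theorem pr_natHat (x : A.Words X Y) : pr X (L Y) (A.natHat f t X Y x) = t X Y x := by
  have : pr X (L Y) ∘ₗ A.natHat f t X Y = t X Y := hom_ext fun p =>
    pr_coder (Q := A.toGQuiver) (j := fun X => X) (l := L) isHat_sg (isHat_hat f) p
  exact LinearMap.congr_fun this x

theorem natHat_mem_reduced (x : A.Words X Y) :
    A.natHat f t X Y x ∈ reduced A.toGQuiver X (L Y) := by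
  induction x using Words.induction_on with
  | h p =>
    exact coder_mem_reduced (Q := A.toGQuiver) (j := fun X => X) (l := L)
      (F := fun X Y => sg X Y) (c := t) (G := hat f) p
  | h₀ => rw [map_zero]; exact zero_mem _
  | hadd x y hx hy => rw [map_add]; exact add_mem hx hy
  | hsmul r x hx => rw [map_smul]; exact Submodule.smul_mem _ r hx

theorem hat_mem_reduced {x : A.Words X Y} (hx : x ∈ reduced A.toGQuiver X Y) :
    hat f X Y x ∈ reduced A.toGQuiver (L X) (L Y) := by
  induction hx using Submodule.span_induction with
  | mem x h =>
    obtain ⟨p, hp, rfl⟩ := h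
    exact (isHat_hat f).mem_reduced hp
  | zero => rw [map_zero]; exact zero_mem _
  | add x y _ _ hx hy => rw [map_add]; exact add_mem hx hy
  | smul r x _ hx => rw [map_smul]; exact Submodule.smul_mem _ r hx

theorem IsPre.natHat_one (h : A.IsPre f t η) (X : A.Obj) :
    A.natHat f t X X (one X) = letter X (L X) (η X) := by
  refine (coder_one (Q := A.toGQuiver) (j := fun X => X) (l := L)
    (F := fun X Y => sg X Y) (c := t) (G := hat f) (isHat_hat f) X).trans ?_
  rw [one, convLetter_of, Path.sumSplits_nil]
  have h1 := h.t_one X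
  have h2 := sg_one X
  rw [one] at h1 h2
  rw [h1, h2]
  exact one_conc _

theorem funDefect_one (X : A.Obj) :
    A.funDefect f X X (one X) = 0 := by
  rw [funDefect, LinearMap.sub_apply, LinearMap.comp_apply, LinearMap.comp_apply, bar_one,
    map_zero, (isHat_hat f).map_one, b_one, sub_zero]

theorem IsPre.natDefect_one (h : A.IsPre f t η) (hη : ∀ X, A.d X (L X) (η X) = 0) (X : A.Obj) :
    A.natDefect f t X X (one X) = 0 := by
  rw [natDefect, LinearMap.add_apply, LinearMap.comp_apply, LinearMap.comp_apply, bar_one,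
    map_zero, h.natHat_one, b_letter, hη, add_zero]

theorem IsPre.funDefect_mem (h : A.IsPre f t η) (p : Path X Y) (s : ℤ) (hp : A.HasDeg p s) :
    A.funDefect f X Y (of p) ∈ A.gr (L X) (L Y) (s + 2) :=
  sub_mem (IsDeg.mem A.isDeg_b ((isHat_hat f).mem_deg h.deg_f p s hp) rfl)
    (IsDeg.mem h.deg_f (A.bar_mem_deg p s hp) (by ring))

theorem IsPre.natHat_mem (h : A.IsPre f t η) (p : Path X Y) (s : ℤ) (hp : A.HasDeg p s) :
    A.natHat f t X Y (of p) ∈ deg A.toGQuiver (s - 1) X (L Y) := by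
  have := coder_mem_deg (Q := A.toGQuiver) (j := fun X => X) (l := L)
    (F := fun X Y => sg X Y) (G := hat f)
    (fun p s h => sg_mem_deg (of_mem_deg h)) h.deg_t
    (fun p s hp => (isHat_hat f).mem_deg h.deg_f p s hp) p s hp
  rwa [add_zero] at this

theorem IsPre.natDefect_mem (h : A.IsPre f t η) (p : Path X Y) (s : ℤ) (hp : A.HasDeg p s) :
    A.natDefect f t X Y (of p) ∈ A.gr X (L Y) (s + 1) :=
  add_mem (IsDeg.mem A.isDeg_b (h.natHat_mem p s hp) (by ring))
    (IsDeg.mem h.deg_t (A.bar_mem_deg p s hp) (by ring))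

theorem funDefect_bar (x : A.Words X Y) :
    A.funDefect f X Y (A.bar X Y x) = A.b (L X) (L Y) (hat f X Y (A.bar X Y x)) := by
  rw [funDefect, LinearMap.sub_apply, LinearMap.comp_apply, LinearMap.comp_apply, bar_bar,
    map_zero, sub_zero]

theorem natDefect_bar (x : A.Words X Y) :
    A.natDefect f t X Y (A.bar X Y x) = A.b X (L Y) (A.natHat f t X Y (A.bar X Y x)) := by
  rw [natDefect, LinearMap.add_apply, LinearMap.comp_apply, LinearMap.comp_apply, bar_bar,
    map_zero, add_zero]

theorem split_hat {M : Type (max u v w)} [AddCommGroup M] [Module k M]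
    (φ : ∀ Z, A.Words (L X) Z →ₗ[k] A.Words Z (L Y) →ₗ[k] M) (x : A.Words X Y) :
    split φ (hat f X Y x) = split (fun Z => (φ (L Z)).compl₁₂ (hat f X Z) (hat f Z Y)) x :=
  IsComult.split_apply (isHat_hat f).comult φ x

theorem split_natHat {M : Type (max u v w)} [AddCommGroup M] [Module k M]
    (φ : ∀ Z, A.Words X Z →ₗ[k] A.Words Z (L Y) →ₗ[k] M) (x : A.Words X Y) :
    split φ (A.natHat f t X Y x) =
      split (fun Z => (φ Z).compl₁₂ (sg X Z) (A.natHat f t Z Y)) x +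
      split (fun Z => (φ (L Z)).compl₁₂ (A.natHat f t X Z) (hat f Z Y)) x :=
  IsCoder.split_apply (Q := A.toGQuiver) (j := fun X => X) (l := L)
    (isCoder_coder isHat_sg.comult (isHat_hat f)) φ x

/-- If the defect vanishes on words of length at most `n`, the failure of the cohomomorphism to
commute with the bar differentials is, on words of length `n + 1`, given by the defect. -/
theorem IsPre.bar_hat (h : A.IsPre f t η) {n : ℕ}
    (hf : ∀ {X Y : A.Obj} (p : Path X Y), p.length ≤ n → A.funDefect f X Y (of p) = 0)
    (p : Path X Y) (hp : p.length ≤ n + 1) :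
    A.bar (L X) (L Y) (hat f X Y (of p)) - hat f X Y (A.bar X Y (of p)) =
      letter (L X) (L Y) (A.funDefect f X Y (of p)) := by
  have hpr : ∀ {X Y : A.Obj} (p : Path X Y), pr (L X) (L Y)
      ((A.bar (L X) (L Y) ∘ₗ hat f X Y - hat f X Y ∘ₗ A.bar X Y) (of p)) =
        A.funDefect f X Y (of p) := fun p => by
    simp only [LinearMap.sub_apply, LinearMap.comp_apply, map_sub, pr_bar, h.pr_hat, funDefect]
  have := eq_letter_of_coder (Q := A.toGQuiver) (j := L) (l := L)
    (r := L) (F := fun X Y => hat f X Y ∘ₗ sg X Y) (G := hat f)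
    (K := fun X Y => A.bar (L X) (L Y) ∘ₗ hat f X Y - hat f X Y ∘ₗ A.bar X Y)
    (A := fun _ _ => 0) (B := fun _ _ => 0)
    (fun _ => (congrArg _ (sg_one _)).trans ((isHat_hat f).map_one _)) (isHat_hat f)
    (fun {X Y M} _ _ φ p => by
      simp only [LinearMap.comp_apply, LinearMap.sub_apply, LinearMap.zero_apply, map_zero,
        Path.sumSplits_zero, add_zero, map_sub]
      rw [split_bar, split_hat, split_hat, split_hat, split_bar]
      simp only [split_of, LinearMap.compl₁₂_apply, LinearMap.comp_apply, h.hat_sg]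
      simp only [Path.sumSplits_sub]
      abel)
    (fun p => sub_mem (A.bar_mem_reduced _) (hat_mem_reduced (A.bar_mem_reduced _))) n
    (fun p hp => (hpr p).trans (hf p hp))
    (fun p _ => by rw [LinearMap.zero_apply, map_zero]) p hp
  rw [hpr, LinearMap.zero_apply, map_zero, LinearMap.zero_apply, add_zero] at this
  exact this

/-- If the defects vanish on words of length at most `n`, the failure of the coderivation to
anticommute with the bar differentials is, on words of length `n + 1`, given by the defects. -/
theorem IsPre.bar_natHat (h : A.IsPre f t η) (hη : ∀ X, η X ∈ A.gr X (L X) 0) {n : ℕ}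
    (hf : ∀ {X Y : A.Obj} (p : Path X Y), p.length ≤ n → A.funDefect f X Y (of p) = 0)
    (ht : ∀ {X Y : A.Obj} (p : Path X Y), p.length ≤ n → A.natDefect f t X Y (of p) = 0)
    (p : Path X Y) (hp : p.length ≤ n + 1) :
    A.bar X (L Y) (A.natHat f t X Y (of p)) + A.natHat f t X Y (A.bar X Y (of p)) =
      letter X (L Y) (A.natDefect f t X Y (of p)) - conc X (L X) (L Y) (letter X (L X) (η X))
        (letter (L X) (L Y) (A.funDefect f X Y (of p))) := by
  have hpr : ∀ {X Y : A.Obj} (p : Path X Y), pr X (L Y)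
      ((A.bar X (L Y) ∘ₗ A.natHat f t X Y + A.natHat f t X Y ∘ₗ A.bar X Y) (of p)) =
        A.natDefect f t X Y (of p) := fun p => by
    simp only [LinearMap.add_apply, LinearMap.comp_apply, map_add, pr_bar, pr_natHat, natDefect]
  have hpr' : ∀ {X Y : A.Obj} (p : Path X Y), pr (L X) (L Y)
      ((A.bar (L X) (L Y) ∘ₗ hat f X Y - hat f X Y ∘ₗ A.bar X Y) (of p)) =
        A.funDefect f X Y (of p) := fun p => by
    simp only [LinearMap.sub_apply, LinearMap.comp_apply, map_sub, pr_bar, h.pr_hat, funDefect]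
  have := eq_letter_of_coder (Q := A.toGQuiver) (j := fun X => X) (l := L)
    (r := L) (F := fun X Y => LinearMap.id) (G := hat f)
    (K := fun X Y => A.bar X (L Y) ∘ₗ A.natHat f t X Y + A.natHat f t X Y ∘ₗ A.bar X Y)
    (A := fun X Y => sg X (L Y) ∘ₗ A.natHat f t X Y)
    (B := fun X Y => A.bar (L X) (L Y) ∘ₗ hat f X Y - hat f X Y ∘ₗ A.bar X Y)
    (fun _ => rfl) (isHat_hat f)
    (fun {X Y M} _ _ φ p => by
      simp only [LinearMap.comp_apply, LinearMap.add_apply, LinearMap.sub_apply, map_add, map_sub]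
      rw [split_bar, split_natHat, split_natHat, split_natHat, split_bar, split_bar]
      simp only [split_of, LinearMap.compl₁₂_apply, LinearMap.comp_apply, LinearMap.id_apply,
        h.natHat_sg, bar_sg, sg_sg, Path.sumSplits_add, Path.sumSplits_sub,
        map_neg, LinearMap.neg_apply, Path.sumSplits_neg]
      abel)
    (fun p => add_mem (A.bar_mem_reduced _) (natHat_mem_reduced _)) n
    (fun p hp => (hpr p).trans (ht p hp)) (fun p hp => (hpr' p).trans (hf p hp)) p hp
  rw [hpr, hpr'] at this
  refine this.trans ?_
  rw [LinearMap.comp_apply, h.natHat_one, sg_letter, A.sgn_of_mem (hη X),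
    show (0 : ℤ) - 1 = -1 by norm_num, Int.negOnePow_neg, Int.negOnePow_one, Units.val_neg,
    Units.val_one, neg_one_smul, map_neg, map_neg, LinearMap.neg_apply, sub_eq_add_neg]

theorem IsPre.d_funDefect (h : A.IsPre f t η) {n : ℕ}
    (hf : ∀ {X Y : A.Obj} (p : Path X Y), p.length ≤ n → A.funDefect f X Y (of p) = 0)
    (p : Path X Y) (hp : p.length ≤ n + 1) :
    A.d (L X) (L Y) (A.funDefect f X Y (of p)) = -A.funDefect f X Y (A.bar X Y (of p)) := by
  rw [← b_letter, ← h.bar_hat hf p hp, map_sub, b_bar, funDefect_bar, zero_sub]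

theorem IsPre.d_natDefect (h : A.IsPre f t η) (hη : ∀ X, η X ∈ A.gr X (L X) 0) {n : ℕ}
    (hf : ∀ {X Y : A.Obj} (p : Path X Y), p.length ≤ n → A.funDefect f X Y (of p) = 0)
    (ht : ∀ {X Y : A.Obj} (p : Path X Y), p.length ≤ n → A.natDefect f t X Y (of p) = 0)
    (p : Path X Y) (hp : p.length ≤ n + 1) :
    A.d X (L Y) (A.natDefect f t X Y (of p)) -
      A.m2 X (L X) (L Y) (η X) (A.funDefect f X Y (of p)) =
        A.natDefect f t X Y (A.bar X Y (of p)) := by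
  rw [← b_letter, ← b_conc_letter, ← map_sub, ← h.bar_natHat hη hf ht p hp, map_add, b_bar,
    natDefect_bar, zero_add]

/-! ### Correcting the components on long words -/

theorem funDefect_eq {f f' φ : ∀ X Y, A.Words X Y →ₗ[k] A.Tot (L X) (L Y)}
    (hf : ∀ X Y x, f' X Y x = f X Y x + φ X Y x) {n : ℕ}
    (hφ : ∀ {X Y : A.Obj} (p : Path X Y), p.length ≤ n → φ X Y (of p) = 0)
    (p : Path X Y) (hp : p.length ≤ n + 1) :
    A.funDefect f' X Y (of p) = A.funDefect f X Y (of p) +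
      (A.d (L X) (L Y) (φ X Y (of p)) - φ X Y (A.bar X Y (of p))) := by
  simp only [funDefect, LinearMap.sub_apply, LinearMap.comp_apply, hf,
    hat_eq_add_letter hf hφ p hp, map_add, b_letter]
  abel

theorem natDefect_eq {f f' φ : ∀ X Y, A.Words X Y →ₗ[k] A.Tot (L X) (L Y)}
    (hf : ∀ X Y x, f' X Y x = f X Y x + φ X Y x)
    {t t' γ : ∀ X Y, A.Words X Y →ₗ[k] A.Tot X (L Y)}
    (ht : ∀ X Y x, t' X Y x = t X Y x + γ X Y x) {n : ℕ}
    (hφ : ∀ {X Y : A.Obj} (p : Path X Y), p.length ≤ n → φ X Y (of p) = 0)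
    (hγ : ∀ {X Y : A.Obj} (p : Path X Y), p.length ≤ n → γ X Y (of p) = 0)
    (hη : ∀ X, t X X (one X) = η X) (p : Path X Y) (hp : p.length ≤ n + 1) :
    A.natDefect f' t' X Y (of p) = A.natDefect f t X Y (of p) +
      (A.d X (L Y) (γ X Y (of p)) + A.m2 X (L X) (L Y) (η X) (φ X Y (of p)) +
        γ X Y (A.bar X Y (of p))) := by
  have h := coder_eq_add_letter (Q := A.toGQuiver) (j := fun X => X) (l := L)
    (F := fun X Y => sg X Y) sg_one hf ht hφ hγ p hp
  simp only [natDefect, natHat, LinearMap.add_apply, LinearMap.comp_apply, ht]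
  rw [h, hη, map_add, map_add, b_letter, b_conc_letter]
  abel

end AInfCat

/-! ### Contractions -/

section Contraction

variable {U V : ℤ → Type*} [∀ n, AddCommGroup (U n)] [∀ n, Module k (U n)]
  [∀ n, AddCommGroup (V n)] [∀ n, Module k (V n)]

variable (k U V) in
/-- The degree `n` part of the direct sum of the graded spaces `U` and `V[-1]`. -/
def coneDeg (n : ℤ) : Submodule k ((⨁ n, U n) × ⨁ n, V n) :=
  (LinearMap.range (DirectSum.lof k ℤ U n)).prod (LinearMap.range (DirectSum.lof k ℤ V (n - 1)))

/-- An acyclic complex of vector spaces is contractible. -/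
theorem exists_contraction (δ : ((⨁ n, U n) × ⨁ n, V n) →ₗ[k] (⨁ n, U n) × ⨁ n, V n)
    (hδ : ∀ n, ∀ x ∈ coneDeg k U V n, δ x ∈ coneDeg k U V (n + 1)) (hδδ : ∀ x, δ (δ x) = 0)
    (exact : ∀ n, ∀ x ∈ coneDeg k U V n, δ x = 0 → ∃ y ∈ coneDeg k U V (n - 1), δ y = x) :
    ∃ h : ((⨁ n, U n) × ⨁ n, V n) →ₗ[k] (⨁ n, U n) × ⨁ n, V n,
      (∀ n, ∀ x ∈ coneDeg k U V n, h x ∈ coneDeg k U V (n - 1)) ∧ ∀ x, δ (h x) + h (δ x) = x := by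
  have h₁ : ∀ n, ∃ σ : ↥(coneDeg k U V n ⊓ LinearMap.ker δ) →ₗ[k] (⨁ n, U n) × ⨁ n, V n,
      (∀ x, σ x ∈ coneDeg k U V (n - 1)) ∧ ∀ x, δ (σ x) = x := by
    intro n
    let δ' : coneDeg k U V (n - 1) →ₗ[k] ↥(coneDeg k U V n ⊓ LinearMap.ker δ) :=
      (δ ∘ₗ (coneDeg k U V (n - 1)).subtype).codRestrict _ fun x =>
        ⟨by simpa using hδ _ _ x.2, hδδ _⟩
    obtain ⟨σ, hσ⟩ := δ'.exists_rightInverse_of_surjective (LinearMap.range_eq_top.2 fun x => by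
      obtain ⟨y, hy, hyx⟩ := exact n x.1 x.2.1 x.2.2
      exact ⟨⟨y, hy⟩, Subtype.ext hyx⟩)
    exact ⟨(coneDeg k U V (n - 1)).subtype ∘ₗ σ, fun x => (σ x).2,
      fun x => congrArg Subtype.val (LinearMap.congr_fun hσ x)⟩
  choose σ hσ hδσ using h₁
  have hmem : ∀ n (x : coneDeg k U V n),
      δ x.1 ∈ coneDeg k U V (n + 1) ⊓ LinearMap.ker δ := fun n x => ⟨hδ n _ x.2, hδδ _⟩
  have hσ' : ∀ n (x : coneDeg k U V n), σ (n + 1) ⟨δ x.1, hmem n x⟩ ∈ coneDeg k U V n := by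
    intro n x
    have := hσ (n + 1) ⟨δ x.1, hmem n x⟩
    rwa [add_sub_cancel_right] at this
  let e : ∀ n, coneDeg k U V n →ₗ[k] ↥(coneDeg k U V (n + 1) ⊓ LinearMap.ker δ) := fun n =>
    (δ ∘ₗ (coneDeg k U V n).subtype).codRestrict _ (hmem n)
  let g : ∀ n, coneDeg k U V n →ₗ[k] ↥(coneDeg k U V n ⊓ LinearMap.ker δ) := fun n =>
    ((coneDeg k U V n).subtype - σ (n + 1) ∘ₗ e n).codRestrict _ fun x =>
      ⟨sub_mem x.2 (hσ' n x), by
        rw [SetLike.mem_coe, LinearMap.mem_ker, LinearMap.sub_apply, map_sub,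
          LinearMap.comp_apply, hδσ]
        exact sub_self _⟩
  let h' : ∀ n, coneDeg k U V n →ₗ[k] (⨁ n, U n) × ⨁ n, V n := fun n => σ n ∘ₗ g n
  have hh : ∀ n (x : coneDeg k U V n),
      δ (h' n x) + h' (n + 1) ⟨δ x.1, hδ n _ x.2⟩ = x.1 := by
    intro n x
    have e₁ : g (n + 1) ⟨δ x.1, hδ n _ x.2⟩ = ⟨δ x.1, hmem n x⟩ := by
      refine Subtype.ext ?_
      change δ x.1 - σ (n + 1 + 1) (e (n + 1) ⟨δ x.1, _⟩) = δ x.1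
      have : e (n + 1) ⟨δ x.1, hδ n _ x.2⟩ = 0 := Subtype.ext (hδδ _)
      rw [this, map_zero, sub_zero]
    change δ (σ n (g n x)) + σ (n + 1) (g (n + 1) _) = x.1
    rw [hδσ, e₁]
    exact sub_add_cancel _ _
  have hcongr : ∀ {n m : ℤ} (_ : n = m) (x : (⨁ n, U n) × ⨁ n, V n) (hn : x ∈ coneDeg k U V n)
      (hm : x ∈ coneDeg k U V m), h' n ⟨x, hn⟩ = h' m ⟨x, hm⟩ := by
    rintro n _ rfl x _ _
    rfl
  have memU : ∀ n (x : U n), ((DirectSum.lof k ℤ U n x, 0) : (⨁ n, U n) × ⨁ n, V n) ∈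
      coneDeg k U V n := fun n x => ⟨⟨x, rfl⟩, zero_mem _⟩
  have memV : ∀ n (x : V n), ((0, DirectSum.lof k ℤ V n x) : (⨁ n, U n) × ⨁ n, V n) ∈
      coneDeg k U V (n + 1) := fun n x => ⟨zero_mem _, by
    rw [add_sub_cancel_right]
    exact ⟨x, rfl⟩⟩
  let h : ((⨁ n, U n) × ⨁ n, V n) →ₗ[k] (⨁ n, U n) × ⨁ n, V n :=
    LinearMap.coprod
      (DirectSum.toModule k ℤ _ fun n => h' n ∘ₗ
        (LinearMap.inl k _ _ ∘ₗ DirectSum.lof k ℤ U n).codRestrict _ (memU n))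
      (DirectSum.toModule k ℤ _ fun n => h' (n + 1) ∘ₗ
        (LinearMap.inr k _ _ ∘ₗ DirectSum.lof k ℤ V n).codRestrict _ (memV n))
  have hU : ∀ n (x : U n), h (DirectSum.lof k ℤ U n x, 0) = h' n ⟨_, memU n x⟩ := by
    intro n x
    refine (LinearMap.coprod_apply _ _ _).trans ?_
    rw [map_zero, add_zero, DirectSum.toModule_lof]
    rfl
  have hV : ∀ n (x : V n), h (0, DirectSum.lof k ℤ V n x) = h' (n + 1) ⟨_, memV n x⟩ := by
    intro n x
    refine (LinearMap.coprod_apply _ _ _).trans ?_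
    rw [map_zero, zero_add, DirectSum.toModule_lof]
    rfl
  have hext : ∀ n (x : coneDeg k U V n), h x.1 = h' n x := by
    rintro n ⟨⟨x₁, x₂⟩, hx⟩
    obtain ⟨a, rfl⟩ : x₁ ∈ LinearMap.range (DirectSum.lof k ℤ U n) := hx.1
    obtain ⟨b, rfl⟩ : x₂ ∈ LinearMap.range (DirectSum.lof k ℤ V (n - 1)) := hx.2
    have e₁ : ((DirectSum.lof k ℤ U n a, DirectSum.lof k ℤ V (n - 1) b) :
        (⨁ n, U n) × ⨁ n, V n) = (DirectSum.lof k ℤ U n a, 0) +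
          (0, DirectSum.lof k ℤ V (n - 1) b) := by simp
    have m₂ : ((0, DirectSum.lof k ℤ V (n - 1) b) : (⨁ n, U n) × ⨁ n, V n) ∈
        coneDeg k U V n := ⟨zero_mem _, ⟨b, rfl⟩⟩
    refine (congrArg h e₁).trans ?_
    rw [map_add, hU, hV, hcongr (sub_add_cancel n 1) _ _ m₂, ← map_add]
    exact congrArg _ (Subtype.ext e₁.symm)
  have key : ∀ n (x : coneDeg k U V n), δ (h x.1) + h (δ x.1) = x.1 := fun n x => by
    rw [hext n x, hext (n + 1) ⟨δ x.1, hδ n _ x.2⟩, hh]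
  refine ⟨h, fun n x hx => ?_, fun x => ?_⟩
  · rw [hext n ⟨x, hx⟩]
    exact hσ n _
  · have : δ ∘ₗ h + h ∘ₗ δ = LinearMap.id := by
      refine LinearMap.prod_ext (DirectSum.linearMap_ext k fun n => LinearMap.ext fun x => ?_)
        (DirectSum.linearMap_ext k fun n => LinearMap.ext fun x => ?_)
      · exact key n ⟨_, memU n x⟩
      · exact key (n + 1) ⟨_, memV n x⟩
    exact LinearMap.congr_fun this x

end Contraction

namespace AInfCat

open GQuiver Words
open Quiver (Path)

variable (A : AInfCat.{w, v, u} k) {X Y Z : A.Obj} {L : A.Obj → A.Obj}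

/-- The differential of the cone of the precomposition with a morphism. -/
noncomputable def preconeD {X X' Y : A.Obj} (c : A.Tot X X') :
    (A.Tot X' Y × A.Tot X Y) →ₗ[k] A.Tot X' Y × A.Tot X Y :=
  (A.d X' Y ∘ₗ LinearMap.fst k _ _).prod
    (-(A.d X Y ∘ₗ LinearMap.snd k _ _) - A.m2 X X' Y c ∘ₗ LinearMap.fst k _ _)

theorem preconeD_apply {X X' Y : A.Obj} (c : A.Tot X X') (x : A.Tot X' Y × A.Tot X Y) :
    A.preconeD c x = (A.d X' Y x.1, -A.d X Y x.2 - A.m2 X X' Y c x.1) := rfl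

theorem d_m2_of_closed {X X' Y : A.Obj} (c : A.Z 0 X X') (a : A.Tot X' Y) :
    A.d X Y (A.m2 X X' Y c.1 a) = A.m2 X X' Y c.1 (A.d X' Y a) := by
  have h := A.d_m2 c.1 a
  rw [A.Z_d c, map_zero, LinearMap.zero_apply, add_zero, A.sgn_of_mem c.2.1,
    show (0 : ℤ) - 1 = -1 by norm_num, Int.negOnePow_neg, Int.negOnePow_one, Units.val_neg,
    Units.val_one, neg_one_smul, map_neg, LinearMap.neg_apply] at h
  exact add_neg_eq_zero.1 h

/-- If precomposition with a closed morphism is bijective on cohomology, its cone is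
contractible. -/
theorem exists_precone_contraction {X X' Y : A.Obj} (c : A.Z 0 X X')
    (hc : ∀ n, Function.Bijective fun f : A.H n X' Y =>
      A.comp (zero_add n) (Submodule.Quotient.mk c : A.H 0 X X') f) :
    ∃ h : (A.Tot X' Y × A.Tot X Y) →ₗ[k] A.Tot X' Y × A.Tot X Y,
      (∀ n, ∀ x : A.Tot X' Y × A.Tot X Y, x.1 ∈ A.gr X' Y n → x.2 ∈ A.gr X Y (n - 1) →
        (h x).1 ∈ A.gr X' Y (n - 1) ∧ (h x).2 ∈ A.gr X Y (n - 1 - 1)) ∧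
      ∀ x, A.preconeD c.1 (h x) + h (A.preconeD c.1 x) = x := by
  have hcomp : ∀ n (f : A.Z n X' Y), A.comp (zero_add n)
      (Submodule.Quotient.mk c : A.H 0 X X') (Submodule.Quotient.mk f) =
        Submodule.Quotient.mk ⟨A.m2 X X' Y c.1 f.1, by
          have := (A.compZ (zero_add n) X X' Y c f).2
          simpa [compZ] using this⟩ := by
    intro n f
    rw [comp_mk]
    congr 1
    refine Subtype.ext ?_
    simp [compZ]
  obtain ⟨h, h₁, h₂⟩ := exists_contraction (A.preconeD (Y := Y) c.1)
    (fun n x hx => by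
      refine ⟨A.d_mem hx.1, sub_mem (neg_mem ?_) ?_⟩
      · have := A.d_mem hx.2
        rwa [show n - 1 + 1 = n + 1 - 1 by ring] at this
      · have := A.m2_mem c.2.1 hx.1
        rwa [show 0 + n = n + 1 - 1 by ring] at this)
    (fun x => by
      simp only [preconeD_apply, d_d, map_sub, map_neg, A.d_m2_of_closed]
      simp)
    (fun n x hx hx0 => by
      obtain ⟨b, r⟩ := x
      rw [preconeD_apply, Prod.mk_eq_zero] at hx0
      obtain ⟨hb, hr⟩ := hx0
      have e₁ : A.comp (zero_add n) (Submodule.Quotient.mk c : A.H 0 X X')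
          (Submodule.Quotient.mk ⟨b, hx.1, hb⟩) = 0 := by
        rw [hcomp]
        refine (mk_eq_zero_iff _).2 ⟨-r, ?_⟩
        change A.d X Y (-r) = A.m2 X X' Y c.1 b
        rw [map_neg]
        exact sub_eq_zero.1 hr
      have e₂ : (Submodule.Quotient.mk ⟨b, hx.1, hb⟩ : A.H n X' Y) = 0 :=
        (hc n).1 (e₁.trans (map_zero (A.comp (zero_add n) _)).symm)
      obtain ⟨b', hb', hbb⟩ := (Submodule.Quotient.mk_eq_zero _).1 e₂
      change A.d X' Y b' = b at hbb
      have hz : r + A.m2 X X' Y c.1 b' ∈ A.Z (n - 1) X Y := by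
        refine ⟨add_mem hx.2 ?_, ?_⟩
        · have := A.m2_mem c.2.1 hb'
          rwa [zero_add] at this
        · rw [SetLike.mem_coe, LinearMap.mem_ker, map_add, A.d_m2_of_closed, hbb]
          have : A.d X Y r = -A.m2 X X' Y c.1 b := by
            linear_combination (norm := module) -hr
          rw [this, neg_add_cancel]
      obtain ⟨q, hq⟩ := (hc (n - 1)).2 (Submodule.Quotient.mk ⟨_, hz⟩)
      obtain ⟨b'', rfl⟩ := Submodule.Quotient.mk_surjective _ q
      dsimp only at hq
      rw [hcomp] at hq
      obtain ⟨r', hr', hrr⟩ := (Submodule.Quotient.eq _).1 hq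
      refine ⟨(b' - b''.1, r'), ⟨sub_mem hb' b''.2.1, hr'⟩, ?_⟩
      rw [preconeD_apply, map_sub, map_sub, A.Z_d b'', hbb, sub_zero]
      refine Prod.ext rfl ?_
      change A.d X Y r' = A.m2 X X' Y c.1 b''.1 - (r + A.m2 X X' Y c.1 b') at hrr
      change -A.d X Y r' - _ = r
      rw [hrr]
      abel)
  exact ⟨h, fun n x hx hx' => h₁ n x ⟨hx, hx'⟩, h₂⟩

end AInfCat

/-! ### Functors from objectwise data -/

theorem exists_seq_of_step {S : Type*} {P : ℕ → S → Prop} {R : ℕ → S → S → Prop}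
    (h₀ : ∃ x, P 0 x) (step : ∀ n x, P n x → ∃ y, P (n + 1) y ∧ R n x y) :
    ∃ s : ℕ → S, (∀ n, P n (s n)) ∧ ∀ n, R n (s n) (s (n + 1)) := by
  obtain ⟨x₀, hx₀⟩ := h₀
  choose y hy hR using step
  let s : ∀ n, {x // P n x} := fun n =>
    Nat.rec ⟨x₀, hx₀⟩ (fun n x => ⟨y n x.1 x.2, hy n x.1 x.2⟩) n
  exact ⟨fun n => (s n).1, fun n => (s n).2, fun n => hR n _ _⟩

namespace GQuiver.Words

open Quiver (Path)

variable {Q : GQuiver.{w, v, u} k} {M : Q.Obj → Q.Obj → Type*} [∀ X Y, AddCommGroup (M X Y)]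
  [∀ X Y, Module k (M X Y)]

/-- A sequence of families of linear maps which stabilizes on words of given length has a
limit. -/
theorem exists_limit (f : ℕ → ∀ X Y, Q.Words X Y →ₗ[k] M X Y)
    (hf : ∀ n, ∀ {X Y : Q.Obj} (p : Path X Y), p.length ≤ n →
      f (n + 1) X Y (of p) = f n X Y (of p)) :
    ∃ g : ∀ X Y, Q.Words X Y →ₗ[k] M X Y, ∀ n, ∀ {X Y : Q.Obj} (p : Path X Y), p.length ≤ n →
      g X Y (of p) = f n X Y (of p) := by
  refine ⟨fun X Y => lift (fun p => f p.length X Y (of p)) ⟨fun p a b q => ?_,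
    fun p r a q => ?_⟩, fun n X Y p hp => ?_⟩
  · simp only [Path.length_comp, Path.length_cons, isMultilinear_of.map_add, map_add]
  · simp only [Path.length_comp, Path.length_cons, isMultilinear_of.map_smul, map_smul]
  · rw [lift_of]
    induction n, hp using Nat.le_induction with
    | base => rfl
    | succ n hn ih => rw [ih, hf n p hn]

end GQuiver.Words

namespace AInfCat

open GQuiver Words
open Quiver (Path)

variable (A : AInfCat.{w, v, u} k) {X Y Z : A.Obj} {L : A.Obj → A.Obj}

theorem map_bar_eq_zero {M : Type*} [AddCommGroup M] [Module k M] {g : A.Words X Y →ₗ[k] M}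
    {n : ℕ} (hg : ∀ p : Path X Y, p.length ≤ n → g (of p) = 0) (p : Path X Y)
    (hp : p.length ≤ n) : g (A.bar X Y (of p)) = 0 := by
  rw [bar, coder_of', Path.map_sumSplits g]
  refine Path.sumSplits_eq_zero fun Z s r hr => ?_
  rw [Path.map_sumSplits g]
  refine Path.sumSplits_eq_zero fun W t q hq => ?_
  have h₁ := Path.length_of_comp_eq hr
  have h₂ := Path.length_of_comp_eq hq
  by_cases ht : t.length = 0
  · cases t with
    | nil => rw [b_of, A.μ.ev_nil, map_zero, map_zero, LinearMap.map_zero₂, map_zero]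
    | cons t a => simp at ht
  · have : conc X W Y (conc X Z W (sg X Z (of s)) (letter Z W (A.b Z W (of t)))) (of q) =
        of (((A.sgnWord s).cons (A.b Z W (of t))).comp q) := by
      rw [sg_of]
      exact (congrArg (fun z => conc X W Y z (of q)) (conc_letter (A.sgnWord s) _)).trans
        (conc_of _ _)
    refine (congrArg g this).trans (hg _ ?_)
    rw [Path.length_comp, Path.length_cons, length_sgnWord]
    omega

variable {A} {f : ∀ X Y, A.Words X Y →ₗ[k] A.Tot (L X) (L Y)}
  {t : ∀ X Y, A.Words X Y →ₗ[k] A.Tot X (L Y)} {η : ∀ X, A.Z 0 X (L X)}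

/-- The inductive step: if the defects vanish on words of length at most `n`, they form a cocycle
on words of length `n + 1`, and contractions of the cones provide corrections which make them
vanish on these words as well. -/
theorem IsPre.exists_correction (h : A.IsPre f t fun X => (η X).1)
    (hη : ∀ n X Y, Function.Bijective fun g : A.H n (L X) (L Y) =>
      A.comp (zero_add n) (Submodule.Quotient.mk (η X) : A.H 0 X (L X)) g) {n : ℕ}
    (hf : ∀ {X Y : A.Obj} (p : Path X Y), p.length ≤ n → A.funDefect f X Y (of p) = 0)
    (ht : ∀ {X Y : A.Obj} (p : Path X Y), p.length ≤ n → A.natDefect f t X Y (of p) = 0) :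
    ∃ (f' : ∀ X Y, A.Words X Y →ₗ[k] A.Tot (L X) (L Y))
      (t' : ∀ X Y, A.Words X Y →ₗ[k] A.Tot X (L Y)), A.IsPre f' t' (fun X => (η X).1) ∧
      (∀ {X Y : A.Obj} (p : Path X Y), p.length ≤ n + 1 → A.funDefect f' X Y (of p) = 0) ∧
      (∀ {X Y : A.Obj} (p : Path X Y), p.length ≤ n + 1 → A.natDefect f' t' X Y (of p) = 0) ∧
      ∀ {X Y : A.Obj} (p : Path X Y), p.length ≤ n →
        f' X Y (of p) = f X Y (of p) ∧ t' X Y (of p) = t X Y (of p) := by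
  choose c hc₁ hc₂ using fun X Y => A.exists_precone_contraction (Y := L Y) (η X)
    fun n => hη n X Y
  let D : ∀ X Y, A.Words X Y →ₗ[k] A.Tot (L X) (L Y) × A.Tot X (L Y) := fun X Y =>
    (A.funDefect f X Y).prod (-A.natDefect f t X Y)
  have hD : ∀ {X Y : A.Obj} (p : Path X Y), p.length ≤ n → D X Y (of p) = 0 := fun p hp =>
    Prod.ext (hf p hp) (neg_eq_zero.2 (ht p hp))
  let φ : ∀ X Y, A.Words X Y →ₗ[k] A.Tot (L X) (L Y) := fun X Y =>
    -(LinearMap.fst k _ _ ∘ₗ c X Y ∘ₗ D X Y)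
  let γ : ∀ X Y, A.Words X Y →ₗ[k] A.Tot X (L Y) := fun X Y =>
    -(LinearMap.snd k _ _ ∘ₗ c X Y ∘ₗ D X Y)
  have hφγ : ∀ X Y x, (φ X Y x, γ X Y x) = -c X Y (D X Y x) := fun X Y x => rfl
  have hφ : ∀ {X Y : A.Obj} (p : Path X Y), p.length ≤ n → φ X Y (of p) = 0 :=
    fun {X Y} p hp => by
      have := hφγ X Y (of p)
      rw [hD p hp, map_zero, neg_zero] at this
      exact congrArg Prod.fst this
  have hγ : ∀ {X Y : A.Obj} (p : Path X Y), p.length ≤ n → γ X Y (of p) = 0 :=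
    fun {X Y} p hp => by
      have := hφγ X Y (of p)
      rw [hD p hp, map_zero, neg_zero] at this
      exact congrArg Prod.snd this
  have hdeg : ∀ {X Y : A.Obj} (p : Path X Y) (s : ℤ), A.HasDeg p s →
      φ X Y (of p) ∈ A.gr (L X) (L Y) (s + 1) ∧ γ X Y (of p) ∈ A.gr X (L Y) s := by
    intro X Y p s hp
    have h₁ := h.natDefect_mem p s hp
    rw [show s + 1 = s + 2 - 1 by ring] at h₁
    have := hc₁ X Y (s + 2) (D X Y (of p)) (h.funDefect_mem p s hp) (neg_mem h₁)
    rw [show s + 2 - 1 = s + 1 by ring, show s + 1 - 1 = s by ring] at this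
    exact ⟨neg_mem this.1, neg_mem this.2⟩
  -- the corrected defect is `D + δ c' - c' b` where `c' = -c D`, and `δ D = -D b`
  have key : ∀ {X Y : A.Obj} (p : Path X Y), p.length ≤ n + 1 →
      D X Y (of p) + (A.preconeD (η X).1 (φ X Y (of p), γ X Y (of p)) -
        (φ X Y (A.bar X Y (of p)), γ X Y (A.bar X Y (of p)))) = 0 := by
    intro X Y p hp
    have e₁ : A.preconeD (η X).1 (D X Y (of p)) = -D X Y (A.bar X Y (of p)) := by
      rw [preconeD_apply]
      refine Prod.ext (h.d_funDefect hf p hp) ?_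
      have := h.d_natDefect (fun X => (η X).2.1) hf ht p hp
      change -A.d X (L Y) (-A.natDefect f t X Y (of p)) - _ = - -A.natDefect f t X Y _
      rw [map_neg, neg_neg, neg_neg]
      exact this
    rw [hφγ, hφγ, map_neg]
    have e₂ := hc₂ X Y (D X Y (of p))
    rw [e₁, map_neg] at e₂
    linear_combination (norm := module) -e₂
  refine ⟨fun X Y => f X Y + φ X Y, fun X Y => t X Y + γ X Y, ⟨fun X => ?_, fun X => ?_,
    fun p s hp => ?_, fun p s hp => ?_⟩, fun {X Y} p hp => ?_, fun {X Y} p hp => ?_,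
    fun p hp => ?_⟩
  · have := hφ (Path.nil : Path X X) (by simp)
    rw [LinearMap.add_apply, h.f_one, zero_add]
    exact this
  · have := hγ (Path.nil : Path X X) (by simp)
    rw [LinearMap.add_apply, h.t_one]
    exact (congrArg _ this).trans (add_zero _)
  · exact add_mem (h.deg_f p s hp) (hdeg p s hp).1
  · refine add_mem (h.deg_t p s hp) ?_
    rw [add_zero]
    exact (hdeg p s hp).2
  · rw [funDefect_eq (f := f) (φ := φ) (fun _ _ _ => rfl) hφ p hp]
    exact congrArg Prod.fst (key p hp)
  · rw [natDefect_eq (f := f) (φ := φ) (fun _ _ _ => rfl) (t := t) (γ := γ) (fun _ _ _ => rfl)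
      hφ hγ h.t_one p hp]
    have := congrArg Prod.snd (key p hp)
    change -A.natDefect f t X Y (of p) + ((-A.d X (L Y) (γ X Y (of p)) -
      A.m2 X (L X) (L Y) (η X).1 (φ X Y (of p))) - γ X Y (A.bar X Y (of p))) = 0 at this
    linear_combination (norm := module) -this
  · exact ⟨(congrArg _ (hφ p hp)).trans (add_zero _), (congrArg _ (hγ p hp)).trans (add_zero _)⟩

/-- If precomposition with `η_X : X → L X` is bijective on `Hom^*(-, L Y)` for all `X` and `Y`,
the objects `L X` and the morphisms `η_X` extend to an `A∞`-functor and a natural transformation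
from the identity to it. -/
theorem exists_isPre (η : ∀ X, A.Z 0 X (L X))
    (hη : ∀ n X Y, Function.Bijective fun g : A.H n (L X) (L Y) =>
      A.comp (zero_add n) (Submodule.Quotient.mk (η X) : A.H 0 X (L X)) g) :
    ∃ (f : ∀ X Y, A.Words X Y →ₗ[k] A.Tot (L X) (L Y))
      (t : ∀ X Y, A.Words X Y →ₗ[k] A.Tot X (L Y)), A.IsPre f t (fun X => (η X).1) ∧
      (∀ {X Y : A.Obj} (p : Path X Y), A.funDefect f X Y (of p) = 0) ∧
      ∀ {X Y : A.Obj} (p : Path X Y), A.natDefect f t X Y (of p) = 0 := by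
  let S := (∀ X Y, A.Words X Y →ₗ[k] A.Tot (L X) (L Y)) ×
    (∀ X Y, A.Words X Y →ₗ[k] A.Tot X (L Y))
  have h₀ : ∃ x : S, A.IsPre x.1 x.2 (fun X => (η X).1) ∧
      (∀ {X Y : A.Obj} (p : Path X Y), p.length ≤ 0 → A.funDefect x.1 X Y (of p) = 0) ∧
      ∀ {X Y : A.Obj} (p : Path X Y), p.length ≤ 0 → A.natDefect x.1 x.2 X Y (of p) = 0 := by
    let t₀ : ∀ {X Y : A.Obj}, Path X Y → A.Tot X (L Y) := fun {X Y} p =>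
      Quiver.Path.rec (motive := fun Y _ => A.Tot X (L Y)) (η X).1 (fun _ _ _ => 0) p
    have t₀_cons : ∀ {X Y Z : A.Obj} (p : Path X Y) (a : Y ⟶ Z), t₀ (p.cons a) = 0 :=
      fun _ _ => rfl
    have t₀_comp : ∀ {X Y Z W : A.Obj} (p : Path X Y) (a : Y ⟶ Z) (q : Path Z W),
        t₀ ((p.cons a).comp q) = 0 := fun p a q => by cases q <;> rfl
    have hpre : A.IsPre (fun X Y => (0 : A.Words X Y →ₗ[k] A.Tot (L X) (L Y)))
        (fun X Y => lift (fun p => t₀ p)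
          ⟨fun p a b q => by rw [t₀_comp, t₀_comp, t₀_comp, add_zero],
            fun p r a q => by rw [t₀_comp, t₀_comp, smul_zero]⟩) (fun X => (η X).1) :=
      ⟨fun _ => rfl, fun X => lift_of _ _ _, fun _ _ _ => zero_mem _, fun {X Y} p s hp => by
        rw [lift_of]
        cases hp with
        | nil => exact (η X).2.1
        | cons n a _ _ => exact zero_mem _⟩
    refine ⟨(_, _), hpre, fun {X Y} p hp => ?_, fun {X Y} p hp => ?_⟩
    · cases p with
      | nil => exact funDefect_one X
      | cons p a => simp at hp
    · cases p with
      | nil => exact hpre.natDefect_one (fun X => A.Z_d (η X)) X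
      | cons p a => simp at hp
  obtain ⟨s, hs, hss⟩ := exists_seq_of_step
    (P := fun n (x : S) => A.IsPre x.1 x.2 (fun X => (η X).1) ∧
      (∀ {X Y : A.Obj} (p : Path X Y), p.length ≤ n → A.funDefect x.1 X Y (of p) = 0) ∧
      ∀ {X Y : A.Obj} (p : Path X Y), p.length ≤ n → A.natDefect x.1 x.2 X Y (of p) = 0)
    (R := fun n x y => ∀ {X Y : A.Obj} (p : Path X Y), p.length ≤ n →
      y.1 X Y (of p) = x.1 X Y (of p) ∧ y.2 X Y (of p) = x.2 X Y (of p)) h₀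
    (fun n x hx => by
      obtain ⟨f', t', h₁, h₂, h₃, h₄⟩ := hx.1.exists_correction hη hx.2.1 hx.2.2
      exact ⟨(f', t'), ⟨h₁, h₂, h₃⟩, h₄⟩)
  obtain ⟨f, hf⟩ := exists_limit (M := fun X Y => A.Tot (L X) (L Y)) (fun n => (s n).1)
    fun n X Y p hp => (hss n p hp).1
  obtain ⟨t, ht⟩ := exists_limit (M := fun X Y => A.Tot X (L Y)) (fun n => (s n).2)
    fun n X Y p hp => (hss n p hp).2
  have hφ : ∀ n, ∀ {X Y : A.Obj} (p : Path X Y), p.length ≤ n →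
      (f X Y - (s n).1 X Y) (of p) = 0 := fun n {X Y} p hp => by
    rw [LinearMap.sub_apply, hf n p hp, sub_self]
  have hγ : ∀ n, ∀ {X Y : A.Obj} (p : Path X Y), p.length ≤ n →
      (t X Y - (s n).2 X Y) (of p) = 0 := fun n {X Y} p hp => by
    rw [LinearMap.sub_apply, ht n p hp, sub_self]
  refine ⟨f, t, ⟨fun X => ?_, fun X => ?_, fun {X Y} p r hp => ?_, fun {X Y} p r hp => ?_⟩,
    fun {X Y} p => ?_, fun {X Y} p => ?_⟩
  · exact (hf 0 (Path.nil : Path X X) (by simp)).trans ((hs 0).1.f_one X)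
  · exact (ht 0 (Path.nil : Path X X) (by simp)).trans ((hs 0).1.t_one X)
  · rw [hf _ p le_rfl]
    exact (hs _).1.deg_f p r hp
  · rw [ht _ p le_rfl]
    exact (hs _).1.deg_t p r hp
  · have hs' := hs p.length
    rw [funDefect_eq (f := (s p.length).1) (φ := fun X Y => f X Y - (s p.length).1 X Y)
      (fun X Y x => (add_sub_cancel _ _).symm) (hφ _) p (Nat.le_succ _), hs'.2.1 p le_rfl,
      hφ _ p le_rfl, A.map_bar_eq_zero (hφ p.length) p le_rfl, map_zero, sub_zero, add_zero]
  · have hs' := hs p.length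
    rw [natDefect_eq (f := (s p.length).1) (φ := fun X Y => f X Y - (s p.length).1 X Y)
      (fun X Y x => (add_sub_cancel _ _).symm) (t := (s p.length).2)
      (γ := fun X Y => t X Y - (s p.length).2 X Y) (fun X Y x => (add_sub_cancel _ _).symm)
      (hφ _) (hγ _) hs'.1.t_one p (Nat.le_succ _), hs'.2.2 p le_rfl,
      hφ _ p le_rfl, hγ _ p le_rfl, A.map_bar_eq_zero (hγ p.length) p le_rfl, map_zero, map_zero,
      add_zero, add_zero, add_zero]

theorem bar_letter (a : A.Tot X Y) :
    A.bar X Y (of (Path.nil.cons a)) = letter X Y (A.d X Y a) := by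
  refine (coder_cons (Q := A.toGQuiver) (j := fun X => X) (l := fun X => X)
    (F := fun X Y => sg X Y) (c := A.b) (G := fun _ _ => LinearMap.id) isHat_id Path.nil a).trans ?_
  have h₁ : coder (Q := A.toGQuiver) (j := fun X => X) (l := fun X => X) (fun X Y => sg X Y) A.b
      (fun _ _ => LinearMap.id) X X (of Path.nil) = 0 := A.bar_one X
  rw [convLetter_of, Path.sumSplits_cons, Path.sumSplits_nil, Path.sumSplits_nil, h₁,
    LinearMap.map_zero₂, zero_add, b_of, b_of, A.μ.ev_nil, map_zero, map_zero, add_zero, sg_of]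
  exact one_conc _

theorem IsPre.natHat_letter {η : ∀ X, A.Tot X (L X)} (h : A.IsPre f t η) (a : A.Tot X Y) :
    A.natHat f t X Y (of (Path.nil.cons a)) =
      conc X (L X) (L Y) (letter X (L X) (η X))
        (letter (L X) (L Y) (f X Y (of (Path.nil.cons a)))) +
      (letter X (L Y) (t X Y (of (Path.nil.cons a))) +
        conc X Y (L Y) (letter X Y (A.sgn X Y a)) (letter Y (L Y) (η Y))) := by
  refine (coder_cons (Q := A.toGQuiver) (j := fun X => X) (l := L)
    (F := fun X Y => sg X Y) (c := t) (G := hat f) (isHat_hat f) Path.nil a).trans ?_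
  have h₁ : coder (Q := A.toGQuiver) (j := fun X => X) (l := L) (fun X Y => sg X Y) t
      (hat f) X X (of Path.nil) = letter X (L X) (η X) := h.natHat_one X
  have h₂ := h.t_one Y
  rw [one] at h₂
  rw [convLetter_of, Path.sumSplits_cons, Path.sumSplits_nil, Path.sumSplits_nil, h₁, h₂, sg_of,
    sg_of]
  exact congrArg₂ (· + ·) rfl (congrArg₂ (· + ·) (one_conc _) rfl)

theorem sum_cutsAux {P : A.Obj → Prop} {L : A.Obj → (A.full P).Obj}
    (Φ : MultiOp A.toGQuiver (A.full P).toGQuiver L 1)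
    (g : ∀ X Y, A.Words X Y →ₗ[k] A.Tot (L X).1 (L Y).1) (hg : ∀ {X Y : A.Obj} (p : Path X Y),
      g X Y (of p) = Φ.ev p) (p : Path X Y) (t : Path Y Z) :
    ((Φ.cutsAux p t).map fun q =>
      (of ((A.fullIncl P).word q) : A.Words (L X).1 (L Z).1)).sum =
        hatAux (j := fun X => (L X).1) g p t := by
  induction p generalizing Z with
  | nil =>
    rw [MultiOp.cutsAux, hatAux, hg]
    exact add_zero _
  | @cons W Y p a ih =>
    rw [MultiOp.cutsAux, hatAux, hg]
    refine (congrArg List.sum List.map_append).trans (List.sum_append.trans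
      (congrArg₂ (· + ·) (ih _) ?_))
    refine Eq.trans ?_ (congrArg ((conc (L X).1 (L Y).1 (L Z).1).flip
      (letter (L Y).1 (L Z).1 (Φ.ev t))) (ih _))
    refine Eq.trans ?_ (map_list_sum ((conc (L X).1 (L Y).1 (L Z).1).flip
      (letter (L Y).1 (L Z).1 (Φ.ev t))) _).symm
    refine congrArg List.sum (List.map_map.trans (Eq.trans ?_ List.map_map.symm))
    refine List.map_congr_left fun q _ => ?_
    exact (conc_letter ((A.fullIncl P).word q) (Φ.ev t)).symm

theorem sum_cuts {P : A.Obj → Prop} {L : A.Obj → (A.full P).Obj}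
    (Φ : MultiOp A.toGQuiver (A.full P).toGQuiver L 1)
    (g : ∀ X Y, A.Words X Y →ₗ[k] A.Tot (L X).1 (L Y).1) (hg : ∀ {X Y : A.Obj} (p : Path X Y),
      g X Y (of p) = Φ.ev p) (p : Path X Y) :
    ((Φ.cuts p).map fun q =>
      (of ((A.fullIncl P).word q) : A.Words (L X).1 (L Y).1)).sum =
        hat (j := fun X => (L X).1) g X Y (of p) := by
  rw [hat_of]
  cases p with
  | nil => exact add_zero _
  | cons p a => exact sum_cutsAux Φ g hg p (Quiver.Hom.toPath a)

/-- Reflections onto a full subcategory, given objectwise, extend to an `A∞`-functor which is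
left adjoint to the inclusion. -/
theorem exists_isLeftAdjoint {P : A.Obj → Prop} (L : A.Obj → (A.full P).Obj)
    (η : ∀ X, A.H 0 X (L X).1)
    (hη : ∀ n X, ∀ Z : A.Obj, P Z → Function.Bijective fun g : A.H n (L X).1 Z =>
      A.comp (zero_add n) (η X) g) :
    ∃ Λ : AInfFunctor A (A.full P) L, Λ.IsLeftAdjoint := by
  choose η' hη' using fun X => Submodule.Quotient.mk_surjective _ (η X)
  obtain ⟨f, t, h, hf, ht⟩ := exists_isPre (L := fun X => (L X).1) η' fun n X Y => by
    rw [hη']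
    exact hη n X _ (L Y).2
  let Φ : MultiOp A.toGQuiver (A.full P).toGQuiver L 1 :=
    { ev := fun {X Y} p => f X Y (of p)
      ev_add := fun p a b q => by
        rw [isMultilinear_of.map_add, map_add]
        rfl
      ev_smul := fun p r a q => by
        rw [isMultilinear_of.map_smul, map_smul]
        rfl
      ev_nil := h.f_one
      ev_mem := h.deg_f }
  let Λ : AInfFunctor A (A.full P) L :=
    { F := Φ
      rel := fun {X Y} p => by
        rw [A.insertSum_eq Φ (f X Y) (fun _ => rfl) p]
        refine Eq.trans ?_ (sub_eq_zero.1 (hf p))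
        rw [LinearMap.comp_apply, ← sum_cuts Φ f (fun _ => rfl) p, map_list_sum]
        refine congrArg List.sum (Eq.trans ?_ List.map_map.symm)
        refine List.map_congr_left fun q _ => ?_
        exact (A.b_of _).symm }
  refine ⟨Λ, η, fun n X Y a => ?_, fun n X Z => hη n X Z.1 Z.2⟩
  obtain ⟨a, rfl⟩ := Submodule.Quotient.mk_surjective _ a
  rw [← hη', ← hη']
  refine (mk_eq_iff _ _).2 ⟨-t X Y (of (Path.nil.cons a.1)), ?_⟩
  have h₁ := ht (Path.nil.cons a.1 : Path X Y)
  rw [natDefect, LinearMap.add_apply, LinearMap.comp_apply, LinearMap.comp_apply, bar_letter,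
    A.Z_d a, map_zero, map_zero, add_zero, h.natHat_letter, map_add, map_add, b_conc_letter,
    b_conc_letter, b_letter, A.sgn_of_mem a.2.1, map_zsmul, LinearMap.smul_apply,
    Int.negOnePow_sub, Int.negOnePow_one, mul_neg, mul_one, Units.val_neg, neg_smul] at h₁
  change _ = (((0 : ℤ).negOnePow : ℤˣ) : ℤ) • A.m2 X (L X).1 (L Y).1 (η' X).1
      (f X Y (of (Path.nil.cons a.1))) -
    ((n.negOnePow : ℤˣ) : ℤ) • A.m2 X Y (L Y).1 a.1 (η' Y).1
  rw [Int.negOnePow_zero, Units.val_one, one_smul, map_neg]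
  linear_combination (norm := abel) -h₁

end AInfCat

/-! ### Directed restrictions -/

namespace AInfCat

variable (A : AInfCat.{w, v, u} k) {ι : Type u₁} [LinearOrder ι] (X : ι → A.Obj)

theorem dirIncl_injective (i j : (A.dirQuiver X).Obj) :
    Function.Injective ((A.dirIncl X).tot i j) :=
  (DirectSum.lmap_injective _).2 fun n => (A.dirHom X i.idx j.idx n).injective_subtype

theorem dirIncl_d {i j : (A.directed X).Obj} (a : (A.directed X).Tot i j) :
    (A.dirIncl X).tot i j ((A.directed X).d i j a) =
      A.d (X i.idx) (X j.idx) ((A.dirIncl X).tot i j a) :=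
  A.dirIncl_dirOp X (Quiver.Path.nil.cons a)

theorem directed_eq_zero {i j : (A.directed X).Obj} (hij : ¬ i.idx < j.idx) {n : ℤ}
    (x : (A.directed X).H n i j) : x = 0 := by
  obtain ⟨x, rfl⟩ := Submodule.Quotient.mk_surjective _ x
  refine (mk_eq_zero_iff _).2 ⟨0, (map_zero _).trans (A.dirIncl_injective X i j ?_)⟩
  exact (map_zero _).trans (A.dirIncl_of_not_lt X hij x.1).symm

end AInfCat

namespace AInfFunctor

variable {A : AInfCat.{w, v, u} k} {B : AInfCat.{w, v', u'} k} {f : A.Obj → B.Obj}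
  (Φ : AInfFunctor A B f) {ι : Type u₁} [LinearOrder ι] (X : ι → A.Obj)

theorem dirIncl_directed_lin {i j : (A.directed X).Obj} (a : (A.directed X).Tot i j) :
    (B.dirIncl (f ∘ X)).tot i j ((Φ.directed X).lin i j a) =
      Φ.lin (X i.idx) (X j.idx) ((A.dirIncl X).tot i j a) :=
  Φ.dirIncl_directedOp X (Quiver.Path.nil.cons a)

/-- The directed restriction of an `A∞`-functor is a quasi-isomorphism if the functor induces
isomorphisms on the left-to-right morphism spaces; all other morphism spaces are zero. -/
theorem directed_isQuasiIso
    (h : ∀ i j, i < j → ∀ n, Function.Bijective (Φ.mapH n (X i) (X j))) :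
    (Φ.directed X).IsQuasiIso := by
  intro n i j
  by_cases hij : i.idx < j.idx
  · constructor
    · refine (injective_iff_map_eq_zero _).2 fun x hx => ?_
      obtain ⟨x, rfl⟩ := Submodule.Quotient.mk_surjective _ x
      obtain ⟨y, hy⟩ := (AInfCat.mk_eq_zero_iff _).1 hx
      have hx' : (A.dirIncl X).tot i j x.1 ∈ A.Z n (X i.idx) (X j.idx) :=
        ⟨(A.dirIncl X).tot_mem x.2.1, LinearMap.mem_ker.2
          ((A.dirIncl_d X x.1).symm.trans ((congrArg _ x.2.2).trans (map_zero _)))⟩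
      have h0 : Φ.mapH n (X i.idx) (X j.idx) (Submodule.Quotient.mk ⟨_, hx'⟩) = 0 :=
        (AInfCat.mk_eq_zero_iff _).2 ⟨(B.dirIncl (f ∘ X)).tot i j y,
          (B.dirIncl_d (f ∘ X) y).symm.trans
            ((congrArg _ hy).trans (Φ.dirIncl_directed_lin X x.1))⟩
      obtain ⟨w, hw⟩ := (AInfCat.mk_eq_zero_iff _).1
        ((h _ _ hij n).1 (h0.trans (map_zero _).symm))
      refine (AInfCat.mk_eq_zero_iff _).2 ⟨A.dirProj X i j w, A.dirIncl_injective X i j ?_⟩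
      exact (A.dirIncl_d X _).trans ((congrArg _ (A.dirIncl_dirProj X hij w)).trans hw)
    · intro y
      obtain ⟨y, rfl⟩ := Submodule.Quotient.mk_surjective _ y
      have hy' : (B.dirIncl (f ∘ X)).tot i j y.1 ∈ B.Z n (f (X i.idx)) (f (X j.idx)) :=
        ⟨(B.dirIncl (f ∘ X)).tot_mem y.2.1, LinearMap.mem_ker.2
          ((B.dirIncl_d (f ∘ X) y.1).symm.trans ((congrArg _ y.2.2).trans (map_zero _)))⟩
      obtain ⟨x, hx⟩ := (h _ _ hij n).2 (Submodule.Quotient.mk ⟨_, hy'⟩)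
      obtain ⟨x, rfl⟩ := Submodule.Quotient.mk_surjective _ x
      obtain ⟨w, hw⟩ := (AInfCat.mk_eq_iff _ _).1 hx
      have hx' : A.dirProj X i j x.1 ∈ (A.directed X).Z n i j :=
        ⟨A.dirProj_mem X x.2.1, LinearMap.mem_ker.2 (A.dirIncl_injective X i j
          (((A.dirIncl_d X _).trans ((congrArg _ (A.dirIncl_dirProj X hij x.1)).trans
            x.2.2)).trans (map_zero _).symm))⟩
      refine ⟨Submodule.Quotient.mk ⟨_, hx'⟩, (AInfCat.mk_eq_iff _ _).2
        ⟨B.dirProj (f ∘ X) i j w, B.dirIncl_injective (f ∘ X) i j ?_⟩⟩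
      refine (B.dirIncl_d (f ∘ X) _).trans
        ((congrArg _ (B.dirIncl_dirProj (f ∘ X) hij w)).trans (hw.trans ?_))
      refine Eq.trans ?_ (map_sub _ _ _).symm
      refine congrArg (· - _) ?_
      exact ((Φ.dirIncl_directed_lin X _).trans
        (congrArg _ (A.dirIncl_dirProj X hij x.1))).symm
  · exact ⟨fun x y _ => (A.directed_eq_zero X hij x).trans (A.directed_eq_zero X hij y).symm,
      fun y => ⟨0, (B.directed_eq_zero (f ∘ X) hij _).trans
        (B.directed_eq_zero (f ∘ X) hij y).symm⟩⟩

end AInfFunctor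

/-! ### Serre functors from perfect pairings -/

namespace SerreFunctor

variable {C : Type u} [Category.{v} C] [Preadditive C] [Linear k C] {σ : C → C}
  (tr : ∀ X, Module.Dual k (X ⟶ σ X))
  (hr : ∀ X Y, Function.Bijective fun g : Y ⟶ σ X => tr X ∘ₗ Linear.rightComp k X g)

/-- The isomorphism `Hom(Y, σ X) ≅ Hom(X, Y)^∨`. -/
noncomputable def dualEquiv (X Y : C) : (Y ⟶ σ X) ≃ₗ[k] Module.Dual k (X ⟶ Y) :=
  LinearEquiv.ofBijective
    { toFun := fun g => tr X ∘ₗ Linear.rightComp k X g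
      map_add' := fun g g' => by
        ext f
        simp
      map_smul' := fun r g => by
        ext f
        simp } (hr X Y)

theorem dualEquiv_apply {X Y : C} (g : Y ⟶ σ X) (f : X ⟶ Y) :
    dualEquiv tr hr X Y g f = tr X (f ≫ g) := rfl

/-- The functor which is `σ` on objects, determined by
`tr (f ≫ σ g) = tr (g ≫ f)`. -/
noncomputable def functor : C ⥤ C where
  obj := σ
  map {X X'} g := (dualEquiv tr hr X' (σ X)).symm (tr X ∘ₗ Linear.leftComp k (σ X) g)
  map_id X := by
    rw [LinearEquiv.symm_apply_eq]
    ext f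
    simp [dualEquiv_apply]
  map_comp {X X' X''} g g' := by
    rw [LinearEquiv.symm_apply_eq]
    ext f
    have h : ∀ {X X' : C} (g : X ⟶ X') (f : X' ⟶ σ X), tr X' (f ≫
        (dualEquiv tr hr X' (σ X)).symm (tr X ∘ₗ Linear.leftComp k (σ X) g)) = tr X (g ≫ f) :=
      fun {X X'} g f => LinearMap.congr_fun
        ((dualEquiv tr hr X' (σ X)).apply_symm_apply (tr X ∘ₗ Linear.leftComp k (σ X) g)) f
    rw [dualEquiv_apply, ← Category.assoc, h g' , ← Category.assoc, h g]
    simp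

theorem tr_comp_map {X X' : C} (g : X ⟶ X') (f : X' ⟶ σ X) :
    tr X' (f ≫ (functor tr hr).map g) = tr X (g ≫ f) :=
  LinearMap.congr_fun ((dualEquiv tr hr X' (σ X)).apply_symm_apply
    (tr X ∘ₗ Linear.leftComp k (σ X) g)) f

/-- A Serre functor with prescribed values on objects. -/
theorem exists_of_perfect
    (hl : ∀ X Y, Function.Bijective fun f : X ⟶ Y => tr X ∘ₗ Linear.leftComp k (σ X) f)
    (hr : ∀ X Y, Function.Bijective fun g : Y ⟶ σ X => tr X ∘ₗ Linear.rightComp k X g)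
    (hσ : ∀ Z, ∃ Y, Nonempty (σ Y ≅ Z)) :
    ∃ S : SerreFunctor k C, ∀ X, S.S.functor.obj X = σ X := by
  have hb : ∀ X X', Function.Bijective
      ((functor tr hr).map : (X ⟶ X') → (σ X ⟶ σ X')) := fun X X' =>
    (dualEquiv tr hr X' (σ X)).symm.bijective.comp (hl X X')
  have : (functor tr hr).Faithful := ⟨fun {X X'} _ _ h => (hb X X').1 h⟩
  have : (functor tr hr).Full := ⟨fun {X X'} => (hb X X').2⟩
  have : (functor tr hr).EssSurj := ⟨hσ⟩
  have : (functor tr hr).IsEquivalence := {}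
  refine ⟨⟨(functor tr hr).asEquivalence, dualEquiv tr hr, fun g h f => ?_, fun h g f => ?_⟩,
    fun X => rfl⟩
  · exact congrArg (tr _) (Category.assoc f g h).symm
  · exact (congrArg (tr _) (Category.assoc f h _).symm).trans ((tr_comp_map tr hr g (f ≫ h)).trans
      (congrArg (tr _) (Category.assoc g f h).symm))

end SerreFunctor

/-! ### Serre functors and isomorphisms on the zeroth cohomology -/

namespace AInfCat

variable {A : AInfCat.{w, v, u} k} [A.Unital]

theorem nonempty_iso_iff {X Y : A.Obj} :
    Nonempty ((⟨X⟩ : H0 A) ≅ ⟨Y⟩) ↔ A.coh.Shift 0 X Y := by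
  constructor
  · rintro ⟨e⟩
    exact GrCat.Shift.mk' (G := A.coh) (X := X) (Y := Y) neg_zero.symm rfl e.hom e.inv
      (fun _ => e.hom_inv_id) fun _ => e.inv_hom_id
  · intro h
    obtain ⟨f, g, h₁, h₂⟩ := GrCat.Shift.exists_iso (G := A.coh) h neg_zero.symm rfl
    exact ⟨⟨f, g, h₁ _, h₂ _⟩⟩

/-- If all objects have Serre duals on both sides, there is a Serre functor on `H⁰`. -/
theorem exists_serreFunctor
    (hr : ∀ Y : A.Obj, ∃ Z : A.Obj, A.coh.SerrePair (fun _ => True) 0 Y Z)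
    (hl : ∀ Z : A.Obj, ∃ Y : A.Obj, A.coh.SerrePair (fun _ => True) 0 Y Z) :
    ∃ S : SerreFunctor k (H0 A), ∀ Y Z : A.Obj, A.coh.SerrePair (fun _ => True) 0 Y Z →
      Nonempty (S.S.functor.obj ⟨Y⟩ ≅ ⟨Z⟩) := by
  choose σ hσ using hr
  choose tr htr using hσ
  have hσ : ∀ Y, A.coh.SerrePair (fun _ => True) 0 Y (σ Y) := fun Y => ⟨tr Y, htr Y⟩
  have iso : ∀ Y Z : A.Obj, A.coh.SerrePair (fun _ => True) 0 Y Z →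
      Nonempty ((⟨σ Y⟩ : H0 A) ≅ ⟨Z⟩) := fun Y Z h => nonempty_iso_iff.2
    (h.shift (G := A.coh) trivial (hσ Y) trivial (GrCat.Shift.refl (G := A.coh) Y) (by norm_num))
  obtain ⟨S, hS⟩ := SerreFunctor.exists_of_perfect (C := H0 A) (σ := fun X => ⟨σ X.obj⟩)
    (fun X => tr X.obj) (fun X Y => (htr X.obj Y.obj trivial (add_zero 0)).1)
    (fun X Y => (htr X.obj Y.obj trivial (add_zero 0)).2)
    (fun Z => (hl Z.obj).imp' H0.mk fun Y h => iso Y Z.obj h)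
  refine ⟨S, fun Y Z h => ?_⟩
  rw [hS]
  exact iso Y Z h

theorem full_id (P : A.Obj → Prop) (X : (A.full P).Obj) : (A.full P).id X = A.id X.1 :=
  ((A.full P).comp_id (X := X) (Y := X) (n := 0) (A.id X.1)).symm.trans
    (A.id_comp (X := X.1) (Y := X.1) _) |>.symm

theorem isShift_full {P : A.Obj → Prop} {n : ℤ} {X Y : (A.full P).Obj}
    (h : A.coh.Shift n X.1 Y.1) : (A.full P).IsShift n X Y := by
  obtain ⟨f, g, h₁, h₂⟩ := h
  exact ⟨f, g, h₁.trans (full_id P X).symm, h₂.trans (full_id P Y).symm⟩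

theorem serrePair_full {P : A.Obj → Prop} {d : ℤ} {Y Z : (A.full P).Obj}
    (h : A.coh.SerrePair P d Y.1 Z.1) : (A.full P).coh.SerrePair (fun _ => True) d Y Z :=
  h.imp fun _ h X _ => h X.1 X.2

theorem comp_inv_hom {X X' Y : A.Obj} (e : (⟨X⟩ : H0 A) ≅ ⟨X'⟩) {n : ℤ} (f : A.H n X' Y) :
    A.comp (zero_add n) (e.inv : A.H 0 X' X)
      (A.comp (zero_add n) (e.hom : A.H 0 X X') f) = f := by
  rw [← A.comp_assoc (add_zero 0) (zero_add n) (zero_add n) (zero_add n)]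
  exact (congrArg (fun u => A.comp (zero_add n) u f) e.inv_hom_id).trans (A.id_comp f)

theorem comp_comp_inv_hom {X Y Y' : A.Obj} (e : (⟨Y⟩ : H0 A) ≅ ⟨Y'⟩) {n : ℤ} (f : A.H n X Y') :
    A.comp (add_zero n) (A.comp (add_zero n) f (e.inv : A.H 0 Y' Y)) (e.hom : A.H 0 Y Y') = f := by
  rw [A.comp_assoc (add_zero n) (add_zero 0) (add_zero n) (add_zero n)]
  exact (congrArg (A.comp (add_zero n) f) e.inv_hom_id).trans (A.comp_id f)

/-- Conjugation by isomorphisms. -/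
noncomputable def isoConj {X X' Y Y' : A.Obj} (e : (⟨X⟩ : H0 A) ≅ ⟨X'⟩)
    (e' : (⟨Y⟩ : H0 A) ≅ ⟨Y'⟩) (n : ℤ) : A.H n X Y ≃ₗ[k] A.H n X' Y' :=
  LinearEquiv.ofLinearMap
    ((A.comp (add_zero n)).flip (e'.hom : A.H 0 Y Y') ∘ₗ
      A.comp (zero_add n) (e.inv : A.H 0 X' X))
    (A.comp (zero_add n) (e.hom : A.H 0 X X') ∘ₗ
      (A.comp (add_zero n)).flip (e'.inv : A.H 0 Y' Y))
    (LinearMap.ext fun f => (congrArg (fun u => A.comp (add_zero n) u (e'.hom : A.H 0 Y Y'))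
      (comp_inv_hom e _)).trans (comp_comp_inv_hom e' f))
    (LinearMap.ext fun f => (congrArg (A.comp (zero_add n) (e.hom : A.H 0 X X'))
      (comp_comp_inv_hom e'.symm _)).trans (comp_inv_hom e.symm f))

theorem isoConj_comp {X X' Y Y' Z Z' : A.Obj} (e : (⟨X⟩ : H0 A) ≅ ⟨X'⟩)
    (e' : (⟨Y⟩ : H0 A) ≅ ⟨Y'⟩) (e'' : (⟨Z⟩ : H0 A) ≅ ⟨Z'⟩) {n n' l : ℤ} (h : n + n' = l)
    (f : A.H n X Y) (g : A.H n' Y Z) :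
    isoConj e e'' l (A.comp h f g) = A.comp h (isoConj e e' n f) (isoConj e' e'' n' g) := by
  change A.comp (add_zero l) (A.comp (zero_add l) _ (A.comp h f g)) _ =
    A.comp h (A.comp (add_zero n) (A.comp (zero_add n) _ f) (e'.hom : A.H 0 Y Y'))
      (A.comp (add_zero n') (A.comp (zero_add n') _ g) _)
  have h' : A.comp (zero_add n') (e'.hom : A.H 0 Y Y')
      (A.comp (zero_add n') (e'.inv : A.H 0 Y' Y) g) = g := comp_inv_hom e'.symm g
  rw [A.comp_assoc (add_zero n) (zero_add n') h h, ← A.comp_assoc (zero_add n') (add_zero n')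
    (add_zero n') (zero_add n'), h', ← A.comp_assoc h (add_zero n') (add_zero l) h,
    A.comp_assoc (zero_add n) h h (zero_add l)]

/-- Serre duality for an exceptional collection with the perfect pairing property: in the
subcategory generated by the collection, the Serre dual of `E_i` is `E_{i+m}`, up to shift. -/
theorem serrePair_exceptional {N m : ℕ} (hmN : m ≤ N) {d : ℤ} {E : ℕ → A.Obj}
    (hE : A.IsExceptional fun i : Fin (N + 1) => E i)
    (hfin : ∀ X : A.Obj, ∀ i ≤ N, A.HomIsFinite X (E i))
    {t : A.Obj → A.Obj} {τ : AInfFunctor A A t} (hτ : τ.IsQuasiIso)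
    (θ : ∀ i, i < N → ((⟨t (E i)⟩ : H0 A) ≅ ⟨E (i + 1)⟩))
    (hvan : ∀ i j, i ≤ N → j ≤ N → i + m < j → A.HomIsZero (E i) (E j))
    (hpair : A.PerfectPairing m E d) (i : ℕ) (hi : i + m ≤ N) :
    A.coh.SerrePair (A.coh.Gen (· ∈ A.coh.seg E 0 (N + 1))) d (E i) (E (i + m)) := by
  let κ (n : ℤ) (i j : ℕ) (hi : i < N) (hj : j < N) :
      A.H n (E i) (E j) ≃ₗ[k] A.H n (E (i + 1)) (E (j + 1)) :=
    (LinearEquiv.ofBijective (τ.mapH n (E i) (E j)) (hτ n _ _)).trans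
      (isoConj (θ i hi) (θ j hj) n)
  refine GrCat.serrePair_of_translation (G := A.coh) (fun X i hi => hfin X i hi)
    (fun i hi => (hE.line ⟨i, by omega⟩).line)
    (fun i j hij hj => (hE.zero ⟨i, by omega⟩ ⟨j, by omega⟩ hij).zero)
    (fun i j hij hj => (hvan i j (by omega) hj hij).zero) hpair.line.line hmN
    (fun i hi him a b h => (hpair.perfect i hi him a b h).2)
    κ (fun h i j r hi hj hr f g => ?_) i _ rfl hi
  refine (congrArg (isoConj (θ i hi) (θ r hr) _) (τ.mapH_comp h f g)).trans ?_
  exact isoConj_comp (θ i hi) (θ j hj) (θ r hr) h _ _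

/-- The reflection of an object in the subcategory generated by an exceptional collection. -/
theorem exists_reflection (hA : A.IsTriangulated) {n : ℕ} (hn : 0 < n) {E : ℕ → A.Obj}
    (hE : A.coh.ExcList (A.coh.seg E 0 n)) (hfin : ∀ X, ∀ i < n, A.coh.HomFin X (E i))
    (X : A.Obj) : ∃ L, A.Gen (fun i : Fin n => E i) L ∧ ∃ η : A.H 0 X L,
      ∀ l Z, A.Gen (fun i : Fin n => E i) Z →
        Function.Bijective fun g : A.H l L Z => A.comp (zero_add l) η g := by
  have : NeZero n := ⟨hn.ne'⟩
  have hP := hA.closed_gen fun i : Fin n => E i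
  have hE' : ∀ Y ∈ (A.coh.seg E 0 n).reverse, ∃ i < n, E i = Y := fun Y hY => by
    obtain ⟨i, -, hi, rfl⟩ := GrCat.mem_seg.1 (List.mem_reverse.1 hY)
    exact ⟨i, hi, rfl⟩
  obtain ⟨L, hL, η, hη⟩ := (A.coh.op.yoneda X).exists_repOn hP.op _ hE.op
    (fun Y hY => by
      obtain ⟨i, hi, rfl⟩ := hE' Y hY
      exact .of (⟨i, hi⟩ : Fin n))
    (fun Y hY W _ => by
      obtain ⟨i, hi, rfl⟩ := hE' Y hY
      exact hfin W i hi)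
    (fun Y hY => by
      obtain ⟨i, hi, rfl⟩ := hE' Y hY
      exact hfin X i hi)
  refine ⟨L, hL, η, fun l Z hZ => ?_⟩
  exact GrCat.CoFun.RepOn.gen (G := A.coh.op) hη ((hZ.coh_gen hA).op.mono fun Y hY =>
    .of (List.mem_reverse.2 hY)) l

end AInfCat

/-! ### Helices -/

/-- Given a relation which can be continued in both directions, `m` elements extend to a sequence
indexed by the integers, in which each element is related to the one `m` places further. -/
theorem exists_bi_infinite_orbit {α : Type u} {R : α → α → Prop} (hr : ∀ x, ∃ y, R x y)
    (hl : ∀ y, ∃ x, R x y) {m : ℕ} (hm : 0 < m) (f : Fin m → α) :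
    ∃ K : ℤ → α, (∀ i : Fin m, K i = f i) ∧ ∀ i, R (K i) (K (i + m)) := by
  choose σ hσ using hr
  choose ρ hρ using hl
  let T : ℤ → α → α := fun n => match n with
    | .ofNat n => σ^[n]
    | .negSucc n => ρ^[n + 1]
  have hT : ∀ n x, R (T n x) (T (n + 1) x) := by
    intro n x
    match n with
    | .ofNat n =>
      change R (σ^[n] x) (σ^[n + 1] x)
      rw [Function.iterate_succ_apply']
      exact hσ _
    | .negSucc 0 => exact hρ x
    | .negSucc (n + 1) =>
      change R (ρ^[n + 1 + 1] x) (ρ^[n + 1] x)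
      rw [Function.iterate_succ_apply' _ (n + 1)]
      exact hρ _
  have hm' : (m : ℤ) ≠ 0 := by omega
  have hlt : ∀ i : ℤ, (i % m).toNat < m := fun i => by
    have h1 := Int.emod_nonneg i hm'
    have h2 := Int.emod_lt_of_pos i (b := m) (by omega)
    omega
  refine ⟨fun i => T (i / m) (f ⟨(i % m).toNat, hlt i⟩), fun i => ?_, fun i => ?_⟩
  · have h1 : (i : ℤ) / m = 0 := Int.ediv_eq_zero_of_lt (by omega) (by omega)
    have h2 : (⟨((i : ℤ) % m).toNat, hlt i⟩ : Fin m) = i := Fin.ext (by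
      simp [Int.emod_eq_of_lt (show 0 ≤ (i : ℤ) by omega) (show (i : ℤ) < m by omega)])
    dsimp only
    rw [h1, h2]
    rfl
  · dsimp only
    simp only [Int.add_emod_right]
    rw [Int.add_ediv_of_dvd_right (dvd_refl _), Int.ediv_self hm']
    exact hT _ _

/-! ### The reflected dual collection -/

namespace AInfCat

variable {A : AInfCat.{w, v, u} k} [A.Unital]

/-- The inclusion of the subcategory generated by an exceptional collection has a left adjoint
which is the identity on the objects of the subcategory. -/
theorem exists_isLeftAdjoint_of_excList (hA : A.IsTriangulated) {n : ℕ} (hn : 0 < n)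
    {E : ℕ → A.Obj} (hE : A.coh.ExcList (A.coh.seg E 0 n))
    (hfin : ∀ X, ∀ i < n, A.coh.HomFin X (E i)) :
    ∃ (L : A.Obj → (A.full (A.Gen fun i : Fin n => E i)).Obj) (Λ : AInfFunctor A _ L),
      Λ.IsLeftAdjoint ∧ ∀ X : (A.full (A.Gen fun i : Fin n => E i)).Obj, L X.1 = X := by
  have key : ∀ X : A.Obj, ∃ L : (A.full (A.Gen fun i : Fin n => E i)).Obj,
      (∃ η : A.H 0 X L.1, ∀ l Z, A.Gen (fun i : Fin n => E i) Z →
        Function.Bijective fun g : A.H l L.1 Z => A.comp (zero_add l) η g) ∧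
      (A.Gen (fun i : Fin n => E i) X → L.1 = X) := by
    intro X
    by_cases hX : A.Gen (fun i : Fin n => E i) X
    · refine ⟨⟨X, hX⟩, ⟨A.id X, fun l Z _ => ?_⟩, fun _ => rfl⟩
      have : (fun g : A.H l X Z => A.comp (zero_add l) (A.id X) g) = _root_.id :=
        funext fun g => A.id_comp g
      exact this ▸ Function.bijective_id
    · obtain ⟨L, hL, h⟩ := exists_reflection hA hn hE hfin X
      exact ⟨⟨L, hL⟩, h, fun h => absurd h hX⟩
  choose L η hL using key
  choose η hη using η
  obtain ⟨Λ, hΛ⟩ := exists_isLeftAdjoint L η fun l X => hη X l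
  exact ⟨L, Λ, hΛ, fun X => Subtype.ext (hL X.1 X.2)⟩

end AInfCat

theorem mainTheorem3 {k : Type w} [Field k] (D : AInfCat.{w, v, u} k) [D.Unital]
    (hD : D.IsTriangulated) (N m : ℕ) (hm : 0 < m) (hmN : m < N) (d : ℤ)
    (E : ℕ → D.Obj) (hE : D.IsExceptional fun i : Fin (N + 1) => E i)
    (hfin : ∀ X : D.Obj, ∀ i ≤ N, D.HomIsFinite X (E i))
    (t : D.Obj → D.Obj) (τ : AInfFunctor D D t) (hτ : τ.IsEquivalence)
    (θ : ∀ i, i < N → ((⟨t (E i)⟩ : H0 D) ≅ ⟨E (i + 1)⟩))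
    (hvan : ∀ i j, i ≤ N → j ≤ N → i + m < j → D.HomIsZero (E i) (E j))
    (hpair : D.PerfectPairing m E d)
    (hcomm : ∀ (i : ℕ) (_ : 0 < i) (hi : m + i ≤ N) (a b : ℤ) (hab : a + b = d)
      (α : D.H a (E 0) (E i)) (β : D.H b (E i) (E m)),
      τ.pow θ i (zero_add i) rfl (le_of_add_le_right hi) hi (D.comp hab α β) =
        D.comp ((add_comm b a).trans hab) β
          (τ.pow θ m (zero_add m) (add_comm i m) hmN.le hi α))
    (F : ℕ → D.Obj) (hF : D.IsLeftDual (N + 1) E F) :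
    D.IsLeftDual m E F ∧
    (∃ (L : D.Obj → (D.full (D.Gen fun i : Fin m => E i)).Obj) (Λ : AInfFunctor D _ L),
      Λ.IsLeftAdjoint ∧ ∀ X : (D.full (D.Gen fun i : Fin m => E i)).Obj, L X.1 = X) ∧
    ∀ (L : D.Obj → (D.full (D.Gen fun i : Fin m => E i)).Obj) (Λ : AInfFunctor D _ L),
      Λ.IsLeftAdjoint →
      (∃ H : ℤ → (D.full (D.Gen fun i : Fin m => E i)).Obj,
        AInfCat.IsHelix _ m H ∧ (∀ i : ℕ, i < m → (H (-i)).1 = F i) ∧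
        ∀ i : ℕ, i ≤ N → AInfCat.IsShift _ (((i / m : ℕ) : ℤ) * (d - 1)) (L (F i)) (H (-i))) ∧
      (Λ.directed fun i : (Fin (N + 1))ᵒᵈ => F (OrderDual.ofDual i : Fin (N + 1))).IsQuasiIso := by
  have hDP := AInfCat.dualPair hD hE hfin hF
  have hexc : D.coh.ExcList (D.coh.seg E 0 m) := hDP.excE (by omega)
  have hfin' : ∀ X, ∀ i < m, D.coh.HomFin X (E i) := fun X i hi => hDP.fin X i (by omega)
  have hgen : ∀ {X : D.Obj}, D.Gen (fun i : Fin m => E i) X ↔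
      D.coh.Gen (· ∈ D.coh.seg E 0 m) X := AInfCat.gen_iff_coh_gen hD hm hexc hfin'
  have hS := fun i => AInfCat.serrePair_exceptional hmN.le hE hfin hτ.1 θ hvan hpair i
  have hcl := hDP.seg_closed hm
  refine ⟨AInfCat.IsLeftDual.truncate hD hm hmN.le hE hfin hF,
    AInfCat.exists_isLeftAdjoint_of_excList hD hm hexc hfin', fun L Λ ⟨η, hnat, hη⟩ => ?_⟩
  have hη' : ∀ i Z, D.coh.Gen (· ∈ D.coh.seg E 0 m) Z → ∀ {a b : ℤ} (hb : 0 + a = b),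
      Function.Bijective fun f : D.H a (L (F i)).1 Z => D.comp hb (η (F i)) f := by
    intro i Z hZ a b hb
    obtain rfl : a = b := by omega
    exact hη a (F i) ⟨Z, hgen.2 hZ⟩
  refine ⟨?_, Λ.directed_isQuasiIso _ fun i j hij n => ?_⟩
  · have hr : ∀ Y : (D.full (D.Gen fun i : Fin m => E i)).Obj,
        ∃ Z : (D.full (D.Gen fun i : Fin m => E i)).Obj,
          D.coh.SerrePair (D.Gen fun i : Fin m => E i) 0 Y.1 Z.1 := fun Y => by
      obtain ⟨Z, hZ, h⟩ := GrCat.exists_serrePair_right hcl hexc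
        (fun X _ => hDP.finE (by omega) X) (fun X hX => .of hX) (fun _ h => h) Y.1
        (hDP.finE (by omega) _)
      exact ⟨⟨Z, hgen.2 hZ⟩, h.mono fun X => hgen.1⟩
    have hl : ∀ Z : (D.full (D.Gen fun i : Fin m => E i)).Obj,
        ∃ Y : (D.full (D.Gen fun i : Fin m => E i)).Obj,
          D.coh.SerrePair (D.Gen fun i : Fin m => E i) 0 Y.1 Z.1 := fun Z => by
      obtain ⟨Y, hY, h⟩ := GrCat.exists_serrePair_left hcl hexc
        (fun X _ => hDP.finE (by omega) X) (fun X hX => .of hX) (fun _ h => h) Z.1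
        (fun X _ => hDP.fin_gen X (GrCat.DualPair.gen_mono le_rfl (by omega) (hgen.1 Z.2)))
      exact ⟨⟨Y, hgen.2 hY⟩, h.mono fun X => hgen.1⟩
    have hFm : ∀ i < m, D.Gen (fun i : Fin m => E i) (F i) := fun i hi =>
      hgen.2 (hDP.memF_seg hi (by omega))
    -- the helix, indexed in the opposite direction
    obtain ⟨K, hK, hKS⟩ := exists_bi_infinite_orbit hr hl hm
      fun i => ⟨F i, hFm i i.2⟩
    have hKF : ∀ i : ℕ, i < m → (K i).1 = F i := fun i hi =>
      congrArg Subtype.val (hK ⟨i, hi⟩)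
    have hKL : ∀ i : ℕ, i ≤ N →
        D.coh.Shift (((i / m : ℕ) : ℤ) * (d - 1)) (L (F i)).1 (K i).1 := by
      intro i
      induction i using Nat.strong_induction_on with
      | _ i ih =>
        intro hi
        rcases lt_or_ge i m with him | him
        · rw [Nat.div_eq_of_lt him, hKF i him, Nat.cast_zero, zero_mul]
          have := GrCat.Shift.of_bijective' (G := D.coh) (add_zero 0) (η (F i)) fun W hW => hη' i W
            (by rcases hW with rfl | rfl; exacts [hgen.1 (hFm i him), hgen.1 (L (F i)).2])
          exact neg_zero (G := ℤ) ▸ this.symm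
        · obtain ⟨i, rfl⟩ : ∃ j, i = j + m := ⟨i - m, by omega⟩
          obtain ⟨R, hR, h₁, h₂⟩ := hDP.serrePair_reflection hm hS hi (hgen.1 (L (F (i + m))).2)
            (η (F i)) (η (F (i + m))) (hη' i) (hη' (i + m))
          have h₃ := (h₁.mono fun X => hgen.1).shift (hgen.2 hR) (hKS i) (K _).2
            (ih i (by omega) (by omega)) rfl
          rw [Nat.add_div_right _ hm]
          refine h₂.trans ?_ h₃.symm
          push_cast
          ring
    obtain ⟨S, hS'⟩ := AInfCat.exists_serreFunctor
      (fun Y => (hr Y).imp fun Z h => AInfCat.serrePair_full h)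
      (fun Z => (hl Z).imp fun Y h => AInfCat.serrePair_full h)
    refine ⟨fun i => K (-i), ⟨S, fun i => hS' _ _ ?_⟩, fun i hi => ?_, fun i hi => ?_⟩
    · have := AInfCat.serrePair_full (hKS (-i))
      rwa [show -i + (m : ℤ) = -(i - m) by ring] at this
    · exact (congrArg (fun j => (K j).1) (neg_neg (i : ℤ))).trans (hKF i hi)
    · exact (congrArg (fun j => AInfCat.IsShift _ _ (L (F i)) (K j)) (neg_neg (i : ℤ))).mpr
        (AInfCat.isShift_full (hKL i hi))
  · -- by naturality, `η ∘ λ(f) = f ∘ η`, where composition with `η` is bijective on both sides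
    have h₁ := hDP.bijective_reflection hm hmN.le hS
      (i := (OrderDual.ofDual i : Fin (N + 1))) (j := (OrderDual.ofDual j : Fin (N + 1)))
      hij (by omega) (hgen.1 (L _).2) (η _) (hη' _) (add_zero n)
    refine (Function.Bijective.of_comp_iff' (hη n _ _) _).1 ?_
    exact (congrArg Function.Bijective (funext fun f => hnat n _ _ f)).mpr h₁
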